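/- Let $\mathbb K$ be a field of characteristic $0$ and let $(L=\bigoplus_{i\in\mathbb Z}L^i,d,[-,-])$ be a DG Lie algebra over $\mathbb K$ (with $d$ of degree $+1$). Write $Z^i(L)$, $B^i(L)$, $H^i(L)$ for its cycles, coboundaries and cohomology in degree $i$. Let $G$ be a linear algebraic group over $\mathbb K$, that is, a Zariski closed subgroup of some $\mathrm{GL}_n(\mathbb K)$, which is (linearly) reductive: every finite-dimensional rational representation of $G$ is semisimple. Assume that: 1. $H^i(L)=0$ for $i<0$, and the Lie algebra $\mathfrak g:=H^0(L)$ is (identified with) the Lie algebra of $G$; 2. there is a Lie algebra morphism $\imath\colon\mathfrak g\to Z^0(L)$ which is a section of the natural projection $Z^0(L)\to H^0(L)$ (hence an embedding); 3. $G$ acts on $L$ by DG Lie algebra automorphisms, every $L^i$ is a rational and finitely supported representation of $G$, and the differential of this action is the adjoint action of $\mathfrak g$, i.e. $\xi\in\mathfrak g$ acts on $L$ as $x\mapsto[\imath(\xi),x]$. (A representation $V$ of $G$ is rational if every vector lies in a finite-dimensional invariant subspace $U$ such that $G\to \mathrm{GL}(U)$ is algebraic; it is finitely supported if, up to isomorphism,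 only finitely many irreducible representations $E$ of $G$ admit a nonzero $G$-equivariant map $E\to V/W$ for some $G$-invariant subspace $W\subseteq V$.) Then there exists a $\mathfrak g$-invariant complement of $B^1(L)$ in $L^1$, where $\mathfrak g$ acts through $[\imath(-),-]$. Moreover, for every such complement $K^1\subseteq L^1$, let $K\subseteq L$ be the DG Lie subalgebra with $K^i=0$ for $i\le 0$, with this $K^1$ in degree $1$, and with $K^i=L^i$ for $i\ge2$. Then $L$ is formal if and only if $K$ is formal. Here a DG Lie algebra $M$ is formal if there is an $L_\infty$ morphism from $M$ to its cohomology graded Lie algebra $H(M)$ (with zero differential and the induced bracket) whose linear part is a quasi-isomorphism. -/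

import Mathlib

open scoped DirectSum

universe u v

/-! ## DG Lie algebras -/

/-- A differential graded Lie algebra over `K` with underlying vector space `L = ⨁ i, L^i`
(differential of degree `+1`). The homogeneous component `L^i` is `deg i`. -/
structure DGLieAlgebra (K : Type v) [Field K] (L : Type u) [AddCommGroup L] [Module K L] where
  deg : ℤ → Submodule K L
  isInternal : DirectSum.IsInternal deg
  d : L →ₗ[K] L
  bracket : L →ₗ[K] L →ₗ[K] L
  d_mem : ∀ {i : ℤ} {x : L}, x ∈ deg i → d x ∈ deg (i + 1)
  d_d : ∀ x : L, d (d x) = 0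
  bracket_mem : ∀ {i j : ℤ} {x y : L}, x ∈ deg i → y ∈ deg j → bracket x y ∈ deg (i + j)
  bracket_skew : ∀ {i j : ℤ} {x y : L}, x ∈ deg i → y ∈ deg j →
    bracket x y = -((i * j).negOnePow • bracket y x)
  jacobi : ∀ {i j : ℤ} {x y : L} (z : L), x ∈ deg i → y ∈ deg j →
    bracket x (bracket y z) =
      bracket (bracket x y) z + (i * j).negOnePow • bracket y (bracket x z)
  leibniz : ∀ {i : ℤ} {x : L} (y : L), x ∈ deg i →
    d (bracket x y) = bracket (d x) y + i.negOnePow • bracket x (d y)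

/-- A family of submodules that spans and that admits a family of projections is a
direct sum decomposition. -/
theorem isInternal_of_proj {K : Type v} [Field K] {M : Type u} [AddCommGroup M] [Module K M]
    (A : ℤ → Submodule K M) (p : ℤ → M →ₗ[K] M)
    (hp : ∀ i, ∀ x ∈ A i, p i x = x) (hp' : ∀ i j, j ≠ i → ∀ x ∈ A j, p i x = 0)
    (htop : ∀ x : M, x ∈ ⨆ i, A i) : DirectSum.IsInternal A := by
  rw [DirectSum.isInternal_submodule_iff_iSupIndep_and_iSup_eq_top]
  refine ⟨fun i => ?_, eq_top_iff.2 fun x _ => htop x⟩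
  rw [Submodule.disjoint_def]
  intro x hx hx'
  have hle : (⨆ (j : ℤ) (_ : j ≠ i), A j) ≤ LinearMap.ker (p i) :=
    iSup_le fun j => iSup_le fun hj y hy => hp' i j hj y hy
  rw [← hp i x hx]
  exact hle hx'

namespace DGLieAlgebra

section Cohomology

variable {K : Type v} [Field K] {L : Type u} [AddCommGroup L] [Module K L]
  (D : DGLieAlgebra K L)

theorem bijective_coeLinearMap : Function.Bijective (DirectSum.coeLinearMap D.deg) :=
  D.isInternal

/-- The decomposition `⨁ i, L^i ≃ L`. -/
noncomputable def decomp : (⨁ i, D.deg i) ≃ₗ[K] L :=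
  LinearEquiv.ofBijective (DirectSum.coeLinearMap D.deg) D.bijective_coeLinearMap

/-- The projection of `L` onto its homogeneous component of degree `i`. -/
noncomputable def proj (i : ℤ) : L →ₗ[K] L :=
  (D.deg i).subtype ∘ₗ DirectSum.component K ℤ (fun j => D.deg j) i ∘ₗ
    D.decomp.symm.toLinearMap

theorem proj_mem (i : ℤ) (x : L) : D.proj i x ∈ D.deg i := by
  simp [proj]

theorem decomp_symm_apply {i : ℤ} {x : L} (hx : x ∈ D.deg i) :
    D.decomp.symm x = DirectSum.lof K ℤ (fun j => D.deg j) i ⟨x, hx⟩ := by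
  rw [LinearEquiv.symm_apply_eq, decomp, LinearEquiv.ofBijective_apply,
    DirectSum.coeLinearMap_lof]

theorem proj_same {i : ℤ} {x : L} (hx : x ∈ D.deg i) : D.proj i x = x := by
  simp only [proj, LinearMap.comp_apply, LinearEquiv.coe_coe, D.decomp_symm_apply hx]
  simp [DirectSum.component.lof_self]

theorem proj_ne {i j : ℤ} (h : j ≠ i) {x : L} (hx : x ∈ D.deg j) : D.proj i x = 0 := by
  simp only [proj, LinearMap.comp_apply, LinearEquiv.coe_coe, D.decomp_symm_apply hx]
  rw [DirectSum.component.of, dif_neg h]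
  simp

theorem mem_iSup_deg (x : L) : x ∈ ⨆ i, D.deg i := by
  rw [D.isInternal.submodule_iSup_eq_top]; trivial

theorem induction_deg {P : L → Prop} (h : ∀ i, ∀ x ∈ D.deg i, P x) (h0 : P 0)
    (hadd : ∀ x y, P x → P y → P (x + y)) (x : L) : P x :=
  Submodule.iSup_induction D.deg (motive := P) (D.mem_iSup_deg x) h h0 hadd

theorem proj_d (i : ℤ) (x : L) : D.proj (i + 1) (D.d x) = D.d (D.proj i x) := by
  refine D.induction_deg (P := fun x => D.proj (i + 1) (D.d x) = D.d (D.proj i x)) ?_ ?_ ?_ x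
  · intro j x hx
    by_cases h : j = i
    · subst h
      rw [D.proj_same hx, D.proj_same (D.d_mem hx)]
    · rw [D.proj_ne h hx, D.proj_ne (by omega) (D.d_mem hx), map_zero]
  · simp
  · intro x y hx hy
    simp only [map_add, hx, hy]

/-- An element all of whose homogeneous components lie in a submodule lies in it. -/
theorem mem_iSup_inf_of_proj_mem {P : Submodule K L} {x : L} (h : ∀ i, D.proj i x ∈ P) :
    x ∈ ⨆ i, P ⊓ D.deg i := by
  classical
  have hx : x = ∑ i ∈ DFinsupp.support (D.decomp.symm x), D.proj i x := by
    conv_lhs => rw [← D.decomp.apply_symm_apply x]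
    rw [decomp, LinearEquiv.ofBijective_apply, DirectSum.coeLinearMap_eq_dfinsuppSum, DFinsupp.sum]
    rfl
  rw [hx]
  exact Submodule.sum_mem _ fun i _ =>
    Submodule.mem_iSup_of_mem i ⟨h i, D.proj_mem i x⟩

/-- The cycles `Z(L) = ker d`. -/
def cycles : Submodule K L := LinearMap.ker D.d

theorem mem_cycles {x : L} : x ∈ D.cycles ↔ D.d x = 0 := Iff.rfl

/-- The coboundaries `B(L) = im d`. -/
def boundaries : Submodule K L := LinearMap.range D.d

theorem proj_mem_cycles (i : ℤ) {x : L} (hx : x ∈ D.cycles) : D.proj i x ∈ D.cycles := by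
  rw [mem_cycles] at hx ⊢
  rw [← D.proj_d, hx, map_zero]

theorem proj_mem_boundaries (i : ℤ) {x : L} (hx : x ∈ D.boundaries) :
    D.proj i x ∈ D.boundaries := by
  obtain ⟨y, rfl⟩ := hx
  refine ⟨D.proj (i - 1) y, ?_⟩
  rw [← D.proj_d, sub_add_cancel]

theorem cycles_induction {P : L → Prop} (h : ∀ i, ∀ x ∈ D.cycles, x ∈ D.deg i → P x) (h0 : P 0)
    (hadd : ∀ x y, P x → P y → P (x + y)) {x : L} (hx : x ∈ D.cycles) : P x :=
  Submodule.iSup_induction (fun i => D.cycles ⊓ D.deg i) (motive := P)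
    (D.mem_iSup_inf_of_proj_mem fun i => D.proj_mem_cycles i hx)
    (fun i x hx => h i x hx.1 hx.2) h0 hadd

theorem bracket_mem_cycles {x y : L} (hx : x ∈ D.cycles) (hy : y ∈ D.cycles) :
    D.bracket x y ∈ D.cycles := by
  rw [mem_cycles] at hy
  refine D.cycles_induction (P := fun x => D.bracket x y ∈ D.cycles) ?_ (by simp) ?_ hx
  · intro i x hx hxi
    rw [mem_cycles] at hx ⊢
    rw [D.leibniz y hxi, hx, hy]
    simp
  · intro a b ha hb
    simpa using add_mem ha hb

theorem bracket_mem_boundaries_right {x y : L} (hx : x ∈ D.cycles) (hy : y ∈ D.boundaries) :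
    D.bracket x y ∈ D.boundaries := by
  obtain ⟨z, rfl⟩ := hy
  refine D.cycles_induction (P := fun x => D.bracket x (D.d z) ∈ D.boundaries) ?_ (by simp) ?_ hx
  · intro i x hx hxi
    rw [mem_cycles] at hx
    refine ⟨i.negOnePow • D.bracket x z, ?_⟩
    have h := D.leibniz z hxi
    rw [hx] at h
    rw [Units.smul_def, map_zsmul, h, map_zero, LinearMap.zero_apply, zero_add, Units.smul_def,
      ← mul_smul, Int.units_coe_mul_self, one_smul]
  · intro a b ha hb
    simpa using add_mem ha hb

theorem bracket_mem_boundaries_left {x y : L} (hx : x ∈ D.boundaries) (hy : y ∈ D.cycles) :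
    D.bracket x y ∈ D.boundaries := by
  obtain ⟨z, rfl⟩ := hx
  rw [mem_cycles] at hy
  refine D.induction_deg (P := fun z => D.bracket (D.d z) y ∈ D.boundaries) ?_ (by simp) ?_ z
  · intro i z hz
    refine ⟨D.bracket z y, ?_⟩
    rw [D.leibniz y hz, hy]
    simp
  · intro a b ha hb
    simpa using add_mem ha hb

/-- The coboundaries as a subspace of the space of cycles. -/
abbrev boundariesInCycles : Submodule K D.cycles := D.boundaries.comap D.cycles.subtype

/-- The (total) cohomology `H(L) = Z(L) / B(L)`. -/
abbrev H : Type u := D.cycles ⧸ D.boundariesInCycles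

/-- The bracket of two cycles, as a bilinear map. -/
def cyclesBracket : D.cycles →ₗ[K] D.cycles →ₗ[K] D.cycles :=
  LinearMap.mk₂ K (fun x y => ⟨D.bracket x y, D.bracket_mem_cycles x.2 y.2⟩)
    (fun _ _ _ => Subtype.ext (by simp)) (fun _ _ _ => Subtype.ext (by simp))
    (fun _ _ _ => Subtype.ext (by simp)) (fun _ _ _ => Subtype.ext (by simp))

theorem cyclesBracket_le_comap (x : D.cycles) :
    D.boundariesInCycles ≤ D.boundariesInCycles.comap (D.cyclesBracket x) :=
  fun y hy => D.bracket_mem_boundaries_right (y := (y : L)) x.2 hy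

/-- The bracket of a cycle with a cohomology class. -/
def cyclesBracketH : D.cycles →ₗ[K] D.H →ₗ[K] D.H where
  toFun x := D.boundariesInCycles.mapQ D.boundariesInCycles (D.cyclesBracket x)
    (D.cyclesBracket_le_comap x)
  map_add' x y := by
    apply Submodule.linearMap_qext
    ext z
    simp
  map_smul' c x := by
    apply Submodule.linearMap_qext
    ext z
    simp

theorem boundariesInCycles_le_ker : D.boundariesInCycles ≤ LinearMap.ker D.cyclesBracketH := by
  intro x hx
  rw [LinearMap.mem_ker]
  apply Submodule.linearMap_qext
  refine LinearMap.ext fun z => (Submodule.Quotient.mk_eq_zero _).2 ?_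
  exact D.bracket_mem_boundaries_left (x := (x : L)) hx z.2

/-- The bracket induced on cohomology. -/
def cohomologyBracket : D.H →ₗ[K] D.H →ₗ[K] D.H :=
  D.boundariesInCycles.liftQ D.cyclesBracketH D.boundariesInCycles_le_ker

theorem cohomologyBracket_mk (x y : D.cycles) :
    D.cohomologyBracket (Submodule.Quotient.mk x) (Submodule.Quotient.mk y) =
      Submodule.Quotient.mk (D.cyclesBracket x y) := rfl

/-- `H^i(L)`: the classes of the cycles of degree `i`. -/
def cohomologyDeg (i : ℤ) : Submodule K D.H :=
  ((D.deg i).comap D.cycles.subtype).map D.boundariesInCycles.mkQ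

/-- The projection of the space of cycles onto its component of degree `i`. -/
noncomputable def cyclesProj (i : ℤ) : D.cycles →ₗ[K] D.cycles :=
  (D.proj i).restrict (fun _ hx => D.proj_mem_cycles i hx)

theorem coe_cyclesProj (i : ℤ) (x : D.cycles) : (D.cyclesProj i x : L) = D.proj i x := rfl

theorem cyclesProj_le_comap (i : ℤ) :
    D.boundariesInCycles ≤ D.boundariesInCycles.comap (D.cyclesProj i) :=
  fun x hx => D.proj_mem_boundaries (x := (x : L)) i hx

theorem cohomologyDeg_isInternal : DirectSum.IsInternal D.cohomologyDeg := by
  refine isInternal_of_proj D.cohomologyDeg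
    (fun i => D.boundariesInCycles.mapQ D.boundariesInCycles (D.cyclesProj i)
      (D.cyclesProj_le_comap i)) ?_ ?_ ?_
  · rintro i _ ⟨x, hx, rfl⟩
    have h : D.cyclesProj i x = x := Subtype.ext (D.proj_same (x := (x : L)) hx)
    simp only [Submodule.mkQ_apply, Submodule.mapQ_apply, h]
  · rintro i j hij _ ⟨x, hx, rfl⟩
    have h : D.cyclesProj i x = 0 := Subtype.ext (D.proj_ne (x := (x : L)) hij hx)
    simp only [Submodule.mkQ_apply, Submodule.mapQ_apply, h, Submodule.Quotient.mk_zero]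
  · intro c
    obtain ⟨⟨x, hx⟩, rfl⟩ := Submodule.Quotient.mk_surjective _ c
    obtain ⟨_, h⟩ := D.cycles_induction (P := fun x => ∃ hx : x ∈ D.cycles,
      (Submodule.Quotient.mk ⟨x, hx⟩ : D.H) ∈ ⨆ i, D.cohomologyDeg i)
      (fun i x hx hxi => ⟨hx, Submodule.mem_iSup_of_mem i ⟨⟨x, hx⟩, hxi, rfl⟩⟩)
      ⟨zero_mem _, zero_mem _⟩
      (fun x y ⟨hx, hx'⟩ ⟨hy, hy'⟩ => ⟨add_mem hx hy, add_mem hx' hy'⟩) hx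
    exact h

/-- The cohomology of a DG Lie algebra, as a DG Lie algebra with zero differential. -/
def cohomology : DGLieAlgebra K D.H where
  deg := D.cohomologyDeg
  isInternal := D.cohomologyDeg_isInternal
  d := 0
  bracket := D.cohomologyBracket
  d_mem := fun _ => zero_mem _
  d_d := fun _ => rfl
  bracket_mem := by
    rintro i j _ _ ⟨x, hx, rfl⟩ ⟨y, hy, rfl⟩
    exact ⟨D.cyclesBracket x y, D.bracket_mem hx hy, rfl⟩
  bracket_skew := by
    rintro i j _ _ ⟨x, hx, rfl⟩ ⟨y, hy, rfl⟩
    simp only [Submodule.mkQ_apply, cohomologyBracket_mk]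
    rw [Units.smul_def, ← Submodule.Quotient.mk_smul, ← Submodule.Quotient.mk_neg]
    congr 1
    exact Subtype.ext (D.bracket_skew hx hy)
  jacobi := by
    rintro i j _ _ z ⟨x, hx, rfl⟩ ⟨y, hy, rfl⟩
    obtain ⟨z, rfl⟩ := Submodule.Quotient.mk_surjective _ z
    simp only [Submodule.mkQ_apply, cohomologyBracket_mk]
    rw [Units.smul_def, ← Submodule.Quotient.mk_smul, ← Submodule.Quotient.mk_add]
    congr 1
    exact Subtype.ext (D.jacobi _ hx hy)
  leibniz := fun _ _ => by simp

end Cohomology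

/-! ### The Lie algebras `L^0`, `Z^0(L)` and `H^0(L)` -/

section DegreeZero

variable {K : Type v} [Field K] {L : Type u} [AddCommGroup L] [Module K L]
  (D : DGLieAlgebra K L)

/-- The bracket of `L` restricted to `L^0`. -/
instance : Bracket (D.deg 0) (D.deg 0) where
  bracket x y := ⟨D.bracket x y, by simpa using D.bracket_mem x.2 y.2⟩

theorem coe_lie (x y : D.deg 0) : ((⁅x, y⁆ : D.deg 0) : L) = D.bracket x y := rfl

variable [CharZero K]

/-- The homogeneous component of degree `0` is a Lie algebra. -/
instance : LieRing (D.deg 0) where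
  add_lie x y z := Subtype.ext (by simp [coe_lie])
  lie_add x y z := Subtype.ext (by simp [coe_lie])
  lie_self x := Subtype.ext (by
    have h : D.bracket (x : L) x = -D.bracket (x : L) x := by
      simpa using D.bracket_skew x.2 x.2
    have h2 : (2 : K) • D.bracket (x : L) x = 0 := by
      rw [two_smul]
      nth_rewrite 1 [h]
      exact neg_add_cancel _
    exact (smul_eq_zero.1 h2).resolve_left two_ne_zero)
  leibniz_lie x y z := Subtype.ext (by simpa [coe_lie] using D.jacobi (z : L) x.2 y.2)

instance : LieAlgebra K (D.deg 0) where
  lie_smul c x y := Subtype.ext (by simp [coe_lie])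

/-- `Z^0(L)`, the Lie algebra of cycles of degree `0`. -/
def zeroCycles : LieSubalgebra K (D.deg 0) where
  toSubmodule := D.cycles.comap (D.deg 0).subtype
  lie_mem' := fun {x y} hx hy => D.bracket_mem_cycles (x := (x : L)) (y := (y : L)) hx hy

/-- The natural projection `Z^0(L) → H^0(L)`. -/
def zeroClass : D.zeroCycles →ₗ⁅K⁆ D.cohomology.deg 0 where
  toFun z := ⟨Submodule.Quotient.mk ⟨((z : D.deg 0) : L), z.2⟩,
    ⟨⟨((z : D.deg 0) : L), z.2⟩, (z : D.deg 0).2, rfl⟩⟩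
  map_add' _ _ := rfl
  map_smul' _ _ := rfl
  map_lie' := rfl

end DegreeZero

/-! ### DG Lie subalgebras -/

section Subalgebra

variable {K : Type v} [Field K] {L : Type u} [AddCommGroup L] [Module K L]

/-- A DG Lie subalgebra of `L`, given by its homogeneous components. -/
structure Sub (D : DGLieAlgebra K L) where
  piece : ℤ → Submodule K L
  piece_le : ∀ i, piece i ≤ D.deg i
  d_mem : ∀ {i : ℤ} {x : L}, x ∈ piece i → D.d x ∈ piece (i + 1)
  bracket_mem : ∀ {i j : ℤ} {x y : L}, x ∈ piece i → y ∈ piece j →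
    D.bracket x y ∈ piece (i + j)

namespace Sub

variable {D : DGLieAlgebra K L} (S : D.Sub)

/-- The underlying subspace `⨁ i, S^i` of `L`. -/
def carrier : Submodule K L := ⨆ i, S.piece i

theorem d_mem_carrier {x : L} (hx : x ∈ S.carrier) : D.d x ∈ S.carrier :=
  Submodule.iSup_induction S.piece (motive := fun x => D.d x ∈ S.carrier) hx
    (fun i _ hx => Submodule.mem_iSup_of_mem (i + 1) (S.d_mem hx)) (by simp)
    (fun x y hx hy => by simpa using add_mem hx hy)

theorem bracket_mem_carrier {x y : L} (hx : x ∈ S.carrier) (hy : y ∈ S.carrier) :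
    D.bracket x y ∈ S.carrier := by
  refine Submodule.iSup_induction S.piece (motive := fun x => D.bracket x y ∈ S.carrier) hx
    (fun i x hx => ?_) (by simp) (fun x y hx hy => by simpa using add_mem hx hy)
  exact Submodule.iSup_induction S.piece (motive := fun y => D.bracket x y ∈ S.carrier) hy
    (fun j y hy => Submodule.mem_iSup_of_mem (i + j) (S.bracket_mem hx hy)) (by simp)
    (fun x y hx hy => by simpa using add_mem hx hy)

/-- The homogeneous components of `S`, inside `S`. -/
def subDeg (i : ℤ) : Submodule K S.carrier := (S.piece i).comap S.carrier.subtype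

theorem mem_subDeg {i : ℤ} {x : S.carrier} : x ∈ S.subDeg i ↔ (x : L) ∈ S.piece i := Iff.rfl

theorem proj_mem_piece (i : ℤ) {x : L} (hx : x ∈ S.carrier) : D.proj i x ∈ S.piece i := by
  refine Submodule.iSup_induction S.piece (motive := fun x => D.proj i x ∈ S.piece i) hx
    (fun j x hx => ?_) (by simp) (fun x y hx hy => by simpa using add_mem hx hy)
  by_cases h : j = i
  · subst h
    rwa [D.proj_same (S.piece_le j hx)]
  · rw [D.proj_ne h (S.piece_le j hx)]
    exact zero_mem _

theorem subDeg_isInternal : DirectSum.IsInternal S.subDeg := by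
  refine isInternal_of_proj S.subDeg
    (fun i => (D.proj i).restrict
      (fun x hx => Submodule.mem_iSup_of_mem i (S.proj_mem_piece i hx))) ?_ ?_ ?_
  · intro i x hx
    exact Subtype.ext (D.proj_same (S.piece_le i hx))
  · intro i j h x hx
    exact Subtype.ext (D.proj_ne h (S.piece_le j hx))
  · rintro ⟨x, hx⟩
    obtain ⟨_, h⟩ := Submodule.iSup_induction S.piece
      (motive := fun x => ∃ hx : x ∈ S.carrier, (⟨x, hx⟩ : S.carrier) ∈ ⨆ i, S.subDeg i) hx
      (fun i x hx => ⟨Submodule.mem_iSup_of_mem i hx, Submodule.mem_iSup_of_mem i hx⟩)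
      ⟨zero_mem _, zero_mem _⟩
      (fun x y ⟨hx, hx'⟩ ⟨hy, hy'⟩ => ⟨add_mem hx hy, add_mem hx' hy'⟩)
    exact h

/-- A DG Lie subalgebra, as a DG Lie algebra with the restricted structure. -/
def toDGLieAlgebra : DGLieAlgebra K S.carrier where
  deg := S.subDeg
  isInternal := S.subDeg_isInternal
  d := D.d.restrict (fun _ hx => S.d_mem_carrier hx)
  bracket := LinearMap.mk₂ K
    (fun x y => ⟨D.bracket x y, S.bracket_mem_carrier x.2 y.2⟩)
    (fun _ _ _ => Subtype.ext (by simp)) (fun _ _ _ => Subtype.ext (by simp))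
    (fun _ _ _ => Subtype.ext (by simp)) (fun _ _ _ => Subtype.ext (by simp))
  d_mem := fun hx => S.d_mem hx
  d_d := fun x => Subtype.ext (D.d_d x)
  bracket_mem := fun hx hy => S.bracket_mem hx hy
  bracket_skew := fun hx hy =>
    Subtype.ext (D.bracket_skew (S.piece_le _ hx) (S.piece_le _ hy))
  jacobi := fun z hx hy =>
    Subtype.ext (D.jacobi (z : L) (S.piece_le _ hx) (S.piece_le _ hy))
  leibniz := fun y hx => Subtype.ext (D.leibniz (y : L) (S.piece_le _ hx))

end Sub

/-- The homogeneous components of `K`: `K^i = 0` for `i ≤ 0`, `K^1 = K₁`, and `K^i = L^i`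
for `i ≥ 2`. -/
def positivePiece (D : DGLieAlgebra K L) (K₁ : Submodule K L) (i : ℤ) : Submodule K L :=
  if i ≤ 0 then ⊥ else if i = 1 then K₁ else D.deg i

theorem positivePiece_of_nonpos (D : DGLieAlgebra K L) (K₁ : Submodule K L) {i : ℤ}
    (h : i ≤ 0) : D.positivePiece K₁ i = ⊥ := if_pos h

theorem positivePiece_of_two_le (D : DGLieAlgebra K L) (K₁ : Submodule K L) {i : ℤ}
    (h : 2 ≤ i) : D.positivePiece K₁ i = D.deg i := by
  rw [positivePiece, if_neg (by omega), if_neg (by omega)]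

theorem positivePiece_le (D : DGLieAlgebra K L) {K₁ : Submodule K L} (h₁ : K₁ ≤ D.deg 1)
    (i : ℤ) : D.positivePiece K₁ i ≤ D.deg i := by
  unfold positivePiece
  split_ifs with h h'
  · exact bot_le
  · exact h' ▸ h₁
  · exact le_rfl

/-- The DG Lie subalgebra `K ⊆ L` with `K^i = 0` for `i ≤ 0`, `K^1 = K₁` a given subspace of
`L^1`, and `K^i = L^i` for `i ≥ 2`. -/
def positiveSub (D : DGLieAlgebra K L) (K₁ : Submodule K L) (h₁ : K₁ ≤ D.deg 1) : D.Sub where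
  piece := D.positivePiece K₁
  piece_le := D.positivePiece_le h₁
  d_mem := by
    intro i x hx
    rcases le_or_gt i 0 with h | h
    · rw [D.positivePiece_of_nonpos K₁ h, Submodule.mem_bot] at hx
      simp [hx]
    · rw [D.positivePiece_of_two_le K₁ (by omega)]
      exact D.d_mem (D.positivePiece_le h₁ i hx)
  bracket_mem := by
    intro i j x y hx hy
    rcases le_or_gt i 0 with h | h
    · rw [D.positivePiece_of_nonpos K₁ h, Submodule.mem_bot] at hx
      simp [hx]
    rcases le_or_gt j 0 with h' | h'
    · rw [D.positivePiece_of_nonpos K₁ h', Submodule.mem_bot] at hy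
      simp [hy]
    rw [D.positivePiece_of_two_le K₁ (by omega)]
    exact D.bracket_mem (D.positivePiece_le h₁ i hx) (D.positivePiece_le h₁ j hy)

/-- `K₁` is a complement of `B^1(L)` in `L^1`. -/
def IsComplementOfB1 (D : DGLieAlgebra K L) (K₁ : Submodule K L) : Prop :=
  (D.boundaries ⊓ D.deg 1) ⊓ K₁ = ⊥ ∧ (D.boundaries ⊓ D.deg 1) ⊔ K₁ = D.deg 1

theorem IsComplementOfB1.le {D : DGLieAlgebra K L} {K₁ : Submodule K L}
    (h : D.IsComplementOfB1 K₁) : K₁ ≤ D.deg 1 :=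
  h.2 ▸ le_sup_right

end Subalgebra

end DGLieAlgebra

/-! ## `L_∞[1]` morphisms and formality -/

section LInfinity

/-- The Koszul sign of a permutation `σ` of homogeneous elements `x_1, …, x_n` of degrees
`s_1, …, s_n`, so that `x_1 ⊙ ⋯ ⊙ x_n = koszulSign s σ • (x_{σ 1} ⊙ ⋯ ⊙ x_{σ n})`. -/
def koszulSign {n : ℕ} (s : Fin n → ℤ) (σ : Equiv.Perm (Fin n)) : ℤˣ :=
  ∏ p : Fin n × Fin n with p.1 < p.2 ∧ σ p.2 < σ p.1, (s (σ p.1) * s (σ p.2)).negOnePow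

/-- The Koszul sign of the unshuffle that moves the elements with index in `A` to the front,
keeping the order inside `A` and inside its complement. -/
def unshuffleSign {n : ℕ} (s : Fin n → ℤ) (A : Finset (Fin n)) : ℤˣ :=
  ∏ p : Fin n × Fin n with p.1 ∈ A ∧ p.2 ∉ A ∧ p.2 < p.1, (s p.1 * s p.2).negOnePow

/-- The subsequence of `x` with indices in `A`, in increasing order. -/
def subseq {n : ℕ} {V : Type u} (x : Fin n → V) (A : Finset (Fin n)) : Fin A.card → V :=
  fun k => x (A.orderEmbOfFin rfl k)

variable {K : Type v} [Field K] {V : Type u} [AddCommGroup V] [Module K V]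
  {W : Type u} [AddCommGroup W] [Module K W]

/-- An `L_∞[1]` morphism `(V[1], Q) ⇢ (W[1], R)` between the `L_∞[1]` algebras of two DG Lie
algebras `V`, `W`, given by its Taylor coefficients `f_n : V[1]^{⊙ n} → W[1]`, `n ≥ 1`.

An element `x ∈ V^a` has degree `a - 1` in `V[1]`, and the `L_∞[1]` structures are
`q_1 x = -d x`, `q_2 (x, y) = (-1)^a [x, y]` for `x ∈ V^a`, and `q_n = 0` for `n ≥ 3`.
The field `relation` is the identity
`r_1 f_n(x_1, …, x_n) + (1/2) ∑_A ± r_2 (f_{|A|}(x_A), f_{n-|A|}(x_{Aᶜ}))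
  = ∑_j ± f_n(x_1, …, q_1 x_j, …, x_n) + ∑_{i < j} ± f_{n-1}(q_2(x_i, x_j), x_1, …, x_n)`
(`x_i`, `x_j` omitted at the end of the last term), where `A` runs over the nonempty proper
subsets of `{1, …, n}`, that is over the unshuffles, and `±` are the Koszul signs. -/
structure LInftyMorphism (D : DGLieAlgebra K V) (E : DGLieAlgebra K W) where
  coeff : ∀ n : ℕ, MultilinearMap K (fun _ : Fin n => V) W
  coeff_zero : coeff 0 = 0
  coeff_mem : ∀ {n : ℕ} (a : Fin n → ℤ) (x : Fin n → V), (∀ j, x j ∈ D.deg (a j)) →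
    coeff n x ∈ E.deg (∑ j, (a j - 1) + 1)
  coeff_symm : ∀ {n : ℕ} (a : Fin n → ℤ) (x : Fin n → V), (∀ j, x j ∈ D.deg (a j)) →
    ∀ σ : Equiv.Perm (Fin n),
      coeff n x = koszulSign (fun j => a j - 1) σ • coeff n (fun j => x (σ j))
  relation : ∀ {n : ℕ} (a : Fin n → ℤ) (x : Fin n → V), 1 ≤ n → (∀ j, x j ∈ D.deg (a j)) →
    -E.d (coeff n x) + (2 : K)⁻¹ •
        ∑ A : Finset (Fin n) with A.Nonempty ∧ Aᶜ.Nonempty,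
          unshuffleSign (fun j => a j - 1) A • (∑ j ∈ A, (a j - 1) + 1).negOnePow •
            E.bracket (coeff A.card (subseq x A)) (coeff Aᶜ.card (subseq x Aᶜ)) =
      (∑ j, (∑ i ∈ Finset.Iio j, (a i - 1)).negOnePow •
          coeff n (Function.update x j (-D.d (x j)))) +
        ∑ p : Fin n × Fin n with p.1 < p.2,
          unshuffleSign (fun j => a j - 1) {p.1, p.2} •
            coeff (({p.1, p.2}ᶜ : Finset (Fin n)).card + 1)
              (Fin.cons ((a p.1).negOnePow • D.bracket (x p.1) (x p.2))
                (subseq x ({p.1, p.2}ᶜ : Finset (Fin n))))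

/-- A map `φ` between the underlying spaces of two DG Lie algebras induces a bijection in
cohomology. -/
def IsQuasiIso (D : DGLieAlgebra K V) (E : DGLieAlgebra K W) (φ : V → W) : Prop :=
  (∀ x ∈ D.cycles, φ x ∈ E.cycles) ∧ (∀ x ∈ D.boundaries, φ x ∈ E.boundaries) ∧
    (∀ x ∈ D.cycles, φ x ∈ E.boundaries → x ∈ D.boundaries) ∧
    (∀ y ∈ E.cycles, ∃ x ∈ D.cycles, y - φ x ∈ E.boundaries)

/-- An `L_∞[1]` morphism is a weak equivalence if its linear part is a quasi-isomorphism. -/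
def LInftyMorphism.IsWeakEquivalence {D : DGLieAlgebra K V} {E : DGLieAlgebra K W}
    (F : LInftyMorphism D E) : Prop :=
  IsQuasiIso D E (fun x => F.coeff 1 (fun _ => x))

/-- A DG Lie algebra is formal if there is an `L_∞[1]` weak equivalence from it to its
cohomology graded Lie algebra. -/
def DGLieAlgebra.IsFormal (D : DGLieAlgebra K V) : Prop :=
  ∃ F : LInftyMorphism D D.cohomology, F.IsWeakEquivalence

end LInfinity

/-! ## Linear algebraic groups and their representations -/

section AlgebraicGroup

variable {K : Type v} [Field K] {n : ℕ}

/-- `G` is a linear algebraic group: a subgroup of `GL_n(K)` that is the set of zeros of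
polynomials in the matrix entries. -/
def IsZariskiClosed (G : Subgroup (GL (Fin n) K)) : Prop :=
  ∃ S : Set (MvPolynomial (Fin n × Fin n) K), ∀ g : GL (Fin n) K,
    g ∈ G ↔ ∀ p ∈ S, MvPolynomial.eval (fun ij => (g : Matrix (Fin n) (Fin n) K) ij.1 ij.2) p = 0

/-- The matrix entry `g ↦ g_{ij}`, as a function on `G`. -/
def entry (G : Subgroup (GL (Fin n) K)) (i j : Fin n) : G → K :=
  fun g => ((g : GL (Fin n) K) : Matrix (Fin n) (Fin n) K) i j

/-- The algebra of regular functions on `G`: polynomials in the entries of `g` and of `g⁻¹`. -/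
def regularFunctions (G : Subgroup (GL (Fin n) K)) : Subalgebra K (G → K) :=
  Algebra.adjoin K
    ({f | ∃ i j, f = entry G i j} ∪ {f | ∃ i j, f = fun g => entry G i j g⁻¹})

/-- Left translation `(λ_h f)(g) = f (h g)` on all functions on `G`. -/
def translateFun (G : Subgroup (GL (Fin n) K)) (h : G) : (G → K) →ₐ[K] (G → K) :=
  AlgHom.pi (fun g => Pi.evalAlgHom K (fun _ : G => K) (h * g))

theorem entry_mul (G : Subgroup (GL (Fin n) K)) (i j : Fin n) (g h : G) :
    entry G i j (g * h) = ∑ k, entry G i k g * entry G k j h := by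
  simp [entry, Matrix.mul_apply]

theorem entry_mem (G : Subgroup (GL (Fin n) K)) (i j : Fin n) :
    entry G i j ∈ regularFunctions G :=
  Algebra.subset_adjoin (Set.mem_union_left _ ⟨i, j, rfl⟩)

theorem entry_inv_mem (G : Subgroup (GL (Fin n) K)) (i j : Fin n) :
    (fun g => entry G i j g⁻¹) ∈ regularFunctions G :=
  Algebra.subset_adjoin (Set.mem_union_right _ ⟨i, j, rfl⟩)

theorem translateFun_mem (G : Subgroup (GL (Fin n) K)) (h : G) {f : G → K}
    (hf : f ∈ regularFunctions G) : translateFun G h f ∈ regularFunctions G := by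
  suffices H : regularFunctions G ≤ (regularFunctions G).comap (translateFun G h) from H hf
  refine Algebra.adjoin_le ?_
  rintro _ (⟨i, j, rfl⟩ | ⟨i, j, rfl⟩)
  · have h1 : translateFun G h (entry G i j) = ∑ k, entry G i k h • entry G k j := by
      funext g
      simp [translateFun, entry_mul]
    change translateFun G h (entry G i j) ∈ regularFunctions G
    rw [h1]
    exact sum_mem fun k _ =>
      Subalgebra.smul_mem _ (entry_mem G k j) _
  · have h1 : translateFun G h (fun g => entry G i j g⁻¹) =
        ∑ k, entry G k j h⁻¹ • fun g => entry G i k g⁻¹ := by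
      funext g
      simp [translateFun, entry_mul, mul_comm]
    change translateFun G h (fun g => entry G i j g⁻¹) ∈ regularFunctions G
    rw [h1]
    exact sum_mem fun k _ =>
      Subalgebra.smul_mem _ (entry_inv_mem G i k) _

/-- Left translation `(λ_h f)(g) = f (h g)` on regular functions. -/
def leftTranslate (G : Subgroup (GL (Fin n) K)) (h : G) :
    regularFunctions G →ₐ[K] regularFunctions G :=
  ((translateFun G h).comp (regularFunctions G).val).codRestrict (regularFunctions G)
    (fun f => translateFun_mem G h f.2)

/-- A derivation of the algebra of regular functions that commutes with left translations. -/
def IsLeftInvariant {G : Subgroup (GL (Fin n) K)}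
    (X : Derivation K (regularFunctions G) (regularFunctions G)) : Prop :=
  ∀ (h : G) (f : regularFunctions G), X (leftTranslate G h f) = leftTranslate G h (X f)

theorem IsLeftInvariant.lie {G : Subgroup (GL (Fin n) K)}
    {X Y : Derivation K (regularFunctions G) (regularFunctions G)}
    (hX : IsLeftInvariant X) (hY : IsLeftInvariant Y) : IsLeftInvariant ⁅X, Y⁆ := by
  intro h f
  rw [Derivation.commutator_apply, Derivation.commutator_apply, map_sub, hY h f, hX h f,
    hX h (Y f), hY h (X f)]

/-- The Lie algebra of `G`: the left invariant derivations of the algebra of regular functions,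
with the commutator bracket. -/
def lieAlgebraOf (G : Subgroup (GL (Fin n) K)) :
    LieSubalgebra K (Derivation K (regularFunctions G) (regularFunctions G)) where
  carrier := {X | IsLeftInvariant X}
  add_mem' {X Y} hX hY h f := by
    rw [Derivation.add_apply, Derivation.add_apply, map_add, hX h f, hY h f]
  zero_mem' h f := by
    rw [Derivation.zero_apply, Derivation.zero_apply, map_zero]
  smul_mem' c X hX h f := by
    rw [Derivation.smul_apply, Derivation.smul_apply, map_smul, hX h f]
  lie_mem' hX hY := IsLeftInvariant.lie hX hY

/-- The tangent vector at `1 ∈ G` of an element of the Lie algebra, applied to a regular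
function. -/
def tangentAtOne {G : Subgroup (GL (Fin n) K)} (X : lieAlgebraOf G) (f : regularFunctions G) : K :=
  ((X : Derivation K (regularFunctions G) (regularFunctions G)) f : G → K) 1

variable {G : Subgroup (GL (Fin n) K)} {V : Type u} [AddCommGroup V] [Module K V]

/-- All matrix coefficients of the representation are regular functions on `G`. For a
finite-dimensional `V` this says that `G → GL(V)` is a morphism of algebraic groups. -/
def IsAlgebraicRep (ρ : Representation K G V) : Prop :=
  ∀ (φ : Module.Dual K V) (v : V), (fun g => φ (ρ g v)) ∈ regularFunctions G

/-- A representation is rational if every vector lies in a finite-dimensional invariant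
subspace `U` on which `G → GL(U)` is algebraic. -/
def IsRationalRep (ρ : Representation K G V) : Prop :=
  ∀ v : V, ∃ U : Subrepresentation ρ, v ∈ U ∧ FiniteDimensional K U.toSubmodule ∧
    IsAlgebraicRep U.toRepresentation

/-- `G` is (linearly) reductive: every finite-dimensional rational representation of `G` is
semisimple. -/
def IsLinearlyReductive (G : Subgroup (GL (Fin n) K)) : Prop :=
  ∀ (m : ℕ) (ρ : Representation K G (Fin m → K)), IsAlgebraicRep ρ → ρ.IsSemisimpleRepresentation

/-- The class of the representation `σ` belongs to the support of `ρ`: `σ` is irreducible and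
has a nonzero equivariant map to the quotient of `ρ` by an invariant subspace. -/
def InSupport (ρ : Representation K G V) {H : Type u} [AddCommGroup H] [Module K H]
    (σ : Representation K G H) : Prop :=
  σ.IsIrreducible ∧ ∃ (W : Submodule K V) (hW : ∀ g, W ≤ W.comap (ρ g)),
    ∃ f : σ.IntertwiningMap (ρ.quotient W hW), f ≠ 0

/-- The support of `ρ` consists of finitely many isomorphism classes. (An irreducible
representation in the support is isomorphic to a subspace of a quotient of `V`, so that
representations in the universe of `V` suffice.) -/
def IsFinitelySupported (ρ : Representation K G V) : Prop :=
  ∃ S : Set (Rep.{u} K G), S.Finite ∧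
    ∀ E : Rep.{u} K G, InSupport ρ E.ρ → ∃ E' ∈ S, Nonempty (E.ρ.Equiv E'.ρ)

/-- `w = dρ(X) v`: the derivative at `1` in the direction `X` of the orbit map `g ↦ ρ(g) v`
is `w`, tested against all linear functionals for which the coefficient is regular (for a
rational representation, all linear functionals). -/
def IsInfinitesimalAction (ρ : Representation K G V) (X : lieAlgebraOf G) (v w : V) : Prop :=
  ∀ (φ : Module.Dual K V) (f : regularFunctions G), (∀ g, (f : G → K) g = φ (ρ g v)) →
    tangentAtOne X f = φ w

/-- `ρ` is an action of `G` on `L` by automorphisms of DG Lie algebras. -/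
structure IsDGLieAction (D : DGLieAlgebra K V) (ρ : Representation K G V) : Prop where
  map_deg : ∀ (g : G) {i : ℤ} {x : V}, x ∈ D.deg i → ρ g x ∈ D.deg i
  map_d : ∀ (g : G) (x : V), ρ g (D.d x) = D.d (ρ g x)
  map_bracket : ∀ (g : G) (x y : V), ρ g (D.bracket x y) = D.bracket (ρ g x) (ρ g y)

/-- The representation on the homogeneous component of degree `i`. -/
def IsDGLieAction.onDeg {D : DGLieAlgebra K V} {ρ : Representation K G V}
    (h : IsDGLieAction D ρ) (i : ℤ) : Representation K G (D.deg i) :=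
  (Subrepresentation.mk (ρ := ρ) (D.deg i) (fun g _ hx => h.map_deg g hx)).toRepresentation

end AlgebraicGroup

set_option linter.unusedSectionVars false

/-! The criterion behind the proof: a DG Lie algebra is formal as soon as the degree derivation of
its cohomology (multiplication by `i` in degree `i`) lifts to an Euler coderivation, that is, a
coderivation of the bar coalgebra that commutes with the codifferential `Q`. An `L_∞` morphism to a
graded Lie algebra is a Maurer–Cartan cochain, a solution of `f Q + ½ [f, f] = 0` (`relation_iff`).

Formality gives an Euler coderivation: the degree derivation of the cohomology is lifted through the
quasi-isomorphism arity by arity, with a contraction onto the cohomology absorbing the obstructions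
(`exists_euler`). Conversely, a Maurer–Cartan cochain is built arity by arity. The curvature in
arity `n` is a closed cochain, and it is exact if it vanishes on representatives of cohomology
classes (`exists_primitive`). The Euler coderivation forces its value there to be killed by the
weight `2 - n`, so it vanishes for `n > 2`; for `n = 2` it vanishes because the linear part is
multiplicative on cycles. To keep this argument alive one also carries a homotopy `s` up to which
`f` intertwines the Euler coderivation with the degree derivation; the defect of this relation has
weight `1 - n` and is removed by dividing by `n - 1` (`exists_step`, `exists_maurerCartan`).

From `L` to `K`: the inclusion is injective in cohomology and bijective onto the positive part.
Restricting a Maurer–Cartan cochain of `L` to `K` gives values in positive degrees, where the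
retraction induces a multiplicative map `H(L) → H(K)` (`isFormal_of_isFormal`).

From `K` to `L`: formality of `K` gives an Euler coderivation `F` of `K`. The group acts on cochains
of `K`; on cochains supported on words of bounded length and weight this action is rational, which
uses finite support, so linear reductivity splits them into invariants and derivatives. Averaging
makes `F` invariant under the Lie algebra while it still commutes with `Q` and acts on cohomology as
before (`exists_invariant_euler`). Composing `F` with the retraction `L → K` extends it to `L`. The
subalgebra spanned by `K` and `ι(𝔤)` carries all the cohomology; on words of this subalgebra the
extension commutes with `Q`, because the obstruction with a letter `ι(ξ)` inserted is, up to sign,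
the infinitesimal action of `ξ` on `F`, which is zero (`contr_codiffComm`, `exists_eulerData`). Such
data suffice for the converse criterion on `L`.

Cochains are functions on words of labelled vectors, and all operations are defined by recursion on
the first letter, so that identities with Koszul signs become inductions on words. -/

namespace LieCochain

/-! ## Signs -/

/-- The sign `(-1)^n` as a scalar. -/
def sgn (K : Type v) [Field K] (n : ℤ) : K := ((n.negOnePow : ℤ) : K)

section Sign

variable (K : Type v) [Field K]

theorem sgn_add (m n : ℤ) : sgn K (m + n) = sgn K m * sgn K n := by
  simp [sgn, Int.negOnePow_add]

@[simp] theorem sgn_zero : sgn K 0 = 1 := by simp [sgn]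

@[simp] theorem sgn_one : sgn K 1 = -1 := by simp [sgn]

@[simp] theorem sgn_two : sgn K 2 = 1 := by
  rw [show (2 : ℤ) = 1 + 1 by norm_num, sgn_add]; simp

theorem sgn_eq_or (n : ℤ) : sgn K n = 1 ∨ sgn K n = -1 := by
  rcases Int.even_or_odd n with h | h
  · left; simp [sgn, Int.negOnePow_even n h]
  · right; simp [sgn, Int.negOnePow_odd n h]

theorem sgn_mul_self (n : ℤ) : sgn K n * sgn K n = 1 := by
  rcases sgn_eq_or K n with h | h <;> simp [h]

theorem sgn_neg (n : ℤ) : sgn K (-n) = sgn K n := by simp [sgn]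

theorem units_smul_eq_sgn {V : Type u} [AddCommGroup V] [Module K V] (n : ℤ) (x : V) :
    n.negOnePow • x = sgn K n • x := by
  rw [sgn, Units.smul_def, Int.cast_smul_eq_zsmul]

end Sign

/-! ## Cochains on words -/

/-- Words in labelled vectors. The letter `(s, x)` stands for `x` placed in shifted degree `s`. -/
abbrev Word (V : Type u) := List (ℤ × V)

/-- The total shifted degree of a word. -/
def Word.weight {V : Type u} (l : Word V) : ℤ := (l.map Prod.fst).sum

@[simp] theorem Word.weight_nil {V : Type u} : Word.weight ([] : Word V) = 0 := rfl

@[simp] theorem Word.weight_cons {V : Type u} (x : ℤ × V) (l : Word V) :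
    Word.weight (x :: l) = x.1 + Word.weight l := by simp [Word.weight]

@[simp] theorem Word.weight_append {V : Type u} (l m : Word V) :
    Word.weight (l ++ m) = Word.weight l + Word.weight m := by simp [Word.weight]

/-- Plugging in a first letter. -/
def contr {V W : Type u} (x : ℤ × V) (f : Word V → W) : Word V → W := fun l => f (x :: l)

theorem contr_apply {V W : Type u} (x : ℤ × V) (f : Word V → W) (l : Word V) :
    contr x f l = f (x :: l) := rfl

section Operations

variable {K : Type v} [Field K] {V W : Type u} [AddCommGroup V] [Module K V]
  [AddCommGroup W] [Module K W]

/-- The convolution product of two cochains with respect to a bilinear map `B`; the integer is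
the degree of the second factor. -/
def conv (B : W →ₗ[K] W →ₗ[K] W) (k : ℤ) (f g : Word V → W) : Word V → W
  | [] => B (f []) (g [])
  -- The letter enters `f` after moving past `g`, which has degree `k`, or enters `g` with no sign
  -- and changes the degree of `g`.
  | x :: l => sgn K (k * x.1) • conv B k (contr x f) g l + conv B (k + x.1) f (contr x g) l

variable (K) in
/-- Composition of `f` with the coderivation with corestriction `F`, of shifted degree `e`. -/
def comp (e : ℤ) (f : Word V → W) (F : Word V → V) : Word V → W
  | [] => f [(e, F [])]
  -- The letter is absorbed by `F`, changing its degree, or moves past `F` to become an argument of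
  -- `f`.
  | x :: l => comp (e + x.1) f (contr x F) l + sgn K (e * x.1) • comp e (contr x f) F l

variable (K) in
/-- Composition of `f` with the coderivation extending the linear map `a`, of degree `e`. -/
def der (e : ℤ) (a : V → V) (f : Word V → W) : Word V → W
  | [] => 0
  | x :: l => f ((x.1 + e, a x.2) :: l) + sgn K (e * x.1) • der e a (contr x f) l

theorem contr_conv (B : W →ₗ[K] W →ₗ[K] W) (k : ℤ) (f g : Word V → W) (x : ℤ × V) :
    contr x (conv B k f g) =
      sgn K (k * x.1) • conv B k (contr x f) g + conv B (k + x.1) f (contr x g) := rfl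

theorem contr_comp (e : ℤ) (f : Word V → W) (F : Word V → V) (x : ℤ × V) :
    contr x (comp K e f F) =
      comp K (e + x.1) f (contr x F) + sgn K (e * x.1) • comp K e (contr x f) F := rfl

theorem contr_add (f g : Word V → W) (x : ℤ × V) : contr x (f + g) = contr x f + contr x g := rfl
theorem contr_sub (f g : Word V → W) (x : ℤ × V) : contr x (f - g) = contr x f - contr x g := rfl
theorem contr_smul (c : K) (f : Word V → W) (x : ℤ × V) : contr x (c • f) = c • contr x f := rfl

/-! ### Linearity -/

theorem conv_add_left (B : W →ₗ[K] W →ₗ[K] W) (k : ℤ) (f f' g : Word V → W) :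
    conv B k (f + f') g = conv B k f g + conv B k f' g := by
  funext l
  induction l generalizing k f f' g with
  | nil => simp [conv]
  | cons x l ih => simp only [conv, contr_add, ih, Pi.add_apply]; module

theorem conv_add_right (B : W →ₗ[K] W →ₗ[K] W) (k : ℤ) (f g g' : Word V → W) :
    conv B k f (g + g') = conv B k f g + conv B k f g' := by
  funext l
  induction l generalizing k f g g' with
  | nil => simp [conv]
  | cons x l ih => simp only [conv, contr_add, ih, Pi.add_apply]; module

theorem conv_smul_left (B : W →ₗ[K] W →ₗ[K] W) (k : ℤ) (c : K) (f g : Word V → W) :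
    conv B k (c • f) g = c • conv B k f g := by
  funext l
  induction l generalizing k f g with
  | nil => simp [conv]
  | cons x l ih => simp only [conv, contr_smul, ih, Pi.smul_apply]; module

theorem conv_smul_right (B : W →ₗ[K] W →ₗ[K] W) (k : ℤ) (c : K) (f g : Word V → W) :
    conv B k f (c • g) = c • conv B k f g := by
  funext l
  induction l generalizing k f g with
  | nil => simp [conv]
  | cons x l ih => simp only [conv, contr_smul, ih, Pi.smul_apply]; module

theorem conv_sub_left (B : W →ₗ[K] W →ₗ[K] W) (k : ℤ) (f f' g : Word V → W) :
    conv B k (f - f') g = conv B k f g - conv B k f' g := by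
  have h := conv_add_left B k (f - f') f' g
  rw [sub_add_cancel] at h
  rw [h, add_sub_cancel_right]

theorem conv_sub_right (B : W →ₗ[K] W →ₗ[K] W) (k : ℤ) (f g g' : Word V → W) :
    conv B k f (g - g') = conv B k f g - conv B k f g' := by
  have h := conv_add_right B k f (g - g') g'
  rw [sub_add_cancel] at h
  rw [h, add_sub_cancel_right]

theorem comp_add_left (e : ℤ) (f f' : Word V → W) (F : Word V → V) :
    comp K e (f + f') F = comp K e f F + comp K e f' F := by
  funext l
  induction l generalizing e f f' F with
  | nil => simp [comp]
  | cons x l ih => simp only [comp, contr_add, ih, Pi.add_apply]; module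

theorem comp_smul_left (e : ℤ) (c : K) (f : Word V → W) (F : Word V → V) :
    comp K e (c • f) F = c • comp K e f F := by
  funext l
  induction l generalizing e f F with
  | nil => simp [comp]
  | cons x l ih => simp only [comp, contr_smul, ih, Pi.smul_apply]; module

theorem comp_zero_left (e : ℤ) (F : Word V → V) : comp K e (0 : Word V → W) F = 0 := by
  simpa using comp_smul_left e (0 : K) (0 : Word V → W) F

theorem comp_sub_left (e : ℤ) (f f' : Word V → W) (F : Word V → V) :
    comp K e (f - f') F = comp K e f F - comp K e f' F := by
  have h := comp_add_left (K := K) e (f - f') f' F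
  rw [sub_add_cancel] at h
  rw [h, add_sub_cancel_right]

theorem der_add (e : ℤ) (a : V → V) (f f' : Word V → W) :
    der K e a (f + f') = der K e a f + der K e a f' := by
  funext l
  induction l generalizing f f' with
  | nil => simp [der]
  | cons x l ih => simp only [der, contr_add, ih, Pi.add_apply]; module

theorem der_smul (e : ℤ) (a : V → V) (c : K) (f : Word V → W) :
    der K e a (c • f) = c • der K e a f := by
  funext l
  induction l generalizing f with
  | nil => simp [der]
  | cons x l ih => simp only [der, contr_smul, ih, Pi.smul_apply]; module

theorem der_sub (e : ℤ) (a : V → V) (f f' : Word V → W) :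
    der K e a (f - f') = der K e a f - der K e a f' := by
  have h := der_add (K := K) e a (f - f') f'
  rw [sub_add_cancel] at h
  rw [h, add_sub_cancel_right]

theorem der_zero (e : ℤ) (a : V → V) : der K e a (0 : Word V → W) = 0 := by
  simpa using der_smul e a (0 : K) (0 : Word V → W)

variable (K) in
/-- A function on words is multilinear if it is linear in each letter. -/
def IsMultilin (f : Word V → W) : Prop :=
  ∀ (p : Word V) (s : ℤ) (q : Word V), IsLinearMap K (fun x => f (p ++ (s, x) :: q))

theorem IsMultilin.contr {f : Word V → W} (hf : IsMultilin K f) (x : ℤ × V) :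
    IsMultilin K (contr x f) := fun p s q => hf (x :: p) s q

theorem IsMultilin.map_add {f : Word V → W} (hf : IsMultilin K f) (p : Word V) (s : ℤ)
    (q : Word V) (x y : V) :
    f (p ++ (s, x + y) :: q) = f (p ++ (s, x) :: q) + f (p ++ (s, y) :: q) :=
  (hf p s q).map_add x y

theorem IsMultilin.map_smul {f : Word V → W} (hf : IsMultilin K f) (p : Word V) (s : ℤ)
    (q : Word V) (c : K) (x : V) :
    f (p ++ (s, c • x) :: q) = c • f (p ++ (s, x) :: q) :=
  (hf p s q).map_smul c x

theorem IsMultilin.map_zero {f : Word V → W} (hf : IsMultilin K f) (p : Word V) (s : ℤ)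
    (q : Word V) : f (p ++ (s, 0) :: q) = 0 := (hf p s q).map_zero

theorem comp_add_right (e : ℤ) {f : Word V → W} (hf : IsMultilin K f) (F F' : Word V → V) :
    comp K e f (F + F') = comp K e f F + comp K e f F' := by
  funext l
  induction l generalizing e f F F' with
  | nil => exact hf.map_add [] e [] _ _
  | cons x l ih =>
    simp only [comp, contr_add, ih _ hf, ih _ (hf.contr x), Pi.add_apply]; module

theorem comp_smul_right (e : ℤ) (c : K) {f : Word V → W} (hf : IsMultilin K f)
    (F : Word V → V) : comp K e f (c • F) = c • comp K e f F := by
  funext l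
  induction l generalizing e f F with
  | nil => exact hf.map_smul [] e [] _ _
  | cons x l ih =>
    simp only [comp, contr_smul, ih _ hf, ih _ (hf.contr x), Pi.smul_apply]; module

theorem comp_zero_right (e : ℤ) {f : Word V → W} (hf : IsMultilin K f) :
    comp K e f 0 = 0 := by
  simpa using comp_smul_right e (0 : K) hf 0

theorem comp_sub_right (e : ℤ) {f : Word V → W} (hf : IsMultilin K f) (F F' : Word V → V) :
    comp K e f (F - F') = comp K e f F - comp K e f F' := by
  have h := comp_add_right e hf (F - F') F'
  rw [sub_add_cancel] at h
  rw [h, add_sub_cancel_right]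

/-! ### Derivation properties -/

/-- Coderivations act on cochains by derivations of the convolution product. -/
theorem comp_conv (B : W →ₗ[K] W →ₗ[K] W) (k e : ℤ) (f g : Word V → W) (F : Word V → V) :
    comp K e (conv B k f g) F =
      sgn K (k * e) • conv B k (comp K e f F) g + conv B (k + e) f (comp K e g F) := by
  funext l
  induction l generalizing k e f g F with
  | nil => simp [comp, conv, contr]
  | cons x l ih =>
    simp only [comp, conv, contr_conv, contr_comp, comp_add_left, comp_smul_left, conv_add_left,
      conv_smul_left, conv_add_right, conv_smul_right, ih, Pi.add_apply, Pi.smul_apply]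
    rw [show k + (e + x.1) = k + e + x.1 by ring, show k + x.1 + e = k + e + x.1 by ring]
    simp only [mul_add, add_mul, sgn_add, mul_comm x.1 e]
    match_scalars <;>
      first
      | ring1
      | (rcases sgn_eq_or K (e * x.1) with h | h <;> rw [h] <;> ring1)

/-- Postcomposition with a linear map. -/
theorem map_comp {U : Type u} [AddCommGroup U] [Module K U] (A : W →ₗ[K] U) (e : ℤ)
    (f : Word V → W) (F : Word V → V) (l : Word V) :
    A (comp K e f F l) = comp K e (fun m => A (f m)) F l := by
  induction l generalizing e f F with
  | nil => rfl
  | cons x l ih => simp only [comp, map_add, map_smul, ih]; rfl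

theorem map_conv (B : W →ₗ[K] W →ₗ[K] W) (A : W →ₗ[K] W)
    (hA : ∀ x y, A (B x y) = B (A x) y + B x (A y)) (k : ℤ) (f g : Word V → W) (l : Word V) :
    A (conv B k f g l) = conv B k (fun m => A (f m)) g l + conv B k f (fun m => A (g m)) l := by
  induction l generalizing k f g with
  | nil => exact hA _ _
  | cons x l ih =>
    have h : ∀ f : Word V → W, contr x (fun m => A (f m)) = fun m => A (contr x f m) :=
      fun _ => rfl
    simp only [conv, map_add, map_smul, ih, h]
    module

/-! ### Vanishing -/

/-- `f` vanishes on words of length less than `m`. -/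
def VanishBelow (m : ℕ) (f : Word V → W) : Prop := ∀ l : Word V, l.length < m → f l = 0

theorem VanishBelow.contr {m : ℕ} {f : Word V → W} (hf : VanishBelow m f) (x : ℤ × V) :
    VanishBelow (m - 1) (contr x f) := fun l hl => hf _ (by simp; omega)

theorem VanishBelow.mono {m n : ℕ} {f : Word V → W} (hf : VanishBelow m f) (h : n ≤ m) :
    VanishBelow n f := fun l hl => hf l (by omega)

/-- The letters are distributed between `f` and `g`; with fewer than `m + r` of them one factor gets
too few. -/
theorem conv_eq_zero (B : W →ₗ[K] W →ₗ[K] W) {m r : ℕ} (k : ℤ) {f g : Word V → W}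
    (hf : VanishBelow m f) (hg : VanishBelow r g) {l : Word V} (hl : l.length < m + r) :
    conv B k f g l = 0 := by
  induction l generalizing k f g m r with
  | nil =>
    rcases Nat.eq_zero_or_pos m with rfl | hm
    · simp [conv, hg [] (by simpa using hl)]
    · simp [conv, hf [] (by simpa using hm)]
  | cons x l ih =>
    simp only [List.length_cons] at hl
    simp only [conv]
    rw [ih k (hf.contr x) hg, ih _ hf (hg.contr x)]
    · simp
    · rcases Nat.eq_zero_or_pos r with rfl | hr
      · omega
      · omega
    · omega

/-- If `F` takes `a` letters, then `f` receives the other `l.length - a` and the output of `F`; this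
output accounts for the `+ 1`. -/
theorem comp_eq_zero {m r : ℕ} (e : ℤ) {f : Word V → W} (hl : IsMultilin K f) {F : Word V → V}
    (hf : VanishBelow m f) (hF : VanishBelow r F) {l : Word V} (h : l.length + 1 < m + r) :
    comp K e f F l = 0 := by
  induction l generalizing e f F m r with
  | nil =>
    simp only [List.length_nil] at h
    rcases Nat.lt_or_ge 1 m with hm | hm
    · exact hf _ (by simpa using hm)
    · have : F [] = 0 := hF _ (by simp; omega)
      simp only [comp, this]
      exact hl.map_zero [] e []
  | cons x l ih =>
    simp only [List.length_cons] at h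
    simp only [comp]
    rw [ih _ hl hf (hF.contr x) (by omega), ih _ (hl.contr x) (hf.contr x) hF (by omega)]
    simp

theorem comp_eq_zero_of_right {r : ℕ} (e : ℤ) {f : Word V → W} (hl : IsMultilin K f)
    {F : Word V → V} (hF : VanishBelow r F) {l : Word V} (h : l.length < r) :
    comp K e f F l = 0 := by
  induction l generalizing e f F r with
  | nil =>
    have : F [] = 0 := hF _ h
    simp only [comp, this]
    exact hl.map_zero [] e []
  | cons x l ih =>
    simp only [List.length_cons] at h
    simp only [comp]
    rw [ih _ hl (hF.contr x) (by omega), ih _ (hl.contr x) hF (by omega)]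
    simp

/-- The leading term of a composition with a coderivation that vanishes in low arity. -/
theorem comp_leading_right {r : ℕ} (e : ℤ) {f : Word V → W} (hl : IsMultilin K f)
    {F : Word V → V} (hF : VanishBelow r F) {l : Word V} (h : l.length = r) :
    comp K e f F l = f [(e + l.weight, F l)] := by
  induction l generalizing e F r with
  | nil => simp [comp]
  | cons x l ih =>
    simp only [List.length_cons] at h
    simp only [comp]
    rw [ih _ (hF.contr x) (by omega), comp_eq_zero_of_right _ (hl.contr x) hF (by omega)]
    simp [contr, add_assoc]

/-- A composition only involves the values of the coderivation on subwords. -/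
theorem comp_eq_zero_of_letters (P : ℤ × V → Prop) (e : ℤ) {f : Word V → W}
    (hl : IsMultilin K f) {F : Word V → V} (hF : ∀ l : Word V, (∀ x ∈ l, P x) → F l = 0)
    {l : Word V} (h : ∀ x ∈ l, P x) : comp K e f F l = 0 := by
  induction l generalizing e f F with
  | nil =>
    simp only [comp, hF [] (by simp)]
    exact hl.map_zero [] e []
  | cons x l ih =>
    have hx := h x (by simp)
    have h' : ∀ y ∈ l, P y := fun y hy => h y (by simp [hy])
    simp only [comp]
    rw [ih _ hl (F := contr x F) (fun m hm => hF (x :: m) (by simpa [hx] using hm)) h',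
      ih _ (hl.contr x) hF h']
    simp

end Operations

/-! ### Symmetric multilinear cochains and commutators of coderivations. -/

section Commutators

variable {K : Type v} [Field K] {V W : Type u} [AddCommGroup V] [Module K V]
  [AddCommGroup W] [Module K W]

variable (K) in
/-- Graded symmetry of a function on words. -/
def IsSymm (f : Word V → W) : Prop :=
  ∀ (p : Word V) (x y : ℤ × V) (q : Word V),
    f (p ++ x :: y :: q) = sgn K (x.1 * y.1) • f (p ++ y :: x :: q)

theorem IsSymm.contr {f : Word V → W} (hf : IsSymm K f) (z : ℤ × V) : IsSymm K (contr z f) :=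
  fun p x y q => hf (z :: p) x y q

theorem IsSymm.contr_contr {f : Word V → W} (hf : IsSymm K f) (x y : ℤ × V) :
    LieCochain.contr y (LieCochain.contr x f) =
      sgn K (x.1 * y.1) • LieCochain.contr x (LieCochain.contr y f) :=
  funext fun l => hf [] x y l

theorem IsMultilin.contr_add {f : Word V → W} (hf : IsMultilin K f) (s : ℤ) (x y : V) :
    LieCochain.contr (s, x + y) f = LieCochain.contr (s, x) f + LieCochain.contr (s, y) f :=
  funext fun l => hf.map_add [] s l x y

theorem IsMultilin.contr_smul {f : Word V → W} (hf : IsMultilin K f) (s : ℤ) (c : K) (x : V) :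
    LieCochain.contr (s, c • x) f = c • LieCochain.contr (s, x) f :=
  funext fun l => hf.map_smul [] s l c x

theorem IsMultilin.comp {f : Word V → W} (hf : IsMultilin K f) {F : Word V → V}
    (hF : IsMultilin K F) (e : ℤ) : IsMultilin K (comp K e f F) := by
  intro p s q
  induction p generalizing e f F with
  | nil =>
    constructor
    · intro x y
      simp only [List.nil_append, LieCochain.comp, hf.contr_add, hF.contr_add, comp_add_left,
        comp_add_right _ hf, Pi.add_apply]
      module
    · intro c x
      simp only [List.nil_append, LieCochain.comp, hf.contr_smul, hF.contr_smul, comp_smul_left,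
        comp_smul_right _ _ hf, Pi.smul_apply]
      module
  | cons z p ih =>
    have h1 := ih hf (hF.contr z) (e + z.1)
    have h2 := ih (hf.contr z) hF e
    constructor
    · intro x y
      simp only [List.cons_append, LieCochain.comp, h1.map_add, h2.map_add]
      module
    · intro c x
      simp only [List.cons_append, LieCochain.comp, h1.map_smul, h2.map_smul]
      module

theorem IsMultilin.conv (B : W →ₗ[K] W →ₗ[K] W) {f g : Word V → W} (hf : IsMultilin K f)
    (hg : IsMultilin K g) (k : ℤ) : IsMultilin K (conv B k f g) := by
  intro p s q
  induction p generalizing k f g with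
  | nil =>
    constructor
    · intro x y
      simp only [List.nil_append, LieCochain.conv, hf.contr_add, hg.contr_add, conv_add_left,
        conv_add_right, Pi.add_apply]
      module
    · intro c x
      simp only [List.nil_append, LieCochain.conv, hf.contr_smul, hg.contr_smul, conv_smul_left,
        conv_smul_right, Pi.smul_apply]
      module
  | cons z p ih =>
    have h1 := ih hf (hg.contr z) (k + z.1)
    have h2 := ih (hf.contr z) hg k
    constructor
    · intro x y
      simp only [List.cons_append, LieCochain.conv, h1.map_add, h2.map_add]
      module
    · intro c x
      simp only [List.cons_append, LieCochain.conv, h1.map_smul, h2.map_smul]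
      module

theorem IsSymm.comp {f : Word V → W} (hf : IsMultilin K f) (hf' : IsSymm K f)
    {F : Word V → V} (hF : IsSymm K F) (e : ℤ) : IsSymm K (comp K e f F) := by
  intro p x y q
  induction p generalizing e f F with
  | nil =>
    simp only [List.nil_append, LieCochain.comp, hf'.contr_contr x y, hF.contr_contr x y,
      comp_smul_left, comp_smul_right _ _ hf, Pi.smul_apply]
    rw [show e + y.1 + x.1 = e + x.1 + y.1 by ring]
    simp only [add_mul, sgn_add, mul_comm y.1 x.1]
    match_scalars <;>
      first
      | ring1
      | (rcases sgn_eq_or K (x.1 * y.1) with h | h <;> rw [h] <;> ring1)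
  | cons z p ih =>
    simp only [List.cons_append, LieCochain.comp, ih hf hf' (hF.contr z),
      ih (hf.contr z) (hf'.contr z) hF]
    module

theorem IsSymm.conv (B : W →ₗ[K] W →ₗ[K] W) {f g : Word V → W} (hf : IsSymm K f)
    (hg : IsSymm K g) (k : ℤ) : IsSymm K (conv B k f g) := by
  intro p x y q
  induction p generalizing k f g with
  | nil =>
    simp only [List.nil_append, LieCochain.conv, hf.contr_contr x y, hg.contr_contr x y,
      conv_smul_left, conv_smul_right, Pi.smul_apply]
    rw [show k + y.1 + x.1 = k + x.1 + y.1 by ring]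
    simp only [add_mul, sgn_add, mul_comm y.1 x.1]
    match_scalars <;>
      first
      | ring1
      | (rcases sgn_eq_or K (x.1 * y.1) with h | h <;> rw [h] <;> ring1)
  | cons z p ih =>
    simp only [List.cons_append, LieCochain.conv, ih hf (hg.contr z), ih (hf.contr z) hg]
    module

/-- The commutator of two coderivations is the coderivation of the commutator of their
corestrictions. -/
theorem comp_comp {f : Word V → W} (hf : IsMultilin K f) (hf' : IsSymm K f)
    {F F' : Word V → V} (hF : IsMultilin K F) (hF' : IsMultilin K F') (e e' : ℤ) :
    comp K e' (comp K e f F) F' - sgn K (e * e') • comp K e (comp K e' f F') F =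
      comp K (e + e') f (comp K e' F F' - sgn K (e * e') • comp K e F' F) := by
  funext l
  induction l generalizing e e' f F F' with
  | nil =>
    -- The terms in which the outputs of `F` and `F'` are separate arguments of `f` cancel by graded
    -- symmetry.
    have h := hf' [] (e', F' []) (e, F []) []
    simp only [List.nil_append] at h
    have h2 : f [(e + e', F [(e', F' [])] - sgn K (e * e') • F' [(e, F [])])] =
        f [(e + e', F [(e', F' [])])] - sgn K (e * e') • f [(e + e', F' [(e, F [])])] := by
      have h3 := hf.map_smul [] (e + e') [] (sgn K (e * e')) (F' [(e, F [])])
      rw [List.nil_append, List.nil_append] at h3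
      rw [← h3]
      exact (hf [] (e + e') []).map_sub _ _
    simp only [comp, Pi.sub_apply, Pi.smul_apply, contr, h2, h]
    rw [add_comm e' e]
    simp only [mul_comm e' e]
    match_scalars <;> ring1
  | cons x l ih =>
    have i1 := ih hf hf' hF (hF'.contr x) e (e' + x.1)
    have i2 := ih hf hf' (hF.contr x) hF' (e + x.1) e'
    have i3 := ih (hf.contr x) (hf'.contr x) hF hF' e e'
    -- The contracted commutator is a combination of commutators with one corestriction contracted,
    -- so the inductive hypotheses `i1` and `i2` apply to it.
    have hc : contr x (comp K e' F F' - sgn K (e * e') • comp K e F' F) =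
        (comp K (e' + x.1) F (contr x F') - sgn K (e * (e' + x.1)) • comp K e (contr x F') F) +
        sgn K (e' * x.1) • (comp K e' (contr x F) F' -
          sgn K ((e + x.1) * e') • comp K (e + x.1) F' (contr x F)) := by
      rw [contr_sub, contr_smul, contr_comp, contr_comp]
      simp only [mul_add, add_mul, sgn_add, mul_comm x.1 e']
      match_scalars <;>
        first
        | ring1
        | (rcases sgn_eq_or K (e' * x.1) with h | h <;> rw [h] <;> ring1)
    simp only [Pi.sub_apply, Pi.smul_apply, comp, contr_comp, comp_add_left, comp_smul_left,
      Pi.add_apply, hc, comp_add_right _ hf, comp_smul_right _ _ hf] at i1 i2 i3 ⊢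
    rw [show e + e' + x.1 = e + (e' + x.1) by ring, ← i1,
      show e + (e' + x.1) = e + x.1 + e' by ring, ← i2, ← i3]
    simp only [mul_add, add_mul, sgn_add, mul_comm x.1 e']
    match_scalars <;>
      first
      | ring1
      | (rcases sgn_eq_or K (e' * x.1) with h | h <;> rw [h] <;> ring1)

end Commutators

/-! ### Graded cochains and their convolution Lie bracket. -/

section Cochains

variable {K : Type v} [Field K] {V W : Type u} [AddCommGroup V] [Module K V]
  [AddCommGroup W] [Module K W]

/-- A graded symmetric multilinear cochain of degree `k`. -/
structure IsCochain (D : DGLieAlgebra K V) (E : DGLieAlgebra K W) (k : ℤ) (f : Word V → W) :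
    Prop where
  -- Labels are shifted degrees but the values are not shifted: `k = 1` is the degree of an `L_∞[1]`
  -- morphism, and also of a coderivation of shifted degree zero.
  mem : ∀ l, f l ∈ E.deg (k + Word.weight l)
  lin : IsMultilin K f
  symm : IsSymm K f
  -- A letter labelled `s` counts only through its component of degree `s + 1`, which ties arbitrary
  -- labels to true degrees.
  proj : ∀ p s x q, f (p ++ (s, x) :: q) = f (p ++ (s, D.proj (s + 1) x) :: q)

variable {D : DGLieAlgebra K V} {E : DGLieAlgebra K W}

theorem IsCochain.contr {k : ℤ} {f : Word V → W} (hf : IsCochain D E k f) (x : ℤ × V) :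
    IsCochain D E (k + x.1) (contr x f) where
  mem l := by
    have := hf.mem (x :: l)
    rwa [Word.weight_cons, ← add_assoc] at this
  lin := hf.lin.contr x
  symm := hf.symm.contr x
  proj p := hf.proj (x :: p)

theorem IsCochain.add {k : ℤ} {f g : Word V → W} (hf : IsCochain D E k f)
    (hg : IsCochain D E k g) : IsCochain D E k (f + g) where
  mem l := add_mem (hf.mem l) (hg.mem l)
  lin p s q := ⟨fun x y => by
      simp only [Pi.add_apply, hf.lin.map_add, hg.lin.map_add]; abel, fun c x => by
      simp only [Pi.add_apply, hf.lin.map_smul, hg.lin.map_smul]; module⟩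
  symm p x y q := by
    simp only [Pi.add_apply, hf.symm p x y q, hg.symm p x y q]; module
  proj p s x q := by
    simp only [Pi.add_apply]
    rw [hf.proj p s x q, hg.proj p s x q]

theorem IsCochain.smul {k : ℤ} {f : Word V → W} (hf : IsCochain D E k f) (c : K) :
    IsCochain D E k (c • f) where
  mem l := Submodule.smul_mem _ _ (hf.mem l)
  lin p s q := ⟨fun x y => by
      simp only [Pi.smul_apply, hf.lin.map_add]; module, fun c x => by
      simp only [Pi.smul_apply, hf.lin.map_smul]; module⟩
  symm p x y q := by
    simp only [Pi.smul_apply, hf.symm p x y q]; module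
  proj p s x q := by
    simp only [Pi.smul_apply]
    rw [hf.proj p s x q]

theorem IsCochain.zero {k : ℤ} : IsCochain D E k 0 where
  mem l := zero_mem _
  lin p s q := ⟨fun x y => by simp, fun c x => by simp⟩
  symm p x y q := by simp
  proj p s x q := by simp

theorem IsCochain.sub {k : ℤ} {f g : Word V → W} (hf : IsCochain D E k f)
    (hg : IsCochain D E k g) : IsCochain D E k (f - g) := by
  have := hf.add (hg.smul (-1))
  rwa [neg_one_smul, ← sub_eq_add_neg] at this

theorem IsCochain.comp {k e : ℤ} {f : Word V → W} (hf : IsCochain D E k f) {F : Word V → V}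
    (hF : IsCochain D D (e + 1) F) : IsCochain D E (k + e) (comp K e f F) where
  mem l := by
    induction l generalizing k e f F with
    | nil => simpa [LieCochain.comp] using hf.mem [(e, F [])]
    | cons x l ih =>
      simp only [LieCochain.comp]
      refine add_mem ?_ (Submodule.smul_mem _ _ ?_)
      · have h := ih hf (F := LieCochain.contr x F) (e := e + x.1)
          (by rw [show e + x.1 + 1 = e + 1 + x.1 by ring]; exact hF.contr x)
        rwa [show k + (e + x.1) + Word.weight l = k + e + Word.weight (x :: l) by
          rw [Word.weight_cons]; ring] at h
      · have h := ih (hf.contr x) hF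
        rwa [show k + x.1 + e + Word.weight l = k + e + Word.weight (x :: l) by
          rw [Word.weight_cons]; ring] at h
  lin := hf.lin.comp hF.lin e
  symm := IsSymm.comp hf.lin hf.symm hF.symm e
  proj p s x q := by
    induction p generalizing k e f F with
    | nil =>
      have h1 : LieCochain.contr (s, x) f = LieCochain.contr (s, D.proj (s + 1) x) f :=
        funext fun l => hf.proj [] s x l
      have h2 : LieCochain.contr (s, x) F = LieCochain.contr (s, D.proj (s + 1) x) F :=
        funext fun l => hF.proj [] s x l
      simp only [List.nil_append, LieCochain.comp, h1, h2]
    | cons z p ih =>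
      simp only [List.cons_append, LieCochain.comp]
      rw [ih (hf.contr z) hF, ih hf (F := LieCochain.contr z F) (e := e + z.1)
        (by rw [show e + z.1 + 1 = e + 1 + z.1 by ring]; exact hF.contr z)]

theorem IsCochain.conv {k k' : ℤ} {f g : Word V → W} (hf : IsCochain D E k f)
    (hg : IsCochain D E k' g) : IsCochain D E (k + k') (conv E.bracket k' f g) where
  mem l := by
    induction l generalizing k k' f g with
    | nil => simpa [LieCochain.conv] using E.bracket_mem (hf.mem []) (hg.mem [])
    | cons x l ih =>
      simp only [LieCochain.conv]
      refine add_mem (Submodule.smul_mem _ _ ?_) ?_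
      · have h := ih (hf.contr x) hg
        rwa [show k + x.1 + k' + Word.weight l = k + k' + Word.weight (x :: l) by
          rw [Word.weight_cons]; ring] at h
      · have h := ih hf (hg.contr x)
        rwa [show k + (k' + x.1) + Word.weight l = k + k' + Word.weight (x :: l) by
          rw [Word.weight_cons]; ring] at h
  lin := IsMultilin.conv _ hf.lin hg.lin k'
  symm := IsSymm.conv _ hf.symm hg.symm k'
  proj p s x q := by
    induction p generalizing k k' f g with
    | nil =>
      have h1 : LieCochain.contr (s, x) f = LieCochain.contr (s, D.proj (s + 1) x) f :=
        funext fun l => hf.proj [] s x l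
      have h2 : LieCochain.contr (s, x) g = LieCochain.contr (s, D.proj (s + 1) x) g :=
        funext fun l => hg.proj [] s x l
      simp only [List.nil_append, LieCochain.conv, h1, h2]
    | cons z p ih =>
      simp only [List.cons_append, LieCochain.conv]
      rw [ih (hf.contr z) hg, ih hf (hg.contr z)]

/-- Graded antisymmetry of the convolution bracket. -/
theorem conv_skew {k k' : ℤ} {f g : Word V → W} (hf : IsCochain D E k f)
    (hg : IsCochain D E k' g) :
    conv E.bracket k' f g = -(sgn K (k * k') • conv E.bracket k g f) := by
  funext l
  induction l generalizing k k' f g with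
  | nil =>
    have h1 : f [] ∈ E.deg k := by simpa using hf.mem []
    have h2 : g [] ∈ E.deg k' := by simpa using hg.mem []
    have := E.bracket_skew h1 h2
    rw [units_smul_eq_sgn K] at this
    simpa [LieCochain.conv] using this
  | cons x l ih =>
    have i1 := ih (hf.contr x) hg
    have i2 := ih hf (hg.contr x)
    simp only [LieCochain.conv, i1, i2, Pi.neg_apply, Pi.smul_apply]
    simp only [mul_add, add_mul, sgn_add, mul_comm x.1 k']
    match_scalars <;>
      first
      | ring1
      | (rcases sgn_eq_or K (k' * x.1) with h | h <;> rw [h] <;> ring1)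

/-- Graded Jacobi identity for the convolution bracket. -/
theorem conv_jacobi {k₁ k₂ k₃ : ℤ} {f g h : Word V → W} (hf : IsCochain D E k₁ f)
    (hg : IsCochain D E k₂ g) (hh : IsCochain D E k₃ h) :
    conv E.bracket (k₂ + k₃) f (conv E.bracket k₃ g h) =
      conv E.bracket k₃ (conv E.bracket k₂ f g) h +
        sgn K (k₁ * k₂) • conv E.bracket (k₁ + k₃) g (conv E.bracket k₃ f h) := by
  funext l
  induction l generalizing k₁ k₂ k₃ f g h with
  | nil =>
    have h1 : f [] ∈ E.deg k₁ := by simpa using hf.mem []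
    have h2 : g [] ∈ E.deg k₂ := by simpa using hg.mem []
    have := E.jacobi (h []) h1 h2
    rw [units_smul_eq_sgn K] at this
    simpa [LieCochain.conv] using this
  | cons x l ih =>
    have i1 := ih (hf.contr x) hg hh
    have i2 := ih hf (hg.contr x) hh
    have i3 := ih hf hg (hh.contr x)
    rw [show k₁ + x.1 + k₃ = k₁ + k₃ + x.1 by ring] at i1
    rw [show k₂ + x.1 + k₃ = k₂ + k₃ + x.1 by ring] at i2
    rw [← add_assoc, ← add_assoc] at i3
    simp only [LieCochain.conv, contr_conv, conv_add_left, conv_add_right, conv_smul_left,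
      conv_smul_right, Pi.add_apply, Pi.smul_apply] at i1 i2 i3 ⊢
    rw [i1, i2, i3]
    simp only [mul_add, add_mul, sgn_add, mul_comm x.1 k₂]
    match_scalars <;>
      first
      | ring1
      | (rcases sgn_eq_or K (k₂ * x.1) with h | h <;> rw [h] <;> ring1)

end Cochains

/-! ### Graded linear maps, cochains of small arity and the codifferential. -/

section Graded

variable {K : Type v} [Field K] {V W : Type u} [AddCommGroup V] [Module K V]
  [AddCommGroup W] [Module K W] (D : DGLieAlgebra K V) (E : DGLieAlgebra K W)

/-- `a` is homogeneous of degree `e`. -/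
def IsGraded (e : ℤ) (a : V →ₗ[K] W) : Prop := ∀ i, ∀ x ∈ D.deg i, a x ∈ E.deg (i + e)

variable {D E} in
theorem IsGraded.proj {e : ℤ} {a : V →ₗ[K] W} (ha : IsGraded D E e a) (i : ℤ) (x : V) :
    E.proj (i + e) (a x) = a (D.proj i x) := by
  refine D.induction_deg (P := fun x => E.proj (i + e) (a x) = a (D.proj i x)) ?_ ?_ ?_ x
  · intro j x hx
    by_cases h : j = i
    · subst h
      rw [D.proj_same hx, E.proj_same (ha j x hx)]
    · rw [D.proj_ne h hx, E.proj_ne (by omega) (ha j x hx), map_zero]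
  · simp
  · intro x y hx hy
    simp only [map_add, hx, hy]

theorem isGraded_d : IsGraded D D 1 D.d := fun _ _ hx => D.d_mem hx

theorem proj_proj (i : ℤ) (x : V) : D.proj i (D.proj i x) = D.proj i x :=
  D.proj_same (D.proj_mem i x)

/-- The homogeneous part of degree `e` of a linear map. -/
noncomputable def gradedPart (e : ℤ) (a : V →ₗ[K] W) : V →ₗ[K] W :=
  DirectSum.toModule K ℤ W (fun i => E.proj (i + e) ∘ₗ a ∘ₗ (D.deg i).subtype) ∘ₗ
    D.decomp.symm.toLinearMap

theorem gradedPart_apply (e : ℤ) (a : V →ₗ[K] W) {i : ℤ} {x : V} (hx : x ∈ D.deg i) :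
    gradedPart D E e a x = E.proj (i + e) (a x) := by
  simp [gradedPart, D.decomp_symm_apply hx]

theorem isGraded_gradedPart (e : ℤ) (a : V →ₗ[K] W) : IsGraded D E e (gradedPart D E e a) := by
  intro i x hx
  rw [gradedPart_apply D E e a hx]
  exact E.proj_mem _ _

variable {D} in
theorem linearMap_ext_deg {a b : V →ₗ[K] W} (h : ∀ i, ∀ x ∈ D.deg i, a x = b x) (x : V) :
    a x = b x := by
  refine D.induction_deg (P := fun x => a x = b x) h (by simp) ?_ x
  intro x y hx hy
  simp [hx, hy]

/-- The degree derivation, equal to `i` on the component of degree `i`. -/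
noncomputable def eulerMap : V →ₗ[K] V :=
  DirectSum.toModule K ℤ V (fun i => (i : K) • (D.deg i).subtype) ∘ₗ D.decomp.symm.toLinearMap

theorem eulerMap_apply {i : ℤ} {x : V} (hx : x ∈ D.deg i) : eulerMap D x = (i : K) • x := by
  simp [eulerMap, D.decomp_symm_apply hx]

theorem isGraded_eulerMap : IsGraded D D 0 (eulerMap D) := by
  intro i x hx
  rw [eulerMap_apply D hx, add_zero]
  exact Submodule.smul_mem _ _ hx

theorem eulerMap_bracket (x y : V) :
    eulerMap D (D.bracket x y) = D.bracket (eulerMap D x) y + D.bracket x (eulerMap D y) := by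
  refine D.induction_deg (P := fun x => eulerMap D (D.bracket x y) =
    D.bracket (eulerMap D x) y + D.bracket x (eulerMap D y)) ?_ (by simp) ?_ x
  · intro i x hx
    refine D.induction_deg (P := fun y => eulerMap D (D.bracket x y) =
      D.bracket (eulerMap D x) y + D.bracket x (eulerMap D y)) ?_ (by simp) ?_ y
    · intro j y hy
      rw [eulerMap_apply D hx, eulerMap_apply D hy, eulerMap_apply D (D.bracket_mem hx hy)]
      simp [add_smul]
    · intro a b ha hb
      simp only [map_add, ha, hb]; abel
  · intro a b ha hb
    simp only [map_add, LinearMap.add_apply, ha, hb]; abel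

/-! ### Cochains of arity zero and one -/

/-- The cochain of arity zero with value `v`. -/
def constCochain (v : W) : Word V → W
  | [] => v
  | _ :: _ => 0

/-- The cochain of arity one given by a linear map. -/
noncomputable def unary (a : V →ₗ[K] W) : Word V → W
  | [x] => a (D.proj (x.1 + 1) x.2)
  | _ => 0

theorem unary_nil (a : V →ₗ[K] W) : unary D a [] = 0 := rfl

theorem unary_single (a : V →ₗ[K] W) (x : ℤ × V) :
    unary D a [x] = a (D.proj (x.1 + 1) x.2) := rfl

theorem unary_cons_cons (a : V →ₗ[K] W) (x y : ℤ × V) (l : Word V) :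
    unary D a (x :: y :: l) = 0 := rfl

theorem contr_unary (a : V →ₗ[K] W) (x : ℤ × V) :
    contr x (unary D a) = constCochain (a (D.proj (x.1 + 1) x.2)) := by
  funext l
  cases l <;> rfl

theorem contr_constCochain (v : W) (x : ℤ × V) : contr x (constCochain v) = 0 := rfl

variable {D E}

theorem isCochain_unary {e : ℤ} {a : V →ₗ[K] W} (ha : IsGraded D E e a) :
    IsCochain D E (e + 1) (unary D a) where
  mem l := by
    match l with
    | [] => exact zero_mem _
    | [x] =>
      have := ha _ _ (D.proj_mem (x.1 + 1) x.2)
      rw [show e + 1 + Word.weight [x] = x.1 + 1 + e by simp; ring]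
      exact this
    | _ :: _ :: _ => exact zero_mem _
  lin p s q := by
    match p, q with
    | [], [] => exact ⟨fun x y => by simp [unary], fun c x => by simp [unary]⟩
    | [], _ :: _ => exact ⟨fun x y => by simp [unary], fun c x => by simp [unary]⟩
    | [_], _ => exact ⟨fun x y => by simp [unary], fun c x => by simp [unary]⟩
    | _ :: _ :: _, _ => exact ⟨fun x y => by simp [unary], fun c x => by simp [unary]⟩
  symm p x y q := by
    match p with
    | [] => simp [unary]
    | [_] => simp [unary]
    | _ :: _ :: _ => simp [unary]
  proj p s x q := by
    match p, q with
    | [], [] => simp [unary, proj_proj]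
    | [], _ :: _ => simp [unary]
    | [_], _ => simp [unary]
    | _ :: _ :: _, _ => simp [unary]

/-- A coderivation with corestriction of arity zero inserts its value; symmetry of `f` brings the
inserted letter to the front. -/
theorem comp_constCochain {f : Word V → W} (hf : IsMultilin K f) (hf' : IsSymm K f) (e : ℤ)
    (v : V) (l : Word V) : comp K e f (constCochain v) l = f ((e, v) :: l) := by
  induction l generalizing f with
  | nil => rfl
  | cons x l ih =>
    simp only [comp, contr_constCochain, comp_zero_right _ hf, ih (hf.contr x) (hf'.contr x),
      contr_apply]
    have h := hf' [] (e, v) x l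
    simp only [List.nil_append] at h
    simp [h]

theorem comp_unary {k e : ℤ} {f : Word V → W} (hf : IsCochain D E k f) {a : V →ₗ[K] V}
    (ha : IsGraded D D e a) (l : Word V) : comp K e f (unary D a) l = der K e a f l := by
  induction l generalizing k f with
  | nil =>
    simp only [comp, unary_nil, der]
    exact hf.lin.map_zero [] e []
  | cons x l ih =>
    simp only [comp, contr_unary, comp_constCochain hf.lin hf.symm, ih (hf.contr x), der]
    have h := hf.proj [] (x.1 + e) (a x.2) l
    rw [show x.1 + e + 1 = x.1 + 1 + e by ring, ha.proj] at h
    simp only [List.nil_append] at h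
    rw [h, add_comm e]

theorem comp_unary_unary {e e' : ℤ} {a : V →ₗ[K] W} (ha : IsGraded D E e' a) {b : V →ₗ[K] V}
    (hb : IsGraded D D e b) : comp K e (unary D a) (unary D b) = unary D (a ∘ₗ b) := by
  funext l
  rw [comp_unary (isCochain_unary ha) hb]
  match l with
  | [] => rfl
  | [x] =>
    simp only [der, unary, LinearMap.comp_apply]
    rw [show x.1 + e + 1 = x.1 + 1 + e by ring, hb.proj, smul_zero, add_zero]
  | x :: y :: l =>
    have h : contr y (contr x (unary D a)) = 0 := rfl
    simp [der, h, der_zero, unary, contr]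

/-! ### The codifferential -/

variable (D) in
/-- The corestriction of the codifferential: `q₁ x = -d x` and `q₂ (x, y) = (-1)^a [x, y]` for
`x` of degree `a`. -/
noncomputable def codiff : Word V → V
  | [x] => -D.d (D.proj (x.1 + 1) x.2)
  | [x, y] => sgn K (x.1 + 1) • D.bracket (D.proj (x.1 + 1) x.2) (D.proj (y.1 + 1) y.2)
  | _ => 0

theorem codiff_nil : codiff D [] = 0 := rfl

theorem codiff_single (x : ℤ × V) : codiff D [x] = -D.d (D.proj (x.1 + 1) x.2) := rfl

theorem codiff_pair (x y : ℤ × V) : codiff D [x, y] =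
    sgn K (x.1 + 1) • D.bracket (D.proj (x.1 + 1) x.2) (D.proj (y.1 + 1) y.2) := rfl

theorem codiff_three (x y z : ℤ × V) (l : Word V) : codiff D (x :: y :: z :: l) = 0 := rfl

theorem isCochain_codiff : IsCochain D D (1 + 1) (codiff D) where
  mem l := by
    match l with
    | [] => exact zero_mem _
    | [x] =>
      have := D.d_mem (D.proj_mem (x.1 + 1) x.2)
      rw [show 1 + 1 + Word.weight [x] = x.1 + 1 + 1 by simp; ring]
      exact neg_mem this
    | [x, y] =>
      rw [show 1 + 1 + Word.weight [x, y] = x.1 + 1 + (y.1 + 1) by simp; ring]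
      exact Submodule.smul_mem _ _ (D.bracket_mem (D.proj_mem _ _) (D.proj_mem _ _))
    | _ :: _ :: _ :: _ => exact zero_mem _
  lin p s q := by
    match p, q with
    | [], [] => exact ⟨fun x y => by simp [codiff]; abel, fun c x => by simp [codiff]⟩
    | [], [_] => exact ⟨fun x y => by simp [codiff], fun c x => by simp [codiff, smul_comm c]⟩
    | [], _ :: _ :: _ => exact ⟨fun x y => by simp [codiff], fun c x => by simp [codiff]⟩
    | [_], [] => exact ⟨fun x y => by simp [codiff], fun c x => by simp [codiff, smul_comm c]⟩
    | [_], _ :: _ => exact ⟨fun x y => by simp [codiff], fun c x => by simp [codiff]⟩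
    | [_, _], _ => exact ⟨fun x y => by simp [codiff], fun c x => by simp [codiff]⟩
    | _ :: _ :: _ :: _, _ => exact ⟨fun x y => by simp [codiff], fun c x => by simp [codiff]⟩
  symm p x y q := by
    match p, q with
    | [], [] =>
      simp only [List.nil_append, codiff_pair]
      rw [D.bracket_skew (D.proj_mem _ _) (D.proj_mem _ _), units_smul_eq_sgn K]
      rw [show (x.1 + 1) * (y.1 + 1) = x.1 * y.1 + x.1 + y.1 + 1 by ring]
      simp only [sgn_add, sgn_one]
      match_scalars
      rcases sgn_eq_or K x.1 with h | h <;> rw [h] <;> ring1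
    | [], _ :: _ => simp [codiff]
    | [_], _ => simp [codiff]
    | [_, _], _ => simp [codiff]
    | _ :: _ :: _ :: _, _ => simp [codiff]
  proj p s x q := by
    match p, q with
    | [], [] => simp [codiff, proj_proj]
    | [], [_] => simp [codiff, proj_proj]
    | [], _ :: _ :: _ => simp [codiff]
    | [_], [] => simp [codiff, proj_proj]
    | [_], _ :: _ => simp [codiff]
    | [_, _], _ => simp [codiff]
    | _ :: _ :: _ :: _, _ => simp [codiff]

/-- The bounds are integers because contractions lower them in the induction, possibly below zero.
-/
theorem comp_eq_zero_of_long {m r : ℤ} (e : ℤ) {f : Word V → W} (hl : IsMultilin K f)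
    {F : Word V → V} (hf : ∀ l : Word V, m < l.length → f l = 0)
    (hF : ∀ l : Word V, r < l.length → F l = 0) {l : Word V} (h : m + r < l.length + 1) :
    comp K e f F l = 0 := by
  induction l generalizing e f F m r with
  | nil =>
    simp only [List.length_nil, Nat.cast_zero, zero_add] at h
    rcases lt_or_ge m 1 with hm | hm
    · exact hf _ (by simpa using hm)
    · have : F [] = 0 := hF _ (by simp; omega)
      simp only [comp, this]
      exact hl.map_zero [] e []
  | cons x l ih =>
    simp only [List.length_cons, Nat.cast_add, Nat.cast_one] at h
    simp only [comp]
    rw [ih (m := m) (r := r - 1) _ hl hf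
        (F := contr x F)
        (fun l hl => hF (x :: l) (by simp only [List.length_cons]; push_cast; omega)) (by omega),
      ih (m := m - 1) (r := r) (f := contr x f) _ (hl.contr x)
        (fun l hl => hf (x :: l) (by simp only [List.length_cons]; push_cast; omega)) hF
        (by omega)]
    simp

theorem codiff_eq_zero_of_long (l : Word V) (h : (2 : ℤ) < l.length) : codiff D l = 0 := by
  match l with
  | [] => rfl
  | [x] => simp at h
  | [x, y] => simp at h
  | x :: y :: z :: l => rfl

/-- In arity one this is `d² = 0`, in arity two the Leibniz rule, in arity three the Jacobi
identity; longer words vanish since `codiff` has arity at most two. -/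
theorem comp_codiff_codiff : comp K 1 (codiff D) (codiff D) = 0 := by
  funext l
  by_cases h : (3 : ℤ) < l.length
  · exact comp_eq_zero_of_long 1 isCochain_codiff.lin codiff_eq_zero_of_long
      codiff_eq_zero_of_long (by omega)
  match l with
  | [] => simp [comp, codiff]
  | [x] =>
    simp only [comp, contr, codiff_single, codiff_pair, codiff_nil, Pi.zero_apply]
    rw [D.proj_same (i := 1 + x.1 + 1)]
    · simp [D.d_d]
    · rw [show 1 + x.1 + 1 = x.1 + 1 + 1 by ring]
      exact neg_mem (D.d_mem (D.proj_mem _ _))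
  | [x, y] =>
    simp only [comp, contr, codiff_single, codiff_pair, codiff_nil, codiff_three, Pi.zero_apply]
    have hx := D.proj_mem (x.1 + 1) x.2
    have hy := D.proj_mem (y.1 + 1) y.2
    generalize D.proj (x.1 + 1) x.2 = a at *
    generalize D.proj (y.1 + 1) y.2 = b at *
    rw [D.proj_same (i := 1 + x.1 + y.1 + 1), D.proj_same (i := 1 + x.1 + 1),
      D.proj_same (i := 1 + y.1 + 1)]
    · have := D.leibniz b hx
      rw [units_smul_eq_sgn K] at this
      simp only [map_smul, this, map_neg, smul_zero, add_zero,
        sgn_add, sgn_one, add_mul, one_mul]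
      have hs := D.bracket_skew (x := D.d a) (y := b) (D.d_mem hx) hy
      rw [units_smul_eq_sgn K] at hs
      rw [hs, show (x.1 + 1 + 1) * (y.1 + 1) = x.1 * y.1 + x.1 + y.1 + y.1 + 1 + 1 by ring]
      simp only [sgn_add, sgn_one]
      match_scalars <;>
      rcases sgn_eq_or K x.1 with h | h <;> rcases sgn_eq_or K y.1 with h' | h' <;>
      simp [h, h']
    · rw [show 1 + y.1 + 1 = y.1 + 1 + 1 by ring]
      exact neg_mem (D.d_mem hy)
    · rw [show 1 + x.1 + 1 = x.1 + 1 + 1 by ring]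
      exact neg_mem (D.d_mem hx)
    · rw [show 1 + x.1 + y.1 + 1 = x.1 + 1 + (y.1 + 1) by ring]
      exact Submodule.smul_mem _ _ (D.bracket_mem hx hy)
  | [x, y, z] =>
    simp only [comp, contr, codiff_single, codiff_pair, codiff_nil, codiff_three, Pi.zero_apply]
    have hx := D.proj_mem (x.1 + 1) x.2
    have hy := D.proj_mem (y.1 + 1) y.2
    have hz := D.proj_mem (z.1 + 1) z.2
    generalize D.proj (x.1 + 1) x.2 = a at *
    generalize D.proj (y.1 + 1) y.2 = b at *
    generalize D.proj (z.1 + 1) z.2 = c at *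
    rw [D.proj_same (i := 1 + x.1 + y.1 + 1), D.proj_same (i := 1 + x.1 + z.1 + 1),
      D.proj_same (i := 1 + y.1 + z.1 + 1)]
    · have h1 := D.jacobi c hx hy
      rw [units_smul_eq_sgn K] at h1
      have h2 := D.bracket_skew (D.bracket_mem hx hy) hz
      rw [units_smul_eq_sgn K] at h2
      simp only [map_smul, h1, h2, map_zero]
      rw [show (x.1 + 1 + (y.1 + 1)) * (z.1 + 1) =
          x.1 * z.1 + y.1 * z.1 + x.1 + y.1 + z.1 + z.1 + 1 + 1 by ring,
        show (x.1 + 1) * (y.1 + 1) = x.1 * y.1 + x.1 + y.1 + 1 by ring]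
      simp only [sgn_add, sgn_one, add_mul, one_mul]
      match_scalars <;>
      rcases sgn_eq_or K x.1 with h | h <;> rcases sgn_eq_or K y.1 with h' | h' <;>
      rcases sgn_eq_or K z.1 with h'' | h'' <;> rcases sgn_eq_or K (x.1 * y.1) with h4 | h4 <;>
      rcases sgn_eq_or K (x.1 * z.1) with h5 | h5 <;>
      rcases sgn_eq_or K (y.1 * z.1) with h6 | h6 <;>
      simp [h, h', h'', h4, h5, h6]
    · rw [show 1 + y.1 + z.1 + 1 = y.1 + 1 + (z.1 + 1) by ring]
      exact Submodule.smul_mem _ _ (D.bracket_mem hy hz)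
    · rw [show 1 + x.1 + z.1 + 1 = x.1 + 1 + (z.1 + 1) by ring]
      exact Submodule.smul_mem _ _ (D.bracket_mem hx hz)
    · rw [show 1 + x.1 + y.1 + 1 = x.1 + 1 + (y.1 + 1) by ring]
      exact Submodule.smul_mem _ _ (D.bracket_mem hx hy)
  | x :: y :: z :: w :: l => simp at h; omega

end Graded

/-! ### The arity filtration: gluing, linear parts and leading terms. -/

section Limits

variable {K : Type v} [Field K] {V W : Type u} [AddCommGroup V] [Module K V]
  [AddCommGroup W] [Module K W] {D : DGLieAlgebra K V} {E : DGLieAlgebra K W}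

/-- Being a cochain can be checked in each arity. -/
theorem IsCochain.diag {k : ℤ} {F : ℕ → Word V → W} (hF : ∀ n, IsCochain D E k (F n)) :
    IsCochain D E k (fun l => F l.length l) where
  mem l := (hF _).mem l
  lin p s q := ⟨fun x y => by
      simpa using (hF (p ++ (s, x) :: q).length).lin.map_add p s q x y, fun c x => by
      simpa using (hF (p ++ (s, x) :: q).length).lin.map_smul p s q c x⟩
  symm p x y q := by
    have h := (hF (p ++ x :: y :: q).length).symm p x y q
    have : (p ++ x :: y :: q).length = (p ++ y :: x :: q).length := by simp
    change F _ _ = _ • F _ _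
    rw [← this]
    exact h
  proj p s x q := by
    have h := (hF (p ++ (s, x) :: q).length).proj p s x q
    have : (p ++ (s, x) :: q).length = (p ++ (s, D.proj (s + 1) x) :: q).length := by simp
    change F _ _ = F _ _
    rw [← this]
    exact h

/-- The component of arity `n`. -/
def arityPart (n : ℕ) (f : Word V → W) : Word V → W := fun l => if l.length = n then f l else 0

theorem arityPart_of_eq {n : ℕ} (f : Word V → W) {l : Word V} (h : l.length = n) :
    arityPart n f l = f l := if_pos h

theorem arityPart_of_ne {n : ℕ} (f : Word V → W) {l : Word V} (h : l.length ≠ n) :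
    arityPart n f l = 0 := if_neg h

theorem vanishBelow_arityPart (n : ℕ) (f : Word V → W) : VanishBelow n (arityPart n f) :=
  fun _ hl => arityPart_of_ne f hl.ne

theorem IsCochain.arityPart {k : ℤ} {f : Word V → W} (hf : IsCochain D E k f) (n : ℕ) :
    IsCochain D E k (arityPart n f) := by
  have h := IsCochain.diag (F := fun m => if m = n then f else 0) (k := k) (D := D) (E := E)
    (fun m => by split_ifs; exacts [hf, IsCochain.zero])
  convert h using 2 with l
  simp only [LieCochain.arityPart]
  split_ifs <;> rfl

/-- The linear part of a cochain. -/
theorem IsCochain.exists_linear {k : ℤ} {f : Word V → W} (hf : IsCochain D E (k + 1) f) :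
    ∃ a : V →ₗ[K] W, IsGraded D E k a ∧ ∀ x, f [x] = unary D a [x] := by
  let g : ∀ i, D.deg i →ₗ[K] W := fun i =>
    { toFun := fun x => f [(i - 1, (x : V))]
      map_add' := fun x y => hf.lin.map_add [] (i - 1) [] x y
      map_smul' := fun c x => hf.lin.map_smul [] (i - 1) [] c x }
  have hg : ∀ i, ∀ x (hx : x ∈ D.deg i),
      (DirectSum.toModule K ℤ W g ∘ₗ D.decomp.symm.toLinearMap) x = f [(i - 1, x)] := by
    intro i x hx
    simp [D.decomp_symm_apply hx, g]
  refine ⟨DirectSum.toModule K ℤ W g ∘ₗ D.decomp.symm.toLinearMap, ?_, ?_⟩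
  · intro i x hx
    rw [hg i x hx]
    have := hf.mem [(i - 1, x)]
    rwa [show k + 1 + Word.weight [(i - 1, x)] = i + k by simp; ring] at this
  · rintro ⟨s, x⟩
    rw [unary_single, hg _ _ (D.proj_mem _ _), add_sub_cancel_right]
    exact hf.proj [] s x []

/-- Since `F [] = 0`, no letter is inserted for free: on words of length at most `m`, only values of
`f` and `g` in arity at most `m` occur. -/
theorem comp_congr_left {m : ℕ} (e : ℤ) {f g : Word V → W} (hf : IsMultilin K (f - g))
    (h : ∀ l : Word V, l.length ≤ m → f l = g l) {F : Word V → V} (hF : F [] = 0)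
    {l : Word V} (hl : l.length ≤ m) : comp K e f F l = comp K e g F l := by
  have := comp_eq_zero (m := m + 1) (r := 1) e hf (F := F)
    (fun l hl => by simp [h l (by omega)])
    (fun l hl => by simpa [List.length_eq_zero_iff.1 (by omega : l.length = 0)] using hF)
    (l := l) (by omega)
  rw [comp_sub_left] at this
  exact sub_eq_zero.1 this

theorem conv_congr (B : W →ₗ[K] W →ₗ[K] W) {m : ℕ} (k : ℤ) {f g f' g' : Word V → W}
    (h : ∀ l : Word V, l.length ≤ m → f l = f' l) (h' : ∀ l : Word V, l.length ≤ m → g l = g' l)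
    {l : Word V} (hl : l.length ≤ m) : conv B k f g l = conv B k f' g' l := by
  have h1 := conv_eq_zero B (m := m + 1) (r := 0) k (f := f - f') (g := g)
    (fun l hl => by simp [h l (by omega)]) (fun l hl => by omega) (l := l) (by omega)
  have h2 := conv_eq_zero B (m := 0) (r := m + 1) k (f := f') (g := g - g')
    (fun l hl => by omega) (fun l hl => by simp [h' l (by omega)]) (l := l) (by omega)
  rw [conv_sub_left] at h1
  rw [conv_sub_right] at h2
  rw [sub_eq_zero.1 h1, sub_eq_zero.1 h2]

/-- The leading term of a composition in the lowest arity. -/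
theorem comp_leading_left {n : ℕ} (e : ℤ) {f : Word V → W} (hf : IsMultilin K f)
    (hv : VanishBelow n f) {F G : Word V → V} (hFG : VanishBelow 2 (F - G)) {l : Word V}
    (hl : l.length = n) : comp K e f F l = comp K e f G l := by
  have := comp_eq_zero e hf hv hFG (l := l) (by omega)
  rw [comp_sub_right _ hf] at this
  exact sub_eq_zero.1 this

theorem vanishBelow_two {F : Word V → W} (h0 : F [] = 0) (h1 : ∀ x, F [x] = 0) :
    VanishBelow 2 F := by
  intro l hl
  match l with
  | [] => exact h0
  | [x] => exact h1 x
  | _ :: _ :: _ => simp at hl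

theorem codiff_sub_unary : VanishBelow 2 (codiff D - unary D (-D.d)) :=
  vanishBelow_two (by simp [codiff, unary]) (fun x => by simp [codiff, unary])

theorem comp_codiff_leading {n : ℕ} {k : ℤ} {f : Word V → W} (hf : IsCochain D E k f)
    (hv : VanishBelow n f) {l : Word V} (hl : l.length = n) :
    comp K 1 f (codiff D) l = -der K 1 D.d f l := by
  rw [comp_leading_left 1 hf.lin hv codiff_sub_unary hl]
  have : unary D (-D.d) = (-1 : K) • unary D D.d := by
    funext l
    match l with
    | [] => simp [unary]
    | [x] => simp [unary]
    | _ :: _ :: _ => simp [unary]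
  rw [this, comp_smul_right _ _ hf.lin, Pi.smul_apply, comp_unary hf (isGraded_d D)]
  simp

/-- The codifferential is odd, so its commutator with itself is twice its square; `comp_comp`
identifies this with a composition with `Q² = 0`. -/
theorem comp_comp_codiff [CharZero K] {k : ℤ} {f : Word V → W} (hf : IsCochain D E k f) :
    comp K 1 (comp K 1 f (codiff D)) (codiff D) = 0 := by
  have h := comp_comp hf.lin hf.symm (isCochain_codiff (D := D)).lin
    (isCochain_codiff (D := D)).lin 1 1
  rw [comp_codiff_codiff] at h
  simp only [mul_one, sgn_one, neg_smul, one_smul, neg_zero, sub_zero, sub_neg_eq_add,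
    comp_zero_right _ hf.lin, ← two_smul K] at h
  exact (smul_eq_zero.1 h).resolve_left two_ne_zero

theorem exists_seq_of_step {α : Type*} (P : ℕ → α → Prop) (R : ℕ → α → α → Prop)
    (h0 : ∃ a, P 0 a) (step : ∀ n a, P n a → ∃ b, P (n + 1) b ∧ R n a b) :
    ∃ s : ℕ → α, ∀ n, P n (s n) ∧ R n (s n) (s (n + 1)) := by
  choose! next hnext using step
  obtain ⟨a, ha⟩ := h0
  let s : ℕ → α := fun n => Nat.rec a (fun n b => next n b) n
  have hs : ∀ n, P n (s n) := by
    intro n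
    induction n with
    | zero => exact ha
    | succ n ih => exact (hnext n _ ih).1
  exact ⟨s, fun n => ⟨hs n, (hnext n _ (hs n)).2⟩⟩

end Limits

/-! ### Contractions of a complex onto its cohomology. -/

section Contraction

variable {K : Type v} [Field K] {V W : Type u} [AddCommGroup V] [Module K V]
  [AddCommGroup W] [Module K W]

/-- A contraction of the complex `V` onto `W` with zero differential. -/
structure Contraction (D : DGLieAlgebra K V) (E : DGLieAlgebra K W) where
  p : V →ₗ[K] W
  i : W →ₗ[K] V
  h : V →ₗ[K] V
  p_graded : IsGraded D E 0 p
  i_graded : IsGraded E D 0 i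
  h_graded : IsGraded D D (-1) h
  p_d : ∀ x, p (D.d x) = 0
  d_i : ∀ w, D.d (i w) = 0
  p_i : ∀ w, p (i w) = w
  homotopy : ∀ x, D.d (h x) + h (D.d x) = x - i (p x)
  p_h : ∀ x, p (h x) = 0

/-- Let `A = ker p` and `Z = ker p ∩ ker d`. The differential maps `A` onto `Z`; with a linear
section `σ` of this map, the homotopy is `σ ∘ (1 - σ d) ∘ (1 - i p)`. As `σ` takes values in `A`,
the side condition `p h = 0` is automatic. -/
theorem exists_homotopy (d : V →ₗ[K] V) (hd : ∀ x, d (d x) = 0) (p : V →ₗ[K] W)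
    (hpd : ∀ x, p (d x) = 0) (hinj : ∀ z, d z = 0 → p z = 0 → ∃ y, d y = z)
    (hsurj : ∀ w, ∃ z, d z = 0 ∧ p z = w) :
    ∃ (i : W →ₗ[K] V) (h : V →ₗ[K] V), (∀ w, d (i w) = 0) ∧ (∀ w, p (i w) = w) ∧
      (∀ x, d (h x) + h (d x) = x - i (p x)) ∧ ∀ x, p (h x) = 0 := by
  obtain ⟨i₀, hi₀⟩ := (p ∘ₗ (LinearMap.ker d).subtype).exists_rightInverse_of_surjective (by
    rw [LinearMap.range_eq_top]
    intro w
    obtain ⟨z, hz, rfl⟩ := hsurj w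
    exact ⟨⟨z, hz⟩, rfl⟩)
  let i : W →ₗ[K] V := (LinearMap.ker d).subtype ∘ₗ i₀
  have hdi : ∀ w, d (i w) = 0 := fun w => (i₀ w).2
  have hpi : ∀ w, p (i w) = w := fun w => LinearMap.congr_fun hi₀ w
  let A : Submodule K V := LinearMap.ker p
  let Z : Submodule K V := LinearMap.ker p ⊓ LinearMap.ker d
  have hdZ : ∀ x : A, d x ∈ Z := fun x => ⟨hpd _, hd _⟩
  let dA : A →ₗ[K] Z := (d.domRestrict A).codRestrict Z hdZ
  obtain ⟨σ, hσ⟩ := dA.exists_rightInverse_of_surjective (by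
    rw [LinearMap.range_eq_top]
    rintro ⟨z, hz⟩
    obtain ⟨y, hy⟩ := hinj z hz.2 hz.1
    -- Subtracting `i (p y)` moves the primitive into `ker p` without changing its differential.
    refine ⟨⟨y - i (p y), by simp [A, hpi]⟩, Subtype.ext ?_⟩
    change d (y - i (p y)) = z
    rw [map_sub, hdi, hy, sub_zero])
  have hdσ : ∀ z : Z, d (σ z : V) = z := fun z => congrArg Subtype.val (LinearMap.congr_fun hσ z)
  let q : V →ₗ[K] A := (LinearMap.id - i ∘ₗ p).codRestrict A (fun x => by simp [A, hpi])
  have hq : ∀ x, (q x : V) = x - i (p x) := fun x => rfl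
  have hqd : ∀ x, (q (d x) : V) = d x := fun x => by rw [hq, hpd, map_zero, sub_zero]
  let r : A →ₗ[K] Z := (A.subtype - A.subtype ∘ₗ σ ∘ₗ dA).codRestrict Z (fun x => by
    refine ⟨sub_mem x.2 (σ (dA x)).2, ?_⟩
    change d ((x : V) - (σ (dA x) : V)) = 0
    rw [map_sub, hdσ]
    exact sub_self _)
  have hr : ∀ x : A, (r x : V) = x - (σ (dA x) : V) := fun x => rfl
  refine ⟨i, A.subtype ∘ₗ σ ∘ₗ r ∘ₗ q, hdi, hpi, ?_, fun x => (σ (r (q x))).2⟩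
  intro x
  have h1 : r (q (d x)) = dA (q x) := by
    apply Subtype.ext
    rw [hr]
    have : dA (q (d x)) = 0 := by
      apply Subtype.ext
      change d (q (d x) : V) = 0
      rw [hqd, hd]
    rw [this, map_zero, hqd]
    change d x - 0 = d (q x : V)
    rw [hq, map_sub, hdi]
  change d (σ (r (q x)) : V) + (σ (r (q (d x))) : V) = _
  rw [hdσ, h1, hr, hq]
  abel

/-- Since `p` and `d` are homogeneous, the identities for `i` and `h` survive replacing these maps
by their parts of degree `0` and `-1`. -/
theorem exists_contraction {D : DGLieAlgebra K V} {E : DGLieAlgebra K W} (p : V →ₗ[K] W)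
    (hp : IsGraded D E 0 p) (hpd : ∀ x, p (D.d x) = 0)
    (hinj : ∀ z, D.d z = 0 → p z = 0 → ∃ y, D.d y = z)
    (hsurj : ∀ w, ∃ z, D.d z = 0 ∧ p z = w) : ∃ C : Contraction D E, C.p = p := by
  obtain ⟨i, h, hdi, hpi, hh, hph⟩ := exists_homotopy D.d D.d_d p hpd hinj hsurj
  have hdp : ∀ j x, D.d (D.proj j x) = D.proj (j + 1) (D.d x) := fun j x => (D.proj_d j x).symm
  have hpp : ∀ j x, p (D.proj j x) = E.proj j (p x) := fun j x => by
    have := hp.proj j x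
    rwa [add_zero, eq_comm] at this
  refine ⟨⟨p, gradedPart E D 0 i, gradedPart D D (-1) h, hp, isGraded_gradedPart _ _ _ _,
    isGraded_gradedPart _ _ _ _, hpd, ?_, ?_, ?_, ?_⟩, rfl⟩
  · refine fun w => linearMap_ext_deg (D := E) (a := D.d ∘ₗ gradedPart E D 0 i) (b := 0) ?_ w
    intro j x hx
    simp only [LinearMap.comp_apply, gradedPart_apply E D 0 i hx, hdp, hdi, map_zero,
      LinearMap.zero_apply]
  · refine fun w => linearMap_ext_deg (D := E) (a := p ∘ₗ gradedPart E D 0 i)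
      (b := LinearMap.id) ?_ w
    intro j x hx
    simp only [LinearMap.comp_apply, gradedPart_apply E D 0 i hx, hpp, hpi, LinearMap.id_apply]
    rw [add_zero, E.proj_same hx]
  · refine fun x => linearMap_ext_deg (D := D)
      (a := D.d ∘ₗ gradedPart D D (-1) h + gradedPart D D (-1) h ∘ₗ D.d)
      (b := LinearMap.id - gradedPart E D 0 i ∘ₗ p) ?_ x
    intro j x hx
    have hpx : p x ∈ E.deg j := by simpa using hp j x hx
    simp only [LinearMap.add_apply, LinearMap.sub_apply, LinearMap.comp_apply,
      gradedPart_apply D D (-1) h hx, gradedPart_apply D D (-1) h (D.d_mem hx),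
      gradedPart_apply E D 0 i hpx, hdp, LinearMap.id_apply]
    rw [show j + -1 + 1 = j by ring, show j + 1 + -1 = j by ring, add_zero, ← map_add, hh,
      map_sub, D.proj_same hx]
  · refine fun x => linearMap_ext_deg (D := D) (a := p ∘ₗ gradedPart D D (-1) h) (b := 0) ?_ x
    intro j x hx
    simp only [LinearMap.comp_apply, gradedPart_apply D D (-1) h hx, hpp, hph, map_zero,
      LinearMap.zero_apply]

end Contraction

/-! ### Exactness of closed cochains that vanish on representatives. -/

section Kuenneth

variable {K : Type v} [Field K] {V W : Type u} [AddCommGroup V] [Module K V]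
  [AddCommGroup W] [Module K W] {D : DGLieAlgebra K V} {E : DGLieAlgebra K W}

theorem IsCochain.der {k e : ℤ} {f : Word V → W} (hf : IsCochain D E k f) {a : V →ₗ[K] V}
    (ha : IsGraded D D e a) : IsCochain D E (k + e) (der K e a f) := by
  have : LieCochain.der K e a f = LieCochain.comp K e f (unary D a) :=
    funext fun l => (comp_unary hf ha l).symm
  rw [this]
  exact hf.comp (isCochain_unary ha)

theorem der_comm {k e e' : ℤ} {f : Word V → W} (hf : IsCochain D E k f) {a b : V →ₗ[K] V}
    (ha : IsGraded D D e a) (hb : IsGraded D D e' b) :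
    der K e' b (der K e a f) - sgn K (e * e') • der K e a (der K e' b f) =
      der K (e + e') (a ∘ₗ b - sgn K (e * e') • b ∘ₗ a) f := by
  have hab : IsGraded D D (e + e') (a ∘ₗ b - sgn K (e * e') • b ∘ₗ a) := by
    intro i x hx
    refine sub_mem ?_ (Submodule.smul_mem _ _ ?_)
    · rw [show i + (e + e') = i + e' + e by ring]
      exact ha _ _ (hb _ _ hx)
    · rw [show i + (e + e') = i + e + e' by ring]
      exact hb _ _ (ha _ _ hx)
  have hu : unary D (a ∘ₗ b - sgn K (e * e') • b ∘ₗ a) =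
      unary D (a ∘ₗ b) - sgn K (e * e') • unary D (b ∘ₗ a) := by
    funext l
    match l with
    | [] => simp [unary]
    | [x] => simp [unary]
    | _ :: _ :: _ => simp [unary]
  have h := comp_comp hf.lin hf.symm (isCochain_unary ha).lin (isCochain_unary hb).lin e e'
  rw [comp_unary_unary ha hb, comp_unary_unary hb ha, ← hu] at h
  have e1 : comp K e f (unary D a) = der K e a f := funext (comp_unary hf ha)
  have e2 : comp K e' f (unary D b) = der K e' b f := funext (comp_unary hf hb)
  have e3 : comp K (e + e') f _ = der K (e + e') _ f := funext (comp_unary hf hab)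
  rw [e1, e2, e3] at h
  have e4 : comp K e' (der K e a f) (unary D b) = _ := funext (comp_unary (hf.der ha) hb)
  have e5 : comp K e (der K e' b f) (unary D a) = _ := funext (comp_unary (hf.der hb) ha)
  rw [e4, e5] at h
  exact h

theorem der_zero_map (e : ℤ) {f : Word V → W} (hf : IsMultilin K f) :
    der K e ((0 : V →ₗ[K] V)) f = 0 := by
  funext l
  induction l generalizing f with
  | nil => rfl
  | cons x l ih =>
    have := hf.map_zero [] (x.1 + e) l
    simp only [List.nil_append] at this
    simp [der, ih (hf.contr x), this]

theorem der_d_d [CharZero K] {k : ℤ} {f : Word V → W} (hf : IsCochain D E k f) :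
    der K 1 D.d (der K 1 D.d f) = 0 := by
  have h := der_comm hf (isGraded_d D) (isGraded_d D)
  have h0 : (D.d ∘ₗ D.d - sgn K (1 * 1) • D.d ∘ₗ D.d : V →ₗ[K] V) = 0 := by
    ext x; simp [D.d_d]
  rw [h0] at h
  rw [der_zero_map _ hf.lin] at h
  simp only [mul_one, sgn_one, neg_smul, one_smul, sub_neg_eq_add, ← two_smul K] at h
  exact (smul_eq_zero.1 h).resolve_left two_ne_zero

/-- `der` preserves the arity. -/
theorem der_congr {n : ℕ} (e : ℤ) (a : V → V) {f g : Word V → W}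
    (h : ∀ l : Word V, l.length = n → f l = g l) {l : Word V} (hl : l.length = n) :
    der K e a f l = der K e a g l := by
  induction l generalizing f g n with
  | nil => rfl
  | cons x l ih =>
    simp only [List.length_cons] at hl
    simp only [der]
    rw [h _ (by simpa using hl), ih (n := n - 1) (f := contr x f) (g := contr x g)
      (fun m hm => h _ (by simp; omega)) (by omega)]

section Count

variable (P : V →ₗ[K] V)

open Classical in
/-- The number of letters that are not annihilated by `P`. -/
noncomputable def letterCount (l : Word V) : ℕ := l.countP (fun x => P x.2 ≠ 0)

/-- Each letter is fixed or annihilated by `P`. -/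
def IsSplitWord (l : Word V) : Prop := ∀ x ∈ l, P x.2 = x.2 ∨ P x.2 = 0

/-- `der K 0 P` sums the effect of `P` on single letters: a fixed letter contributes `1`, an
annihilated one `0`. -/
theorem der_apply_of_isSplitWord {f : Word V → W} (hf : IsMultilin K f) {l : Word V}
    (hl : IsSplitWord P l) : der K 0 P f l = (letterCount P l : K) • f l := by
  induction l generalizing f with
  | nil => simp [der, letterCount]
  | cons x l ih =>
    have ih' := ih (hf.contr x) (fun y hy => hl y (by simp [hy]))
    simp only [der, ih', zero_mul, sgn_zero, one_smul, add_zero, contr_apply]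
    have hx := hl x (by simp)
    by_cases h0 : P x.2 = 0
    · have : letterCount P (x :: l) = letterCount P l := by
        simp [letterCount, h0]
      rw [this, h0]
      have := hf.map_zero [] x.1 l
      simp only [List.nil_append] at this
      rw [this, zero_add]
    · have : letterCount P (x :: l) = letterCount P l + 1 := by
        simp [letterCount, h0]
      rw [this, hx.resolve_right h0]
      push_cast
      rw [add_smul, one_smul, add_comm]

theorem letterCount_le (l : Word V) : letterCount P l ≤ l.length := List.countP_le_length

/-- Each letter is `P x + (x - P x)`, which is split by idempotence; multilinearity does the rest.
-/
theorem eq_zero_of_isSplitWord (hP : ∀ x, P (P x) = P x) {f : Word V → W}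
    (hf : IsMultilin K f) {l : Word V}
    (h : ∀ m : Word V, m.length = l.length → IsSplitWord P m → f m = 0) : f l = 0 := by
  induction l generalizing f with
  | nil => exact h [] rfl (by simp [IsSplitWord])
  | cons x l ih =>
    have hx : x = (x.1, P x.2 + (x.2 - P x.2)) := by simp
    have key : ∀ y, P y = y ∨ P y = 0 → f ((x.1, y) :: l) = 0 := by
      intro y hy
      refine ih (hf.contr (x.1, y)) (fun m hm hs => h _ (by simpa using hm) ?_)
      intro z hz
      rcases List.mem_cons.1 hz with rfl | hz
      · exact hy
      · exact hs z hz
    have := hf.map_add [] x.1 l (P x.2) (x.2 - P x.2)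
    simp only [List.nil_append] at this
    rw [hx, this, key _ (Or.inl (hP _)), key _ (Or.inr (by simp [hP])), add_zero]

end Count

/-- A closed cochain of arity `n` that vanishes on the representatives of cohomology classes is
exact. -/
theorem exists_primitive [CharZero K] (C : Contraction D E) {n : ℕ} {k : ℤ} {c : Word V → W}
    (hc : IsCochain D E k c) (hclosed : ∀ l : Word V, l.length = n → der K 1 D.d c l = 0)
    (hvan : ∀ l : Word V, l.length = n → c (l.map fun x => (x.1, C.i (C.p x.2))) = 0) :
    ∃ g, IsCochain D E (k - 1) g ∧ (∀ l : Word V, l.length ≠ n → g l = 0) ∧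
      ∀ l : Word V, l.length = n → der K 1 D.d g l = c l := by
  set P : V →ₗ[K] V := LinearMap.id - C.i ∘ₗ C.p with hPdef
  have hPx : ∀ x, P x = x - C.i (C.p x) := fun x => rfl
  have hPP : ∀ x, P (P x) = P x := fun x => by simp [hPx, C.p_i]
  have hgrP : IsGraded D D 0 P := by
    intro i x hx
    rw [add_zero]
    refine sub_mem hx ?_
    have := C.i_graded _ _ (C.p_graded _ _ hx)
    rwa [add_zero, add_zero] at this
  -- As `P = d h + h d`, the operator `der h` contracts closed cochains up to `der P`.
  have hhom : ∀ {f : Word V → W}, IsCochain D E k f → der K 1 D.d f = 0 →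
      der K 1 D.d (der K (-1) C.h f) = der K 0 P f := by
    intro f hf h0
    have h := der_comm hf (isGraded_d D) C.h_graded
    have e1 : (D.d ∘ₗ C.h - sgn K (1 * -1) • C.h ∘ₗ D.d : V →ₗ[K] V) = P := by
      ext x
      have := C.homotopy x
      simp [sgn_neg, hPx, ← this]
    rw [h0, e1, der_zero] at h
    simpa [sgn_neg] using h
  -- The cochain vanishes on split words with at most `j` letters outside the representatives; `r`
  -- bounds the number of levels still to be treated. Level `j = 0` is the hypothesis `hvan`.
  suffices H : ∀ (r j : ℕ) (f : Word V → W), n ≤ j + r → IsCochain D E k f →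
      (∀ l : Word V, l.length ≠ n → f l = 0) → der K 1 D.d f = 0 →
      (∀ l : Word V, IsSplitWord P l → letterCount P l ≤ j → f l = 0) →
      ∃ g, IsCochain D E (k - 1) g ∧ der K 1 D.d g = f by
    have h0 : der K 1 D.d (arityPart n c) = 0 := by
      funext l
      by_cases hl : l.length = n
      · rw [der_congr (n := n) 1 D.d (g := c) (fun m hm => arityPart_of_eq c hm) hl]
        exact hclosed l hl
      · rw [der_congr (n := l.length) 1 D.d (g := 0)
          (fun m hm => arityPart_of_ne c (by omega)) rfl, der_zero]
    obtain ⟨g, hg, hg'⟩ := H n 0 (arityPart n c) (by omega) (hc.arityPart n)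
      (fun l hl => arityPart_of_ne c hl) h0 (by
        intro l hs hl
        by_cases hn : l.length = n
        · rw [arityPart_of_eq c hn]
          have : l.map (fun x => (x.1, C.i (C.p x.2))) = l := by
            conv_rhs => rw [← List.map_id l]
            refine List.map_congr_left fun x hx => ?_
            have h1 : P x.2 = 0 := by
              by_contra h
              have : 0 < letterCount P l := List.countP_pos_iff.2 ⟨x, hx, by simpa using h⟩
              omega
            rw [hPx, sub_eq_zero] at h1
            rw [← h1]; rfl
          rw [← this]
          exact hvan l hn
        · exact arityPart_of_ne c hn)
    refine ⟨arityPart n g, hg.arityPart n, fun l hl => arityPart_of_ne g hl, fun l hl => ?_⟩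
    rw [der_congr (n := n) 1 D.d (g := g) (fun m hm => arityPart_of_eq g hm) hl, hg',
      arityPart_of_eq c hl]
  intro r
  induction r with
  | zero =>
    intro j f hj hf hn h0 hv
    refine ⟨0, IsCochain.zero, ?_⟩
    rw [der_zero]
    funext l
    refine (eq_zero_of_isSplitWord P hPP hf.lin fun m hm hs => ?_).symm
    by_cases hmn : m.length = n
    · exact hv m hs ((letterCount_le P m).trans (by omega))
    · exact hn m hmn
  | succ r ih =>
    intro j f hj hf hn h0 hv
    have hPf : IsCochain D E k (der K 0 P f) := by simpa using hf.der hgrP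
    -- The operator `der P - (j + 1)` kills the level `j + 1`, so its value on `f` has a primitive
    -- `g` by induction; since `der P f` has primitive `der h f`, dividing by `j + 1` gives one for
    -- `f`.
    obtain ⟨g, hg, hg'⟩ := ih (j + 1) (der K 0 P f - ((j + 1 : ℕ) : K) • f) (by omega)
      (hPf.sub (hf.smul _))
      (fun l hl => by
        rw [Pi.sub_apply, Pi.smul_apply, hn l hl,
          der_congr (n := l.length) 0 P (g := 0) (fun m hm => hn m (by omega)) rfl, der_zero]
        simp)
      (by rw [der_sub, der_smul, h0, ← hhom hf h0, der_d_d (by simpa using hf.der C.h_graded)]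
          simp)
      (fun l hs hl => by
        rw [Pi.sub_apply, Pi.smul_apply, der_apply_of_isSplitWord P hf.lin hs]
        rcases Nat.lt_or_ge (letterCount P l) (j + 1) with h | h
        · rw [hv l hs (by omega)]; simp
        · rw [show letterCount P l = j + 1 by omega, sub_self])
    refine ⟨((j + 1 : ℕ) : K)⁻¹ • (der K (-1) C.h f - g),
      ((hf.der C.h_graded).sub hg).smul _, ?_⟩
    rw [der_smul, der_sub, hhom hf h0, hg', sub_sub_cancel, smul_smul, inv_mul_cancel₀, one_smul]
    exact Nat.cast_ne_zero.2 (by omega)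

end Kuenneth

/-! ### Formality produces an Euler coderivation. -/

section Euler

variable {K : Type v} [Field K] {V W : Type u} [AddCommGroup V] [Module K V]
  [AddCommGroup W] [Module K W] {D : DGLieAlgebra K V} {E : DGLieAlgebra K W}

theorem IsCochain.map {U : Type u} [AddCommGroup U] [Module K U] {E' : DGLieAlgebra K U}
    {k j : ℤ} {f : Word V → W} (hf : IsCochain D E k f) {a : W →ₗ[K] U}
    (ha : IsGraded E E' j a) : IsCochain D E' (k + j) (fun l => a (f l)) where
  mem l := by
    have := ha _ _ (hf.mem l)
    rwa [show k + Word.weight l + j = k + j + Word.weight l by ring] at this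
  lin p s q := ⟨fun x y => by simp only [hf.lin.map_add, map_add], fun c x => by
    simp only [hf.lin.map_smul, map_smul]⟩
  symm p x y q := by simp only [hf.symm p x y q, map_smul]
  proj p s x q := by simp only [hf.proj p s x q]

theorem map_der {U : Type u} [AddCommGroup U] [Module K U] (A : W →ₗ[K] U) (e : ℤ) (a : V → V)
    (f : Word V → W) (l : Word V) : der K e a (fun m => A (f m)) l = A (der K e a f l) := by
  induction l generalizing f with
  | nil => simp [der]
  | cons x l ih =>
    have : contr x (fun m => A (f m)) = fun m => A (contr x f m) := rfl
    simp only [der, map_add, map_smul, this, ih]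

theorem comp_congr_right {m : ℕ} (e : ℤ) {f : Word V → W} (hf : IsMultilin K f)
    {F G : Word V → V} (h : ∀ l : Word V, l.length ≤ m → F l = G l) {l : Word V}
    (hl : l.length ≤ m) : comp K e f F l = comp K e f G l := by
  have := comp_eq_zero_of_right (r := m + 1) e hf (F := F - G)
    (fun l hl => by simp [h l (by omega)]) (l := l) (by omega)
  rw [comp_sub_right _ hf] at this
  exact sub_eq_zero.1 this

theorem conv_comm_of_one {f g : Word V → W} (hf : IsCochain D E 1 f) (hg : IsCochain D E 1 g) :
    conv E.bracket 1 f g = conv E.bracket 1 g f := by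
  rw [conv_skew hf hg]
  simp

theorem apply_single {f : Word V → W} {e : ℤ} {v : V} {j : ℤ}
    {a : V →ₗ[K] W} (ha : ∀ x, f [x] = unary D a [x]) (hv : v ∈ D.deg j) (hj : j = e + 1) :
    f [(e, v)] = a v := by
  subst hj
  rw [ha, unary_single, D.proj_same hv]

theorem vanishBelow_codiff : VanishBelow 1 (codiff D) := by
  intro l hl
  rw [List.length_eq_zero_iff.1 (by omega : l.length = 0)]
  rfl

/-- The arity-wise extension step for the Euler coderivation. -/
theorem exists_euler_step [CharZero K] (C : Contraction D E) {f : Word V → W}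
    (hf : IsCochain D E 1 f) (hf0 : f [] = 0) (hf1 : ∀ x, f [x] = unary D C.p [x])
    (hMC : comp K 1 f (codiff D) + (2 : K)⁻¹ • conv E.bracket 1 f f = 0) (n : ℕ)
    {F : Word V → V} (hF : IsCochain D D 1 F) (hF0 : F [] = 0)
    (hZ : ∀ l : Word V, l.length ≤ n → comp K 1 F (codiff D) l = comp K 0 (codiff D) F l)
    (hu : ∀ l : Word V, l.length ≤ n → comp K 0 f F l = eulerMap E (f l)) :
    ∃ F', (IsCochain D D 1 F' ∧ F' [] = 0 ∧
      (∀ l : Word V, l.length ≤ n + 1 →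
        comp K 1 F' (codiff D) l = comp K 0 (codiff D) F' l) ∧
      ∀ l : Word V, l.length ≤ n + 1 → comp K 0 f F' l = eulerMap E (f l)) ∧
      ∀ l : Word V, l.length ≤ n → F' l = F l := by
  have hQ := isCochain_codiff (D := D)
  set θf : Word V → W := fun l => eulerMap E (f l) with hθf
  have hθ : IsCochain D E 1 θf := by simpa using hf.map (isGraded_eulerMap E)
  -- `Z` measures the failure of `F` to commute with `Q`, and `w` the failure of `f` to transport
  -- `F` to the degree derivation. Both start in arity `n + 1`.
  set Z := comp K 1 F (codiff D) - comp K 0 (codiff D) F with hZdef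
  set w := comp K 0 f F - θf with hw
  have hZc : IsCochain D D 2 Z := (hF.comp (e := 1) hQ).sub (hQ.comp (e := 0) hF)
  have hfF : IsCochain D E 1 (comp K 0 f F) := hf.comp (e := 0) hF
  have hwc : IsCochain D E 1 w := hfF.sub hθ
  have hZv : VanishBelow (n + 1) Z := fun l hl => by simp [Z, hZ l (by omega)]
  have hwv : VanishBelow (n + 1) w := fun l hl => by simp [w, hu l (by omega), θf]
  have hfQ : comp K 1 f (codiff D) = -((2 : K)⁻¹ • conv E.bracket 1 f f) :=
    eq_neg_of_add_eq_zero_left hMC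
  have hhalf : ∀ x : Word V → W, (2 : K)⁻¹ • (x + x) = x := fun x => by
    rw [← two_smul K, smul_smul, inv_mul_cancel₀ two_ne_zero, one_smul]
  -- the compatibility between the two obstructions
  have key : comp K 1 f Z = comp K 1 w (codiff D) + conv E.bracket 1 f w := by
    have h1 := comp_comp hf.lin hf.symm hF.lin hQ.lin 0 1
    simp only [zero_mul, sgn_zero, one_smul, zero_add] at h1
    have h2 : comp K 1 θf (codiff D) = -conv E.bracket 1 f θf := by
      funext l
      rw [hθf, ← map_comp, hfQ]
      simp only [Pi.neg_apply, Pi.smul_apply, map_neg, map_smul]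
      rw [map_conv E.bracket (eulerMap E) (eulerMap_bracket E)]
      have := congrFun (conv_comm_of_one hθ hf) l
      simp only [← hθf, this]
      rw [← two_smul K, smul_smul, inv_mul_cancel₀ two_ne_zero, one_smul]
    have h3 : comp K 0 (comp K 1 f (codiff D)) F = -conv E.bracket 1 f (comp K 0 f F) := by
      rw [hfQ, ← neg_one_smul K, comp_smul_left, comp_smul_left, comp_conv, neg_one_smul]
      simp only [mul_zero, sgn_zero, one_smul, add_zero]
      rw [conv_comm_of_one hfF hf, hhalf]
    have h4 : comp K 0 f F = w + θf := by rw [hw, sub_add_cancel]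
    rw [← h1, h3, h4, comp_add_left, h2, conv_add_right]
    abel
  -- A commutator with `Q` is closed because `Q² = 0`.
  have hZcl : comp K 1 Z (codiff D) = -comp K 1 (codiff D) Z := by
    have h1 := comp_comp hQ.lin hQ.symm hF.lin hQ.lin 0 1
    simp only [zero_mul, sgn_zero, one_smul, zero_add, comp_codiff_codiff, comp_zero_left,
      sub_zero] at h1
    rw [← h1, hZdef, comp_sub_left, comp_comp_codiff hF, zero_sub]
  have hpZ : ∀ l : Word V, l.length = n + 1 → C.p (Z l) = -der K 1 D.d w l := by
    intro l hl
    have h := congrFun key l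
    rw [comp_leading_right 1 hf.lin hZv hl, Pi.add_apply, comp_codiff_leading hwc hwv hl,
      conv_eq_zero (m := 1) (r := n + 1) _ _ (fun m hm => by
        rw [List.length_eq_zero_iff.1 (by omega : m.length = 0)]; exact hf0) hwv (by omega),
      add_zero, apply_single hf1 (hZc.mem l) (by ring)] at h
    exact h
  have hdZ : ∀ l : Word V, l.length = n + 1 → der K 1 D.d Z l = -D.d (Z l) := by
    intro l hl
    have h := congrFun hZcl l
    rw [comp_codiff_leading hZc hZv hl, Pi.neg_apply, comp_leading_right 1 hQ.lin hZv hl,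
      codiff_single, D.proj_same (by
        have := hZc.mem l
        rwa [show 2 + Word.weight l = 1 + Word.weight l + 1 by ring] at this)] at h
    simp only [neg_neg] at h
    rw [← h, neg_neg]
  -- By `hpZ` the image of `Z` under `p` is `-δ w`; the added term brings it into `ker p`, where `h`
  -- contracts.
  set Z' : Word V → V := Z + fun l => C.i (der K 1 D.d w l) with hZ'
  have hZ'c : IsCochain D D 2 Z' :=
    hZc.add (by simpa using (hwc.der (isGraded_d D)).map C.i_graded)
  have hpZ' : ∀ l : Word V, l.length = n + 1 → C.p (Z' l) = 0 := by
    intro l hl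
    simp [Z', C.p_i, hpZ l hl]
  have hdZ' : ∀ l : Word V, l.length = n + 1 → der K 1 D.d Z' l = -D.d (Z' l) := by
    intro l hl
    rw [hZ', der_add, Pi.add_apply, map_der, der_d_d hwc, hdZ l hl]
    simp [C.d_i]
  -- The term `-i w` cancels `w` because `p i = 1` and `p h = 0`; the term `-h Z'` then cancels `Z`,
  -- because `d h + h d` is the identity on `ker p`.
  set e : Word V → V := arityPart (n + 1) ((fun l => -C.i (w l)) - fun l => C.h (Z' l)) with he
  have hec : IsCochain D D 1 e := by
    refine IsCochain.arityPart (IsCochain.sub ?_ ?_) _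
    · have := (hwc.map C.i_graded).smul (-1)
      rw [add_zero] at this
      convert this using 2 with l
      simp
    · simpa using hZ'c.map C.h_graded
  have hev : VanishBelow (n + 1) e := vanishBelow_arityPart _ _
  have hel : ∀ l : Word V, l.length = n + 1 → e l = -C.i (w l) - C.h (Z' l) := fun l hl => by
    rw [he, arityPart_of_eq _ hl]; rfl
  have hde : ∀ l : Word V, l.length = n + 1 →
      der K 1 D.d e l = -C.i (der K 1 D.d w l) + C.h (D.d (Z' l)) := by
    intro l hl
    rw [he, der_congr (n := n + 1) 1 D.d (fun m hm => arityPart_of_eq _ hm) hl, der_sub,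
      Pi.sub_apply, map_der]
    have : (fun l => -C.i (w l)) = fun l => (-C.i) (w l) := rfl
    rw [this, map_der, hdZ' l hl]
    simp
  refine ⟨F + e, ⟨hF.add hec, by simp [hF0, hev [] (by simp)], ?_, ?_⟩, fun l hl => by
    simp [hev l (by omega)]⟩
  · intro l hl
    rw [comp_add_left, comp_add_right _ hQ.lin, Pi.add_apply, Pi.add_apply]
    rcases Nat.lt_or_ge l.length (n + 1) with h | h
    · rw [hZ l (by omega), comp_eq_zero_of_right 0 hQ.lin hev h,
        comp_eq_zero 1 hec.lin hev vanishBelow_codiff (by omega)]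
    · have hl' : l.length = n + 1 := by omega
      have hle : e l ∈ D.deg (0 + Word.weight l + 1) := by
        have := hec.mem l
        rwa [show 1 + Word.weight l = 0 + Word.weight l + 1 by ring] at this
      rw [comp_codiff_leading hec hev hl', comp_leading_right 0 hQ.lin hev hl', codiff_single,
        D.proj_same hle, hde l hl', hel l hl', map_sub, map_neg, C.d_i]
      have h1 : comp K 1 F (codiff D) l = Z l + comp K 0 (codiff D) F l := by simp [Z]
      have h2 := C.homotopy (Z' l)
      rw [hpZ' l hl', map_zero, sub_zero] at h2
      have h3 : Z' l = Z l + C.i (der K 1 D.d w l) := rfl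
      have h4 : C.h (D.d (Z' l)) = Z l + C.i (der K 1 D.d w l) - D.d (C.h (Z' l)) := by
        rw [← h3]
        exact eq_sub_of_add_eq' h2
      rw [h1, h4]
      abel
  · intro l hl
    rw [comp_add_right _ hf.lin, Pi.add_apply]
    rcases Nat.lt_or_ge l.length (n + 1) with h | h
    · rw [hu l (by omega), comp_eq_zero_of_right 0 hf.lin hev h, add_zero]
    · have hl' : l.length = n + 1 := by omega
      rw [comp_leading_right 0 hf.lin hev hl', apply_single hf1 (hec.mem l) (by ring), hel l hl']
      have h1 : comp K 0 f F l = w l + eulerMap E (f l) := by simp [w, θf]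
      rw [h1, map_sub, map_neg, C.p_i, C.p_h]
      abel

/-- A formal DG Lie algebra has an Euler coderivation: a coderivation that commutes with the
codifferential and is transported to the degree derivation of the cohomology. -/
theorem exists_euler [CharZero K] (C : Contraction D E) {f : Word V → W}
    (hf : IsCochain D E 1 f) (hf0 : f [] = 0) (hf1 : ∀ x, f [x] = unary D C.p [x])
    (hMC : comp K 1 f (codiff D) + (2 : K)⁻¹ • conv E.bracket 1 f f = 0) :
    ∃ F, IsCochain D D 1 F ∧ F [] = 0 ∧ comp K 1 F (codiff D) = comp K 0 (codiff D) F ∧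
      ∀ x, C.p (F [x]) = eulerMap E (f [x]) := by
  obtain ⟨s, hs⟩ := exists_seq_of_step
    (P := fun n F => IsCochain D D 1 F ∧ F [] = 0 ∧
      (∀ l : Word V, l.length ≤ n → comp K 1 F (codiff D) l = comp K 0 (codiff D) F l) ∧
      ∀ l : Word V, l.length ≤ n → comp K 0 f F l = eulerMap E (f l))
    (R := fun n F F' => ∀ l : Word V, l.length ≤ n → F' l = F l)
    ⟨0, IsCochain.zero, rfl, fun l hl => by
        rw [comp_zero_left, comp_zero_right _ isCochain_codiff.lin],
      fun l hl => by
        rw [comp_zero_right _ hf.lin, List.length_eq_zero_iff.1 (by omega : l.length = 0), hf0]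
        simp⟩
    (fun n F ⟨h1, h2, h3, h4⟩ => exists_euler_step C hf hf0 hf1 hMC n h1 h2 h3 h4)
  -- A step changes nothing in the arities already treated, so the sequence is eventually constant
  -- on each word.
  have hstab : ∀ n m, n ≤ m → ∀ l : Word V, l.length ≤ n → s m l = s n l := by
    intro n m hnm
    induction m, hnm using Nat.le_induction with
    | base => exact fun _ _ => rfl
    | succ m hm ih => exact fun l hl => ((hs m).2 l (by omega)).trans (ih l hl)
  set F : Word V → V := fun l => s l.length l with hFdef
  have hF : IsCochain D D 1 F := IsCochain.diag fun n => (hs n).1.1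
  have hFs : ∀ n, ∀ l : Word V, l.length ≤ n → F l = s n l :=
    fun n l hl => (hstab _ _ hl l le_rfl).symm
  refine ⟨F, hF, (hs 0).1.2.1, ?_, ?_⟩
  · funext l
    rw [comp_congr_left 1 (hF.sub (hs l.length).1.1).lin (hFs l.length) codiff_nil le_rfl,
      comp_congr_right 0 isCochain_codiff.lin (hFs l.length) le_rfl]
    exact (hs l.length).1.2.2.1 l le_rfl
  · intro x
    have h := (hs 1).1.2.2.2 [x] le_rfl
    rw [← comp_congr_right 0 hf.lin (hFs 1) (l := [x]) le_rfl,
      comp_leading_right (r := 1) 0 hf.lin (fun m hm => by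
        rw [List.length_eq_zero_iff.1 (by omega : m.length = 0)]; exact (hs 0).1.2.1) rfl,
      apply_single hf1 (hF.mem [x]) (by ring)] at h
    exact h

end Euler

/-! ### Pulling cochains back along linear maps. -/

section Pull

variable {K : Type v} [Field K] {V W : Type u} [AddCommGroup V] [Module K V]
  [AddCommGroup W] [Module K W] {D : DGLieAlgebra K V} {E : DGLieAlgebra K W}

/-- Apply a map to all letters. -/
def mapWord {U : Type u} (r : U → V) (l : Word U) : Word V := l.map fun x => (x.1, r x.2)

@[simp] theorem mapWord_nil {U : Type u} (r : U → V) : mapWord r ([] : Word U) = [] := rfl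

@[simp] theorem mapWord_cons {U : Type u} (r : U → V) (x : ℤ × U) (l : Word U) :
    mapWord r (x :: l) = (x.1, r x.2) :: mapWord r l := rfl

@[simp] theorem mapWord_append {U : Type u} (r : U → V) (l m : Word U) :
    mapWord r (l ++ m) = mapWord r l ++ mapWord r m := by simp [mapWord]

@[simp] theorem length_mapWord {U : Type u} (r : U → V) (l : Word U) :
    (mapWord r l).length = l.length := by simp [mapWord]

@[simp] theorem weight_mapWord {U : Type u} (r : U → V) (l : Word U) :
    Word.weight (mapWord r l) = Word.weight l := by
  induction l with
  | nil => rfl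
  | cons x l ih => simp [ih]

theorem mapWord_mapWord {U T : Type u} (r : U → V) (r' : T → U) (l : Word T) :
    mapWord r (mapWord r' l) = mapWord (fun x => r (r' x)) l := by
  simp [mapWord]

/-- Precomposition with a linear map in each letter. -/
def pull {U : Type u} (r : U → V) (f : Word V → W) : Word U → W := fun l => f (mapWord r l)

theorem pull_apply {U : Type u} (r : U → V) (f : Word V → W) (l : Word U) :
    pull r f l = f (mapWord r l) := rfl

theorem contr_pull {U : Type u} (r : U → V) (f : Word V → W) (x : ℤ × U) :
    contr x (pull r f) = pull r (contr (x.1, r x.2) f) := rfl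

theorem IsCochain.pull {U : Type u} [AddCommGroup U] [Module K U] {D' : DGLieAlgebra K U}
    {k : ℤ} {f : Word V → W} (hf : IsCochain D E k f) {r : U →ₗ[K] V}
    (hr : IsGraded D' D 0 r) : IsCochain D' E k (pull r f) where
  mem l := by
    have := hf.mem (mapWord r l)
    rwa [weight_mapWord] at this
  lin p s q := ⟨fun x y => by simp [LieCochain.pull, hf.lin.map_add], fun c x => by
    simp [LieCochain.pull, hf.lin.map_smul]⟩
  symm p x y q := by
    simpa [LieCochain.pull] using hf.symm (mapWord r p) (x.1, r x.2) (y.1, r y.2) (mapWord r q)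
  proj p s x q := by
    have h := hr.proj (s + 1) x
    rw [add_zero] at h
    simp only [LieCochain.pull, mapWord_append, mapWord_cons, ← h]
    exact hf.proj _ _ _ _

theorem der_pull {U : Type u} [AddCommGroup U] [Module K U] (e : ℤ) (a : V → V) (b : U → U)
    (r : U → V) (hr : ∀ x, r (b x) = a (r x)) (f : Word V → W) (l : Word U) :
    der K e b (pull r f) l = der K e a f (mapWord r l) := by
  induction l generalizing f with
  | nil => rfl
  | cons x l ih =>
    simp only [der, contr_pull, ih, mapWord_cons, pull_apply, hr]

theorem conv_pull {U : Type u} (B : W →ₗ[K] W →ₗ[K] W) (k : ℤ) (r : U → V)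
    (f g : Word V → W) (l : Word U) :
    conv B k (pull r f) (pull r g) l = conv B k f g (mapWord r l) := by
  induction l generalizing f g k with
  | nil => rfl
  | cons x l ih => simp only [conv, contr_pull, ih, mapWord_cons]

/-- Restriction of a composition along `r`, when the coderivation preserves words in the
image of `r`. -/
theorem comp_pull {U : Type u} (e : ℤ) (r : U → V) (f : Word V → W) {F : Word V → V}
    {G : Word U → U} (hF : ∀ l, F (mapWord r l) = r (G l)) (l : Word U) :
    comp K e f F (mapWord r l) = comp K e (pull r f) G l := by
  induction l generalizing f F G e with
  | nil => simp [comp, pull, ← hF]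
  | cons x l ih =>
    simp only [comp, contr_pull, mapWord_cons]
    rw [ih (e + x.1) f (F := contr (x.1, r x.2) F) (G := contr x G) (fun m => hF (x :: m)),
      ih e (contr (x.1, r x.2) f) hF]

theorem IsCochain.apply_proj {k : ℤ} {f : Word V → W} (hf : IsCochain D E k f) (l : Word V) :
    f l = f (l.map fun x => (x.1, D.proj (x.1 + 1) x.2)) := by
  induction l generalizing f k with
  | nil => rfl
  | cons x l ih =>
    rw [List.map_cons]
    refine (ih (hf.contr x)).trans ?_
    exact hf.proj [] x.1 x.2 _

end Pull

/-! ### Closed cochains evaluated on cycles. -/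

section Cycles

variable {K : Type v} [Field K] {V W : Type u} [AddCommGroup V] [Module K V]
  [AddCommGroup W] [Module K W] {D : DGLieAlgebra K V} {E : DGLieAlgebra K W}

theorem der_eq_zero_of_forall (e : ℤ) (a : V → V) {f : Word V → W} (hf : IsMultilin K f)
    {l : Word V} (hl : ∀ x ∈ l, a x.2 = 0) : der K e a f l = 0 := by
  induction l generalizing f with
  | nil => rfl
  | cons x l ih =>
    have := hf.map_zero [] (x.1 + e) l
    simp only [List.nil_append] at this
    simp only [der, ih (hf.contr x) (fun y hy => hl y (by simp [hy])), hl x (by simp), this]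
    simp

variable (D) in
/-- `f` is closed in arity `n`. -/
def ClosedAt (n : ℕ) (f : Word V → W) : Prop :=
  ∀ l : Word V, l.length = n → der K 1 D.d f l = 0

/-- Differentiating the cycle `x` gives nothing, so closedness at `x :: l` is closedness of the
contraction at `l`, up to sign. -/
theorem ClosedAt.contr {n : ℕ} {f : Word V → W} (hf : IsMultilin K f)
    (hc : ClosedAt D (n + 1) f) {x : ℤ × V} (hx : D.d x.2 = 0) : ClosedAt D n (contr x f) := by
  intro l hl
  have h := hc (x :: l) (by simp [hl])
  simp only [der, hx] at h
  have h0 := hf.map_zero [] (x.1 + 1) l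
  simp only [List.nil_append] at h0
  rw [h0, zero_add] at h
  refine (smul_eq_zero.1 h).resolve_left ?_
  rcases sgn_eq_or K (1 * x.1) with hs | hs <;> rw [hs] <;> simp

/-- Closedness at the word beginning with `(s - 1, y)`: the other letters are cycles and only the
term containing `d y` remains. -/
theorem ClosedAt.apply_boundary {n : ℕ} {f : Word V → W} (hf : IsMultilin K f)
    (hc : ClosedAt D (n + 1) f) {l : Word V} (hl : l.length = n) (hcyc : ∀ x ∈ l, D.d x.2 = 0)
    (s : ℤ) (y : V) : f ((s, D.d y) :: l) = 0 := by
  have h := hc ((s - 1, y) :: l) (by simp [hl])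
  simp only [der] at h
  rw [der_eq_zero_of_forall 1 D.d (hf.contr _) hcyc, smul_zero, add_zero, sub_add_cancel] at h
  exact h

/-- A closed cochain only depends on the cohomology classes of cycles. -/
theorem ClosedAt.congr {n : ℕ} {f : Word V → W} (hf : IsMultilin K f) (hc : ClosedAt D n f)
    {l : Word V} (hl : l.length = n) (hcyc : ∀ x ∈ l, D.d x.2 = 0) (r : V →ₗ[K] V)
    (hr : ∀ x ∈ l, D.d (r x.2) = 0) (hb : ∀ x ∈ l, ∃ y, x.2 = r x.2 + D.d y) :
    f l = f (mapWord r l) := by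
  induction l generalizing f n with
  | nil => rfl
  | cons x l ih =>
    obtain ⟨n, rfl⟩ : ∃ m, n = m + 1 := ⟨l.length, by simpa using hl.symm⟩
    have hl' : l.length = n := by simpa using hl
    obtain ⟨y, hy⟩ := hb x (by simp)
    have h1 : f (x :: l) = f ((x.1, r x.2) :: l) := by
      have := hf.map_add [] x.1 l (r x.2) (D.d y)
      simp only [List.nil_append, ← hy] at this
      rw [hc.apply_boundary hf hl' (fun z hz => hcyc z (by simp [hz])), add_zero] at this
      exact this
    rw [h1, mapWord_cons]
    exact ih (hf.contr (x.1, r x.2)) (hc.contr hf (hr x (by simp))) hl'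
      (fun z hz => hcyc z (by simp [hz])) (fun z hz => hr z (by simp [hz]))
      (fun z hz => hb z (by simp [hz]))

/-- A degree zero operator that acts on the classes of cycles through the degree acts on
closed cochains through the total degree. -/
theorem ClosedAt.der_euler {n : ℕ} {f : Word V → W} (hf : IsMultilin K f) (hc : ClosedAt D n f)
    (a : V →ₗ[K] V) {l : Word V} (hl : l.length = n) (hcyc : ∀ x ∈ l, D.d x.2 = 0)
    (ha : ∀ x ∈ l, ∃ y, a x.2 = ((x.1 + 1 : ℤ) : K) • x.2 + D.d y) :
    der K 0 a f l = ((Word.weight l + n : ℤ) : K) • f l := by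
  induction l generalizing f n with
  | nil =>
    obtain rfl : 0 = n := by simpa using hl
    simp [der]
  | cons x l ih =>
    obtain ⟨n, rfl⟩ : ∃ m, n = m + 1 := ⟨l.length, by simpa using hl.symm⟩
    have hl' : l.length = n := by simpa using hl
    have hx := hcyc x (by simp)
    obtain ⟨y, hy⟩ := ha x (by simp)
    have h1 := hf.map_add [] x.1 l (((x.1 + 1 : ℤ) : K) • x.2) (D.d y)
    have h2 := hf.map_smul [] x.1 l ((x.1 + 1 : ℤ) : K) x.2
    simp only [List.nil_append] at h1 h2
    rw [hc.apply_boundary hf hl' (fun z hz => hcyc z (by simp [hz])), add_zero, h2] at h1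
    simp only [der, add_zero, zero_mul, sgn_zero, one_smul, hy, h1]
    rw [ih (hf.contr x) (hc.contr hf hx) hl' (fun z hz => hcyc z (by simp [hz]))
      (fun z hz => ha z (by simp [hz]))]
    simp only [contr_apply, Word.weight_cons, ← add_smul]
    congr 1
    push_cast
    ring

end Cycles

/-! ### Euler data, curvature and the intertwining defect. -/

section Formality

variable {K : Type v} [Field K] {V W : Type u} [AddCommGroup V] [Module K V]
  [AddCommGroup W] [Module K W]

/-- A contraction onto the cohomology, together with a retraction `r` onto a quasi-isomorphic
subalgebra and an Euler coderivation of that subalgebra. -/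
structure EulerData (D : DGLieAlgebra K V) (E : DGLieAlgebra K W) extends Contraction D E where
  p_bracket : ∀ z z', D.d z = 0 → D.d z' = 0 → p (D.bracket z z') = E.bracket (p z) (p z')
  r : V →ₗ[K] V
  r_graded : IsGraded D D 0 r
  r_d : ∀ x, r (D.d x) = D.d (r x)
  r_r : ∀ x, r (r x) = r x
  r_bracket : ∀ x y, r (D.bracket (r x) (r y)) = D.bracket (r x) (r y)
  -- With the preceding fields this says that the image of `r` is a DG Lie subalgebra carrying the
  -- whole cohomology.
  p_r : ∀ z, D.d z = 0 → p (r z) = p z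
  F : Word V → V
  F_cochain : IsCochain D D 1 F
  F_nil : F [] = 0
  -- Commutation with `Q` is demanded only on words from the image of `r`; outside this subalgebra
  -- an extended coderivation need not commute.
  F_comm : ∀ l, comp K 1 F (codiff D) (mapWord r l) = comp K 0 (codiff D) F (mapWord r l)
  F_single : ∀ s z, z ∈ D.deg (s + 1) → D.d z = 0 →
    p (F [(s, r z)]) = ((s + 1 : ℤ) : K) • p z

variable {D : DGLieAlgebra K V} {E : DGLieAlgebra K W}

/-- The curvature of a cochain. -/
noncomputable def curv (D : DGLieAlgebra K V) (E : DGLieAlgebra K W) (f : Word V → W) :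
    Word V → W :=
  comp K 1 f (codiff D) + (2 : K)⁻¹ • conv E.bracket 1 f f

theorem IsCochain.curv {f : Word V → W} (hf : IsCochain D E 1 f) :
    IsCochain D E 2 (curv D E f) :=
  (hf.comp (e := 1) isCochain_codiff).add ((hf.conv hf).smul _)

theorem half_smul_add [CharZero K] {M : Type*} [AddCommGroup M] [Module K M] (x : M) :
    (2 : K)⁻¹ • (x + x) = x := by
  rw [← two_smul K, smul_smul, inv_mul_cancel₀ two_ne_zero, one_smul]

/-- For odd `f` the Jacobi identity reads `3 [f, [f, f]] = 0`. -/
theorem conv_self_conv_self [CharZero K] {f : Word V → W} (hf : IsCochain D E 1 f) :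
    conv E.bracket 2 f (conv E.bracket 1 f f) = 0 := by
  have h1 := conv_jacobi hf hf hf
  have h2 := conv_skew (hf.conv hf) hf
  rw [h2] at h1
  norm_num at h1
  generalize conv E.bracket 2 f (conv E.bracket 1 f f) = x at h1 ⊢
  have h3 : (3 : K) • x = 0 := by
    rw [show (3 : K) • x = x - (-x + -x) by module, ← h1, sub_self]
  exact (smul_eq_zero.1 h3).resolve_left three_ne_zero

/-- The Bianchi identity. -/
theorem comp_curv_codiff [CharZero K] {f : Word V → W} (hf : IsCochain D E 1 f) :
    comp K 1 (curv D E f) (codiff D) = conv E.bracket 2 f (curv D E f) := by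
  have hfQ : IsCochain D E 2 (comp K 1 f (codiff D)) := hf.comp (e := 1) isCochain_codiff
  rw [curv, comp_add_left, comp_comp_codiff hf, zero_add, comp_smul_left, comp_conv,
    conv_add_right, conv_smul_right, conv_self_conv_self hf, smul_zero, add_zero]
  have h2 := conv_skew hfQ hf
  rw [h2]
  norm_num
  module

namespace EulerData

variable (X : EulerData D E)

/-- The failure of `f` to intertwine the Euler coderivation with the degree derivation up to the
homotopy `s`. -/
noncomputable def defect (f s : Word V → W) : Word V → W :=
  (fun l => eulerMap E (f l)) - comp K 0 f X.F -
    (comp K 1 s (codiff D) - conv E.bracket 0 f s)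

theorem isCochain_defect {f s : Word V → W} (hf : IsCochain D E 1 f) (hs : IsCochain D E 0 s) :
    IsCochain D E 1 (X.defect f s) := by
  refine IsCochain.sub (IsCochain.sub ?_ (hf.comp (e := 0) X.F_cochain)) (IsCochain.sub ?_ ?_)
  · simpa using hf.map (isGraded_eulerMap E)
  · simpa using hs.comp (e := 1) isCochain_codiff
  · simpa using hf.conv hs

/-- Write `κ` for the curvature, `υ` for the defect and `θ` for the degree derivation. The identity
is `θ κ - κ F = υ Q + [f, υ] - [κ, s] + f [F, Q]`; the term in `s` arises because the differential
twisted by `f` squares to the bracket with `-κ`. In the lowest arity the right-hand side becomes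
exact, and this links the Euler weight to the obstruction `κ`. -/
theorem euler_curv [CharZero K] {f s : Word V → W} (hf : IsCochain D E 1 f)
    (hs : IsCochain D E 0 s) :
    (fun l => eulerMap E (curv D E f l)) - comp K 0 (curv D E f) X.F =
      comp K 1 (X.defect f s) (codiff D) + conv E.bracket 1 f (X.defect f s) -
        conv E.bracket 0 (curv D E f) s +
        comp K 1 f (comp K 1 X.F (codiff D) - comp K 0 (codiff D) X.F) := by
  have hQ := isCochain_codiff (D := D)
  set θf : Word V → W := fun l => eulerMap E (f l) with hθf
  have hθ : IsCochain D E 1 θf := by simpa using hf.map (isGraded_eulerMap E)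
  have hfF : IsCochain D E 1 (comp K 0 f X.F) := hf.comp (e := 0) X.F_cochain
  have h1 := comp_comp hf.lin hf.symm X.F_cochain.lin hQ.lin 0 1
  simp only [zero_mul, sgn_zero, one_smul, zero_add] at h1
  have h2 : (fun l => eulerMap E (curv D E f l)) =
      comp K 1 θf (codiff D) + conv E.bracket 1 f θf := by
    funext l
    simp only [curv, Pi.add_apply, Pi.smul_apply, map_add, map_smul]
    rw [map_comp, map_conv E.bracket (eulerMap E) (eulerMap_bracket E)]
    have := congrFun (conv_comm_of_one hθ hf) l
    simp only [← hθf, this]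
    rw [half_smul_add]
  have h3 : comp K 0 (curv D E f) X.F =
      comp K 0 (comp K 1 f (codiff D)) X.F + conv E.bracket 1 f (comp K 0 f X.F) := by
    rw [curv, comp_add_left, comp_smul_left, comp_conv]
    simp only [mul_zero, sgn_zero, one_smul, add_zero]
    rw [conv_comm_of_one hfF hf, half_smul_add]
  -- the square of the twisted differential
  have h4 : comp K 1 (comp K 1 s (codiff D) - conv E.bracket 0 f s) (codiff D) +
      conv E.bracket 1 f (comp K 1 s (codiff D) - conv E.bracket 0 f s) =
      -conv E.bracket 0 (curv D E f) s := by
    rw [comp_sub_left, comp_comp_codiff hs, comp_conv, conv_sub_right, curv, conv_add_left,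
      conv_smul_left]
    have h5 := conv_jacobi hf hf hs
    norm_num at h5 ⊢
    have h6 : conv E.bracket 1 f (conv E.bracket 0 f s) =
        (2 : K)⁻¹ • conv E.bracket 0 (conv E.bracket 1 f f) s := by
      rw [← half_smul_add (K := K) (conv E.bracket 1 f (conv E.bracket 0 f s))]
      congr 1
      nth_rewrite 1 [h5]
      abel
    rw [h6]
    module
  have h7 : X.defect f s =
      θf - comp K 0 f X.F - (comp K 1 s (codiff D) - conv E.bracket 0 f s) := rfl
  rw [h2, h3, ← h1, h7, comp_sub_left, comp_sub_left, conv_sub_right, conv_sub_right]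
  rw [eq_neg_iff_add_eq_zero] at h4
  rw [← sub_eq_zero, ← h4]
  abel

end EulerData

end Formality

/-! ### From Euler data to a Maurer–Cartan cochain. -/

section Formality

variable {K : Type v} [Field K] {V W : Type u} [AddCommGroup V] [Module K V]
  [AddCommGroup W] [Module K W] {D : DGLieAlgebra K V} {E : DGLieAlgebra K W}

theorem Contraction.exists_boundary (C : Contraction D E) {z : V} (hz : D.d z = 0)
    (hp : C.p z = 0) : ∃ y, z = D.d y := by
  have := C.homotopy z
  rw [hz, hp, map_zero, map_zero, add_zero, sub_zero] at this
  exact ⟨_, this.symm⟩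

theorem vanishBelow_one {f : Word V → W} (h : f [] = 0) : VanishBelow 1 f := by
  intro l hl
  rw [List.length_eq_zero_iff.1 (by omega : l.length = 0)]
  exact h

/-- The curvature of a perturbation in arity `n`. -/
theorem curv_add {n : ℕ} (hn : 1 ≤ n) {f g : Word V → W} (hf0 : f [] = 0)
    (hgv : VanishBelow n g) {l : Word V} (hl : l.length ≤ n) :
    curv D E (f + g) l = curv D E f l + comp K 1 g (codiff D) l := by
  have hfv := vanishBelow_one hf0
  simp only [curv, comp_add_left, conv_add_left, conv_add_right, Pi.add_apply, Pi.smul_apply]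
  rw [conv_eq_zero E.bracket 1 hfv hgv (by omega), conv_eq_zero E.bracket 1 hgv hfv (by omega),
    conv_eq_zero E.bracket 1 hgv hgv (by omega)]
  simp only [add_zero]
  abel

theorem curv_add_of_lt {n : ℕ} (hn : 1 ≤ n) {f g : Word V → W} (hf0 : f [] = 0)
    (hg : IsCochain D E 1 g) (hgv : VanishBelow n g) {l : Word V} (hl : l.length < n) :
    curv D E (f + g) l = curv D E f l := by
  rw [curv_add hn hf0 hgv hl.le, comp_eq_zero 1 hg.lin hgv vanishBelow_codiff (by omega),
    add_zero]

namespace EulerData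

variable (X : EulerData D E)

/-- The image of `r` is closed under the differential and the bracket, so `Q` preserves words from
it. -/
theorem r_codiff (l : Word V) :
    codiff D (mapWord X.r l) = X.r (codiff D (mapWord X.r l)) := by
  have hp : ∀ j x, D.proj j (X.r x) = X.r (D.proj j x) := fun j x => by
    have := X.r_graded.proj j x
    rwa [add_zero] at this
  match l with
  | [] => simp [codiff]
  | [x] => simp [codiff, hp, ← X.r_d, X.r_r]
  | [x, y] => simp [codiff, hp, X.r_bracket]
  | _ :: _ :: _ :: _ => simp [codiff]

/-- The leading term of the codifferential of a cochain restricted along the retraction. -/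
theorem comp_codiff_mapWord {n : ℕ} {k : ℤ} {f : Word V → W} (hf : IsCochain D E k f)
    (hv : VanishBelow n (pull X.r f)) {l : Word V} (hl : l.length = n) :
    comp K 1 f (codiff D) (mapWord X.r l) = -der K 1 D.d (pull X.r f) l := by
  have hc := hf.pull X.r_graded
  rw [comp_pull 1 X.r f (G := pull X.r (codiff D)) X.r_codiff]
  have hdr : IsGraded D D 1 (-(D.d ∘ₗ X.r)) := fun i x hx => neg_mem (D.d_mem (by
    simpa using X.r_graded i x hx))
  have hp : ∀ j x, D.proj j (X.r x) = X.r (D.proj j x) := fun j x => by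
    have := X.r_graded.proj j x
    rwa [add_zero] at this
  rw [comp_leading_left (G := unary D (-(D.d ∘ₗ X.r))) 1 hc.lin hv
    (vanishBelow_two (by simp [pull, codiff, unary])
      (fun x => by simp [pull, codiff, unary, hp])) hl, comp_unary hc hdr]
  have : ∀ (g : Word V → W), IsMultilin K g → ∀ m : Word V,
      der K 1 (-(D.d ∘ₗ X.r)) (pull X.r g) m = -der K 1 D.d (pull X.r g) m := by
    intro g hg m
    induction m generalizing g with
    | nil => simp [der]
    | cons x m ih =>
      have h1 := hg.map_smul [] (x.1 + 1) (mapWord X.r m) (-1) (D.d (X.r x.2))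
      simp only [List.nil_append] at h1
      simp only [der, contr_pull, ih _ (hg.contr _), pull_apply, mapWord_cons]
      have h2 : X.r ((-(D.d ∘ₗ X.r)) x.2) = (-1 : K) • D.d (X.r x.2) := by
        simp [X.r_d, X.r_r]
      rw [h2, h1, X.r_d]
      module
  exact this f hf.lin l

/-- The leading terms of the compatibility between the two obstructions. -/
theorem euler_curv_leading [CharZero K] {n : ℕ} {f s : Word V → W}
    (hf : IsCochain D E 1 f) (hf0 : f [] = 0) (hs : IsCochain D E 0 s) (hs0 : s [] = 0)
    (hκ : VanishBelow n (curv D E f)) (hυ : VanishBelow n (pull X.r (X.defect f s)))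
    {l : Word V} (hl : l.length = n) :
    eulerMap E (curv D E f (mapWord X.r l)) - comp K 0 (curv D E f) X.F (mapWord X.r l) =
      -der K 1 D.d (pull X.r (X.defect f s)) l := by
  have h := congrFun (X.euler_curv hf hs) (mapWord X.r l)
  simp only [Pi.sub_apply, Pi.add_apply] at h
  rw [h, X.comp_codiff_mapWord (X.isCochain_defect hf hs) hυ hl, ← conv_pull,
    conv_eq_zero (m := 1) (r := n) E.bracket 1 (vanishBelow_one (by simpa [pull] using hf0)) hυ
      (by omega),
    conv_eq_zero E.bracket 0 hκ (vanishBelow_one hs0) (by simp; omega),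
    comp_eq_zero_of_letters (fun x => X.r x.2 = x.2) 1 hf.lin]
  · simp
  -- The evaluation only involves subwords with letters fixed by `r`, and there `F` commutes with
  -- `Q`.
  · intro m hm
    have : mapWord X.r m = m := by
      conv_rhs => rw [← List.map_id m]
      exact List.map_congr_left fun x hx => by rw [hm x hx]; rfl
    rw [← this, Pi.sub_apply, X.F_comm, sub_self]
  · intro x hx
    simp only [mapWord, List.mem_map] at hx
    obtain ⟨y, _, rfl⟩ := hx
    exact X.r_r _

/-- The leading term of the Bianchi identity: `[f, κ]` starts one arity higher because `f [] = 0`.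
-/
theorem closedAt_curv [CharZero K] {n : ℕ} {f : Word V → W} (hf : IsCochain D E 1 f)
    (hf0 : f [] = 0) (hκ : VanishBelow n (curv D E f)) : ClosedAt D n (curv D E f) := by
  intro l hl
  have h := congrFun (comp_curv_codiff hf) l
  rw [comp_codiff_leading hf.curv hκ hl,
    conv_eq_zero E.bracket 2 (vanishBelow_one hf0) hκ (by omega)] at h
  exact neg_eq_zero.1 h

/-- A word whose letters are homogeneous cycles. -/
def IsCycleWord (D : DGLieAlgebra K V) (l : Word V) : Prop :=
  ∀ x ∈ l, x.2 ∈ D.deg (x.1 + 1) ∧ D.d x.2 = 0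

/-- The action of the Euler coderivation on the classes of closed cochains. -/
theorem weight_formula {n : ℕ} {k : ℤ} {c : Word V → W} (hc : IsCochain D E k c)
    (hv : VanishBelow n c) (hcl : ClosedAt D n c) {l : Word V} (hl : l.length = n)
    (hcyc : IsCycleWord D l) :
    eulerMap E (c (mapWord X.r l)) - comp K 0 c X.F (mapWord X.r l) =
      ((k - n : ℤ) : K) • c (mapWord X.r l) := by
  obtain ⟨a, ha, ha'⟩ := IsCochain.exists_linear (k := 0) X.F_cochain
  rw [comp_leading_left (G := unary D a) 0 hc.lin hv
    (vanishBelow_two (by simp [X.F_nil, unary]) (fun x => by simp [ha'])) (by simpa using hl),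
    comp_unary hc ha]
  have hd : ∀ x ∈ mapWord X.r l, D.d x.2 = 0 := by
    intro x hx
    simp only [mapWord, List.mem_map] at hx
    obtain ⟨y, hy, rfl⟩ := hx
    simp [← X.r_d, (hcyc y hy).2]
  -- The value has degree `k + weight`, while the degrees of the `n` letters add up to `weight + n`,
  -- a label `s` standing for degree `s + 1`. The difference is `k - n`.
  rw [hcl.der_euler hc.lin a (by simpa using hl) hd, eulerMap_apply E (hc.mem _), ← sub_smul]
  · congr 1
    push_cast
    ring
  · intro x hx
    simp only [mapWord, List.mem_map] at hx
    obtain ⟨y, hy, rfl⟩ := hx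
    obtain ⟨hy1, hy2⟩ := hcyc y hy
    have hry : X.r y.2 ∈ D.deg (y.1 + 1) := by simpa using X.r_graded _ _ hy1
    have hay : a (X.r y.2) = X.F [(y.1, X.r y.2)] := by
      rw [ha', unary_single, D.proj_same hry]
    have hday : D.d (a (X.r y.2)) = 0 := by
      have h := X.F_comm [y]
      rw [mapWord_cons, mapWord_nil, comp_leading_right (r := 1) 1 X.F_cochain.lin
        vanishBelow_codiff rfl, comp_leading_right (r := 1) 0 isCochain_codiff.lin
        (vanishBelow_one X.F_nil) rfl, codiff_single, codiff_single, D.proj_same hry,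
        ← X.r_d, hy2, map_zero, neg_zero, ← hay, D.proj_same] at h
      · have h0 := X.F_cochain.lin.map_zero [] (1 + Word.weight [(y.1, X.r y.2)]) []
        rw [List.nil_append] at h0
        rw [h0] at h
        exact neg_eq_zero.1 h.symm
      · simpa using ha _ _ hry
    obtain ⟨w, hw⟩ := X.exists_boundary
      (z := a (X.r y.2) - ((y.1 + 1 : ℤ) : K) • X.r y.2)
      (by rw [map_sub, map_smul, hday, ← X.r_d, hy2]; simp)
      (by rw [map_sub, map_smul, hay, X.F_single _ _ hy1 hy2, X.p_r _ hy2, sub_self])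
    exact ⟨w, by rw [← hw]; simp⟩

/-- Representatives of cohomology classes. -/
theorem isCycleWord_rep (l : Word V) :
    IsCycleWord D ((mapWord (fun x => X.i (X.p x)) l).map
      fun x => (x.1, D.proj (x.1 + 1) x.2)) := by
  intro x hx
  simp only [mapWord, List.map_map, List.mem_map, Function.comp_apply] at hx
  obtain ⟨y, _, rfl⟩ := hx
  refine ⟨D.proj_mem _ _, ?_⟩
  simp only [← D.proj_d, X.d_i, map_zero]

/-- On two cycles the curvature is, up to sign, `p [x, y] - [p x, p y]`. Arity two needs this
separate argument since the weight `2 - n` is zero there. -/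
theorem curv_apply_pair [CharZero K] {f : Word V → W} (hf : IsCochain D E 1 f)
    (hf0 : f [] = 0) (hf1 : ∀ x, f [x] = unary D X.p [x]) {x y : ℤ × V}
    (hx : x.2 ∈ D.deg (x.1 + 1)) (hdx : D.d x.2 = 0) (hy : y.2 ∈ D.deg (y.1 + 1))
    (hdy : D.d y.2 = 0) : curv D E f [x, y] = 0 := by
  have hz : ∀ p s q, f (p ++ (s, 0) :: q) = 0 := fun p s q => hf.lin.map_zero p s q
  have hz1 := hz [y] (1 + x.1) []
  have hz2 := hz [x] (1 + y.1) []
  have hz3 := hz [x, y] 1 []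
  simp only [List.cons_append, List.nil_append] at hz1 hz2 hz3
  have hQx : codiff D [x] = 0 := by rw [codiff_single, D.proj_same hx, hdx, neg_zero]
  have hQy : codiff D [y] = 0 := by rw [codiff_single, D.proj_same hy, hdy, neg_zero]
  have hfx : f [x] = X.p x.2 := by rw [hf1, unary_single, D.proj_same hx]
  have hfy : f [y] = X.p y.2 := by rw [hf1, unary_single, D.proj_same hy]
  have h1 : comp K 1 f (codiff D) [x, y] = f [(1 + x.1 + y.1, codiff D [x, y])] := by
    simp only [comp, contr, hQx, hQy, codiff_nil, hz1, hz2, hz3]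
    simp
  have h2 : conv E.bracket 1 f f [x, y] =
      sgn K x.1 • E.bracket (X.p x.2) (X.p y.2) +
        sgn K ((1 + x.1) * y.1) • E.bracket (X.p y.2) (X.p x.2) := by
    simp only [conv, contr, hf0, hfx, hfy]
    simp
  have hpx : X.p x.2 ∈ E.deg (x.1 + 1) := by simpa using X.p_graded _ _ hx
  have hpy : X.p y.2 ∈ E.deg (y.1 + 1) := by simpa using X.p_graded _ _ hy
  rw [curv, Pi.add_apply, Pi.smul_apply, h1, h2, apply_single hf1
      (isCochain_codiff.mem [x, y]) (by simp; ring), codiff_pair, D.proj_same hx,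
    D.proj_same hy, map_smul, X.p_bracket _ _ hdx hdy, E.bracket_skew hpy hpx,
    units_smul_eq_sgn K, show (y.1 + 1) * (x.1 + 1) = x.1 * y.1 + y.1 + x.1 + 1 by ring]
  simp only [add_mul, one_mul, sgn_add, sgn_one]
  match_scalars
  rcases sgn_eq_or K y.1 with h | h <;> rcases sgn_eq_or K (x.1 * y.1) with h' | h' <;>
    rw [h, h'] <;> ring

/-- The curvature in the lowest arity vanishes on representatives of cohomology classes. -/
theorem curv_apply_rep [CharZero K] {n : ℕ} (hn : 2 ≤ n) {f s : Word V → W}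
    (hf : IsCochain D E 1 f) (hf0 : f [] = 0) (hf1 : ∀ x, f [x] = unary D X.p [x])
    (hs : IsCochain D E 0 s) (hs0 : s [] = 0) (hκ : VanishBelow n (curv D E f))
    (hυ : VanishBelow n (pull X.r (X.defect f s))) {l : Word V} (hl : l.length = n) :
    curv D E f (mapWord (fun x => X.i (X.p x)) l) = 0 := by
  rw [hf.curv.apply_proj]
  have hcyc := X.isCycleWord_rep l
  have hm : ((mapWord (fun x => X.i (X.p x)) l).map
      fun x => (x.1, D.proj (x.1 + 1) x.2)).length = n := by simpa using hl
  generalize (mapWord (fun x => X.i (X.p x)) l).map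
      (fun x => (x.1, D.proj (x.1 + 1) x.2)) = m at hcyc hm
  rcases Nat.lt_or_ge 2 n with h3 | h3
  · have hcl := closedAt_curv hf hf0 hκ
    -- Closedness allows each cycle to be replaced by its image under `r`, which is cohomologous to
    -- it and lies where the Euler identity is available.
    rw [hcl.congr hf.curv.lin hm (fun x hx => (hcyc x hx).2) X.r
      (fun x hx => by rw [← X.r_d, (hcyc x hx).2, map_zero])]
    · have h1 := X.euler_curv_leading hf hf0 hs hs0 hκ hυ hm
      rw [X.weight_formula hf.curv hκ hcl hm hcyc,
        der_eq_zero_of_forall 1 D.d ((X.isCochain_defect hf hs).pull X.r_graded).lin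
          (fun x hx => (hcyc x hx).2), neg_zero] at h1
      -- The defect is differentiated along cycles only and contributes zero, so `(2 - n) κ = 0`
      -- with `n > 2`.
      refine (smul_eq_zero.1 h1).resolve_left ?_
      exact Int.cast_ne_zero.2 (by omega)
    · intro x hx
      obtain ⟨y, hy⟩ := X.exists_boundary (z := x.2 - X.r x.2)
        (by rw [map_sub, ← X.r_d, (hcyc x hx).2]; simp)
        (by rw [map_sub, X.p_r _ (hcyc x hx).2, sub_self])
      exact ⟨y, by rw [← hy]; simp⟩
  · obtain rfl : n = 2 := by omega
    match m with
    | [x, y] =>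
      have h1 := hcyc x (by simp)
      have h2 := hcyc y (by simp)
      exact X.curv_apply_pair hf hf0 hf1 h1.1 h1.2 h2.1 h2.2
    | [] => simp at hm
    | [_] => simp at hm
    | _ :: _ :: _ :: _ => simp at hm

theorem defect_add (f g s : Word V → W) : X.defect (f + g) s = X.defect f s +
    ((fun l => eulerMap E (g l)) - comp K 0 g X.F + conv E.bracket 0 g s) := by
  funext l
  simp only [defect, comp_add_left, conv_add_left, Pi.add_apply, Pi.sub_apply, map_add]
  abel

/-- Correction of the homotopy. -/
theorem exists_homotopy_step [CharZero K] {n : ℕ} (hn : 1 ≤ n) {f s : Word V → W}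
    (hf : IsCochain D E 1 f) (hf0 : f [] = 0) (hs : IsCochain D E 0 s) (hs0 : s [] = 0)
    (hκ : VanishBelow (n + 1) (curv D E f)) (hυ : VanishBelow n (pull X.r (X.defect f s)))
    (hrep : ∀ l : Word V, l.length = n →
      X.defect f s (mapWord X.r (mapWord (fun x => X.i (X.p x)) l)) = 0) :
    ∃ s', IsCochain D E 0 s' ∧ s' [] = 0 ∧
      VanishBelow (n + 1) (pull X.r (X.defect f s')) := by
  have hd := X.isCochain_defect hf hs
  -- The curvature vanishes up to and including arity `n`, so the leading Euler identity says that
  -- the derivative of the defect is zero.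
  have hcl : ClosedAt D n (pull X.r (X.defect f s)) := by
    intro l hl
    have h := X.euler_curv_leading hf hf0 hs hs0 (hκ.mono (by omega)) hυ hl
    rw [hκ _ (by simp; omega), comp_eq_zero 0 hf.curv.lin hκ (vanishBelow_one X.F_nil)
      (by simp; omega), map_zero, sub_zero] at h
    exact neg_eq_zero.1 h.symm
  obtain ⟨t, ht, htn, htd⟩ := exists_primitive X.toContraction (hd.pull X.r_graded) hcl hrep
  have htv : VanishBelow n t := fun l hl => htn l (by omega)
  refine ⟨s - t, hs.sub (by simpa using ht), by simp [hs0, htv [] (by simp; omega)], ?_⟩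
  intro l hl
  have ht' : IsCochain D E 0 t := by simpa using ht
  have h1 : X.defect f (s - t) = X.defect f s +
      (comp K 1 t (codiff D) - conv E.bracket 0 f t) := by
    simp only [defect, comp_sub_left, conv_sub_right]
    abel
  rw [pull_apply, h1, Pi.add_apply, Pi.sub_apply, conv_eq_zero E.bracket 0 (vanishBelow_one hf0)
    htv (by simp; omega), sub_zero]
  rcases Nat.lt_or_ge l.length n with h | h
  · rw [comp_eq_zero 1 ht.lin htv vanishBelow_codiff (by simp; omega), add_zero]
    exact hυ l h
  -- In arity `n`, replacing `s` by `s - t` adds `-δ t` to the defect, and on words from the image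
  -- of `r` this cancels it, as `r` is idempotent.
  · have hl' : l.length = n := by omega
    rw [comp_codiff_leading ht' htv (by simpa using hl'), htd _ (by simpa using hl'), pull_apply,
      mapWord_mapWord]
    simp [X.r_r]

/-- The arity-wise extension step. -/
theorem exists_step [CharZero K] {n : ℕ} (hn : 2 ≤ n) {f s : Word V → W}
    (hf : IsCochain D E 1 f) (hf0 : f [] = 0) (hf1 : ∀ x, f [x] = unary D X.p [x])
    (hs : IsCochain D E 0 s) (hs0 : s [] = 0) (hκ : VanishBelow n (curv D E f))
    (hυ : VanishBelow n (pull X.r (X.defect f s))) :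
    ∃ f' s', IsCochain D E 1 f' ∧ f' [] = 0 ∧ (∀ x, f' [x] = unary D X.p [x]) ∧
      IsCochain D E 0 s' ∧ s' [] = 0 ∧ VanishBelow (n + 1) (curv D E f') ∧
      VanishBelow (n + 1) (pull X.r (X.defect f' s')) ∧
      ∀ l : Word V, l.length < n → f' l = f l := by
  -- adding a cochain of arity `n` does not change the defect in lower arity
  have hadd : ∀ {f g : Word V → W}, IsCochain D E 1 g → VanishBelow n g →
      VanishBelow n (pull X.r (X.defect f s)) →
      VanishBelow n (pull X.r (X.defect (f + g) s)) := by
    intro f g hg hgv hv l hl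
    have h1 := hv l hl
    rw [pull_apply] at h1
    rw [pull_apply, X.defect_add, Pi.add_apply, h1, Pi.add_apply, Pi.sub_apply,
      hgv _ (by simpa using hl),
      comp_eq_zero 0 hg.lin hgv (vanishBelow_one X.F_nil) (by simp; omega),
      conv_eq_zero E.bracket 0 hgv (vanishBelow_one hs0) (by simp; omega)]
    simp
  -- Adding `g` changes the curvature in arity `n` by `-δ g`, hence kills it there.
  obtain ⟨g, hg, hgn, hgd⟩ := exists_primitive X.toContraction hf.curv
    (closedAt_curv hf hf0 hκ) (fun l hl => X.curv_apply_rep hn hf hf0 hf1 hs hs0 hκ hυ hl)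
  replace hg : IsCochain D E 1 g := by simpa using hg
  have hgv : VanishBelow n g := fun l hl => hgn l (by omega)
  have hf' := hf.add hg
  have hf'0 : (f + g) [] = 0 := by simp [hf0, hgv [] (by simp; omega)]
  have hκ' : VanishBelow (n + 1) (curv D E (f + g)) := by
    intro l hl
    rcases Nat.lt_or_ge l.length n with h | h
    · rw [curv_add_of_lt (by omega) hf0 hg hgv h]
      exact hκ l h
    · have hl' : l.length = n := by omega
      rw [curv_add (by omega) hf0 hgv hl'.le, comp_codiff_leading hg hgv hl', hgd l hl',
        add_neg_cancel]
  have hυ' := hadd hg hgv hυ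
  -- correction of the class of the defect
  set π : V →ₗ[K] V := X.i ∘ₗ X.p with hπ
  have hπg : IsGraded D D 0 π := fun i x hx => by
    have := X.i_graded _ _ (X.p_graded _ _ hx)
    rwa [add_zero] at this
  have hd' := X.isCochain_defect hf' hs
  set c₀ := pull π (pull X.r (X.defect (f + g) s)) with hc₀
  have hc₀c : IsCochain D E 1 c₀ := (hd'.pull X.r_graded).pull hπg
  -- By `weight_formula` with `k = 1`, adding a closed `c` changes the defect on representatives by
  -- `(1 - n) c`, which dictates the factor. Pulling back along `i p` makes `c` closed, so the
  -- curvature in arity `n` is not disturbed.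
  set c := ((n - 1 : ℤ) : K)⁻¹ • arityPart n c₀ with hcdef
  have hc : IsCochain D E 1 c := (hc₀c.arityPart n).smul _
  have hcv : VanishBelow n c := fun l hl => by
    rw [hcdef, Pi.smul_apply, vanishBelow_arityPart n c₀ l hl, smul_zero]
  have hccl : ClosedAt D n c := by
    intro l hl
    rw [hcdef, der_smul, Pi.smul_apply,
      der_congr (n := n) 1 D.d (g := c₀) (fun m hm => arityPart_of_eq _ hm) hl, hc₀,
      der_pull 1 D.d D.d π (fun x => by simp [π, X.p_d, X.d_i]),
      der_eq_zero_of_forall 1 D.d (hd'.pull X.r_graded).lin, smul_zero]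
    intro x hx
    simp only [mapWord, List.mem_map] at hx
    obtain ⟨y, _, rfl⟩ := hx
    exact X.d_i _
  have hf'' := hf'.add hc
  have hf''0 : (f + g + c) [] = 0 := by
    rw [Pi.add_apply, hf'0, hcv [] (by simp; omega), add_zero]
  have hκ'' : VanishBelow (n + 1) (curv D E (f + g + c)) := by
    intro l hl
    rcases Nat.lt_or_ge l.length n with h | h
    · rw [curv_add_of_lt (by omega) hf'0 hc hcv h]
      exact hκ' l (by omega)
    · have hl' : l.length = n := by omega
      rw [curv_add (by omega) hf'0 hcv hl'.le, comp_codiff_leading hc hcv hl', hccl l hl',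
        hκ' l hl, neg_zero, add_zero]
  have hυ'' := hadd hc hcv hυ'
  have hrep : ∀ l : Word V, l.length = n →
      X.defect (f + g + c) s (mapWord X.r (mapWord (fun x => X.i (X.p x)) l)) = 0 := by
    intro l hl
    have hd'' := (X.isCochain_defect hf'' hs).pull X.r_graded
    rw [← pull_apply X.r (X.defect (f + g + c) s), hd''.apply_proj]
    have hcyc := X.isCycleWord_rep l
    have hm : ((mapWord (fun x => X.i (X.p x)) l).map
      fun x => (x.1, D.proj (x.1 + 1) x.2)).length = n := by simpa using hl
    -- Representatives are fixed by `i p r`: they are cycles, so `p r = p` on them, and `p i = 1`.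
    have hπm : mapWord (fun x => π (X.r x)) ((mapWord (fun x => X.i (X.p x)) l).map
        fun x => (x.1, D.proj (x.1 + 1) x.2)) = ((mapWord (fun x => X.i (X.p x)) l).map
        fun x => (x.1, D.proj (x.1 + 1) x.2)) := by
      simp only [mapWord, List.map_map]
      refine List.map_congr_left fun x _ => ?_
      simp only [Function.comp_apply]
      congr 1
      have h1 := X.i_graded.proj (x.1 + 1) (X.p x.2)
      rw [add_zero] at h1
      rw [h1]
      change X.i (X.p (X.r _)) = _
      rw [X.p_r _ (X.d_i _), X.p_i]
    generalize (mapWord (fun x => X.i (X.p x)) l).map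
      (fun x => (x.1, D.proj (x.1 + 1) x.2)) = m at hcyc hm hπm
    have hcm : c (mapWord X.r m) =
        ((n - 1 : ℤ) : K)⁻¹ • X.defect (f + g) s (mapWord X.r m) := by
      rw [hcdef, Pi.smul_apply, arityPart_of_eq _ (by simpa using hm), hc₀, pull_apply,
        mapWord_mapWord, hπm]
      rfl
    rw [pull_apply, X.defect_add, Pi.add_apply, Pi.add_apply, Pi.sub_apply,
      conv_eq_zero E.bracket 0 hcv (vanishBelow_one hs0) (by simp; omega), add_zero,
      X.weight_formula hc hcv hccl hm hcyc, hcm, smul_smul]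
    have h1 : ((1 - n : ℤ) : K) * ((n - 1 : ℤ) : K)⁻¹ = -1 := by
      have : ((n - 1 : ℤ) : K) ≠ 0 := Int.cast_ne_zero.2 (by omega)
      field_simp
      push_cast
      ring
    rw [h1, neg_one_smul, add_neg_cancel]
  obtain ⟨s', hs', hs'0, hυs⟩ := X.exists_homotopy_step (by omega) hf'' hf''0 hs hs0 hκ'' hυ''
    hrep
  refine ⟨f + g + c, s', hf'', hf''0, fun x => ?_, hs', hs'0, hκ'', hυs, fun l hl => ?_⟩
  · rw [Pi.add_apply, Pi.add_apply, hgv [x] (by simp; omega), hcv [x] (by simp; omega), add_zero,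
      add_zero, hf1]
  · rw [Pi.add_apply, Pi.add_apply, hgv l hl, hcv l hl, add_zero, add_zero]

/-- An Euler coderivation on a quasi-isomorphic subalgebra gives a Maurer-Cartan cochain with
values in the cohomology. -/
theorem exists_maurerCartan [CharZero K] : ∃ f : Word V → W, IsCochain D E 1 f ∧ f [] = 0 ∧
    (∀ x, f [x] = unary D X.p [x]) ∧ curv D E f = 0 := by
  have hu : IsCochain D E 1 (unary D X.p) := isCochain_unary (e := 0) X.p_graded
  have hκ : VanishBelow 2 (curv D E (unary D X.p)) := by
    refine vanishBelow_two ?_ fun x => ?_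
    · rw [curv, Pi.add_apply, Pi.smul_apply,
        comp_eq_zero_of_right 1 hu.lin vanishBelow_codiff (by simp),
        conv_eq_zero E.bracket 1 (vanishBelow_one (unary_nil D X.p))
          (vanishBelow_one (unary_nil D X.p)) (by simp)]
      simp
    · rw [curv, Pi.add_apply, Pi.smul_apply,
        comp_leading_right 1 hu.lin vanishBelow_codiff (by simp),
        conv_eq_zero E.bracket 1 (vanishBelow_one (unary_nil D X.p))
          (vanishBelow_one (unary_nil D X.p)) (by simp), apply_single (fun _ => rfl)
          (isCochain_codiff.mem [x]) (by ring), codiff_single, map_neg, X.p_d]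
      simp
  have h0 : IsCochain D E 0 (0 : Word V → W) := IsCochain.zero
  -- The weight `1 - n` is zero in arity one, so no rescaling could help; there the defect of the
  -- linear cochain vanishes on representatives by `F_single`, and only the homotopy has to be
  -- adjusted.
  obtain ⟨s₀, hs₀, hs₀0, hυ₀⟩ := X.exists_homotopy_step le_rfl hu (unary_nil D X.p) h0 rfl hκ
    (by
      refine vanishBelow_one ?_
      rw [pull_apply, defect, comp_zero_left]
      simp only [mapWord_nil, Pi.sub_apply, comp, X.F_nil, conv, unary_nil]
      simp [unary])
    (by
      intro l hl
      match l with
      | [x] =>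
        have hz : X.r (X.i (X.p (D.proj (x.1 + 1) x.2))) ∈ D.deg (x.1 + 1) := by
          simpa using X.r_graded _ _ (X.i_graded _ _ (X.p_graded _ _ (D.proj_mem (x.1 + 1) x.2)))
        have hz' : X.i (X.p (D.proj (x.1 + 1) x.2)) ∈ D.deg (x.1 + 1) := by
          simpa using X.i_graded _ _ (X.p_graded _ _ (D.proj_mem (x.1 + 1) x.2))
        have hπr : IsGraded D D 0 (X.r ∘ₗ X.i ∘ₗ X.p) := fun i x hx => by
          simpa using X.r_graded _ _ (X.i_graded _ _ (X.p_graded _ _ hx))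
        have h1 := (X.isCochain_defect hu h0).pull hπr
        have h2 : ∀ y, X.defect (unary D X.p) 0
            (mapWord X.r (mapWord (fun x => X.i (X.p x)) [y])) =
            pull (X.r ∘ₗ X.i ∘ₗ X.p) (X.defect (unary D X.p) 0) [y] := fun _ => rfl
        rw [h2, h1.apply_proj]
        simp only [List.map_cons, List.map_nil, pull_apply, mapWord_cons, mapWord_nil,
          LinearMap.comp_apply]
        simp only [defect, comp_zero_left, Pi.sub_apply, zero_sub, Pi.neg_apply,
          sub_neg_eq_add]
        rw [comp_leading_right 0 hu.lin (vanishBelow_one X.F_nil) (by simp),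
          conv_eq_zero (m := 1) (r := 1) (g := 0) E.bracket 0 (vanishBelow_one (unary_nil D X.p))
            (fun _ _ => rfl) (by simp), add_zero, apply_single (fun _ => rfl)
            (X.F_cochain.mem _) (by ring), X.F_single _ _ hz' (X.d_i _), unary_single,
          D.proj_same hz, X.p_r _ (X.d_i _), X.p_i,
          eulerMap_apply E (i := x.1 + 1) (by simpa using X.p_graded _ _ (D.proj_mem (x.1 + 1) x.2)),
          sub_self]
      | [] => simp at hl
      | _ :: _ :: _ => simp at hl)
  -- Stage `n` controls the arities below `n + 2`, since the induction starts with the linear part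
  -- known.
  obtain ⟨t, ht⟩ := exists_seq_of_step
    (P := fun n (q : (Word V → W) × (Word V → W)) => IsCochain D E 1 q.1 ∧ q.1 [] = 0 ∧
      (∀ x, q.1 [x] = unary D X.p [x]) ∧ IsCochain D E 0 q.2 ∧ q.2 [] = 0 ∧
      VanishBelow (n + 2) (curv D E q.1) ∧ VanishBelow (n + 2) (pull X.r (X.defect q.1 q.2)))
    (R := fun n q q' => ∀ l : Word V, l.length ≤ n + 1 → q'.1 l = q.1 l)
    ⟨(unary D X.p, s₀), hu, unary_nil D X.p, fun _ => rfl, hs₀, hs₀0, hκ, hυ₀⟩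
    (fun n q ⟨h1, h2, h3, h4, h5, h6, h7⟩ => by
      obtain ⟨f', s', a1, a2, a3, a4, a5, a6, a7, a8⟩ :=
        X.exists_step (by omega) h1 h2 h3 h4 h5 h6 h7
      exact ⟨(f', s'), ⟨a1, a2, a3, a4, a5, a6, a7⟩, fun l hl => a8 l (by omega)⟩)
  have hstab : ∀ n m, n ≤ m → ∀ l : Word V, l.length ≤ n + 1 → (t m).1 l = (t n).1 l := by
    intro n m hnm
    induction m, hnm using Nat.le_induction with
    | base => exact fun _ _ => rfl
    | succ m hm ih => exact fun l hl => ((ht m).2 l (by omega)).trans (ih l hl)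
  set f : Word V → W := fun l => (t l.length).1 l with hfdef
  have hf : IsCochain D E 1 f := IsCochain.diag (F := fun n => (t n).1) fun n => (ht n).1.1
  have hft : ∀ n, ∀ l : Word V, l.length ≤ n → f l = (t n).1 l :=
    fun n l hl => (hstab _ _ hl l (by omega)).symm
  refine ⟨f, hf, (ht 0).1.2.1, fun x => (ht 1).1.2.2.1 x, ?_⟩
  funext l
  rw [curv, Pi.add_apply, Pi.smul_apply,
    comp_congr_left 1 (hf.sub (ht l.length).1.1).lin (hft l.length) codiff_nil le_rfl,
    conv_congr E.bracket 1 (hft l.length) (hft l.length) le_rfl]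
  exact (ht l.length).1.2.2.2.2.2.1 l (by omega)

end EulerData

end Formality

/-! ## Sums over unshuffles -/

section Subwords

variable {α : Type u}

/-- The subword with positions in `A`. -/
def subword {n : ℕ} (y : Fin n → α) (A : Finset (Fin n)) : List α := A.sort.map y

theorem ofFn_subseq {n : ℕ} (y : Fin n → α) (A : Finset (Fin n)) :
    List.ofFn (subseq y A) = subword y A := by
  rw [subword, ← A.listMap_orderEmbOfFin_finRange rfl, List.map_map, List.ofFn_eq_map]
  rfl

theorem subword_map_succ {n : ℕ} (y : Fin (n + 1) → α) (A : Finset (Fin n)) :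
    subword y (A.map (Fin.succEmb n)) = subword (Fin.tail y) A := by
  have h : (A.map (Fin.succEmb n)).sort = A.sort.map Fin.succ := by
    have := Finset.map_sort (r := (· ≤ ·)) (r' := (· ≤ ·)) (Fin.succEmb n) A (by simp)
    simpa using this.symm
  rw [subword, h, List.map_map]
  rfl

theorem subword_insert_zero {n : ℕ} (y : Fin (n + 1) → α) (A : Finset (Fin n)) :
    subword y (insert 0 (A.map (Fin.succEmb n))) = y 0 :: subword (Fin.tail y) A := by
  rw [← subword_map_succ, subword, Finset.sort_insert, List.map_cons, subword]
  · exact fun b _ => Fin.zero_le b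
  · simp [Fin.succ_ne_zero]

theorem subword_pair {n : ℕ} (y : Fin n → α) {i j : Fin n} (h : i < j) :
    subword y {i, j} = [y i, y j] := by
  rw [subword, Finset.sort_insert, Finset.sort_singleton]
  · rfl
  · intro b hb
    rw [Finset.mem_singleton] at hb
    exact hb ▸ h.le
  · simpa using h.ne

theorem length_subword {n : ℕ} (y : Fin n → α) (A : Finset (Fin n)) :
    (subword y A).length = A.card := by simp [subword]

theorem compl_map_succ {n : ℕ} (A : Finset (Fin n)) :
    (A.map (Fin.succEmb n))ᶜ = insert 0 (Aᶜ.map (Fin.succEmb n)) := by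
  ext i
  cases i using Fin.cases <;> simp

theorem compl_insert_zero {n : ℕ} (A : Finset (Fin n)) :
    (insert 0 (A.map (Fin.succEmb n)))ᶜ = Aᶜ.map (Fin.succEmb n) := by
  rw [← compl_compl A, ← compl_map_succ, compl_compl, compl_compl]

/-- Subsets are sorted by whether they contain `0`, that is, by which factor receives the first
letter; this matches the two terms of the recursions for `conv` and `comp`. -/
theorem sum_finset_fin_succ {M : Type u} [AddCommMonoid M] {n : ℕ}
    (φ : Finset (Fin (n + 1)) → M) :
    ∑ A, φ A = ∑ A : Finset (Fin n), φ (insert 0 (A.map (Fin.succEmb n))) +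
      ∑ A : Finset (Fin n), φ (A.map (Fin.succEmb n)) := by
  have h0 : (0 : Fin (n + 1)) ∉ (Finset.univ : Finset (Fin n)).map (Fin.succEmb n) := by simp
  have hu : (Finset.univ : Finset (Fin (n + 1))) = insert 0 (Finset.univ.map (Fin.succEmb n)) := by
    ext i
    cases i using Fin.cases <;> simp
  have hs : ∀ ψ : Finset (Fin (n + 1)) → M,
      ∑ A ∈ (Finset.univ.map (Fin.succEmb n)).powerset, ψ A =
        ∑ A : Finset (Fin n), ψ (A.map (Fin.succEmb n)) := by
    intro ψ
    refine (Finset.sum_nbij (fun A : Finset (Fin n) => A.map (Fin.succEmb n)) ?_ ?_ ?_ fun _ _ => rfl).symm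
    · intro A _
      simp
    · intro A _ B _ h
      exact Finset.map_injective _ h
    · intro A hA
      obtain ⟨B, _, rfl⟩ := Finset.subset_map_iff.1 (Finset.mem_powerset.1 hA)
      exact ⟨B, by simp, rfl⟩
  rw [← Finset.powerset_univ, hu, Finset.sum_powerset_insert h0, hs, hs, add_comm]

theorem unshuffleSign_insert_zero {n : ℕ} (s : Fin (n + 1) → ℤ) (A : Finset (Fin n)) :
    unshuffleSign s (insert 0 (A.map (Fin.succEmb n))) = unshuffleSign (Fin.tail s) A := by
  unfold unshuffleSign
  rw [Finset.prod_filter, Finset.prod_filter, Fintype.prod_prod_type, Fintype.prod_prod_type,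
    Fin.prod_univ_succ]
  simp [Fin.prod_univ_succ, Fin.tail, Fin.succ_ne_zero]

/-- When `0` is not selected, every selected letter jumps over it, whence the extra factor; when it
is selected, as in the preceding lemma, nothing jumps over it. -/
theorem unshuffleSign_map_succ {n : ℕ} (s : Fin (n + 1) → ℤ) (A : Finset (Fin n)) :
    unshuffleSign s (A.map (Fin.succEmb n)) =
      (s 0 * ∑ j ∈ A, Fin.tail s j).negOnePow * unshuffleSign (Fin.tail s) A := by
  unfold unshuffleSign
  have h : (s 0 * ∑ j ∈ A, Fin.tail s j).negOnePow =
      ∏ j ∈ A, (Fin.tail s j * s 0).negOnePow := by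
    induction A using Finset.induction_on with
    | empty => simp
    | insert a A ha ih =>
      rw [Finset.sum_insert ha, Finset.prod_insert ha, mul_add, Int.negOnePow_add, ih, mul_comm (s 0)]
  rw [h, Finset.prod_filter, Finset.prod_filter, Fintype.prod_prod_type, Fintype.prod_prod_type,
    Fin.prod_univ_succ]
  have h0 : ∏ x : Fin n, (if x ∈ A then (Fin.tail s x * s 0).negOnePow else 1) =
      ∏ j ∈ A, (Fin.tail s j * s 0).negOnePow := by
    rw [Finset.prod_ite_mem, Finset.univ_inter]
  rw [← h0, ← Finset.prod_mul_distrib]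
  simp only [Fin.prod_univ_succ]
  simp [Fin.tail, Fin.succ_ne_zero]

end Subwords

section Formulas

variable {K : Type v} [Field K] {V W : Type u} [AddCommGroup V] [Module K V]
  [AddCommGroup W] [Module K W]

theorem units_smul_eq {M : Type u} [AddCommGroup M] [Module K M] (ε : ℤˣ) (x : M) :
    ε • x = ((ε : ℤ) : K) • x := by
  rw [Units.smul_def, Int.cast_smul_eq_zsmul]

/-- The convolution product as a sum over unshuffles. -/
theorem conv_ofFn (B : W →ₗ[K] W →ₗ[K] W) {n : ℕ} (k : ℤ) (f g : Word V → W)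
    (y : Fin n → ℤ × V) :
    conv B k f g (List.ofFn y) = ∑ A : Finset (Fin n), unshuffleSign (fun j => (y j).1) A •
      (k * ∑ j ∈ A, (y j).1).negOnePow • B (f (subword y A)) (g (subword y Aᶜ)) := by
  induction n generalizing k f g with
  | zero =>
    rw [Fintype.sum_eq_single ∅ (fun A h => absurd (Subsingleton.elim A ∅) h)]
    simp [conv, subword, unshuffleSign]
  | succ n ih =>
    have ht : ∀ j, (y (Fin.succ j)).1 = (Fin.tail y j).1 := fun _ => rfl
    have hs : (Fin.tail fun j => (y j).1) = fun j => (Fin.tail y j).1 := rfl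
    rw [List.ofFn_succ, conv, sum_finset_fin_succ]
    change _ • conv B k _ _ (List.ofFn (Fin.tail y)) + conv B _ _ _ (List.ofFn (Fin.tail y)) = _
    rw [ih, ih, Finset.smul_sum]
    congr 1
    · refine Finset.sum_congr rfl fun A _ => ?_
      rw [subword_insert_zero, compl_insert_zero, subword_map_succ, unshuffleSign_insert_zero, hs,
        Finset.sum_insert (by simp [Fin.succ_ne_zero]), Finset.sum_map, mul_add,
        Int.negOnePow_add, ← units_smul_eq_sgn, contr_apply, mul_smul, smul_comm]
      rfl
    · refine Finset.sum_congr rfl fun A _ => ?_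
      rw [compl_map_succ, subword_insert_zero, subword_map_succ, unshuffleSign_map_succ, hs,
        Finset.sum_map, add_mul, Int.negOnePow_add, contr_apply]
      simp only [smul_smul]
      have h : ∀ a b c : ℤˣ, a * (b * c) = c * a * b := fun a b c => by
        rw [mul_comm c, mul_assoc, mul_comm b]
      congr 1
      exact h _ _ _

/-- The composition with a coderivation as a sum over unshuffles. -/
theorem comp_ofFn {n : ℕ} (e : ℤ) {f : Word V → W} (hf : IsSymm K f) (F : Word V → V)
    (y : Fin n → ℤ × V) :
    comp K e f F (List.ofFn y) = ∑ A : Finset (Fin n), unshuffleSign (fun j => (y j).1) A •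
      f ((e + ∑ j ∈ A, (y j).1, F (subword y A)) :: subword y Aᶜ) := by
  induction n generalizing e f F with
  | zero =>
    rw [Fintype.sum_eq_single ∅ (fun A h => absurd (Subsingleton.elim A ∅) h)]
    simp [comp, subword, unshuffleSign]
  | succ n ih =>
    have hs : (Fin.tail fun j => (y j).1) = fun j => (Fin.tail y j).1 := rfl
    rw [List.ofFn_succ, comp, sum_finset_fin_succ]
    change comp K _ _ _ (List.ofFn (Fin.tail y)) + _ • comp K _ _ _ (List.ofFn (Fin.tail y)) = _
    rw [ih _ hf, ih _ (hf.contr _), Finset.smul_sum]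
    congr 1
    · refine Finset.sum_congr rfl fun A _ => ?_
      rw [subword_insert_zero, compl_insert_zero, subword_map_succ, unshuffleSign_insert_zero, hs,
        Finset.sum_insert (by simp [Fin.succ_ne_zero]), Finset.sum_map, contr_apply, ← add_assoc]
      rfl
    · refine Finset.sum_congr rfl fun A _ => ?_
      rw [compl_map_succ, subword_insert_zero, subword_map_succ, unshuffleSign_map_succ, hs,
        Finset.sum_map, contr_apply]
      have h := hf [] (y 0) (e + ∑ j ∈ A, (Fin.tail y j).1, F (subword (Fin.tail y) A))
        (subword (Fin.tail y) Aᶜ)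
      simp only [List.nil_append] at h
      rw [h, mul_comm (Int.negOnePow _), mul_smul, units_smul_eq_sgn K (_ * _), mul_add, sgn_add,
        units_smul_eq (K := K), units_smul_eq (K := K)]
      simp only [← mul_smul]
      congr 1
      have h2 := sgn_mul_self K (e * (y 0).1)
      rw [mul_comm (y 0).1 e]
      change _ = _ * sgn K ((y 0).1 * ∑ j ∈ A, (Fin.tail y j).1)
      linear_combination
        ((unshuffleSign (fun j => (Fin.tail y j).1) A : ℤ) : K) *
          sgn K ((y 0).1 * ∑ j ∈ A, (Fin.tail y j).1) * h2

theorem der_ofFn {n : ℕ} (e : ℤ) (a : V → V) (f : Word V → W) (y : Fin n → ℤ × V) :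
    der K e a f (List.ofFn y) = ∑ j, (e * ∑ i ∈ Finset.Iio j, (y i).1).negOnePow •
      f (List.ofFn (Function.update y j ((y j).1 + e, a (y j).2))) := by
  induction n generalizing f with
  | zero => simp [der]
  | succ n ih =>
    rw [List.ofFn_succ, der, Fin.sum_univ_succ]
    change _ + _ • der K _ _ _ (List.ofFn (Fin.tail y)) = _
    rw [ih, Finset.smul_sum]
    congr 1
    · rw [List.ofFn_succ]
      have : (Finset.Iio (0 : Fin (n + 1))) = ∅ := by ext i; simp
      simp [this]
    · refine Finset.sum_congr rfl fun j _ => ?_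
      have hI : Finset.Iio j.succ = insert 0 ((Finset.Iio j).map (Fin.succEmb n)) := by
        ext i
        cases i using Fin.cases <;> simp
      rw [hI, Finset.sum_insert (by simp), Finset.sum_map, mul_add,
        Int.negOnePow_add, mul_smul, ← units_smul_eq_sgn, contr_apply, List.ofFn_succ]
      congr 3
      rw [List.cons.injEq]
      refine ⟨(Function.update_of_ne (Fin.succ_ne_zero j).symm _ _).symm, ?_⟩
      congr 1
      funext i
      by_cases h : i = j
      · subst h
        simp [Fin.tail]
      · simp [h, Fin.tail]

end Formulas

/-! ## Koszul signs -/

section Koszul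

/-- The contribution of a pair of positions to the Koszul sign. -/
def pairSign {n : ℕ} (s : Fin n → ℤ) (σ : Equiv.Perm (Fin n)) (p : Fin n × Fin n) : ℤˣ :=
  if σ p.2 < σ p.1 then (s (σ p.1) * s (σ p.2)).negOnePow else 1

theorem koszulSign_eq {n : ℕ} (s : Fin n → ℤ) (σ : Equiv.Perm (Fin n)) :
    koszulSign s σ = ∏ p : Fin n × Fin n with p.1 < p.2, pairSign s σ p := by
  rw [koszulSign, Finset.prod_filter, Finset.prod_filter]
  refine Finset.prod_congr rfl fun p _ => ?_
  unfold pairSign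
  by_cases h1 : p.1 < p.2 <;> by_cases h2 : σ p.2 < σ p.1 <;> simp [h1, h2]

/-- The product for `σ` is reindexed along `τ`, where `srt` puts the image of a pair back in
increasing order. A pair inverted by `τ` and again by `σ` contributes the same sign twice, hence
trivially. -/
theorem koszulSign_mul {n : ℕ} (s : Fin n → ℤ) (σ τ : Equiv.Perm (Fin n)) :
    koszulSign s (σ * τ) = koszulSign s σ * koszulSign (fun j => s (σ j)) τ := by
  have hsq : ∀ k : ℤ, k.negOnePow * k.negOnePow = 1 := fun k => Int.units_mul_self _
  rw [koszulSign_eq, koszulSign_eq, koszulSign_eq]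
  let srt : Fin n × Fin n → Fin n × Fin n := fun p => if p.1 < p.2 then p else (p.2, p.1)
  have hsrt : ∏ p : Fin n × Fin n with p.1 < p.2, pairSign s σ (srt (τ p.1, τ p.2)) =
      ∏ p : Fin n × Fin n with p.1 < p.2, pairSign s σ p := by
    refine Finset.prod_nbij' (fun p => srt (τ p.1, τ p.2))
      (fun p => srt (τ.symm p.1, τ.symm p.2)) ?_ ?_ ?_ ?_ fun _ _ => rfl
    · intro p hp
      simp only [Finset.mem_filter, Finset.mem_univ, true_and, srt] at hp ⊢
      have : τ p.1 ≠ τ p.2 := fun h => hp.ne (τ.injective h)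
      split_ifs with h
      · exact h
      · exact lt_of_le_of_ne (not_lt.1 h) this.symm
    · intro p hp
      simp only [Finset.mem_filter, Finset.mem_univ, true_and, srt] at hp ⊢
      have : τ.symm p.1 ≠ τ.symm p.2 := fun h => hp.ne (τ.symm.injective h)
      split_ifs with h
      · exact h
      · exact lt_of_le_of_ne (not_lt.1 h) this.symm
    · intro p hp
      simp only [Finset.mem_filter, Finset.mem_univ, true_and, srt] at hp ⊢
      by_cases h : τ p.1 < τ p.2 <;> simp [h, hp, hp.not_gt]
    · intro p hp
      simp only [Finset.mem_filter, Finset.mem_univ, true_and, srt] at hp ⊢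
      by_cases h : τ.symm p.1 < τ.symm p.2 <;> simp [h, hp, hp.not_gt]
  rw [← hsrt, ← Finset.prod_mul_distrib]
  refine Finset.prod_congr rfl fun p hp => ?_
  simp only [Finset.mem_filter, Finset.mem_univ, true_and] at hp
  have hne : τ p.1 ≠ τ p.2 := fun h => hp.ne (τ.injective h)
  have hne' : σ (τ p.1) ≠ σ (τ p.2) := fun h => hne (σ.injective h)
  simp only [pairSign, srt, Equiv.Perm.mul_apply]
  rcases lt_or_gt_of_ne hne with h | h
  · simp only [h, h.not_gt, if_true, if_false, mul_one]
    rfl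
  · rcases lt_or_gt_of_ne hne' with h' | h'
    · simp [h, h.not_gt, h', h'.not_gt, mul_comm (s (σ (τ p.2))), hsq]
    · simp [h, h.not_gt, h', h'.not_gt]

theorem koszulSign_swap {n : ℕ} (s : Fin (n + 1) → ℤ) (i : Fin n) :
    koszulSign s (Equiv.swap i.castSucc i.succ) = (s i.castSucc * s i.succ).negOnePow := by
  rw [koszulSign, Finset.prod_eq_single_of_mem (i.castSucc, i.succ)]
  · simp [mul_comm]
  · simp
  · rintro ⟨a, b⟩ hp hne
    exfalso
    simp only [Finset.mem_filter, Finset.mem_univ, true_and] at hp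
    obtain ⟨h1, h2⟩ := hp
    apply hne
    simp only [Equiv.swap_apply_def] at h2
    simp only [Prod.mk.injEq, Fin.ext_iff, Fin.lt_def] at *
    split_ifs at h2 <;> simp_all <;> omega

end Koszul

/-! ### Words as finite families: permutation and linearity in each position. -/

section Words

variable {K : Type v} [Field K] {V W : Type u} [AddCommGroup V] [Module K V]
  [AddCommGroup W] [Module K W]

theorem weight_ofFn {n : ℕ} (y : Fin n → ℤ × V) :
    Word.weight (List.ofFn y) = ∑ j, (y j).1 := by
  rw [Word.weight, List.map_ofFn, List.sum_ofFn]
  rfl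

theorem IsSymm.ofFn_swap {n : ℕ} {f : Word V → W} (hf : IsSymm K f) (y : Fin (n + 1) → ℤ × V)
    (i : Fin n) : f (List.ofFn y) = sgn K ((y i.castSucc).1 * (y i.succ).1) •
      f (List.ofFn (y ∘ Equiv.swap i.castSucc i.succ)) := by
  induction n generalizing f with
  | zero => exact i.elim0
  | succ n ih =>
    cases i using Fin.cases with
    | zero =>
      have h := hf [] (y 0) (y 1) (List.ofFn fun i : Fin n => y i.succ.succ)
      have h1 : ∀ i : Fin n, Equiv.swap (0 : Fin (n + 2)) 1 i.succ.succ = i.succ.succ := fun i =>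
        Equiv.swap_apply_of_ne_of_ne (Fin.succ_ne_zero _)
          (by rw [← Fin.succ_zero_eq_one]; exact fun h => Fin.succ_ne_zero _ (Fin.succ_injective _ h))
      simp only [List.ofFn_succ, List.nil_append] at h ⊢
      simpa [h1] using h
    | succ i =>
      have h := ih (hf.contr (y 0)) (Fin.tail y) i
      simp only [contr_apply] at h
      rw [List.ofFn_succ (f := y), List.ofFn_succ (f := y ∘ _)]
      refine h.trans ?_
      have h0 : Equiv.swap i.succ.castSucc i.succ.succ 0 = (0 : Fin (n + 2)) :=
        Equiv.swap_apply_of_ne_of_ne (by simp [Fin.ext_iff]) (by simp [Fin.ext_iff])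
      have h1 : ∀ j : Fin (n + 1), Equiv.swap i.succ.castSucc i.succ.succ j.succ =
          (Equiv.swap i.castSucc i.succ j).succ := fun j => by
        simp only [Equiv.swap_apply_def, Fin.ext_iff]
        split_ifs <;> simp_all
      simp only [Function.comp_apply, h0, h1]
      rfl

/-- Adjacent transpositions generate the symmetric group and the Koszul sign is multiplicative in
the sense of `koszulSign_mul`. -/
theorem IsSymm.ofFn_perm {n : ℕ} {f : Word V → W} (hf : IsSymm K f) (σ : Equiv.Perm (Fin n))
    (y : Fin n → ℤ × V) :
    f (List.ofFn y) = koszulSign (fun j => (y j).1) σ • f (List.ofFn (y ∘ σ)) := by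
  cases n with
  | zero =>
    have : koszulSign (fun j => (y j).1) σ = 1 := by
      rw [koszulSign]
      exact Finset.prod_eq_one fun p _ => p.1.elim0
    rw [this, one_smul, List.ofFn_zero, List.ofFn_zero]
  | succ n =>
    have hσ : σ ∈ Submonoid.closure
        (Set.range fun i : Fin n => Equiv.swap i.castSucc i.succ) := by
      rw [Equiv.Perm.mclosure_swap_castSucc_succ]; trivial
    induction hσ using Submonoid.closure_induction generalizing y with
    | mem σ h =>
      obtain ⟨i, rfl⟩ := h
      rw [koszulSign_swap, units_smul_eq_sgn K]
      exact hf.ofFn_swap y i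
    | one =>
      have : koszulSign (fun j => (y j).1) 1 = 1 := by
        rw [koszulSign]
        refine Finset.prod_eq_one fun p hp => ?_
        replace hp := (Finset.mem_filter.1 hp)
        exact absurd hp.2.1 hp.2.2.not_gt
      rw [this, one_smul]
      rfl
    | mul σ τ _ _ h1 h2 =>
      rw [koszulSign_mul, mul_smul, h1, h2]
      rfl

theorem IsMultilin.ofFn_update {n : ℕ} {f : Word V → W} (hf : IsMultilin K f)
    (y : Fin n → ℤ × V) (j : Fin n) (s : ℤ) :
    IsLinearMap K fun x => f (List.ofFn (Function.update y j (s, x))) := by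
  induction n generalizing f with
  | zero => exact j.elim0
  | succ n ih =>
    cases j using Fin.cases with
    | zero =>
      have h : ∀ x, List.ofFn (Function.update y 0 (s, x)) = (s, x) :: List.ofFn (Fin.tail y) := by
        intro x
        rw [List.ofFn_succ]
        simp
        rfl
      simp only [h]
      exact hf [] s _
    | succ j =>
      have h : ∀ x, List.ofFn (Function.update y j.succ (s, x)) =
          y 0 :: List.ofFn (Function.update (Fin.tail y) j (s, x)) := by
        intro x
        rw [List.ofFn_succ, Function.update_of_ne (Fin.succ_ne_zero j).symm]
        congr 2
        funext i
        by_cases h : i = j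
        · subst h; simp
        · simp [h, Fin.tail]
      simp only [h]
      exact ih (hf.contr (y 0)) (Fin.tail y) j

theorem exists_ofFn_swap {α : Type u} (p : List α) (a b : α) (q : List α) :
    ∃ (n : ℕ) (y : Fin (n + 1) → α) (i : Fin n), List.ofFn y = p ++ a :: b :: q ∧
      List.ofFn (y ∘ Equiv.swap i.castSucc i.succ) = p ++ b :: a :: q ∧
      y i.castSucc = a ∧ y i.succ = b := by
  induction p with
  | nil =>
    refine ⟨q.length + 1, Fin.cons a (Fin.cons b q.get), 0, ?_, ?_, rfl, rfl⟩
    · simp [List.ofFn_succ]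
    · have h1 : ∀ i : Fin q.length, Equiv.swap (0 : Fin (q.length + 2)) 1 i.succ.succ =
          i.succ.succ := fun i =>
        Equiv.swap_apply_of_ne_of_ne (Fin.succ_ne_zero _)
          (by rw [← Fin.succ_zero_eq_one]; exact fun h => Fin.succ_ne_zero _ (Fin.succ_injective _ h))
      simp [List.ofFn_succ, h1]
  | cons z p ih =>
    obtain ⟨n, y, i, h1, h2, h3, h4⟩ := ih
    refine ⟨n + 1, Fin.cons z y, i.succ, ?_, ?_, ?_, ?_⟩
    · rw [List.ofFn_succ, List.cons_append, ← h1]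
      rfl
    · have h0 : Equiv.swap i.succ.castSucc i.succ.succ 0 = (0 : Fin (n + 2)) :=
        Equiv.swap_apply_of_ne_of_ne (by simp [Fin.ext_iff]) (by simp [Fin.ext_iff])
      have h1 : ∀ j : Fin (n + 1), Equiv.swap i.succ.castSucc i.succ.succ j.succ =
          (Equiv.swap i.castSucc i.succ j).succ := fun j => by
        simp only [Equiv.swap_apply_def, Fin.ext_iff]
        split_ifs <;> simp_all
      rw [List.ofFn_succ, List.cons_append, ← h2]
      simp only [Function.comp_apply, h0, h1]
      rfl
    · rw [← Fin.succ_castSucc]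
      simpa using h3
    · simpa using h4

end Words

/-! ## Cochains and `L_∞` morphisms -/

section Translation

variable {K : Type v} [Field K] {V W : Type u} [AddCommGroup V] [Module K V]
  [AddCommGroup W] [Module K W] {D : DGLieAlgebra K V} {E : DGLieAlgebra K W}

variable (D) in
/-- The quadratic part of the codifferential. -/
noncomputable def codiffQuad : Word V → V
  | [x, y] => codiff D [x, y]
  | _ => 0

theorem codiff_eq : codiff D = unary D (-D.d) + codiffQuad D := by
  funext l
  match l with
  | [] => simp [codiff, unary, codiffQuad]
  | [x] => simp [codiff, unary, codiffQuad]
  | [x, y] => simp [unary, codiffQuad]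
  | x :: y :: z :: l => simp [codiff, unary, codiffQuad]

theorem sum_pairs {M : Type u} [AddCommMonoid M] {n : ℕ} (φ : Finset (Fin n) → M) :
    ∑ A : Finset (Fin n) with A.card = 2, φ A =
      ∑ p : Fin n × Fin n with p.1 < p.2, φ {p.1, p.2} := by
  refine (Finset.sum_nbij (fun p : Fin n × Fin n => ({p.1, p.2} : Finset (Fin n))) ?_ ?_ ?_ fun _ _ => rfl).symm
  · intro p hp
    simp only [Finset.mem_filter, Finset.mem_univ, true_and] at hp ⊢
    exact Finset.card_pair hp.ne
  · rintro ⟨a, b⟩ hp ⟨c, d⟩ hq h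
    simp only [Finset.coe_filter, Finset.mem_univ, true_and, Set.mem_ofPred_eq] at hp hq
    beta_reduce at h
    have h1 : a ∈ ({c, d} : Finset (Fin n)) := by rw [← h]; simp
    have h2 : b ∈ ({c, d} : Finset (Fin n)) := by rw [← h]; simp
    simp only [Finset.mem_insert, Finset.mem_singleton] at h1 h2
    simp only [Prod.mk.injEq]
    rcases h1 with rfl | rfl <;> rcases h2 with rfl | rfl
    · exact absurd hp (lt_irrefl _)
    · exact ⟨rfl, rfl⟩
    · exact absurd hp hq.not_gt
    · exact absurd hp (lt_irrefl _)
  · intro A hA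
    simp only [Finset.coe_filter, Finset.mem_univ, true_and, Set.mem_ofPred_eq] at hA
    obtain ⟨a, b, hab, rfl⟩ := Finset.card_eq_two.1 hA
    rcases lt_or_gt_of_ne hab with h | h
    · exact ⟨(a, b), by simpa using h, rfl⟩
    · exact ⟨(b, a), by simpa using h, Finset.pair_comm b a⟩

theorem codiffQuad_of_length {l : Word V} (h : l.length ≠ 2) : codiffQuad D l = 0 := by
  match l with
  | [] => rfl
  | [x] => rfl
  | [x, y] => simp at h
  | x :: y :: z :: l => rfl

/-- The composition with the codifferential on a homogeneous word. -/
theorem comp_codiff_ofFn {k : ℤ} {f : Word V → W} (hf : IsCochain D E k f) {n : ℕ}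
    (a : Fin n → ℤ) (x : Fin n → V) (hx : ∀ j, x j ∈ D.deg (a j)) :
    comp K 1 f (codiff D) (List.ofFn fun j => (a j - 1, x j)) =
      (∑ j, (∑ i ∈ Finset.Iio j, (a i - 1)).negOnePow •
        f (List.ofFn (Function.update (fun j => (a j - 1, x j)) j (a j, -D.d (x j))))) +
      ∑ p : Fin n × Fin n with p.1 < p.2, unshuffleSign (fun j => a j - 1) {p.1, p.2} •
        f ((a p.1 + a p.2 - 1, (a p.1).negOnePow • D.bracket (x p.1) (x p.2)) ::
          subword (fun j => (a j - 1, x j)) {p.1, p.2}ᶜ) := by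
  have hd : IsGraded D D 1 (-D.d) := fun i x hx => neg_mem (D.d_mem hx)
  rw [codiff_eq, comp_add_right _ hf.lin, Pi.add_apply, comp_unary hf hd, der_ofFn,
    comp_ofFn _ hf.symm]
  congr 1
  · refine Finset.sum_congr rfl fun j _ => ?_
    simp
  · refine Eq.trans ?_ ((sum_pairs fun A => unshuffleSign (fun j => a j - 1) A •
      f ((1 + ∑ j ∈ A, (a j - 1), codiffQuad D (subword (fun j => (a j - 1, x j)) A)) ::
          subword (fun j => (a j - 1, x j)) Aᶜ)).trans ?_)
    · refine (Finset.sum_filter_of_ne fun A _ hA => ?_).symm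
      by_contra hc
      apply hA
      rw [codiffQuad_of_length (by rw [length_subword]; exact hc)]
      have := hf.lin.map_zero [] (1 + ∑ j ∈ A, (a j - 1)) (subword (fun j => (a j - 1, x j)) Aᶜ)
      simp only [List.nil_append] at this
      rw [this, smul_zero]
    · refine Finset.sum_congr rfl fun p hp => ?_
      simp only [Finset.mem_filter, Finset.mem_univ, true_and] at hp
      rw [subword_pair _ hp, Finset.sum_pair hp.ne, codiffQuad, codiff_pair, units_smul_eq_sgn K]
      simp only [sub_add_cancel]
      rw [D.proj_same (hx _), D.proj_same (hx _)]
      congr 4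
      ring

/-- The empty and the full subset drop out because `f [] = 0`; the overall minus sign comes from the
`+ 1` in the exponent. -/
theorem conv_ofFn_self {f : Word V → W} (hf0 : f [] = 0) {n : ℕ} (y : Fin n → ℤ × V) :
    conv E.bracket 1 f f (List.ofFn y) =
      -∑ A : Finset (Fin n) with A.Nonempty ∧ Aᶜ.Nonempty, unshuffleSign (fun j => (y j).1) A •
        (∑ j ∈ A, (y j).1 + 1).negOnePow •
          E.bracket (f (subword y A)) (f (subword y Aᶜ)) := by
  rw [conv_ofFn, ← Finset.sum_neg_distrib, Finset.sum_filter]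
  refine Finset.sum_congr rfl fun A _ => ?_
  split_ifs with h
  · simp [Int.negOnePow_succ]
  · rw [not_and_or, Finset.not_nonempty_iff_eq_empty, Finset.not_nonempty_iff_eq_empty] at h
    rcases h with h | h <;> simp [h, subword, hf0]

variable [CharZero K]

/-- The relation of an `L_∞` morphism to a graded Lie algebra is the Maurer–Cartan equation. -/
theorem relation_iff (hE : E.d = 0) {f : Word V → W} (hf : IsCochain D E 1 f) (hf0 : f [] = 0)
    (c : ∀ n : ℕ, MultilinearMap K (fun _ : Fin n => V) W)
    (hc : ∀ {n : ℕ} (a : Fin n → ℤ) (x : Fin n → V), (∀ j, x j ∈ D.deg (a j)) →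
      c n x = f (List.ofFn fun j => (a j - 1, x j)))
    {n : ℕ} (a : Fin n → ℤ) (x : Fin n → V) (hx : ∀ j, x j ∈ D.deg (a j)) :
    -E.d (c n x) + (2 : K)⁻¹ •
        ∑ A : Finset (Fin n) with A.Nonempty ∧ Aᶜ.Nonempty,
          unshuffleSign (fun j => a j - 1) A • (∑ j ∈ A, (a j - 1) + 1).negOnePow •
            E.bracket (c A.card (subseq x A)) (c Aᶜ.card (subseq x Aᶜ)) =
      (∑ j, (∑ i ∈ Finset.Iio j, (a i - 1)).negOnePow •
          c n (Function.update x j (-D.d (x j)))) +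
        ∑ p : Fin n × Fin n with p.1 < p.2,
          unshuffleSign (fun j => a j - 1) {p.1, p.2} •
            c (({p.1, p.2}ᶜ : Finset (Fin n)).card + 1)
              (Fin.cons ((a p.1).negOnePow • D.bracket (x p.1) (x p.2))
                (subseq x ({p.1, p.2}ᶜ : Finset (Fin n)))) ↔
      curv D E f (List.ofFn fun j => (a j - 1, x j)) = 0 := by
  have hsub : ∀ A : Finset (Fin n), c A.card (subseq x A) =
      f (subword (fun j => (a j - 1, x j)) A) := by
    intro A
    rw [hc (subseq a A) (subseq x A) fun j => hx _, ← ofFn_subseq]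
    rfl
  have h1 : ∀ j, c n (Function.update x j (-D.d (x j))) =
      f (List.ofFn (Function.update (fun j => (a j - 1, x j)) j (a j, -D.d (x j)))) := by
    intro j
    rw [hc (Function.update a j (a j + 1))]
    · congr 2
      funext i
      by_cases h : i = j
      · subst h; simp
      · simp [h]
    · intro i
      by_cases h : i = j
      · subst h; simpa using D.d_mem (hx i)
      · simpa [h] using hx i
  have h2 : ∀ p : Fin n × Fin n, c (({p.1, p.2}ᶜ : Finset (Fin n)).card + 1)
      (Fin.cons ((a p.1).negOnePow • D.bracket (x p.1) (x p.2))
        (subseq x ({p.1, p.2}ᶜ : Finset (Fin n)))) =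
      f ((a p.1 + a p.2 - 1, (a p.1).negOnePow • D.bracket (x p.1) (x p.2)) ::
          subword (fun j => (a j - 1, x j)) {p.1, p.2}ᶜ) := by
    intro p
    rw [hc (Fin.cons (a p.1 + a p.2) (subseq a {p.1, p.2}ᶜ)), List.ofFn_succ, ← ofFn_subseq]
    · rfl
    · intro j
      cases j using Fin.cases with
      | zero =>
        simp only [Fin.cons_zero]
        rw [units_smul_eq_sgn K]
        exact Submodule.smul_mem _ _ (D.bracket_mem (hx _) (hx _))
      | succ j => exact hx _
  simp only [hsub, h1, h2]
  rw [← comp_codiff_ofFn hf a x hx, hE, LinearMap.zero_apply, neg_zero, zero_add, curv,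
    Pi.add_apply, Pi.smul_apply, conv_ofFn_self hf0, smul_neg, ← sub_eq_add_neg, sub_eq_zero]
  exact eq_comm

/-! ### From morphisms to cochains -/

variable (D) in
/-- The function on words given by a family of multilinear maps. -/
noncomputable def wordFn : Word V → (∀ n : ℕ, MultilinearMap K (fun _ : Fin n => V) W) → W
  | [], c => c 0 Fin.elim0
  | x :: l, c => wordFn l fun n => (c (n + 1)).curryLeft (D.proj (x.1 + 1) x.2)

theorem wordFn_ofFn (c : ∀ n : ℕ, MultilinearMap K (fun _ : Fin n => V) W) {n : ℕ}
    (y : Fin n → ℤ × V) :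
    wordFn D (List.ofFn y) c = c n fun j => D.proj ((y j).1 + 1) (y j).2 := by
  induction n generalizing c with
  | zero =>
    simp only [List.ofFn_zero, wordFn]
    congr 1
    exact Subsingleton.elim _ _
  | succ n ih =>
    rw [List.ofFn_succ, wordFn]
    refine (ih _ _).trans ?_
    rw [MultilinearMap.curryLeft_apply]
    congr 1
    funext j
    cases j using Fin.cases <;> rfl

theorem wordFn_add (c c' : ∀ n : ℕ, MultilinearMap K (fun _ : Fin n => V) W) (l : Word V) :
    wordFn D l (c + c') = wordFn D l c + wordFn D l c' := by
  induction l generalizing c c' with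
  | nil => rfl
  | cons x l ih =>
    exact ih (fun n => (c (n + 1)).curryLeft (D.proj (x.1 + 1) x.2))
      (fun n => (c' (n + 1)).curryLeft (D.proj (x.1 + 1) x.2))

theorem wordFn_smul (t : K) (c : ∀ n : ℕ, MultilinearMap K (fun _ : Fin n => V) W)
    (l : Word V) : wordFn D l (t • c) = t • wordFn D l c := by
  induction l generalizing c with
  | nil => rfl
  | cons x l ih => exact ih fun n => (c (n + 1)).curryLeft (D.proj (x.1 + 1) x.2)

theorem wordFn_lin (c : ∀ n : ℕ, MultilinearMap K (fun _ : Fin n => V) W) :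
    IsMultilin K fun l => wordFn D l c := by
  intro p s q
  induction p generalizing c with
  | nil =>
    constructor
    · intro x y
      simp only [List.nil_append, wordFn, map_add]
      exact wordFn_add _ _ q
    · intro t x
      simp only [List.nil_append, wordFn, map_smul]
      exact wordFn_smul _ _ q
  | cons z p ih => exact ih _

theorem wordFn_proj (c : ∀ n : ℕ, MultilinearMap K (fun _ : Fin n => V) W) (p : Word V) (s : ℤ)
    (x : V) (q : Word V) :
    wordFn D (p ++ (s, x) :: q) c = wordFn D (p ++ (s, D.proj (s + 1) x) :: q) c := by
  induction p generalizing c with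
  | nil => simp only [List.nil_append, wordFn, proj_proj]
  | cons z p ih => exact ih _

theorem isCochain_wordFn (F : LInftyMorphism D E) :
    IsCochain D E 1 fun l => wordFn D l F.coeff where
  mem l := by
    have h := F.coeff_mem (fun j => (l.get j).1 + 1) (fun j => D.proj ((l.get j).1 + 1) (l.get j).2)
      fun j => D.proj_mem _ _
    rw [← wordFn_ofFn F.coeff l.get, List.ofFn_get] at h
    have hw := weight_ofFn l.get
    rw [List.ofFn_get] at hw
    rw [hw, add_comm]
    simpa using h
  lin := wordFn_lin F.coeff
  symm p x y q := by
    obtain ⟨n, z, i, h1, h2, h3, h4⟩ := exists_ofFn_swap p x y q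
    rw [← h1, ← h2]
    beta_reduce
    rw [wordFn_ofFn, wordFn_ofFn,
      F.coeff_symm (fun j => (z j).1 + 1) _ (fun j => D.proj_mem _ _)
        (Equiv.swap i.castSucc i.succ), koszulSign_swap, units_smul_eq_sgn K]
    simp [h3, h4]
  proj := wordFn_proj F.coeff

theorem wordFn_homogeneous (c : ∀ n : ℕ, MultilinearMap K (fun _ : Fin n => V) W) {n : ℕ}
    (a : Fin n → ℤ) (x : Fin n → V) (hx : ∀ j, x j ∈ D.deg (a j)) :
    c n x = wordFn D (List.ofFn fun j => (a j - 1, x j)) c := by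
  rw [wordFn_ofFn]
  congr 1
  funext j
  simp [D.proj_same (hx j)]

/-- The relations of a morphism concern homogeneous inputs of positive arity. A cochain sees only
homogeneous components of letters, and the empty word is checked directly. -/
theorem curv_wordFn (hE : E.d = 0) (F : LInftyMorphism D E) :
    curv D E (fun l => wordFn D l F.coeff) = 0 := by
  have hf := isCochain_wordFn F
  have hf0 : (fun l => wordFn D l F.coeff) [] = 0 := by
    simp [wordFn, F.coeff_zero]
  funext l
  rw [hf.curv.apply_proj]
  rcases Nat.eq_zero_or_pos l.length with h | h
  · rw [List.eq_nil_of_length_eq_zero h]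
    simp only [curv, List.map_nil, Pi.add_apply, Pi.smul_apply, comp, conv, codiff_nil, hf0]
    have := hf.lin.map_zero [] 1 []
    simp only [List.nil_append] at this
    simp [this]
  · have h1 := (relation_iff hE hf hf0 F.coeff (fun a x hx => wordFn_homogeneous F.coeff a x hx)
      (fun j => (l.get j).1 + 1) (fun j => D.proj ((l.get j).1 + 1) (l.get j).2)
      fun j => D.proj_mem _ _).1 (F.relation _ _ h fun j => D.proj_mem _ _)
    rw [Pi.zero_apply, ← h1]
    congr 1
    conv_lhs => rw [← List.ofFn_get l, List.map_ofFn]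
    simp
    rfl

/-! ### From cochains to morphisms -/

/-- The restriction of a function on words to homogeneous components. -/
noncomputable def homogeneousCoeff {f : Word V → W} (hf : IsMultilin K f) {n : ℕ} (a : Fin n → ℤ) :
    MultilinearMap K (fun j => D.deg (a j)) W where
  toFun x := f (List.ofFn fun j => (a j - 1, (x j : V)))
  map_update_add' {inst} x j u v := by
    obtain rfl : inst = instDecidableEqFin n := Subsingleton.elim _ _
    have h : ∀ w : D.deg (a j), (fun i => (a i - 1, ((Function.update x j w i : D.deg (a i)) : V))) =
        Function.update (fun i => (a i - 1, (x i : V))) j (a j - 1, (w : V)) := by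
      intro w
      funext i
      by_cases hi : i = j
      · subst hi; simp
      · simp [hi]
    simp only [h]
    exact (hf.ofFn_update _ j _).map_add _ _
  map_update_smul' {inst} x j t u := by
    obtain rfl : inst = instDecidableEqFin n := Subsingleton.elim _ _
    have h : ∀ w : D.deg (a j), (fun i => (a i - 1, ((Function.update x j w i : D.deg (a i)) : V))) =
        Function.update (fun i => (a i - 1, (x i : V))) j (a j - 1, (w : V)) := by
      intro w
      funext i
      by_cases hi : i = j
      · subst hi; simp
      · simp [hi]
    simp only [h]
    exact (hf.ofFn_update _ j _).map_smul _ _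

variable (D) in
/-- The multilinear maps given by a multilinear function on words. -/
noncomputable def coeffOf {f : Word V → W} (hf : IsMultilin K f) (n : ℕ) :
    MultilinearMap K (fun _ : Fin n => V) W :=
  (MultilinearMap.fromDFinsuppEquiv (M := fun (_ : Fin n) (j : ℤ) => D.deg j) (fun _ => ℤ) K
    fun a => homogeneousCoeff hf a).compLinearMap fun _ => D.decomp.symm.toLinearMap

theorem coeffOf_apply {f : Word V → W} (hf : IsMultilin K f) {n : ℕ} (a : Fin n → ℤ)
    (x : Fin n → V) (hx : ∀ j, x j ∈ D.deg (a j)) :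
    coeffOf D hf n x = f (List.ofFn fun j => (a j - 1, x j)) := by
  have h : (fun j => D.decomp.symm (x j)) =
      fun j => (DFinsupp.single (β := fun i => D.deg i) (a j) ⟨x j, hx j⟩) :=
    funext fun j => D.decomp_symm_apply (hx j)
  rw [coeffOf, MultilinearMap.compLinearMap_apply]
  simp only [LinearEquiv.coe_coe]
  rw [h]
  exact MultilinearMap.fromDFinsuppEquiv_single (M := fun (_ : Fin n) (j : ℤ) => D.deg j) _ a
    fun j => ⟨x j, hx j⟩

/-- A Maurer–Cartan cochain defines an `L_∞` morphism. -/
noncomputable def toMorphism (hE : E.d = 0) {f : Word V → W} (hf : IsCochain D E 1 f)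
    (hf0 : f [] = 0) (hmc : curv D E f = 0) : LInftyMorphism D E where
  coeff := coeffOf D hf.lin
  coeff_zero := by
    ext x
    rw [coeffOf_apply hf.lin (fun _ => 0) x fun j => j.elim0]
    simpa using hf0
  coeff_mem a x hx := by
    rw [coeffOf_apply hf.lin a x hx, add_comm]
    have h := hf.mem (List.ofFn fun j => (a j - 1, x j))
    rwa [weight_ofFn] at h
  coeff_symm a x hx σ := by
    rw [coeffOf_apply hf.lin a x hx, coeffOf_apply hf.lin (fun j => a (σ j)) _ fun j => hx _]
    exact hf.symm.ofFn_perm σ _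
  relation a x _ hx :=
    (relation_iff hE hf hf0 _ (fun a x hx => coeffOf_apply hf.lin a x hx) a x hx).2
      (congrFun hmc _)

/-- The linear map given by a multilinear map in one variable. -/
def linearOf (c : MultilinearMap K (fun _ : Fin 1 => V) W) : V →ₗ[K] W where
  toFun x := c fun _ => x
  map_add' x y := by
    have := c.map_update_add (fun _ => 0) 0 x y
    simp only [Function.update_eq_const_of_subsingleton] at this
    exact this
  map_smul' t x := by
    have := c.map_update_smul (fun _ => 0) 0 t x
    simp only [Function.update_eq_const_of_subsingleton] at this
    exact this

theorem toMorphism_linear (hE : E.d = 0) {f : Word V → W} (hf : IsCochain D E 1 f)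
    (hf0 : f [] = 0) (hmc : curv D E f = 0) {p : V →ₗ[K] W} (hp : ∀ x, f [x] = unary D p [x])
    (x : V) : (toMorphism hE hf hf0 hmc).coeff 1 (fun _ => x) = p x := by
  refine linearMap_ext_deg (D := D) (a := linearOf ((toMorphism hE hf hf0 hmc).coeff 1)) (b := p)
    (fun i x hx => ?_) x
  change coeffOf D hf.lin 1 _ = _
  rw [coeffOf_apply hf.lin (fun _ => i) _ fun _ => hx]
  simpa using apply_single hp hx (by ring)

/-- The Maurer–Cartan cochain of a weak equivalence to a graded Lie algebra. -/
theorem exists_cochain_of_isWeakEquivalence (hE : E.d = 0) {F : LInftyMorphism D E}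
    (hF : F.IsWeakEquivalence) : ∃ (C : Contraction D E) (f : Word V → W), IsCochain D E 1 f ∧
      f [] = 0 ∧ (∀ x, f [x] = unary D C.p [x]) ∧ curv D E f = 0 := by
  have hb : ∀ w, w ∈ E.boundaries ↔ w = 0 := fun w => by
    simp [DGLieAlgebra.boundaries, hE]
  obtain ⟨h1, h2, h3, h4⟩ := hF
  obtain ⟨C, hC⟩ := exists_contraction (D := D) (E := E) (linearOf (F.coeff 1))
    (fun i x hx => by
      have h := F.coeff_mem (n := 1) (fun _ => i) (fun _ => x) fun _ => hx
      simp only [Finset.univ_unique, Finset.sum_singleton, sub_add_cancel] at h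
      rwa [add_zero])
    (fun x => (hb _).1 (h2 _ ⟨x, rfl⟩))
    (fun z hz hpz => h3 z hz ((hb _).2 hpz))
    (fun w => by
      obtain ⟨x, hx, hx'⟩ := h4 w (by rw [DGLieAlgebra.mem_cycles, hE]; rfl)
      exact ⟨x, hx, (sub_eq_zero.1 ((hb _).1 hx')).symm⟩)
  refine ⟨C, _, isCochain_wordFn F, by simp [wordFn, F.coeff_zero], fun x => ?_,
    curv_wordFn hE F⟩
  have := wordFn_ofFn (D := D) F.coeff (fun _ : Fin 1 => x)
  rw [unary_single, hC]
  exact this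

/-- A Maurer–Cartan cochain with invertible linear part gives a weak equivalence. -/
theorem exists_isWeakEquivalence (hE : E.d = 0) (C : Contraction D E) {f : Word V → W}
    (hf : IsCochain D E 1 f) (hf0 : f [] = 0) (hp : ∀ x, f [x] = unary D C.p [x])
    (hmc : curv D E f = 0) : ∃ F : LInftyMorphism D E, F.IsWeakEquivalence := by
  have hb : ∀ w, w ∈ E.boundaries ↔ w = 0 := fun w => by
    simp [DGLieAlgebra.boundaries, hE]
  refine ⟨toMorphism hE hf hf0 hmc, ?_, ?_, ?_, ?_⟩
  · intro x _
    rw [DGLieAlgebra.mem_cycles, hE]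
    rfl
  · rintro _ ⟨x, rfl⟩
    rw [hb]
    exact (toMorphism_linear hE hf hf0 hmc hp _).trans (C.p_d x)
  · intro x hx h
    rw [hb] at h
    obtain ⟨y, hy⟩ := C.exists_boundary hx ((toMorphism_linear hE hf hf0 hmc hp _).symm.trans h)
    exact ⟨y, hy.symm⟩
  · intro y _
    refine ⟨C.i y, C.d_i y, ?_⟩
    rw [hb, sub_eq_zero]
    exact ((toMorphism_linear hE hf hf0 hmc hp _).trans (C.p_i y)).symm

end Translation

/-! ## Regular maps on a linear algebraic group and their derivatives -/

section Regular

variable {K : Type v} [Field K] {n : ℕ} {G : Subgroup (GL (Fin n) K)}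

theorem regular_comp_inv {f : G → K} (hf : f ∈ regularFunctions G) :
    (fun g => f g⁻¹) ∈ regularFunctions G := by
  let φ : (G → K) →ₐ[K] (G → K) := AlgHom.pi fun g => Pi.evalAlgHom K (fun _ : G => K) g⁻¹
  suffices H : regularFunctions G ≤ (regularFunctions G).comap φ from H hf
  refine Algebra.adjoin_le ?_
  rintro _ (⟨i, j, rfl⟩ | ⟨i, j, rfl⟩)
  · exact entry_inv_mem G i j
  · have h : φ (fun g => entry G i j g⁻¹) = entry G i j := by
      funext g
      simp [φ]
    change φ (fun g => entry G i j g⁻¹) ∈ regularFunctions G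
    rw [h]
    exact entry_mem G i j

/-- Right translation is left translation by the inverse, conjugated by inversion. -/
theorem regular_mul_right (h : G) {f : G → K} (hf : f ∈ regularFunctions G) :
    (fun g => f (g * h)) ∈ regularFunctions G := by
  have h1 := regular_comp_inv (translateFun_mem G h⁻¹ (regular_comp_inv hf))
  convert h1 using 2 with g
  simp [translateFun]

/-- Right translation of regular functions. -/
def rightTranslate (h : G) : regularFunctions G →ₐ[K] regularFunctions G :=
  ((AlgHom.pi fun g => Pi.evalAlgHom K (fun _ : G => K) (g * h)).comp
    (regularFunctions G).val).codRestrict (regularFunctions G) fun f => regular_mul_right h f.2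

theorem rightTranslate_apply (h : G) (f : regularFunctions G) (g : G) :
    (rightTranslate h f : G → K) g = (f : G → K) (g * h) := rfl

theorem leftTranslate_apply (h : G) (f : regularFunctions G) (g : G) :
    (leftTranslate G h f : G → K) g = (f : G → K) (h * g) := rfl

theorem left_rightTranslate (h k : G) (f : regularFunctions G) :
    leftTranslate G h (rightTranslate k f) = rightTranslate k (leftTranslate G h f) := by
  apply Subtype.ext
  funext g
  simp [rightTranslate_apply, leftTranslate_apply, mul_assoc]

theorem rightTranslate_inv (h : G) (f : regularFunctions G) :
    rightTranslate h (rightTranslate h⁻¹ f) = f := by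
  apply Subtype.ext
  funext g
  simp [rightTranslate_apply]

/-- The adjoint action of `G` on its Lie algebra. -/
def adjointAction (g : G) (X : lieAlgebraOf G) : lieAlgebraOf G :=
  ⟨Derivation.mk' ((rightTranslate g).toLinearMap ∘ₗ
      (X : Derivation K (regularFunctions G) (regularFunctions G)).toLinearMap ∘ₗ
        (rightTranslate g⁻¹).toLinearMap) (fun a b => by
      change rightTranslate g (X.1 (rightTranslate g⁻¹ (a * b))) =
        a * rightTranslate g (X.1 (rightTranslate g⁻¹ b)) +
          b * rightTranslate g (X.1 (rightTranslate g⁻¹ a))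
      rw [map_mul, Derivation.leibniz, map_add, smul_eq_mul, smul_eq_mul, map_mul, map_mul,
        rightTranslate_inv, rightTranslate_inv]), by
    intro h f
    change rightTranslate g (X.1 (rightTranslate g⁻¹ (leftTranslate G h f))) =
      leftTranslate G h (rightTranslate g (X.1 (rightTranslate g⁻¹ f)))
    rw [← left_rightTranslate, X.2 h (rightTranslate g⁻¹ f), left_rightTranslate]⟩

theorem tangentAtOne_adjoint (g : G) (X : lieAlgebraOf G) (f : regularFunctions G) :
    tangentAtOne (adjointAction g X) f =
      tangentAtOne X (leftTranslate G g (rightTranslate g⁻¹ f)) := by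
  have h : tangentAtOne (adjointAction g X) f =
      ((X : Derivation K (regularFunctions G) (regularFunctions G)) (rightTranslate g⁻¹ f) :
        G → K) (1 * g) := rfl
  rw [h, tangentAtOne, X.2 g, leftTranslate_apply, one_mul, mul_one]

theorem tangentAtOne_add (X : lieAlgebraOf G) (f f' : regularFunctions G) :
    tangentAtOne X (f + f') = tangentAtOne X f + tangentAtOne X f' := by
  simp [tangentAtOne]

theorem tangentAtOne_smul (X : lieAlgebraOf G) (c : K) (f : regularFunctions G) :
    tangentAtOne X (c • f) = c * tangentAtOne X f := by
  simp [tangentAtOne]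

theorem tangentAtOne_zero (X : lieAlgebraOf G) :
    tangentAtOne X (0 : regularFunctions G) = 0 := by
  simp [tangentAtOne]

theorem tangentAtOne_one (X : lieAlgebraOf G) :
    tangentAtOne X (1 : regularFunctions G) = 0 := by
  simp [tangentAtOne]

theorem tangentAtOne_mul (X : lieAlgebraOf G) (f f' : regularFunctions G) :
    tangentAtOne X (f * f') =
      tangentAtOne X f * (f' : G → K) 1 + (f : G → K) 1 * tangentAtOne X f' := by
  simp [tangentAtOne, Derivation.leibniz]
  ring

variable (G) in
/-- Pairs consisting of a regular map `G → M` and its derivative at the identity. -/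
def regularPairs (M : Type*) [AddCommGroup M] [Module K M] :
    Submodule K ((G → M) × (lieAlgebraOf G → M)) :=
  Submodule.span K {p | ∃ (m : regularFunctions G) (v : M),
    p = (fun g => (m : G → K) g • v, fun X => tangentAtOne X m • v)}

/-- `Φ` is a regular map `G → M` with derivative `δ` at the identity. -/
def HasTangent {M : Type*} [AddCommGroup M] [Module K M] (Φ : G → M) (δ : lieAlgebraOf G → M) :
    Prop := (Φ, δ) ∈ regularPairs G M

variable {M N P : Type*} [AddCommGroup M] [Module K M] [AddCommGroup N] [Module K N]
  [AddCommGroup P] [Module K P]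

theorem hasTangent_smul_const (m : regularFunctions G) (v : M) :
    HasTangent (fun g => (m : G → K) g • v) fun X => tangentAtOne X m • v :=
  Submodule.subset_span ⟨m, v, rfl⟩

theorem HasTangent.add {Φ Ψ : G → M} {δ ε : lieAlgebraOf G → M} (h : HasTangent Φ δ)
    (h' : HasTangent Ψ ε) : HasTangent (Φ + Ψ) (δ + ε) := add_mem h h'

theorem HasTangent.smul {Φ : G → M} {δ : lieAlgebraOf G → M} (h : HasTangent Φ δ) (c : K) :
    HasTangent (c • Φ) (c • δ) := Submodule.smul_mem _ c h

theorem hasTangent_zero : HasTangent (0 : G → M) 0 := zero_mem (regularPairs G M)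

theorem hasTangent_const (v : M) : HasTangent (fun _ : G => v) 0 := by
  convert hasTangent_smul_const (G := G) 1 v using 1
  · funext g; simp
  · funext X; simp [tangentAtOne_one]

theorem HasTangent.sum {ι : Type*} (s : Finset ι) {Φ : ι → G → M} {δ : ι → lieAlgebraOf G → M}
    (h : ∀ i ∈ s, HasTangent (Φ i) (δ i)) :
    HasTangent (fun g => ∑ i ∈ s, Φ i g) fun X => ∑ i ∈ s, δ i X := by
  have := Submodule.sum_mem (regularPairs G M) (t := s) (f := fun i => (Φ i, δ i)) h
  convert this using 1
  simp only [HasTangent]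
  congr! 1
  rw [Prod.ext_iff]
  constructor
  · funext g; simp [Prod.fst_sum]
  · funext g; simp [Prod.snd_sum]

theorem HasTangent.induction {p : (G → M) → (lieAlgebraOf G → M) → Prop}
    (hs : ∀ (m : regularFunctions G) (v : M),
      p (fun g => (m : G → K) g • v) fun X => tangentAtOne X m • v)
    (h0 : p 0 0) (hadd : ∀ Φ δ Ψ ε, p Φ δ → p Ψ ε → p (Φ + Ψ) (δ + ε))
    (hsmul : ∀ (c : K) Φ δ, p Φ δ → p (c • Φ) (c • δ))
    {Φ : G → M} {δ : lieAlgebraOf G → M} (h : HasTangent Φ δ) : p Φ δ := by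
  refine Submodule.span_induction (p := fun x _ => p x.1 x.2) ?_ h0 ?_ ?_ h
  · rintro _ ⟨m, v, rfl⟩
    exact hs m v
  · intro x y _ _ hx hy
    exact hadd _ _ _ _ hx hy
  · intro c x _ hx
    exact hsmul c _ _ hx

theorem HasTangent.map {Φ : G → M} {δ : lieAlgebraOf G → M} (h : HasTangent Φ δ)
    (A : M →ₗ[K] N) : HasTangent (fun g => A (Φ g)) fun X => A (δ X) := by
  refine h.induction (p := fun Φ δ => HasTangent (fun g => A (Φ g)) fun X => A (δ X)) ?_ ?_ ?_ ?_
  · intro m v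
    simpa using hasTangent_smul_const m (A v)
  · convert hasTangent_zero (G := G) (M := N) using 1 <;> funext <;> simp
  · intro Φ δ Ψ ε h1 h2
    convert h1.add h2 using 1 <;> funext <;> simp
  · intro c Φ δ h
    convert h.smul c using 1 <;> funext <;> simp

theorem HasTangent.bilin (B : M →ₗ[K] N →ₗ[K] P) {Φ : G → M} {δ : lieAlgebraOf G → M}
    (h : HasTangent Φ δ) {Ψ : G → N} {ε : lieAlgebraOf G → N} (h' : HasTangent Ψ ε) :
    HasTangent (fun g => B (Φ g) (Ψ g)) fun X => B (δ X) (Ψ 1) + B (Φ 1) (ε X) := by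
  refine h.induction (p := fun Φ δ => HasTangent (fun g => B (Φ g) (Ψ g))
    fun X => B (δ X) (Ψ 1) + B (Φ 1) (ε X)) ?_ ?_ ?_ ?_
  · intro m v
    refine h'.induction (p := fun Ψ ε => HasTangent (fun g => B ((m : G → K) g • v) (Ψ g))
      fun X => B (tangentAtOne X m • v) (Ψ 1) + B ((m : G → K) 1 • v) (ε X)) ?_ ?_ ?_ ?_
    · intro k w
      convert hasTangent_smul_const (m * k) (B v w) using 1
      · funext g
        simp [smul_smul]
        rw [mul_comm]
      · funext X
        simp [tangentAtOne_mul, smul_smul, add_smul]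
        rw [mul_comm, mul_comm (tangentAtOne X k)]
    · convert hasTangent_zero (G := G) (M := P) using 1 <;> funext <;> simp
    · intro Φ δ Ψ ε h1 h2
      convert h1.add h2 using 1
      · funext g; simp
      · funext X
        simp only [Pi.add_apply, map_add]
        abel
    · intro c Φ δ h
      convert h.smul c using 1
      · funext g; simp
      · funext X
        simp only [Pi.smul_apply, map_smul, smul_add]
  · convert hasTangent_zero (G := G) (M := P) using 1 <;> funext <;> simp
  · intro Φ δ Ψ ε h1 h2
    convert h1.add h2 using 1
    · funext g; simp
    · funext X
      simp only [Pi.add_apply, map_add, LinearMap.add_apply]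
      abel
  · intro c Φ δ h
    convert h.smul c using 1
    · funext g; simp
    · funext X
      simp only [Pi.smul_apply, map_smul, smul_add, LinearMap.smul_apply]

theorem HasTangent.functional {Φ : G → M} {δ : lieAlgebraOf G → M} (h : HasTangent Φ δ)
    (φ : Module.Dual K M) : ∃ m : regularFunctions G, (∀ g, (m : G → K) g = φ (Φ g)) ∧
      ∀ X, tangentAtOne X m = φ (δ X) := by
  refine h.induction (p := fun Φ δ => ∃ m : regularFunctions G, (∀ g, (m : G → K) g = φ (Φ g)) ∧
      ∀ X, tangentAtOne X m = φ (δ X)) ?_ ?_ ?_ ?_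
  · intro m v
    refine ⟨φ v • m, fun g => ?_, fun X => ?_⟩
    · simp [mul_comm]
    · simp [tangentAtOne_smul, mul_comm]
  · exact ⟨0, by simp, fun X => by simp [tangentAtOne_zero]⟩
  · rintro Φ δ Ψ ε ⟨m, h1, h2⟩ ⟨m', h1', h2'⟩
    exact ⟨m + m', fun g => by simp [h1, h1'], fun X => by simp [tangentAtOne_add, h2, h2']⟩
  · rintro c Φ δ ⟨m, h1, h2⟩
    exact ⟨c • m, fun g => by simp [h1], fun X => by simp [tangentAtOne_smul, h2]⟩

/-- Functionals separate points, and composing with one turns `Φ` into a regular function whose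
derivative at the identity is determined. -/
theorem HasTangent.unique {Φ : G → M} {δ ε : lieAlgebraOf G → M} (h : HasTangent Φ δ)
    (h' : HasTangent Φ ε) (X : lieAlgebraOf G) : δ X = ε X := by
  rw [← sub_eq_zero, ← Module.forall_dual_apply_eq_zero_iff K]
  intro φ
  obtain ⟨m, h1, h2⟩ := h.functional φ
  obtain ⟨m', h1', h2'⟩ := h'.functional φ
  have : m = m' := Subtype.ext (funext fun g => by rw [h1, h1'])
  rw [map_sub, ← h2, ← h2', this, sub_self]

/-- In the quotient by `U` the map is zero, and so is its derivative by uniqueness. -/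
theorem HasTangent.mem {Φ : G → M} {δ : lieAlgebraOf G → M} (h : HasTangent Φ δ)
    {U : Submodule K M} (hU : ∀ g, Φ g ∈ U) (X : lieAlgebraOf G) : δ X ∈ U := by
  have h1 := h.map U.mkQ
  have h2 : (fun g => U.mkQ (Φ g)) = 0 := funext fun g => by simpa using hU g
  rw [h2] at h1
  simpa using h1.unique hasTangent_zero X

/-- A regular map is a finite sum of terms `m(g) v`. This is the source of local finiteness, and
hence of rationality, for actions on spaces of cochains. -/
theorem HasTangent.exists_fg {Φ : G → M} {δ : lieAlgebraOf G → M} (h : HasTangent Φ δ) :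
    ∃ U : Submodule K M, U.FG ∧ ∀ g, Φ g ∈ U := by
  refine h.induction (p := fun Φ _ => ∃ U : Submodule K M, U.FG ∧ ∀ g, Φ g ∈ U) ?_ ?_ ?_ ?_
  · intro m v
    exact ⟨Submodule.span K {v}, Submodule.fg_span_singleton v, fun g =>
      Submodule.smul_mem _ _ (Submodule.mem_span_singleton_self v)⟩
  · exact ⟨⊥, Submodule.fg_bot, fun g => zero_mem _⟩
  · rintro Φ δ Ψ ε ⟨U, h1, h2⟩ ⟨U', h1', h2'⟩
    exact ⟨U ⊔ U', h1.sup h1', fun g =>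
      add_mem (Submodule.mem_sup_left (h2 g)) (Submodule.mem_sup_right (h2' g))⟩
  · rintro c Φ δ ⟨U, h1, h2⟩
    exact ⟨U, h1, fun g => Submodule.smul_mem _ _ (h2 g)⟩

theorem HasTangent.conj {Φ : G → M} {δ : lieAlgebraOf G → M} (h : HasTangent Φ δ) (k : G) :
    HasTangent (fun g => Φ (k * g * k⁻¹)) fun X => δ (adjointAction k X) := by
  refine h.induction (p := fun Φ δ => HasTangent (fun g => Φ (k * g * k⁻¹))
    fun X => δ (adjointAction k X)) ?_ hasTangent_zero (fun _ _ _ _ h1 h2 => h1.add h2)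
    fun c _ _ h => h.smul c
  intro m v
  convert hasTangent_smul_const (leftTranslate G k (rightTranslate k⁻¹ m)) v using 1
  · funext g
    rw [leftTranslate_apply, rightTranslate_apply]
  · funext X
    beta_reduce
    rw [tangentAtOne_adjoint]

theorem HasTangent.exists_inv {Φ : G → M} {δ : lieAlgebraOf G → M} (h : HasTangent Φ δ) :
    ∃ ε, HasTangent (fun g => Φ g⁻¹) ε := by
  refine h.induction (p := fun Φ _ => ∃ ε, HasTangent (fun g => Φ g⁻¹) ε) ?_ ?_ ?_ ?_
  · intro m v
    let m' : regularFunctions G := ⟨_, regular_comp_inv m.2⟩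
    exact ⟨_, hasTangent_smul_const m' v⟩
  · exact ⟨0, hasTangent_zero⟩
  · rintro _ _ _ _ ⟨ε, h1⟩ ⟨ε', h2⟩
    exact ⟨ε + ε', h1.add h2⟩
  · rintro c _ _ ⟨ε, h⟩
    exact ⟨c • ε, h.smul c⟩

/-- The derivative of `g ↦ Φ(g⁻¹)` for a multiplicative family of endomorphisms. -/
theorem HasTangent.inv_of_mul {Φ : G → M →ₗ[K] M} {δ : lieAlgebraOf G → M →ₗ[K] M}
    (h : HasTangent Φ δ) (hmul : ∀ g, Φ g ∘ₗ Φ g⁻¹ = Φ 1) (h1 : ∀ X, δ X ∘ₗ Φ 1 = δ X)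
    (h1' : ∀ g, Φ 1 ∘ₗ Φ g = Φ g) :
    HasTangent (fun g => Φ g⁻¹) fun X => -δ X := by
  obtain ⟨ε, hε⟩ := h.exists_inv
  have h2 := h.bilin (LinearMap.llcomp K M M M) hε
  have h3 : (fun g => LinearMap.llcomp K M M M (Φ g) (Φ g⁻¹)) = fun _ => Φ 1 := funext hmul
  rw [h3] at h2
  have h4 := h2.unique (hasTangent_const (Φ 1))
  have h5 : ε = fun X => -δ X := by
    funext X
    have h6 := h4 X
    have h7 := (hε.map (LinearMap.llcomp K M M M (Φ 1)))
    have h8 : (fun g : G => LinearMap.llcomp K M M M (Φ 1) (Φ g⁻¹)) = fun g => Φ g⁻¹ :=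
      funext fun g => h1' _
    rw [h8] at h7
    have h9 := h7.unique hε X
    rw [h9, Pi.zero_apply, inv_one] at h6
    have h10 : LinearMap.llcomp K M M M (δ X) (Φ 1) = δ X := h1 X
    rw [h10] at h6
    exact (neg_eq_of_add_eq_zero_right h6).symm
  rwa [h5] at hε

end Regular

/-! ## Rational representations of a linearly reductive group -/

section Rational

variable {K : Type v} [Field K] {n : ℕ} {G : Subgroup (GL (Fin n) K)}
  {V W : Type u} [AddCommGroup V] [Module K V] [AddCommGroup W] [Module K W]

theorem isSemisimple_of_bijective {V : Type*} {W : Type*} [AddCommGroup V] [Module K V]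
    [AddCommGroup W] [Module K W] {ρ : Representation K G V} {σ : Representation K G W}
    (f : ρ.IntertwiningMap σ) (hf : Function.Bijective f.toLinearMap)
    (h : σ.IsSemisimpleRepresentation) : ρ.IsSemisimpleRepresentation := by
  rw [Representation.isSemisimpleRepresentation_iff_isSemisimpleModule_asModule] at h ⊢
  exact (LinearEquiv.ofBijective
    (Representation.IntertwiningMap.equivLinearMapAsModule ρ σ f) hf).isSemisimpleModule_iff.2 h

/-- A subrepresentation, as a submodule over the group algebra. -/
noncomputable def asSubmoduleEquiv {ρ : Representation K G V} (U : Subrepresentation ρ) :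
    U.toRepresentation.asModule ≃ₗ[MonoidAlgebra K G] U.asSubmodule :=
  LinearEquiv.ofBijective
    ((Representation.IntertwiningMap.equivLinearMapAsModule U.toRepresentation ρ
      (LinearMap.intertwiningMap_of_isIntertwiningMap U.toRepresentation ρ U.toSubmodule.subtype
        fun _ _ => rfl)).codRestrict U.asSubmodule fun y => Subtype.prop (p := (· ∈ U.toSubmodule)) y)
    ⟨fun _ _ h => Subtype.ext (congrArg Subtype.val h),
      fun x => ⟨⟨x.1, x.2⟩, rfl⟩⟩

theorem isSemisimple_of_finite (hred : IsLinearlyReductive G) {ρ : Representation K G V}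
    [FiniteDimensional K V] (hρ : IsAlgebraicRep ρ) : ρ.IsSemisimpleRepresentation := by
  let b := (Module.finBasis K V).equivFun
  let σ : Representation K G (Fin (Module.finrank K V) → K) :=
    { toFun := fun g => b.toLinearMap ∘ₗ ρ g ∘ₗ b.symm.toLinearMap
      map_one' := by ext; simp
      map_mul' := fun g h => by ext; simp }
  have hσ : IsAlgebraicRep σ := fun φ v => hρ (φ ∘ₗ b.toLinearMap) (b.symm v)
  exact isSemisimple_of_bijective (σ := σ)
    (LinearMap.intertwiningMap_of_isIntertwiningMap ρ σ b.toLinearMap fun g v => by simp [σ])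
    b.bijective (hred _ σ hσ)

/-- The space is the sum of its finite-dimensional algebraic subrepresentations, each semisimple by
reductivity. -/
theorem isSemisimple_of_isRationalRep (hred : IsLinearlyReductive G) {ρ : Representation K G V}
    (hρ : IsRationalRep ρ) : ρ.IsSemisimpleRepresentation := by
  rw [Representation.isSemisimpleRepresentation_iff_isSemisimpleModule_asModule]
  refine isSemisimpleModule_of_isSemisimpleModule_submodule
    (s := {U : Subrepresentation ρ | FiniteDimensional K U.toSubmodule ∧
      IsAlgebraicRep U.toRepresentation}) (p := Subrepresentation.asSubmodule) ?_ ?_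
  · rintro U ⟨_, h⟩
    have h1 := isSemisimple_of_finite hred h
    rw [Representation.isSemisimpleRepresentation_iff_isSemisimpleModule_asModule] at h1
    exact (asSubmoduleEquiv U).isSemisimpleModule_iff.1 h1
  · rw [eq_top_iff]
    intro x _
    obtain ⟨U, hx, h1, h2⟩ := hρ x
    exact Submodule.mem_iSup_of_mem U (Submodule.mem_iSup_of_mem ⟨h1, h2⟩ hx)

theorem exists_invariant_complement (hred : IsLinearlyReductive G) {ρ : Representation K G V}
    (hρ : IsRationalRep ρ) (W : Submodule K V) (hW : ∀ g, ∀ x ∈ W, ρ g x ∈ W) :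
    ∃ C : Submodule K V, (∀ g, ∀ x ∈ C, ρ g x ∈ C) ∧ W ⊓ C = ⊥ ∧ W ⊔ C = ⊤ := by
  have := isSemisimple_of_isRationalRep hred hρ
  obtain ⟨C, hC⟩ := exists_isCompl (⟨W, fun g x hx => hW g x hx⟩ : Subrepresentation ρ)
  refine ⟨C.toSubmodule, fun g x hx => C.apply_mem_toSubmodule g hx, ?_, ?_⟩
  · exact congrArg Subrepresentation.toSubmodule hC.inf_eq_bot
  · exact congrArg Subrepresentation.toSubmodule hC.sup_eq_top

theorem isAlgebraicRep_of_hasTangent {ρ : Representation K G V} {δ : V → lieAlgebraOf G → V}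
    (h : ∀ v, HasTangent (fun g => ρ g v) (δ v)) (U : Subrepresentation ρ) :
    IsAlgebraicRep U.toRepresentation := by
  intro φ x
  obtain ⟨φ', hφ'⟩ := LinearMap.exists_extend φ
  obtain ⟨m, hm, -⟩ := (h x).functional φ'
  have : (fun g => φ (U.toRepresentation g x)) = m := by
    funext g
    rw [hm, ← hφ']
    rfl
  rw [this]
  exact m.2

/-- A representation with regular orbit maps is rational. -/
theorem isRationalRep_of_hasTangent {ρ : Representation K G V} {δ : V → lieAlgebraOf G → V}
    (h : ∀ v, HasTangent (fun g => ρ g v) (δ v)) : IsRationalRep ρ := by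
  intro v
  obtain ⟨U, hU, hv⟩ := (h v).exists_fg
  have hle : Submodule.span K (Set.range fun g => ρ g v) ≤ U :=
    Submodule.span_le.2 (by rintro _ ⟨g, rfl⟩; exact hv g)
  refine ⟨⟨Submodule.span K (Set.range fun g => ρ g v), ?_⟩, ?_, ?_, ?_⟩
  · intro g x hx
    have : Submodule.span K (Set.range fun g => ρ g v) ≤
        (Submodule.span K (Set.range fun g => ρ g v)).comap (ρ g) := by
      refine Submodule.span_le.2 ?_
      rintro _ ⟨k, rfl⟩
      refine Submodule.subset_span ⟨g * k, ?_⟩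
      simp
    exact this hx
  · exact Submodule.subset_span ⟨1, by simp⟩
  · have : FiniteDimensional K U := Module.Finite.of_fg hU
    exact Submodule.finiteDimensional_of_le hle
  · exact isAlgebraicRep_of_hasTangent h _

theorem semisimple_induction {ρ : Representation K G V} (hρ : ρ.IsSemisimpleRepresentation)
    {P : V → Prop} (h : ∀ U : Subrepresentation ρ, U.toRepresentation.IsIrreducible →
      ∀ x ∈ U, P x) (h0 : P 0) (hadd : ∀ x y, P x → P y → P (x + y)) (v : V) : P v := by
  rw [Representation.isSemisimpleRepresentation_iff_isSemisimpleModule_asModule] at hρ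
  have htop := IsSemisimpleModule.sSup_simples_eq_top (MonoidAlgebra K G) ρ.asModule
  rw [sSup_eq_iSup'] at htop
  have hv : ∀ w : ρ.asModule, w ∈ ⨆ a : {m : Submodule (MonoidAlgebra K G) ρ.asModule |
    IsSimpleModule (MonoidAlgebra K G) m}, (a : Submodule (MonoidAlgebra K G) ρ.asModule) :=
      fun w => htop ▸ Submodule.mem_top
  refine Submodule.iSup_induction _ (motive := fun v : ρ.asModule => P v) (hv v) ?_ h0 hadd
  rintro ⟨E, hE⟩ x hx
  refine h (Subrepresentation.ofSubmodule' E) ?_ x hx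
  rw [Representation.irreducible_iff_isSimpleModule_asModule]
  have hE' : IsSimpleModule (MonoidAlgebra K G) (Subrepresentation.ofSubmodule' E).asSubmodule := hE
  exact IsSimpleModule.congr (asSubmoduleEquiv (Subrepresentation.ofSubmodule' E))

/-- A finite-dimensional invariant subspace through a nonzero vector of `U` meets `U` in a nonzero
subrepresentation, which must be all of `U`. -/
theorem finiteDimensional_of_isIrreducible {ρ : Representation K G V} (hρ : IsRationalRep ρ)
    (U : Subrepresentation ρ) (hU : U.toRepresentation.IsIrreducible) :
    FiniteDimensional K U.toSubmodule := by
  have hnt : Nontrivial U.toSubmodule := by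
    by_contra hc
    rw [not_nontrivial_iff_subsingleton] at hc
    have : (⊥ : Subrepresentation U.toRepresentation) = ⊤ :=
      Subrepresentation.toSubmodule_injective (Subsingleton.elim _ _)
    exact bot_ne_top this
  obtain ⟨x, hx⟩ := exists_ne (0 : U.toSubmodule)
  obtain ⟨U', hxU', hfd, -⟩ := hρ x
  let A : Subrepresentation U.toRepresentation :=
    ⟨U'.toSubmodule.comap U.toSubmodule.subtype, fun g y hy => U'.apply_mem_toSubmodule g hy⟩
  rcases eq_bot_or_eq_top A with h | h
  · exfalso
    have hxA : x ∈ A.toSubmodule := hxU'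
    rw [h] at hxA
    exact hx hxA
  · refine Submodule.finiteDimensional_of_le (S₂ := U'.toSubmodule) fun y hy => ?_
    have : (⟨y, hy⟩ : U.toSubmodule) ∈ A.toSubmodule := by
      rw [h]
      exact Submodule.mem_top (R := K)
    exact this

/-- The coefficient functions of a rational finitely supported representation span a
finite-dimensional space. -/
theorem finite_coefficients (hred : IsLinearlyReductive G) {ρ : Representation K G V}
    (hρ : IsRationalRep ρ) (hfin : IsFinitelySupported ρ) :
    FiniteDimensional K (Submodule.span K
      {f : G → K | ∃ (φ : Module.Dual K V) (v : V), f = fun g => φ (ρ g v)}) := by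
  obtain ⟨S, hS, hS'⟩ := hfin
  -- The coefficient functions of `E` are the range of `c E`, which is finite-dimensional when `E`
  -- is.
  let c : (E : Rep.{u} K G) → Module.Dual K (E.V →ₗ[K] E.V) →ₗ[K] (G → K) := fun E =>
    LinearMap.pi fun g => LinearMap.applyₗ (E.ρ g)
  let T : Set (Rep.{u} K G) := {E ∈ S | FiniteDimensional K E.V}
  have hT : T.Finite := hS.subset fun _ h => h.1
  have hfg : (⨆ E ∈ hT.toFinset, LinearMap.range (c E)).FG := by
    refine Submodule.fg_biSup hT.toFinset (fun E => LinearMap.range (c E)) fun E hE => ?_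
    have : FiniteDimensional K E.V := (hT.mem_toFinset.1 hE).2
    rw [LinearMap.range_eq_map]
    exact Module.Finite.fg_top.map (c E)
  have hfd : FiniteDimensional K ↥(⨆ E ∈ hT.toFinset, LinearMap.range (c E)) :=
    Module.Finite.of_fg hfg
  refine Submodule.finiteDimensional_of_le (S₂ := ⨆ E ∈ hT.toFinset, LinearMap.range (c E))
    (Submodule.span_le.2 ?_)
  rintro _ ⟨φ, v, rfl⟩
  refine semisimple_induction (isSemisimple_of_isRationalRep hred hρ)
    (P := fun v => (fun g => φ (ρ g v)) ∈ ⨆ E ∈ hT.toFinset, LinearMap.range (c E)) ?_ ?_ ?_ v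
  · intro U hU x hx
    have hUfd := finiteDimensional_of_isIrreducible hρ U hU
    have hne : ∃ y : U.toSubmodule, y ≠ 0 := by
      by_contra! hc
      have : (⊥ : Subrepresentation U.toRepresentation) = ⊤ :=
        Subrepresentation.toSubmodule_injective
          (Submodule.ext fun y => by rw [hc y]; simp)
      exact bot_ne_top this
    obtain ⟨y, hy⟩ := hne
    -- An irreducible subrepresentation lies in the support, taking the zero subspace as the one
    -- divided out.
    obtain ⟨E, hE, ⟨e⟩⟩ := hS' (Rep.of U.toRepresentation) ⟨hU, ⊥, fun g x hx => by
      rw [Submodule.mem_bot] at hx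
      simp [hx], LinearMap.intertwiningMap_of_isIntertwiningMap _ _
        ((⊥ : Submodule K V).mkQ ∘ₗ U.toSubmodule.subtype) fun g v => rfl, fun h => by
        have h1 : (⊥ : Submodule K V).mkQ (y : V) = 0 :=
          congrArg (fun f : Representation.IntertwiningMap _ _ => f.toLinearMap y) h
        rw [Submodule.mkQ_apply, Submodule.Quotient.mk_eq_zero, Submodule.mem_bot] at h1
        exact hy (Subtype.ext h1)⟩
    have hEfd : FiniteDimensional K E.V := e.toLinearEquiv.finiteDimensional
    refine Submodule.mem_iSup_of_mem E (Submodule.mem_iSup_of_mem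
      (hT.mem_toFinset.2 ⟨hE, hEfd⟩) ?_)
    refine ⟨(φ ∘ₗ U.toSubmodule.subtype ∘ₗ e.toLinearEquiv.symm.toLinearMap) ∘ₗ
      LinearMap.applyₗ (e.toLinearEquiv ⟨x, hx⟩), ?_⟩
    funext g
    have h2 : E.ρ g (e.toLinearEquiv ⟨x, hx⟩) = e.toLinearEquiv (U.toRepresentation g ⟨x, hx⟩) :=
      (LinearMap.congr_fun (e.toIntertwiningMap.isIntertwining' g) ⟨x, hx⟩).symm
    change φ ((e.toLinearEquiv.symm (E.ρ g (e.toLinearEquiv ⟨x, hx⟩)) : U.toSubmodule) : V) = _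
    rw [h2, LinearEquiv.symm_apply_apply]
    rfl
  · have : (fun g => φ (ρ g (0 : V))) = 0 := by funext g; simp
    exact this ▸ zero_mem _
  · intro x y hx hy
    have : (fun g => φ (ρ g (x + y))) = (fun g => φ (ρ g x)) + fun g => φ (ρ g y) := by
      funext g; simp
    exact this ▸ add_mem hx hy

theorem regular_coefficient {ρ : Representation K G V} (hρ : IsRationalRep ρ)
    (φ : Module.Dual K V) (v : V) : (fun g => φ (ρ g v)) ∈ regularFunctions G := by
  obtain ⟨U, hv, -, hU⟩ := hρ v
  exact hU (φ ∘ₗ U.toSubmodule.subtype) ⟨v, hv⟩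

/-- A rational finitely supported representation is regular as a map to the endomorphisms. -/
theorem exists_regular_expansion (hred : IsLinearlyReductive G) {ρ : Representation K G V}
    (hρ : IsRationalRep ρ) (hfin : IsFinitelySupported ρ) :
    ∃ (m : ℕ) (c : Fin m → regularFunctions G) (A : Fin m → V →ₗ[K] V),
      ∀ g, ρ g = ∑ k, (c k : G → K) g • A k := by
  have := finite_coefficients hred hρ hfin
  set C := Submodule.span K
      {f : G → K | ∃ (φ : Module.Dual K V) (v : V), f = fun g => φ (ρ g v)} with hC
  have hCR : C ≤ Subalgebra.toSubmodule (regularFunctions G) := by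
    rw [hC, Submodule.span_le]
    rintro _ ⟨φ, v, rfl⟩
    exact regular_coefficient hρ φ v
  let b := Module.finBasis K C
  let ev : G → Module.Dual K C := fun g => LinearMap.proj g ∘ₗ C.subtype
  -- A function in `C` that vanishes at every point is zero, so point evaluations span the dual.
  -- Writing each coordinate functional as a combination of evaluations yields `A k` as the same
  -- combination of the operators `ρ g`.
  have hev : Submodule.span K (Set.range ev) = ⊤ := by
    refine Submodule.span_eq_top_of_ne_zero fun z hz => ?_
    by_contra! hc
    exact hz (Subtype.ext (funext fun g => hc (ev g) ⟨g, rfl⟩))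
  have hco : ∀ k, ∃ a : G →₀ K, Finsupp.linearCombination K ev a = b.coord k := fun k => by
    have h : b.coord k ∈ Submodule.span K (Set.range ev) := hev ▸ Submodule.mem_top
    exact (Finsupp.mem_span_range_iff_exists_finsupp.1 h)
  choose a ha using hco
  refine ⟨_, fun k => ⟨b k, hCR (b k).2⟩, fun k => (a k).sum fun g t => t • ρ g, fun g => ?_⟩
  ext v
  rw [← sub_eq_zero, ← Module.forall_dual_apply_eq_zero_iff K]
  intro φ
  let f : C := ⟨fun g => φ (ρ g v), Submodule.subset_span ⟨φ, v, rfl⟩⟩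
  have h1 : ∀ k, b.coord k f = φ (((a k).sum fun g t => t • ρ g) v) := by
    intro k
    rw [← ha, Finsupp.linearCombination_apply, Finsupp.sum, Finsupp.sum]
    simp [LinearMap.sum_apply, ev, f]
  have h2 := congrFun (congrArg Subtype.val (b.sum_repr f)) g
  rw [map_sub, sub_eq_zero]
  refine h2.symm.trans ?_
  simp only [LinearMap.sum_apply, LinearMap.smul_apply, map_sum, map_smul, ← h1,
    AddSubmonoidClass.coe_finsetSum, Finset.sum_apply]
  refine Finset.sum_congr rfl fun k _ => ?_
  simp [mul_comm]

/-! ### Invariants and coinvariants of the infinitesimal action -/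

section Infinitesimal

variable {τ : Representation K G V} {δ : lieAlgebraOf G → V →ₗ[K] V}

/-- The identity `g k v = (g k g⁻¹) (g v)` is differentiated in `k` at the identity. -/
theorem infinitesimal_adjoint (h : ∀ v, HasTangent (fun g => τ g v) fun X => δ X v) (g : G)
    (X : lieAlgebraOf G) (v : V) : τ g (δ X v) = δ (adjointAction g X) (τ g v) := by
  have h1 := (h v).map (τ g)
  have h2 := (h (τ g v)).conj g
  have h3 : (fun k => τ (g * k * g⁻¹) (τ g v)) = fun k => τ g (τ k v) := by
    funext k
    rw [← Module.End.mul_apply, ← Module.End.mul_apply, ← map_mul, ← map_mul]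
    simp
  rw [h3] at h2
  exact h1.unique h2 X

theorem infinitesimal_mem (h : ∀ v, HasTangent (fun g => τ g v) fun X => δ X v)
    {U : Submodule K V} (hU : ∀ g, ∀ x ∈ U, τ g x ∈ U) (X : lieAlgebraOf G) {x : V}
    (hx : x ∈ U) : δ X x ∈ U := (h x).mem (fun g => hU g x hx) X

theorem adjointAction_inv (g : G) (X : lieAlgebraOf G) :
    adjointAction g (adjointAction g⁻¹ X) = X := by
  apply Subtype.ext
  ext f
  change ((rightTranslate g (rightTranslate g⁻¹ (X.1 (rightTranslate g⁻¹⁻¹ (rightTranslate g⁻¹ f)))) :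
    regularFunctions G) : G → K) _ = _
  have h2 := rightTranslate_inv g⁻¹ f
  rw [rightTranslate_inv, inv_inv]
  rw [inv_inv] at h2
  rw [rightTranslate_inv]

/-- Every vector is the sum of an invariant one and a combination of derivatives. -/
theorem exists_invariant_add (hred : IsLinearlyReductive G)
    (h : ∀ v, HasTangent (fun g => τ g v) fun X => δ X v) (v : V) :
    ∃ v₀ : V, (∀ X, δ X v₀ = 0) ∧ v - v₀ ∈ Submodule.span K {y | ∃ X x, y = δ X x} := by
  obtain ⟨C, hC, hinf, hsup⟩ := exists_invariant_complement hred (isRationalRep_of_hasTangent h)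
    (Submodule.span K {y | ∃ X x, y = δ X x}) (by
      intro g
      change Submodule.span K {y | ∃ X x, y = δ X x} ≤
        (Submodule.span K {y | ∃ X x, y = δ X x}).comap (τ g)
      refine Submodule.span_le.2 ?_
      rintro _ ⟨X, x, rfl⟩
      exact Submodule.subset_span ⟨_, _, infinitesimal_adjoint h g X x⟩)
  obtain ⟨w, hw, c, hc, rfl⟩ := Submodule.mem_sup.1 (hsup ▸ Submodule.mem_top : v ∈ _)
  refine ⟨c, fun X => ?_, by simpa using hw⟩
  -- Derivatives of the stable complement `C` remain in `C` and are derivatives as well, hence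
  -- vanish.
  have h1 : δ X c ∈ Submodule.span K {y | ∃ X x, y = δ X x} ⊓ C :=
    ⟨Submodule.subset_span ⟨X, c, rfl⟩, infinitesimal_mem h hC X hc⟩
  rwa [hinf] at h1

/-- An invariant vector that is a combination of derivatives vanishes. -/
theorem eq_zero_of_invariant (hred : IsLinearlyReductive G)
    (h : ∀ v, HasTangent (fun g => τ g v) fun X => δ X v) {v : V} (hv : ∀ X, δ X v = 0)
    (hv' : v ∈ Submodule.span K {y | ∃ X x, y = δ X x}) : v = 0 := by
  obtain ⟨C, hC, hinf, hsup⟩ := exists_invariant_complement hred (isRationalRep_of_hasTangent h)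
    (⨅ X, LinearMap.ker (δ X)) (by
      intro g x hx
      rw [Submodule.mem_iInf] at hx ⊢
      intro X
      rw [LinearMap.mem_ker, ← adjointAction_inv g X, ← infinitesimal_adjoint h,
        LinearMap.mem_ker.1 (hx _), map_zero])
  -- Splitting `x` into an invariant part and a part in `C`, only the latter has derivatives, and
  -- these stay in `C`.
  have hle : Submodule.span K {y | ∃ X x, y = δ X x} ≤ C := by
    refine Submodule.span_le.2 ?_
    rintro _ ⟨X, x, rfl⟩
    obtain ⟨w, hw, c, hc, rfl⟩ := Submodule.mem_sup.1 (hsup ▸ Submodule.mem_top : x ∈ _)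
    rw [map_add, LinearMap.mem_ker.1 (Submodule.mem_iInf _ |>.1 hw X), zero_add]
    exact infinitesimal_mem h hC X hc
  have h1 : v ∈ (⨅ X, LinearMap.ker (δ X)) ⊓ C :=
    ⟨(Submodule.mem_iInf _).2 hv, hle hv'⟩
  rwa [hinf] at h1

end Infinitesimal

end Rational

/-! ## Infinitesimal actions on cochains -/

section Action

variable {K : Type v} [Field K] {V W : Type u} [AddCommGroup V] [Module K V]
  [AddCommGroup W] [Module K W] {D : DGLieAlgebra K V} {E : DGLieAlgebra K W}

/-- The action of a linear endomorphism on cochains with values in the same space. -/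
def infAct (a : V →ₗ[K] V) : (Word V → V) →ₗ[K] (Word V → V) where
  toFun f := fun l => a (f l) - der K 0 a f l
  map_add' f g := by
    funext l
    simp only [der_add, Pi.add_apply, map_add]
    abel
  map_smul' c f := by
    funext l
    simp only [der_smul, Pi.smul_apply, map_smul, RingHom.id_apply, smul_sub]

theorem infAct_apply (a : V →ₗ[K] V) (f : Word V → V) (l : Word V) :
    infAct a f l = a (f l) - der K 0 a f l := rfl

theorem comp_constCochain_left (v : W) (e : ℤ) (F : Word V → V) :
    comp K e (constCochain v) F = (0 : Word V → W) := by
  funext l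
  induction l generalizing e F v with
  | nil => rfl
  | cons x l ih =>
    simp only [comp, ih, contr_constCochain, comp_zero_left, Pi.zero_apply, smul_zero, add_zero]

/-- Composition of an endomorphism of degree zero with a cochain. -/
theorem comp_unary_left {e : ℤ} {f : Word V → V} (hf : IsCochain D D (e + 1) f)
    (a : V →ₗ[K] V) (l : Word V) : comp K e (unary D a) f l = a (f l) := by
  induction l generalizing e f with
  | nil =>
    have h := hf.mem []
    rw [Word.weight_nil, add_zero] at h
    simp only [comp, unary_single, D.proj_same h]
  | cons x l ih =>
    have h : IsCochain D D (e + x.1 + 1) (contr x f) := by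
      have := hf.contr x
      rwa [show e + 1 + x.1 = e + x.1 + 1 by ring] at this
    simp only [comp, ih h, contr_unary, comp_constCochain_left, contr_apply, Pi.zero_apply,
      smul_zero, add_zero]

/-- The obstruction for `f` to commute with the codifferential. -/
noncomputable def codiffComm (D : DGLieAlgebra K V) (f : Word V → V) : Word V → V :=
  comp K 1 f (codiff D) - comp K 0 (codiff D) f

theorem IsCochain.codiffComm {f : Word V → V} (hf : IsCochain D D 1 f) :
    IsCochain D D 2 (codiffComm D f) := by
  have h1 := hf.comp (e := 1) isCochain_codiff
  have h2 := (isCochain_codiff (D := D)).comp (e := 0) (by simpa using hf)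
  exact h1.sub (by simpa using h2)

theorem codiffComm_add (f g : Word V → V) :
    codiffComm D (f + g) = codiffComm D f + codiffComm D g := by
  rw [codiffComm, comp_add_left, comp_add_right _ isCochain_codiff.lin, codiffComm, codiffComm]
  abel

theorem codiffComm_smul (c : K) (f : Word V → V) :
    codiffComm D (c • f) = c • codiffComm D f := by
  rw [codiffComm, comp_smul_left, comp_smul_right _ _ isCochain_codiff.lin, codiffComm, smul_sub]

/-- A derivation of a DG Lie algebra of degree zero. -/
structure IsDerivation (D : DGLieAlgebra K V) (a : V →ₗ[K] V) : Prop where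
  graded : IsGraded D D 0 a
  comm_d : ∀ x, a (D.d x) = D.d (a x)
  leibniz : ∀ x y, a (D.bracket x y) = D.bracket (a x) y + D.bracket x (a y)

theorem der_congr_of_labels (a : V → V) {f g : Word V → W} {l : Word V}
    (h : ∀ m : Word V, m.map Prod.fst = l.map Prod.fst → f m = g m) :
    der K 0 a f l = der K 0 a g l := by
  induction l generalizing f g with
  | nil => rfl
  | cons x l ih =>
    rw [der, der, h _ (by simp), ih (f := contr x f) (g := contr x g)
      fun m hm => h _ (by simp [hm])]

theorem infAct_codiff {a : V →ₗ[K] V} (ha : IsDerivation D a) : infAct a (codiff D) = 0 := by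
  have hp : ∀ i x, D.proj i (a x) = a (D.proj i x) := fun i x => by
    simpa using ha.graded.proj i x
  funext l
  rw [infAct_apply]
  match l with
  | [] => simp [der, codiff]
  | [x] => simp [der, codiff, hp, ha.comm_d]
  | [x, y] =>
    simp [der, codiff, contr, hp, ha.leibniz]
  | x :: y :: z :: l =>
    rw [der_congr_of_labels (g := 0) a fun m hm => codiff_eq_zero_of_long m (by
      have : m.length = l.length + 3 := by simpa using congrArg List.length hm
      omega), der_zero, codiff_three]
    simp

/-- The operator `infAct a` is the commutator with the coderivation of `a`, and this coderivation
commutes with `Q` because `a` is a derivation. The claim is then the Jacobi identity for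
coderivations, applied through `comp_comp`. -/
theorem infAct_codiffComm {a : V →ₗ[K] V} (ha : IsDerivation D a) {f : Word V → V}
    (hf : IsCochain D D 1 f) :
    infAct a (codiffComm D f) = codiffComm D (infAct a f) := by
  have hQ := isCochain_codiff (D := D)
  have hu : IsCochain D D (0 + 1) (unary D a) := isCochain_unary ha.graded
  have hf' : IsCochain D D (0 + 1) f := by simpa using hf
  have hQu : comp K 0 (codiff D) (unary D a) = comp K 1 (unary D a) (codiff D) := by
    funext l
    rw [comp_unary hQ ha.graded, comp_unary_left hQ]
    have := congrFun (infAct_codiff ha) l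
    rw [infAct_apply, Pi.zero_apply, sub_eq_zero] at this
    exact this.symm
  have hact : ∀ g : Word V → V, IsCochain D D (0 + 1) g →
      infAct a g = comp K 0 (unary D a) g - comp K 0 g (unary D a) := by
    intro g hg
    funext l
    rw [infAct_apply, Pi.sub_apply, comp_unary_left hg, comp_unary hg ha.graded]
  have hact2 : infAct a (codiffComm D f) =
      comp K 1 (unary D a) (codiffComm D f) - comp K 0 (codiffComm D f) (unary D a) := by
    have h2 : IsCochain D D (1 + 1) (codiffComm D f) := hf.codiffComm
    funext l
    rw [infAct_apply, Pi.sub_apply, comp_unary_left h2, comp_unary h2 ha.graded]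
  have e1 := comp_comp hu.lin hu.symm hf.lin hQ.lin 0 1
  have e1' := comp_comp hu.lin hu.symm hQ.lin hf.lin 1 0
  have e2 := comp_comp hf.lin hf.symm hQ.lin hu.lin 1 0
  have e3 := comp_comp hQ.lin hQ.symm hf.lin hu.lin 0 0
  have e4 := comp_comp hf.lin hf.symm hu.lin hQ.lin 0 1
  simp only [mul_zero, zero_mul, sgn_zero, one_smul, zero_add, add_zero] at e1 e2 e3
  rw [hact2, hact f hf', codiffComm, codiffComm, comp_sub_left, comp_sub_left,
    comp_sub_right _ hQ.lin]
  rw [hQu, sub_self, comp_zero_right _ hf.lin, sub_eq_zero] at e2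
  rw [hQu, comp_sub_right _ hQ.lin] at e3
  rw [← e1, e2]
  have e3' : comp K 0 (comp K 0 (codiff D) f) (unary D a) =
      comp K 0 (comp K 1 (unary D a) (codiff D)) f + (comp K 0 (codiff D) (comp K 0 f (unary D a)) -
        comp K 0 (codiff D) (comp K 0 (unary D a) f)) := by
    rw [← e3]; abel
  rw [e3']
  abel

/-! ### Truncation -/

/-- The words of bounded length and weight. -/
def Low (N : ℤ) (l : Word V) : Prop := (l.length : ℤ) ≤ N ∧ Word.weight l ≤ N

theorem exists_low (l : Word V) : ∃ N, Low N l :=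
  ⟨max l.length (Word.weight l), le_max_left _ _, le_max_right _ _⟩

open Classical in
variable (K) in
/-- Truncation of a function on words. -/
noncomputable def trunc (N : ℤ) : (Word V → W) →ₗ[K] (Word V → W) where
  toFun f := fun l => if Low N l then f l else 0
  map_add' f g := by
    funext l
    by_cases h : Low N l <;> simp [h]
  map_smul' c f := by
    funext l
    by_cases h : Low N l <;> simp [h]

theorem trunc_of_low {N : ℤ} {f : Word V → W} {l : Word V} (h : Low N l) :
    trunc K N f l = f l := if_pos h

theorem trunc_of_not_low {N : ℤ} {f : Word V → W} {l : Word V} (h : ¬ Low N l) :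
    trunc K N f l = 0 := if_neg h

theorem trunc_trunc {N N' : ℤ} (h : N ≤ N') (f : Word V → W) :
    trunc K N (trunc K N' f) = trunc K N f := by
  funext l
  by_cases hl : Low N l
  · rw [trunc_of_low hl, trunc_of_low hl, trunc_of_low ⟨hl.1.trans h, hl.2.trans h⟩]
  · rw [trunc_of_not_low hl, trunc_of_not_low hl]

theorem IsCochain.trunc {k : ℤ} {f : Word V → W} (hf : IsCochain D E k f) (N : ℤ) :
    IsCochain D E k (trunc K N f) where
  mem l := by
    by_cases h : Low N l
    · rw [trunc_of_low h]; exact hf.mem l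
    · rw [trunc_of_not_low h]; exact zero_mem _
  lin p s q := by
    by_cases h : Low N (p ++ (s, (0 : V)) :: q)
    · have h' : ∀ x, Low N (p ++ (s, x) :: q) := fun x => by simpa [Low] using h
      simp only [trunc_of_low (h' _)]
      exact hf.lin p s q
    · have h' : ∀ x, ¬ Low N (p ++ (s, x) :: q) := fun x => by simpa [Low] using h
      simp only [trunc_of_not_low (h' _)]
      exact ⟨by simp, by simp⟩
  symm p x y q := by
    by_cases h : Low N (p ++ x :: y :: q)
    · have h' : Low N (p ++ y :: x :: q) := by
        simpa [Low, add_left_comm] using h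
      rw [trunc_of_low h, trunc_of_low h']
      exact hf.symm p x y q
    · have h' : ¬ Low N (p ++ y :: x :: q) := by
        simpa [Low, add_left_comm] using h
      rw [trunc_of_not_low h, trunc_of_not_low h', smul_zero]
  proj p s x q := by
    by_cases h : Low N (p ++ (s, x) :: q)
    · have h' : Low N (p ++ (s, D.proj (s + 1) x) :: q) := by simpa [Low] using h
      rw [trunc_of_low h, trunc_of_low h']
      exact hf.proj p s x q
    · have h' : ¬ Low N (p ++ (s, D.proj (s + 1) x) :: q) := by simpa [Low] using h
      rw [trunc_of_not_low h, trunc_of_not_low h']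

theorem low_iff_of_labels {N : ℤ} {l m : Word V} (h : m.map Prod.fst = l.map Prod.fst) :
    Low N m ↔ Low N l := by
  have h1 : m.length = l.length := by simpa using congrArg List.length h
  simp [Low, Word.weight, h, h1]

theorem infAct_trunc (N : ℤ) (a : V →ₗ[K] V) (f : Word V → V) :
    infAct a (trunc K N f) = trunc K N (infAct a f) := by
  funext l
  rw [infAct_apply]
  by_cases h : Low N l
  · rw [trunc_of_low h, trunc_of_low h, infAct_apply,
      der_congr_of_labels (f := trunc K N f) (g := f) a fun m hm =>
        trunc_of_low ((low_iff_of_labels hm).2 h)]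
  · rw [trunc_of_not_low h, trunc_of_not_low h,
      der_congr_of_labels (f := trunc K N f) (g := 0) a fun m hm =>
        trunc_of_not_low (fun h' => h ((low_iff_of_labels hm).1 h')), der_zero]
    simp

theorem comp_eq_zero_of_weight (e : ℤ) {f : Word V → W} {F : Word V → V} {l : Word V}
    (h : ∀ m : Word V, m.length ≤ l.length + 1 → Word.weight m = Word.weight l + e → f m = 0) :
    comp K e f F l = 0 := by
  induction l generalizing e f F with
  | nil => exact h _ (by simp) (by simp)
  | cons x l ih =>
    rw [comp, ih, ih, smul_zero, add_zero]
    · intro m hm hw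
      exact h _ (by simpa using hm) (by simp [hw]; ring)
    · intro m hm hw
      exact h _ (by simp; omega) (by simp [hw]; ring)

theorem comp_eq_zero_of_sublist (e : ℤ) {f : Word V → W} (hf : IsMultilin K f)
    {F : Word V → V} {l : Word V} (h : ∀ m : Word V, m.Sublist l → F m = 0) :
    comp K e f F l = 0 := by
  induction l generalizing e f F with
  | nil =>
    rw [comp, h [] (List.Sublist.refl _)]
    exact hf.map_zero [] e []
  | cons x l ih =>
    rw [comp, ih _ hf (F := contr x F) fun m hm => h _ (hm.cons_cons x),
      ih _ (hf.contr x) fun m hm => h _ (hm.cons x), smul_zero, add_zero]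

theorem IsCochain.eq_zero_of_neg {k : ℤ} {f : Word V → W} (hf : IsCochain D E k f)
    (hD : ∀ i ≤ 0, D.deg i = ⊥) {l : Word V} {x : ℤ × V} (hx : x ∈ l) (h : x.1 < 0) :
    f l = 0 := by
  obtain ⟨p, q, rfl⟩ := List.append_of_mem hx
  have h0 : D.proj (x.1 + 1) x.2 = 0 := by
    have := D.proj_mem (x.1 + 1) x.2
    rwa [hD _ (by omega), Submodule.mem_bot] at this
  have := hf.proj p x.1 x.2 q
  rw [h0, hf.lin.map_zero] at this
  exact this

theorem weight_le_of_sublist {l m : Word V} (h : m.Sublist l) (hl : ∀ x ∈ l, 0 ≤ x.1) :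
    Word.weight m ≤ Word.weight l := by
  induction h with
  | slnil => rfl
  | cons x h ih =>
    have := ih fun y hy => hl y (by simp [hy])
    have := hl x (by simp)
    simp
    omega
  | cons_cons x h ih =>
    have := ih fun y hy => hl y (by simp [hy])
    simpa using this

/-- In `f Q` the arguments of `f` have weight larger by one and length larger by at most one. In `Q
f` the cochain `f` is evaluated on subwords, whose weight is no larger because labels are
nonnegative. Hence a truncation at `N` only sees the truncation of `f` at `N + 1`. -/
theorem trunc_codiffComm (hD : ∀ i ≤ 0, D.deg i = ⊥) {f : Word V → V} (hf : IsCochain D D 1 f)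
    {N : ℤ} (h : trunc K (N + 1) f = 0) : trunc K N (codiffComm D f) = 0 := by
  have hlow : ∀ m, Low (N + 1) m → f m = 0 := fun m hm => by
    rw [← trunc_of_low (K := K) (f := f) hm, h]; rfl
  funext l
  by_cases hl : Low N l
  · rw [trunc_of_low hl]
    by_cases hn : ∀ x ∈ l, 0 ≤ x.1
    · rw [codiffComm, Pi.sub_apply, comp_eq_zero_of_weight, comp_eq_zero_of_sublist]
      · simp
      · exact isCochain_codiff.lin
      · intro m hm
        have h1 := weight_le_of_sublist hm hn
        have h2 := hm.length_le
        exact hlow m ⟨by have := hl.1; omega, by have := hl.2; omega⟩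
      · intro m hm hw
        exact hlow m ⟨by have := hl.1; omega, by have := hl.2; omega⟩
    · push Not at hn
      obtain ⟨x, hx, hx'⟩ := hn
      exact hf.codiffComm.eq_zero_of_neg hD hx hx'
  · rw [trunc_of_not_low hl]
    rfl

end Action

/-! ## Averaging of cochains -/

section Averaging

variable {K : Type v} [Field K] {n : ℕ} {G : Subgroup (GL (Fin n) K)}
  {V W : Type u} [AddCommGroup V] [Module K V]
  [AddCommGroup W] [Module K W] {D : DGLieAlgebra K V}

/-- A graded linear action of `G` on a DG Lie algebra compatible with the differential, regular
in each degree, whose derivative acts by derivations. -/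
structure IsRegularAction (D : DGLieAlgebra K V) (ρ : Representation K G V)
    (a : lieAlgebraOf G → V →ₗ[K] V) : Prop where
  graded : ∀ g, IsGraded D D 0 (ρ g)
  comm_d : ∀ g x, ρ g (D.d x) = D.d (ρ g x)
  tangent : ∀ i, HasTangent (fun g => ρ g ∘ₗ D.proj i) fun X => a X ∘ₗ D.proj i
  -- Only the derivative is required to respect the bracket. The action induced on `K` need not
  -- consist of automorphisms, since its degree one part is stable under the Lie algebra but
  -- possibly not under the group.
  derivation : ∀ X, IsDerivation D (a X)

variable {ρ : Representation K G V} {a : lieAlgebraOf G → V →ₗ[K] V}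

theorem IsRegularAction.proj (h : IsRegularAction D ρ a) (g : G) (i : ℤ) (x : V) :
    D.proj i (ρ g x) = ρ g (D.proj i x) := by
  simpa using (h.graded g).proj i x

theorem IsRegularAction.tangent_inv (h : IsRegularAction D ρ a) (i : ℤ) :
    HasTangent (fun g => ρ g⁻¹ ∘ₗ D.proj i) fun X => -(a X ∘ₗ D.proj i) := by
  refine (h.tangent i).inv_of_mul ?_ ?_ ?_
  · intro g
    ext x
    simp only [LinearMap.comp_apply, h.proj, proj_proj]
    rw [← Module.End.mul_apply, ← map_mul, mul_inv_cancel]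
  · intro X
    ext x
    simp [proj_proj]
  · intro g
    ext x
    simp [h.proj, proj_proj]

/-- Insertion of a letter with label `i` into a function with values in linear maps. -/
def insertLetter (i : ℤ) :
    (Word V → V →ₗ[K] W) →ₗ[K] (V →ₗ[K] V) →ₗ[K] (Word V → W) :=
  LinearMap.mk₂ K (fun Θ A l => match l with
    | [] => 0
    | x :: l => if x.1 = i then Θ l (A x.2) else 0)
    (fun Θ Θ' A => by
      funext l
      rcases l with _ | ⟨x, l⟩
      · simp
      · by_cases hx : x.1 = i <;> simp [hx])
    (fun c Θ A => by
      funext l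
      rcases l with _ | ⟨x, l⟩
      · simp
      · by_cases hx : x.1 = i <;> simp [hx])
    (fun Θ A A' => by
      funext l
      rcases l with _ | ⟨x, l⟩
      · simp
      · by_cases hx : x.1 = i <;> simp [hx])
    (fun c Θ A => by
      funext l
      rcases l with _ | ⟨x, l⟩
      · simp
      · by_cases hx : x.1 = i <;> simp [hx])

theorem insertLetter_nil (i : ℤ) (Θ : Word V → V →ₗ[K] W) (A : V →ₗ[K] V) :
    insertLetter i Θ A [] = 0 := rfl

theorem insertLetter_cons (i : ℤ) (Θ : Word V → V →ₗ[K] W) (A : V →ₗ[K] V) (x : ℤ × V)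
    (l : Word V) : insertLetter i Θ A (x :: l) = if x.1 = i then Θ l (A x.2) else 0 := rfl

/-- The function with values in linear maps given by the first letter. -/
def splitLetter {T : Word V → W} (hT : IsMultilin K T) (i : ℤ) : Word V → V →ₗ[K] W :=
  fun l => (hT [] i l).mk' _

theorem splitLetter_apply {T : Word V → W} (hT : IsMultilin K T) (i : ℤ) (l : Word V) (x : V) :
    splitLetter hT i l x = T ((i, x) :: l) := rfl

theorem der_apply_apply (b : V → V) (Θ : Word V → V →ₗ[K] W) (l : Word V) (x : V) :
    der K 0 b Θ l x = der K 0 b (fun m => Θ m x) l := by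
  induction l generalizing Θ with
  | nil => rfl
  | cons y l ih =>
    simp only [der, LinearMap.add_apply, LinearMap.smul_apply, ih]
    rfl

/-- Pulling back a multilinear function with given labels along the action is regular. -/
theorem hasTangent_pull (h : IsRegularAction D ρ a) (s : List ℤ) {W : Type u} [AddCommGroup W]
    [Module K W] {T : Word V → W} (hT : IsMultilin K T)
    (hproj : ∀ p s x q, T (p ++ (s, x) :: q) = T (p ++ (s, D.proj (s + 1) x) :: q))
    (hs : ∀ l : Word V, l.map Prod.fst ≠ s → T l = 0) :
    HasTangent (fun g => pull (ρ g⁻¹) T) fun X => -der K 0 (a X) T := by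
  induction s generalizing W with
  | nil =>
    have h0 : ∀ l : Word V, l ≠ [] → T l = 0 := fun l hl => hs l (by simpa using hl)
    convert hasTangent_const (G := G) T using 1
    · funext g l
      rcases l with _ | ⟨x, l⟩
      · rfl
      · rw [pull_apply, h0 _ (by simp), h0 _ (by simp)]
    · funext X l
      rw [Pi.neg_apply, Pi.zero_apply, Pi.zero_apply]
      rcases l with _ | ⟨x, l⟩
      · simp [der]
      · rw [der_congr_of_labels (g := 0) _ fun m hm => h0 m (by rintro rfl; simp at hm), der_zero]
        simp
  | cons i s ih =>
    -- The first letter is split off: `T` becomes a function on shorter words with values in linear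
    -- maps. The bilinear operation `insertLetter` restores the letter, and the product rule gives
    -- the derivative.
    have h1 := ih (T := splitLetter hT i)
      (fun p t q => ⟨fun x y => by
          ext z
          exact hT.map_add ((i, z) :: p) t q x y, fun c x => by
          ext z
          exact hT.map_smul ((i, z) :: p) t q c x⟩)
      (fun p t x q => by
        ext z
        exact hproj ((i, z) :: p) t x q)
      (fun l hl => by
        ext z
        exact hs _ (by simpa using hl))
    have h2 := h1.bilin (insertLetter i) (h.tangent_inv (i + 1))
    have hp : ∀ x l, T ((i, D.proj (i + 1) x) :: l) = T ((i, x) :: l) :=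
      fun x l => (hproj [] i x l).symm
    convert h2 using 1
    · funext g l
      rcases l with _ | ⟨⟨j, x⟩, l⟩
      · rw [insertLetter_nil, pull_apply]
        exact hs _ (by simp)
      · rw [insertLetter_cons, pull_apply, mapWord_cons]
        split_ifs with hj
        · obtain rfl : j = i := hj
          rw [pull_apply, splitLetter_apply, LinearMap.comp_apply, ← h.proj, hp]
        · exact hs _ (by simp [hj])
    · funext X l
      have hone : ρ (1 : G)⁻¹ = LinearMap.id := by rw [inv_one, map_one]; rfl
      have hpull : pull (ρ (1 : G)⁻¹) (splitLetter hT i) = splitLetter hT i := by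
        funext m
        rw [pull_apply, hone]
        simp [mapWord]
      rw [hpull, hone]
      rcases l with _ | ⟨⟨j, x⟩, l⟩
      · simp [insertLetter_nil, der]
      · rw [Pi.neg_apply, Pi.add_apply, insertLetter_cons, insertLetter_cons]
        by_cases hj : j = i
        · subst hj
          have haX : D.proj (j + 1) (a X x) = a X (D.proj (j + 1) x) := by
            simpa using (h.derivation X).graded.proj (j + 1) x
          have hc : contr (j, D.proj (j + 1) x) T = contr (j, x) T := funext fun m => hp x m
          simp only [if_true, der, LinearMap.neg_apply, LinearMap.comp_apply, Pi.neg_apply,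
            LinearMap.id_apply, der_apply_apply, map_neg, splitLetter_apply, zero_mul, sgn_zero,
            one_smul, add_zero]
          have e1 : (fun m => T ((j, D.proj (j + 1) x) :: m)) = contr (j, x) T := hc
          rw [e1, ← haX, hp]
          abel
        · simp only [hj, if_false, add_zero]
          rw [der_congr_of_labels (g := 0) _ fun m hm => hs m (by
            intro h'; rw [h'] at hm; simp only [List.map_cons, List.cons.injEq] at hm
            exact hj hm.1.symm), der_zero]
          simp

/-- The action of `G` on functions on words. -/
def wordRep (ρ : Representation K G V) : Representation K G (Word V → V) where
  toFun g :=
    { toFun := fun T l => ρ g (T (mapWord (ρ g⁻¹) l))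
      map_add' := fun T T' => by funext l; simp
      map_smul' := fun c T => by funext l; simp }
  map_one' := by
    ext T l
    simp [mapWord]
  map_mul' g k := by
    ext T l
    simp [mapWord_mapWord]
    rfl

theorem wordRep_apply (g : G) (T : Word V → V) (l : Word V) :
    wordRep ρ g T l = ρ g (T (mapWord (ρ g⁻¹) l)) := rfl

/-- Postcomposition with an endomorphism. -/
def postcomp : (V →ₗ[K] V) →ₗ[K] (Word V → V) →ₗ[K] (Word V → V) :=
  LinearMap.mk₂ K (fun A T l => A (T l)) (fun _ _ _ => by funext l; simp)
    (fun _ _ _ => by funext l; simp) (fun _ _ _ => by funext l; simp)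
    (fun _ _ _ => by funext l; simp)

theorem postcomp_apply (A : V →ₗ[K] V) (T : Word V → V) (l : Word V) :
    postcomp A T l = A (T l) := rfl

theorem hasTangent_wordRep_of_labels (h : IsRegularAction D ρ a) (s : List ℤ) (j : ℤ)
    {T : Word V → V} (hT : IsMultilin K T)
    (hproj : ∀ p s x q, T (p ++ (s, x) :: q) = T (p ++ (s, D.proj (s + 1) x) :: q))
    (hs : ∀ l : Word V, l.map Prod.fst ≠ s → T l = 0) (hj : ∀ l, T l ∈ D.deg j) :
    HasTangent (fun g => wordRep ρ g T) fun X => infAct (a X) T := by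
  have h1 := hasTangent_pull h s hT hproj hs
  have h2 := (h.tangent j).bilin postcomp h1
  have h3 := h1.map (postcomp (D.proj j))
  have h4 : (fun g => postcomp (D.proj j) (pull (ρ g⁻¹) T)) = fun g => pull (ρ g⁻¹) T := by
    funext g l
    exact D.proj_same (hj _)
  rw [h4] at h3
  convert h2 using 1
  · funext g l
    rw [postcomp_apply, LinearMap.comp_apply, pull_apply, D.proj_same (hj _)]
    rfl
  · funext X l
    have h5 := congrFun (h3.unique h1 X) l
    rw [postcomp_apply] at h5
    have hone : ρ (1 : G)⁻¹ = LinearMap.id := by rw [inv_one, map_one]; rfl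
    have hone' : ρ (1 : G) = LinearMap.id := by rw [map_one]; rfl
    rw [Pi.add_apply, postcomp_apply, postcomp_apply, hone', LinearMap.id_comp, h5, pull_apply,
      hone, LinearMap.comp_apply, D.proj_same (hj _), infAct_apply, sub_eq_add_neg]
    simp [mapWord]

/-- A cochain supported on finitely many label lists is the finite sum of its restrictions to single
lists. Such a piece has values in one degree, where the action is regular. -/
theorem hasTangent_wordRep (h : IsRegularAction D ρ a) {k : ℤ} (S : Finset (List ℤ))
    {T : Word V → V} (hT : IsCochain D D k T)
    (hS : ∀ l : Word V, l.map Prod.fst ∉ S → T l = 0) :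
    HasTangent (fun g => wordRep ρ g T) fun X => infAct (a X) T := by
  classical
  let c : List ℤ → Word V → V := fun s l => if l.map Prod.fst = s then T l else 0
  have hc : ∀ s l, c s l = if l.map Prod.fst = s then T l else 0 := fun _ _ => rfl
  have hsum : T = ∑ s ∈ S, c s := by
    funext l
    rw [Finset.sum_apply]
    by_cases hl : l.map Prod.fst ∈ S
    · rw [Finset.sum_eq_single (l.map Prod.fst)]
      · simp [hc]
      · intro s _ hs
        simp [hc, hs.symm]
      · exact fun h => absurd hl h
    · rw [hS l hl, Finset.sum_eq_zero]
      intro s hs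
      rw [hc, if_neg]
      rintro rfl
      exact hl hs
  have hmain : ∀ s ∈ S, HasTangent (fun g => wordRep ρ g (c s)) fun X => infAct (a X) (c s) := by
    intro s _
    refine hasTangent_wordRep_of_labels h s (k + s.sum) ?_ ?_ ?_ ?_
    · intro p t q
      constructor
      · intro x y
        simp only [hc, List.map_append, List.map_cons, hT.lin.map_add]
        split_ifs <;> simp
      · intro r x
        simp only [hc, List.map_append, List.map_cons, hT.lin.map_smul]
        split_ifs <;> simp
    · intro p t x q
      simp only [hc, List.map_append, List.map_cons, hT.proj p t x q]
    · intro l hl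
      simp [hc, hl]
    · intro l
      rw [hc]
      split_ifs with hl
      · have := hT.mem l
        rwa [Word.weight, hl] at this
      · exact zero_mem _
  have := HasTangent.sum S hmain
  simp only [← map_sum, ← hsum] at this
  exact this

/-- The label lists of bounded length with entries between `0` and `N`. -/
noncomputable def labelLists (N : ℤ) : ℕ → Finset (List ℤ)
  | 0 => {[]}
  | m + 1 => insert [] ((Finset.Icc 0 N ×ˢ labelLists N m).image fun p => p.1 :: p.2)

theorem mem_labelLists {N : ℤ} {m : ℕ} {s : List ℤ} (hs : s.length ≤ m)
    (h : ∀ x ∈ s, 0 ≤ x ∧ x ≤ N) : s ∈ labelLists N m := by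
  induction m generalizing s with
  | zero => simpa [labelLists] using hs
  | succ m ih =>
    rcases s with _ | ⟨x, s⟩
    · simp [labelLists]
    · simp only [labelLists, Finset.mem_insert, Finset.mem_image, Finset.mem_product]
      refine Or.inr ⟨(x, s), ⟨Finset.mem_Icc.2 (h x (by simp)), ih (by simpa using hs) ?_⟩, rfl⟩
      exact fun y hy => h y (by simp [hy])

/-- In positive degrees only nonnegative labels matter, so bounded length and weight leave finitely
many label lists. This is the purpose of truncation: the action on all cochains need not be
rational. -/
theorem hasTangent_of_trunc (h : IsRegularAction D ρ a) (hD : ∀ i ≤ 0, D.deg i = ⊥) {k N : ℤ}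
    {T : Word V → V} (hT : IsCochain D D k T) (hN : trunc K N T = T) :
    HasTangent (fun g => wordRep ρ g T) fun X => infAct (a X) T := by
  refine hasTangent_wordRep h (labelLists N N.toNat) hT fun l hl => ?_
  by_contra hne
  apply hl
  have hlow : Low N l := by
    by_contra hc
    rw [← hN, trunc_of_not_low hc] at hne
    exact hne rfl
  have hnn : ∀ x ∈ l, 0 ≤ x.1 := by
    intro x hx
    by_contra! hc
    exact hne (hT.eq_zero_of_neg hD hx hc)
  refine mem_labelLists ?_ ?_
  · have := hlow.1
    simp
    omega
  · intro y hy
    obtain ⟨x, hx, rfl⟩ := List.mem_map.1 hy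
    refine ⟨hnn x hx, ?_⟩
    have h1 := weight_le_of_sublist (List.singleton_sublist.2 hx) hnn
    have h2 := hlow.2
    simp at h1
    omega

theorem IsCochain.wordRep (h : IsRegularAction D ρ a) {k : ℤ} {T : Word V → V}
    (hT : IsCochain D D k T) (g : G) : IsCochain D D k (wordRep ρ g T) := by
  have := (hT.pull (h.graded g⁻¹)).map (h.graded g)
  rwa [add_zero] at this

theorem trunc_wordRep (N : ℤ) (g : G) (T : Word V → V) :
    trunc K N (wordRep ρ g T) = wordRep ρ g (trunc K N T) := by
  funext l
  rw [wordRep_apply]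
  have hlab : (mapWord (ρ g⁻¹) l).map Prod.fst = l.map Prod.fst := by simp [mapWord]
  by_cases hl : Low N l
  · rw [trunc_of_low hl, trunc_of_low ((low_iff_of_labels hlab).2 hl), wordRep_apply]
  · rw [trunc_of_not_low hl, trunc_of_not_low fun h => hl ((low_iff_of_labels hlab).1 h), map_zero]

theorem HasTangent.codRestrict {M : Type*} [AddCommGroup M] [Module K M] {U : Submodule K M}
    {Φ : G → U} {δ : lieAlgebraOf G → U}
    (h : HasTangent (fun g => (Φ g : M)) fun X => (δ X : M)) : HasTangent Φ δ := by
  obtain ⟨π, hπ⟩ := U.subtype.exists_leftInverse_of_injective (Submodule.ker_subtype U)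
  have h1 := h.map π
  have h2 : ∀ u : U, π u = u := fun u => LinearMap.congr_fun hπ u
  simpa only [h2] using h1

/-- Spaces of cochains to which the averaging process applies. -/
structure IsAveragingSpace (ρ : Representation K G V) (a : lieAlgebraOf G → V →ₗ[K] V)
    (U : Submodule K (Word V → V)) : Prop where
  stable : ∀ g, ∀ T ∈ U, wordRep ρ g T ∈ U
  tangent : ∀ T ∈ U, HasTangent (fun g => wordRep ρ g T) fun X => infAct (a X) T

theorem IsAveragingSpace.infAct_mem {U : Submodule K (Word V → V)}
    (hU : IsAveragingSpace ρ a U) (X : lieAlgebraOf G) {T : Word V → V} (hT : T ∈ U) :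
    infAct (a X) T ∈ U :=
  (hU.tangent T hT).mem (fun g => hU.stable g T hT) X

/-- The span of the derivatives of the elements of `U`. -/
def derivSpan (a : lieAlgebraOf G → V →ₗ[K] V) (U : Submodule K (Word V → V)) :
    Submodule K (Word V → V) :=
  Submodule.span K {S | ∃ X, ∃ T ∈ U, S = infAct (a X) T}

theorem IsAveragingSpace.exists_invariant_add {U : Submodule K (Word V → V)}
    (hU : IsAveragingSpace ρ a U) (hred : IsLinearlyReductive G) {T : Word V → V} (hT : T ∈ U) :
    ∃ T₀ ∈ U, (∀ X, infAct (a X) T₀ = 0) ∧ T - T₀ ∈ derivSpan a U := by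
  let τ : Representation K G U :=
    (Subrepresentation.mk (ρ := wordRep ρ) U fun g _ h => hU.stable g _ h).toRepresentation
  let δ : lieAlgebraOf G → U →ₗ[K] U := fun X =>
    (infAct (a X)).restrict fun T hT => hU.infAct_mem X hT
  obtain ⟨T₀, h1, h2⟩ := LieCochain.exists_invariant_add (τ := τ) (δ := δ) hred
    (fun T => HasTangent.codRestrict (hU.tangent T T.2)) ⟨T, hT⟩
  refine ⟨T₀, T₀.2, fun X => congrArg Subtype.val (h1 X), ?_⟩
  have h3 : Submodule.span K {y | ∃ X x, y = δ X x} ≤ (derivSpan a U).comap U.subtype := by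
    refine Submodule.span_le.2 ?_
    rintro _ ⟨X, x, rfl⟩
    exact Submodule.subset_span ⟨X, x, x.2, rfl⟩
  exact h3 h2

theorem IsAveragingSpace.eq_zero {U : Submodule K (Word V → V)}
    (hU : IsAveragingSpace ρ a U) (hred : IsLinearlyReductive G) {T : Word V → V}
    (h : ∀ X, infAct (a X) T = 0) (hT : T ∈ derivSpan a U) : T = 0 := by
  let τ : Representation K G U :=
    (Subrepresentation.mk (ρ := wordRep ρ) U fun g _ h => hU.stable g _ h).toRepresentation
  let δ : lieAlgebraOf G → U →ₗ[K] U := fun X =>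
    (infAct (a X)).restrict fun T hT => hU.infAct_mem X hT
  have h3 : derivSpan a U ≤ (Submodule.span K {y | ∃ X x, y = δ X x}).map U.subtype := by
    refine Submodule.span_le.2 ?_
    rintro _ ⟨X, x, hx, rfl⟩
    exact ⟨δ X ⟨x, hx⟩, Submodule.subset_span ⟨X, ⟨x, hx⟩, rfl⟩, rfl⟩
  obtain ⟨T', hT', rfl⟩ := h3 hT
  have := LieCochain.eq_zero_of_invariant (τ := τ) (δ := δ) hred
    (fun T => HasTangent.codRestrict (hU.tangent T T.2)) (v := T')
    (fun X => Subtype.ext (h X)) hT'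
  rw [this]
  rfl

end Averaging

/-! ### Averaging an Euler coderivation. -/

section Invariant

variable {K : Type v} [Field K] {V W : Type u} [AddCommGroup V] [Module K V]
  [AddCommGroup W] [Module K W] {D : DGLieAlgebra K V} {E : DGLieAlgebra K W}

theorem eq_of_forall_trunc {f g : Word V → W} (h : ∀ N, trunc K N f = trunc K N g) : f = g := by
  funext l
  obtain ⟨N, hN⟩ := exists_low l
  rw [← trunc_of_low (K := K) (f := f) hN, h N, trunc_of_low hN]

theorem isCochain_of_trunc {k : ℤ} {f : Word V → W}
    (h : ∀ N, IsCochain D E k (LieCochain.trunc K N f)) : IsCochain D E k f where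
  mem l := by
    obtain ⟨N, hN⟩ := exists_low l
    rw [← trunc_of_low (K := K) (f := f) hN]
    exact (h N).mem l
  lin p s q := by
    obtain ⟨N, hN⟩ := exists_low (p ++ (s, (0 : V)) :: q)
    have h' : ∀ x, f (p ++ (s, x) :: q) = LieCochain.trunc K N f (p ++ (s, x) :: q) :=
      fun x => (trunc_of_low (by simpa [Low] using hN)).symm
    simp only [h']
    exact (h N).lin p s q
  symm p x y q := by
    obtain ⟨N, hN⟩ := exists_low (p ++ x :: y :: q)
    have hN' : Low N (p ++ y :: x :: q) := by simpa [Low, add_left_comm] using hN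
    rw [← trunc_of_low (K := K) (f := f) hN, ← trunc_of_low (K := K) (f := f) hN']
    exact (h N).symm p x y q
  proj p s x q := by
    obtain ⟨N, hN⟩ := exists_low (p ++ (s, x) :: q)
    have hN' : Low N (p ++ (s, D.proj (s + 1) x) :: q) := by simpa [Low] using hN
    rw [← trunc_of_low (K := K) (f := f) hN, ← trunc_of_low (K := K) (f := f) hN']
    exact (h N).proj p s x q

theorem infAct_unary_eulerMap {a : V →ₗ[K] V} (ha : IsGraded D D 0 a) :
    infAct a (unary D (eulerMap D)) = 0 := by
  have hp : ∀ i x, D.proj i (a x) = a (D.proj i x) := fun i x => by simpa using ha.proj i x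
  funext l
  rw [infAct_apply]
  match l with
  | [] => simp [der, unary_nil]
  | [x] =>
    have h1 : D.proj (x.1 + 1) x.2 ∈ D.deg (x.1 + 1) := D.proj_mem _ _
    have h2 : a (D.proj (x.1 + 1) x.2) ∈ D.deg (x.1 + 1) := by simpa using ha _ _ h1
    simp [der, unary_single, hp, eulerMap_apply D h1, eulerMap_apply D h2]
  | x :: y :: l =>
    rw [der_congr_of_labels (g := 0) a fun m hm => by
      rcases m with _ | ⟨z, _ | ⟨w, m⟩⟩
      · simp at hm
      · simp at hm
      · exact unary_cons_cons (D := D) (eulerMap D) z w m]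
    simp [der_zero, unary_cons_cons]

/-- The cochains of degree `k` concentrated on words of bounded length and weight. -/
def boundedCochains (D : DGLieAlgebra K V) (k N : ℤ) : Submodule K (Word V → V) where
  carrier := {T | IsCochain D D k T ∧ trunc K N T = T}
  add_mem' h h' := ⟨h.1.add h'.1, by rw [map_add, h.2, h'.2]⟩
  zero_mem' := ⟨IsCochain.zero, map_zero _⟩
  smul_mem' c _ h := ⟨h.1.smul c, by rw [map_smul, h.2]⟩

/-- The functions on words whose linear part sends cycles to boundaries. -/
def homologicallyTrivial (D : DGLieAlgebra K V) : Submodule K (Word V → V) where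
  carrier := {T | T [] = 0 ∧
    ∀ (s : ℤ) (z : V), z ∈ D.deg (s + 1) → D.d z = 0 → T [(s, z)] ∈ D.boundaries}
  add_mem' h h' := ⟨by simp [h.1, h'.1], fun s z hz hd =>
    add_mem (h.2 s z hz hd) (h'.2 s z hz hd)⟩
  zero_mem' := ⟨rfl, fun _ _ _ _ => zero_mem _⟩
  smul_mem' c _ h := ⟨by simp [h.1], fun s z hz hd => Submodule.smul_mem _ c (h.2 s z hz hd)⟩

theorem trunc_mem_homologicallyTrivial {T : Word V → V} (hT : T ∈ homologicallyTrivial D) (N : ℤ) :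
    trunc K N T ∈ homologicallyTrivial D := by
  refine ⟨?_, fun s z hz hd => ?_⟩
  · by_cases h : Low N ([] : Word V)
    · rw [trunc_of_low h, hT.1]
    · rw [trunc_of_not_low h]
  · by_cases h : Low N [(s, z)]
    · rw [trunc_of_low h]
      exact hT.2 s z hz hd
    · rw [trunc_of_not_low h]
      exact zero_mem _

/-- The obstruction for commutation with the codifferential, as a linear map. -/
noncomputable def codiffCommLin (D : DGLieAlgebra K V) : (Word V → V) →ₗ[K] (Word V → V) where
  toFun := codiffComm D
  map_add' := codiffComm_add
  map_smul' c f := codiffComm_smul c f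

theorem codiffCommLin_apply (f : Word V → V) : codiffCommLin D f = codiffComm D f := rfl

variable {n : ℕ} {G : Subgroup (GL (Fin n) K)} {ρ : Representation K G V}
  {a : lieAlgebraOf G → V →ₗ[K] V}

theorem derivSpan_map {U U' : Submodule K (Word V → V)} (φ : (Word V → V) →ₗ[K] (Word V → V))
    (hU : ∀ T ∈ U, φ T ∈ U') (hφ : ∀ X, ∀ T ∈ U, φ (infAct (a X) T) = infAct (a X) (φ T))
    {T : Word V → V} (hT : T ∈ derivSpan a U) : φ T ∈ derivSpan a U' := by
  have : derivSpan a U ≤ (derivSpan a U').comap φ := by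
    refine Submodule.span_le.2 ?_
    rintro _ ⟨X, T, hT, rfl⟩
    exact Submodule.subset_span ⟨X, φ T, hU T hT, hφ X T hT⟩
  exact this hT

theorem IsRegularAction.isAveragingSpace_boundedCochains (h : IsRegularAction D ρ a)
    (hD : ∀ i ≤ 0, D.deg i = ⊥) (k N : ℤ) : IsAveragingSpace ρ a (boundedCochains D k N) where
  stable g T hT := ⟨hT.1.wordRep h g, by rw [trunc_wordRep, hT.2]⟩
  tangent _ hT := hasTangent_of_trunc h hD hT.1 hT.2

theorem IsRegularAction.isAveragingSpace_homologicallyTrivial (h : IsRegularAction D ρ a)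
    (hD : ∀ i ≤ 0, D.deg i = ⊥) (k N : ℤ) :
    IsAveragingSpace ρ a (boundedCochains D k N ⊓ homologicallyTrivial D) where
  stable g T hT := by
    refine ⟨(h.isAveragingSpace_boundedCochains hD k N).stable g T hT.1, ?_, ?_⟩
    · rw [wordRep_apply]
      change ρ g (T []) = 0
      rw [hT.2.1, map_zero]
    · intro s z hz hd
      rw [wordRep_apply]
      obtain ⟨y, hy⟩ := hT.2.2 s (ρ g⁻¹ z) (by simpa using h.graded g⁻¹ _ _ hz)
        (by rw [← h.comm_d, hd, map_zero])
      refine ⟨ρ g y, ?_⟩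
      rw [← h.comm_d, hy]
      rfl
  tangent _ hT := hasTangent_of_trunc h hD hT.1.1 hT.1.2

/-- A cochain commuting with the codifferential can be made invariant under the Lie algebra,
without changing its action on cohomology. -/
theorem IsRegularAction.exists_invariant_euler (h : IsRegularAction D ρ a)
    (hred : IsLinearlyReductive G) (hD : ∀ i ≤ 0, D.deg i = ⊥) {F : Word V → V}
    (hF : IsCochain D D 1 F) (hF0 : F [] = 0) (hcomm : codiffComm D F = 0)
    (hF1 : ∀ (s : ℤ) (z : V), z ∈ D.deg (s + 1) → D.d z = 0 →
      F [(s, z)] - ((s + 1 : ℤ) : K) • z ∈ D.boundaries) :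
    ∃ F', IsCochain D D 1 F' ∧ F' [] = 0 ∧ codiffComm D F' = 0 ∧
      (∀ X, infAct (a X) F' = 0) ∧
      ∀ (s : ℤ) (z : V), z ∈ D.deg (s + 1) → D.d z = 0 →
        F' [(s, z)] - ((s + 1 : ℤ) : K) • z ∈ D.boundaries := by
  set Θ : Word V → V := unary D (eulerMap D) with hΘ
  have hΘc : IsCochain D D 1 Θ := by simpa using isCochain_unary (isGraded_eulerMap D)
  have hΘ1 : ∀ (s : ℤ) (z : V), z ∈ D.deg (s + 1) → Θ [(s, z)] = ((s + 1 : ℤ) : K) • z := by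
    intro s z hz
    rw [hΘ, unary_single, D.proj_same hz, eulerMap_apply D hz]
  set U : ℤ → Submodule K (Word V → V) := fun N => boundedCochains D 1 N ⊓ homologicallyTrivial D
    with hUdef
  have hU : ∀ N, IsAveragingSpace ρ a (U N) :=
    h.isAveragingSpace_homologicallyTrivial hD 1
  have hUt : ∀ N T, IsCochain D D 1 T → T ∈ homologicallyTrivial D → trunc K N T ∈ U N :=
    fun N T hT hT' => ⟨⟨hT.trunc N, trunc_trunc le_rfl T⟩, trunc_mem_homologicallyTrivial hT' N⟩
  -- The invariant coderivation `Θ` already has the right action on cohomology, so only the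
  -- deviation is averaged. It lies in the stable space of homologically trivial cochains, hence its
  -- average does too.
  set S := F - Θ with hSdef
  have hS : IsCochain D D 1 S := hF.sub hΘc
  have hS' : S ∈ homologicallyTrivial D := by
    refine ⟨by simp [hSdef, hΘ, hF0, unary_nil], fun s z hz hd => ?_⟩
    rw [hSdef, Pi.sub_apply, hΘ1 s z hz]
    exact hF1 s z hz hd
  choose A hAU hA0 hAd using fun N => (hU N).exists_invariant_add hred (hUt N S hS hS')
  -- Both sides are invariant and congruent to the same truncation of `S` modulo derivatives; an
  -- invariant combination of derivatives is zero.
  have hcompat : ∀ N N', N' ≤ N → trunc K N' (A N) = A N' := by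
    intro N N' hN
    have h1 : trunc K N' (trunc K N S - A N) ∈ derivSpan a (U N') :=
      derivSpan_map (U := U N) (U' := U N') (trunc K N') (fun T hT => hUt N' T hT.1.1 hT.2)
        (fun X T _ => (infAct_trunc N' (a X) T).symm) (hAd N)
    rw [map_sub, trunc_trunc hN] at h1
    have h2 := (hU N').eq_zero hred (T := trunc K N' (A N) - A N')
      (fun X => by rw [map_sub, infAct_trunc, hA0, hA0, map_zero, sub_zero]) (by
        have := sub_mem (hAd N') h1
        rwa [sub_sub_sub_cancel_left] at this)
    exact sub_eq_zero.1 h2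
  -- The averages of the truncations glue: a word is evaluated at the first truncation that contains
  -- it.
  set B : Word V → V := fun l => A (max l.length (Word.weight l)) l with hB
  have hBA : ∀ N, trunc K N B = A N := by
    intro N
    funext l
    by_cases hl : Low N l
    · rw [trunc_of_low hl]
      simp only [hB]
      rw [← hcompat N _ (max_le hl.1 hl.2), trunc_of_low ⟨le_max_left _ _, le_max_right _ _⟩]
    · rw [trunc_of_not_low hl, ← (hAU N).1.2, trunc_of_not_low hl]
  have hBc : IsCochain D D 1 B := isCochain_of_trunc fun N => by
    rw [hBA]
    exact (hAU N).1.1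
  have hB0 : ∀ X, infAct (a X) B = 0 := fun X => eq_of_forall_trunc (K := K) fun N => by
    rw [← infAct_trunc, hBA, hA0, map_zero]
  have hBt : B ∈ homologicallyTrivial D :=
    ⟨(hAU _).2.1, fun s z hz hd => (hAU _).2.2 s z hz hd⟩
  have hinv : ∀ X, infAct (a X) (Θ + B) = 0 := fun X => by
    rw [map_add, hB0, infAct_unary_eulerMap (h.derivation X).graded, add_zero]
  refine ⟨Θ + B, hΘc.add hBc, by simp [hΘ, unary_nil, hBt.1], ?_, hinv, fun s z hz hd => ?_⟩
  · have hdec : codiffComm D (Θ + B) = codiffComm D (B - S) := by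
      have : Θ + B = F + (B - S) := by rw [hSdef]; abel
      rw [this, codiffComm_add, hcomm, zero_add]
    refine eq_of_forall_trunc (K := K) fun N => ?_
    rw [map_zero]
    -- The obstruction is invariant because `Θ + B` is, and it is a combination of derivatives
    -- because it is the image of `B - S` under a map commuting with the infinitesimal action. Hence
    -- it vanishes.
    refine (h.isAveragingSpace_boundedCochains hD 2 N).eq_zero hred (fun X => ?_) ?_
    · rw [infAct_trunc, infAct_codiffComm (h.derivation X) (hΘc.add hBc), hinv,
        ← codiffCommLin_apply, map_zero, map_zero]
    · have h1 : trunc K N (codiffComm D (B - S)) =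
          trunc K N (codiffComm D (trunc K (N + 1) (B - S))) := by
        have h2 := trunc_codiffComm hD (f := B - S - trunc K (N + 1) (B - S)) (N := N)
          ((hBc.sub hS).sub ((hBc.sub hS).trunc _)) (by
            rw [map_sub, trunc_trunc le_rfl, sub_self])
        rw [← codiffCommLin_apply, map_sub, map_sub, sub_eq_zero] at h2
        exact h2
      rw [hdec, h1]
      have h3 : trunc K (N + 1) (B - S) ∈ derivSpan a (U (N + 1)) := by
        rw [map_sub, hBA, ← neg_sub]
        exact neg_mem (hAd (N + 1))
      exact derivSpan_map (U := U (N + 1)) (U' := boundedCochains D 2 N) (trunc K N ∘ₗ codiffCommLin D)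
        (fun T hT => ⟨hT.1.1.codiffComm.trunc N, trunc_trunc le_rfl _⟩)
        (fun X T hT => by
          rw [LinearMap.comp_apply, LinearMap.comp_apply, infAct_trunc, codiffCommLin_apply,
            codiffCommLin_apply, infAct_codiffComm (h.derivation X) hT.1.1]) h3
  · rw [Pi.add_apply, hΘ1 s z hz, add_sub_cancel_left]
    exact hBt.2 s z hz hd

end Invariant

/-! ## Retractions onto subalgebras in positive degree -/

section Retract

variable {K : Type v} [Field K] {V M : Type u} [AddCommGroup V] [Module K V]
  [AddCommGroup M] [Module K M]

/-- A morphism of DG Lie algebras `M → V` with a retraction of complexes, where `M` is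
concentrated in positive degrees and `V`, up to boundaries of degree one, agrees with it in
positive degrees. -/
structure PositiveRetract (D : DGLieAlgebra K V) (E : DGLieAlgebra K M) where
  incl : M →ₗ[K] V
  pr : V →ₗ[K] M
  incl_graded : IsGraded E D 0 incl
  pr_graded : IsGraded D E 0 pr
  incl_d : ∀ x, incl (E.d x) = D.d (incl x)
  pr_d : ∀ x, pr (D.d x) = E.d (pr x)
  pr_incl : ∀ x, pr (incl x) = x
  incl_bracket : ∀ x y, incl (E.bracket x y) = D.bracket (incl x) (incl y)
  deg_nonpos : ∀ i ≤ 0, E.deg i = ⊥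
  sub_mem : ∀ i, 1 ≤ i → ∀ x ∈ D.deg i, x - incl (pr x) ∈ D.boundaries
  eq_of_two_le : ∀ i, 2 ≤ i → ∀ x ∈ D.deg i, incl (pr x) = x

namespace PositiveRetract

variable {D : DGLieAlgebra K V} {E : DGLieAlgebra K M} (R : PositiveRetract D E)

theorem pr_eq_zero {i : ℤ} (hi : i ≤ 0) {x : V} (hx : x ∈ D.deg i) : R.pr x = 0 := by
  have := R.pr_graded i x hx
  rwa [add_zero, R.deg_nonpos i hi, Submodule.mem_bot] at this

theorem exists_of_mem_boundaries {i : ℤ} {x : V} (hx : x ∈ D.deg i) (hb : x ∈ D.boundaries) :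
    ∃ y ∈ D.deg (i - 1), D.d y = x := by
  obtain ⟨y, rfl⟩ := hb
  refine ⟨D.proj (i - 1) y, D.proj_mem _ _, ?_⟩
  rw [← D.proj_d, sub_add_cancel, D.proj_same hx]

theorem incl_pr_mem {i : ℤ} {x : V} (hx : x ∈ D.deg i) : R.incl (R.pr x) ∈ D.deg i := by
  have := R.incl_graded _ _ (R.pr_graded _ _ hx)
  simpa using this

/-- Endomorphisms of the complex `V` induce compatible endomorphisms of `M`. -/
theorem pr_comp_incl_pr {A : V →ₗ[K] V} (hA : IsGraded D D 0 A) (hd : ∀ x, A (D.d x) = D.d (A x))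
    (x : V) : R.pr (A (R.incl (R.pr x))) = R.pr (A x) := by
  refine linearMap_ext_deg (D := D) (a := R.pr ∘ₗ A ∘ₗ R.incl ∘ₗ R.pr) (b := R.pr ∘ₗ A) ?_ x
  intro i x hx
  simp only [LinearMap.comp_apply]
  have hA' : ∀ {j : ℤ} {y : V}, y ∈ D.deg j → A y ∈ D.deg j := fun hy => by
    simpa using hA _ _ hy
  rcases le_or_gt i 0 with h | h
  · rw [R.pr_eq_zero h (hA' hx), R.pr_eq_zero h (hA' (R.incl_pr_mem hx))]
  · rcases eq_or_lt_of_le (show 1 ≤ i by omega) with rfl | h2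
    -- In degree one the difference is `d y` with `y` of degree zero; `A` commutes with `d`, and
    -- `pr` kills degree zero.
    · obtain ⟨y, hy, hyx⟩ := exists_of_mem_boundaries (Submodule.sub_mem _ hx (R.incl_pr_mem hx))
        (R.sub_mem 1 le_rfl x hx)
      have h3 : R.pr (A (x - R.incl (R.pr x))) = 0 := by
        rw [← hyx, hd, R.pr_d, R.pr_eq_zero (i := 0) le_rfl (hA' (by simpa using hy)), map_zero]
      rw [map_sub, map_sub, sub_eq_zero] at h3
      exact h3.symm
    · rw [R.eq_of_two_le i (by omega) x hx]

theorem proj_incl (i : ℤ) (x : M) : D.proj i (R.incl x) = R.incl (E.proj i x) := by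
  simpa using R.incl_graded.proj i x

theorem incl_injective : Function.Injective R.incl := fun x y h => by
  rw [← R.pr_incl x, h, R.pr_incl]

variable {n : ℕ} {G : Subgroup (GL (Fin n) K)} {ρ : Representation K G V}

/-- The induced action on `M`. -/
def inducedRep (hρ : IsDGLieAction D ρ) : Representation K G M where
  -- The operator `ρ g` may move the image of `M`, so it is compressed; `pr_comp_incl_pr` makes the
  -- compression multiplicative.
  toFun g := R.pr ∘ₗ ρ g ∘ₗ R.incl
  map_one' := by
    ext x
    simp [R.pr_incl]
  map_mul' g k := by
    ext x
    have := R.pr_comp_incl_pr (A := ρ g) (fun i x hx => by simpa using hρ.map_deg g hx)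
      (hρ.map_d g) (ρ k (R.incl x))
    simpa using this.symm

theorem inducedRep_apply (hρ : IsDGLieAction D ρ) (g : G) (x : M) :
    R.inducedRep hρ g x = R.pr (ρ g (R.incl x)) := rfl

theorem isDerivation_bracket {ξ : V} (h0 : ξ ∈ D.deg 0) (hd : D.d ξ = 0) :
    IsDerivation D (D.bracket ξ) where
  graded i x hx := by simpa [add_comm] using D.bracket_mem h0 hx
  comm_d x := by
    have := D.leibniz x h0
    simpa [hd] using this.symm
  leibniz x y := by
    refine linearMap_ext_deg (D := D) (a := D.bracket ξ ∘ₗ D.bracket.flip y)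
      (b := D.bracket.flip y ∘ₗ D.bracket ξ + D.bracket.flip (D.bracket ξ y)) ?_ x
    intro i x hx
    simpa using D.jacobi y h0 hx

/-- The endomorphism of `M` induced by an endomorphism of `V`. -/
def compress : (V →ₗ[K] V) →ₗ[K] (M →ₗ[K] M) where
  toFun A := R.pr ∘ₗ A ∘ₗ R.incl
  map_add' A B := by ext; simp
  map_smul' c A := by ext; simp

theorem compress_apply (A : V →ₗ[K] V) (x : M) : R.compress A x = R.pr (A (R.incl x)) := rfl

theorem isDerivation_compress {A : V →ₗ[K] V} (hA : IsDerivation D A)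
    (hinv : ∀ x, ∃ y, A (R.incl x) = R.incl y) : IsDerivation E (R.compress A) where
  graded i x hx := by
    have := R.pr_graded _ _ (hA.graded _ _ (R.incl_graded _ _ hx))
    simpa [compress_apply] using this
  comm_d x := by
    rw [compress_apply, R.incl_d, hA.comm_d, R.pr_d, compress_apply]
  leibniz x y := by
    have h : ∀ x, R.incl (R.compress A x) = A (R.incl x) := fun x => by
      obtain ⟨y, hy⟩ := hinv x
      rw [compress_apply, hy, R.pr_incl]
    apply R.incl_injective
    rw [h, map_add, R.incl_bracket, R.incl_bracket, R.incl_bracket, h, h, hA.leibniz]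

/-- Compression is linear and carries the derivative along. The compressed bracket with `ζ X` is a
derivation because that bracket preserves the image of `incl`. -/
theorem isRegularAction_inducedRep (hρ : IsDGLieAction D ρ) {ζ : lieAlgebraOf G → V}
    (hζ : ∀ X, ζ X ∈ D.deg 0) (hζd : ∀ X, D.d (ζ X) = 0)
    (hinv : ∀ X x, ∃ y, D.bracket (ζ X) (R.incl x) = R.incl y)
    (ht : ∀ i, HasTangent (fun g => ρ g ∘ₗ D.proj i) fun X => D.bracket (ζ X) ∘ₗ D.proj i) :
    IsRegularAction E (R.inducedRep hρ) fun X => R.compress (D.bracket (ζ X)) where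
  graded g i x hx := by
    have := R.pr_graded _ _ (hρ.map_deg g (R.incl_graded _ _ hx))
    simpa [inducedRep_apply] using this
  comm_d g x := by
    rw [inducedRep_apply, R.incl_d, hρ.map_d, R.pr_d, inducedRep_apply]
  tangent i := by
    have h := (ht i).map R.compress
    convert h using 1
    · funext g
      ext x
      simp [inducedRep_apply, compress_apply, R.proj_incl]
    · funext X
      ext x
      simp [compress_apply, R.proj_incl]
  derivation X := R.isDerivation_compress (isDerivation_bracket (hζ X) (hζd X)) (hinv X)

end PositiveRetract

end Retract

/-! ### The derivative of the given action and the invariant complement. -/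

section Tangent

variable {K : Type v} [Field K] {V : Type u} [AddCommGroup V] [Module K V]
  {D : DGLieAlgebra K V} {n : ℕ} {G : Subgroup (GL (Fin n) K)} {ρ : Representation K G V}

/-- Finite support expands the action in a fixed degree as a finite sum of regular functions times
endomorphisms, so it has a derivative as a map to endomorphisms; linear functionals identify it with
`a X`. -/
theorem hasTangent_of_isInfinitesimalAction (hred : IsLinearlyReductive G)
    (hρ : IsDGLieAction D ρ) {i : ℤ} (hrat : IsRationalRep (hρ.onDeg i))
    (hfin : IsFinitelySupported (hρ.onDeg i)) {a : lieAlgebraOf G → V →ₗ[K] V}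
    (ha : ∀ X x, IsInfinitesimalAction ρ X x (a X x)) :
    HasTangent (fun g => ρ g ∘ₗ D.proj i) fun X => a X ∘ₗ D.proj i := by
  obtain ⟨m, c, A, hA⟩ := exists_regular_expansion hred hrat hfin
  let π : V →ₗ[K] D.deg i := (D.proj i).codRestrict (D.deg i) (D.proj_mem i)
  let ψ : (D.deg i →ₗ[K] D.deg i) →ₗ[K] (V →ₗ[K] V) :=
    { toFun := fun B => (D.deg i).subtype ∘ₗ B ∘ₗ π
      map_add' := fun B B' => by ext; simp
      map_smul' := fun r B => by ext; simp }
  have h := (HasTangent.sum Finset.univ fun k _ => hasTangent_smul_const (c k) (A k)).map ψ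
  have h1 : (fun g => ψ (∑ k, (c k : G → K) g • A k)) = fun g => ρ g ∘ₗ D.proj i := by
    funext g
    rw [← hA]
    rfl
  rw [h1] at h
  convert h using 1
  funext X
  ext x
  rw [← sub_eq_zero, ← Module.forall_dual_apply_eq_zero_iff K]
  intro φ
  obtain ⟨f, hf, hf'⟩ := h.functional (φ ∘ₗ LinearMap.applyₗ x)
  have h2 := ha X (D.proj i x) φ f fun g => hf g
  have h3 := hf' X
  rw [map_sub, sub_eq_zero]
  exact h2.symm.trans h3

/-- There is a complement of the boundaries of degree one stable under the Lie algebra. -/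
theorem exists_isComplementOfB1 (hred : IsLinearlyReductive G) (hρ : IsDGLieAction D ρ)
    (hrat : IsRationalRep (hρ.onDeg 1)) {a : lieAlgebraOf G → V →ₗ[K] V}
    (ht : HasTangent (fun g => ρ g ∘ₗ D.proj 1) fun X => a X ∘ₗ D.proj 1) :
    ∃ K₁ : Submodule K V, D.IsComplementOfB1 K₁ ∧ ∀ X, ∀ x ∈ K₁, a X x ∈ K₁ := by
  obtain ⟨C, hC, hinf, hsup⟩ := exists_invariant_complement hred hrat
    (D.boundaries.comap (D.deg 1).subtype) (by
      rintro g x ⟨y, hy⟩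
      exact ⟨ρ g y, by rw [← hρ.map_d, hy]; rfl⟩)
  have hW : D.boundaries ⊓ D.deg 1 = (D.boundaries.comap (D.deg 1).subtype).map
      (D.deg 1).subtype := by
    rw [Submodule.map_comap_subtype, inf_comm]
  refine ⟨C.map (D.deg 1).subtype, ⟨?_, ?_⟩, ?_⟩
  · rw [hW, ← Submodule.map_inf _ (Submodule.injective_subtype _), hinf, Submodule.map_bot]
  · rw [hW, ← Submodule.map_sup, hsup, Submodule.map_top, Submodule.range_subtype]
  · rintro X _ ⟨x, hx, rfl⟩
    have h := (ht.map (LinearMap.applyₗ (x : V))).mem (U := C.map (D.deg 1).subtype) (fun g => by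
      refine ⟨hρ.onDeg 1 g x, hC g x hx, ?_⟩
      simp only [LinearMap.applyₗ_apply_apply, LinearMap.comp_apply, D.proj_same x.2]
      rfl) X
    simpa [D.proj_same x.2] using h

end Tangent

/-! ### Extending an invariant Euler coderivation from `K` to `L`. -/

section Extension

variable {K : Type v} [Field K] {V M : Type u} [AddCommGroup V] [Module K V]
  [AddCommGroup M] [Module K M] {D : DGLieAlgebra K V} {E : DGLieAlgebra K M}

theorem IsSymm.eq_zero_of_head {W : Type u} [AddCommGroup W] [Module K W]
    {f : Word V → W} (hf : IsSymm K f) {x : ℤ × V} (h : ∀ l, f (x :: l) = 0) (p q : Word V) :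
    f (p ++ x :: q) = 0 := by
  induction p using List.reverseRecOn generalizing q with
  | nil => exact h q
  | append_singleton p y ih =>
    have := hf p y x q
    rw [List.append_assoc, List.singleton_append, this, ih, smul_zero]

/-- The label `-1` denotes degree zero. The linear part of `Q` vanishes on a cycle, and the
quadratic part becomes the inner derivation. -/
theorem contr_codiff {ξ : V} (h0 : ξ ∈ D.deg 0) (hd : D.d ξ = 0) :
    contr (-1, ξ) (codiff D) = unary D (D.bracket ξ) := by
  have hp : D.proj (-1 + 1) ξ = ξ := D.proj_same (by simpa using h0)
  funext l
  rw [contr_apply]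
  match l with
  | [] => rw [codiff_single, hp, hd, unary_nil, neg_zero]
  | [x] => rw [codiff_pair, hp, unary_single]; simp
  | x :: y :: l => rw [codiff_three, unary_cons_cons]

/-- The obstruction for commutation with the codifferential, evaluated on a cycle of degree zero
that is annihilated by the cochain, is the infinitesimal action of the cycle. -/
theorem contr_codiffComm {ξ : V} (h0 : ξ ∈ D.deg 0) (hd : D.d ξ = 0) {F : Word V → V}
    (hF : IsCochain D D 1 F) (hξ : contr (-1, ξ) F = 0) :
    contr (-1, ξ) (codiffComm D F) = -infAct (D.bracket ξ) F := by
  have hg := (PositiveRetract.isDerivation_bracket h0 hd).graded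
  have hF' : IsCochain D D (0 + 1) F := by simpa using hF
  rw [codiffComm, contr_sub, contr_comp, contr_comp, contr_codiff h0 hd, hξ, comp_zero_left,
    comp_zero_right _ isCochain_codiff.lin]
  funext l
  simp only [Pi.sub_apply, Pi.neg_apply, smul_zero,
    add_zero, zero_add, zero_mul, sgn_zero, one_smul]
  rw [comp_unary_left hF', infAct_apply]
  rw [show (1 : ℤ) + -1 = 0 by norm_num, comp_unary hF hg, neg_sub]

namespace PositiveRetract

variable (R : PositiveRetract D E)

/-- The extension of a cochain of `M` to `V`. -/
def extend (F : Word M → M) : Word V → V := fun l => R.incl (F (mapWord R.pr l))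

theorem extend_apply (F : Word M → M) (l : Word V) :
    R.extend F l = R.incl (F (mapWord R.pr l)) := rfl

theorem isCochain_extend {k : ℤ} {F : Word M → M} (hF : IsCochain E E k F) :
    IsCochain D D k (R.extend F) := by
  have := (hF.pull R.pr_graded).map R.incl_graded
  rwa [add_zero] at this

theorem mapWord_pr_incl (l : Word M) : mapWord R.pr (mapWord R.incl l) = l := by
  rw [mapWord_mapWord]
  simp [mapWord, R.pr_incl]

theorem codiff_mapWord (l : Word M) : codiff D (mapWord R.incl l) = R.incl (codiff E l) := by
  match l with
  | [] => simp [codiff]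
  | [x] => simp [codiff, R.proj_incl, R.incl_d]
  | [x, y] => simp [codiff, R.proj_incl, R.incl_bracket]
  | x :: y :: z :: l => simp [codiff]

/-- Along the DG Lie morphism `incl`, the codifferential restricts to that of `M` and the extension
to `F`. -/
theorem codiffComm_mapWord {F : Word M → M} (hF : codiffComm E F = 0) (l : Word M) :
    codiffComm D (R.extend F) (mapWord R.incl l) = 0 := by
  have h1 : ∀ l, R.extend F (mapWord R.incl l) = R.incl (F l) := fun l => by
    rw [extend_apply, R.mapWord_pr_incl]
  have h2 : pull R.incl (R.extend F) = fun l => R.incl (F l) := funext h1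
  have h3 : pull R.incl (codiff D) = fun l => R.incl (codiff E l) := funext R.codiff_mapWord
  rw [codiffComm, Pi.sub_apply, comp_pull 1 R.incl _ R.codiff_mapWord, comp_pull 0 R.incl _ h1,
    h2, h3, ← map_comp, ← map_comp, ← map_sub]
  have := congrFun hF l
  rw [codiffComm, Pi.sub_apply] at this
  rw [this]
  simp

theorem infAct_extend {A : V →ₗ[K] V} (hA : IsDerivation D A)
    (hinv : ∀ x, ∃ y, A (R.incl x) = R.incl y) {F : Word M → M}
    (hF : infAct (R.compress A) F = 0) : infAct A (R.extend F) = 0 := by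
  funext l
  have h1 : ∀ x, R.incl (R.compress A x) = A (R.incl x) := fun x => by
    obtain ⟨y, hy⟩ := hinv x
    rw [compress_apply, hy, R.pr_incl]
  have h2 : der K 0 A (R.extend F) l = R.incl (der K 0 (R.compress A) F (mapWord R.pr l)) := by
    rw [← der_pull 0 (R.compress A) A R.pr (fun x => by
      rw [compress_apply, R.pr_comp_incl_pr hA.graded hA.comm_d])]
    have : ∀ (G : Word V → M) (l : Word V),
        der K 0 A (fun l => R.incl (G l)) l = R.incl (der K 0 A G l) := by
      intro G l
      induction l generalizing G with
      | nil => simp [der]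
      | cons x l ih =>
        have := ih (contr x G)
        simp only [der, map_add, map_smul, ← this]
        rfl
    exact this _ _
  rw [infAct_apply, h2, extend_apply, ← h1, ← map_sub]
  have := congrFun hF (mapWord R.pr l)
  rw [infAct_apply] at this
  rw [this]
  simp

variable {H : Type u} [AddCommGroup H] [Module K H] {E' : DGLieAlgebra K H}

/-- A contraction onto a graded Lie algebra, with a section in degree zero, together with an
invariant Euler coderivation of `M`, gives an Euler coderivation of `V`. -/
theorem exists_eulerData (C : Contraction D E')
    (hC : ∀ z z', D.d z = 0 → D.d z' = 0 → C.p (D.bracket z z') = E'.bracket (C.p z) (C.p z'))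
    (hneg : ∀ i < 0, E'.deg i = ⊥) (σ : H →ₗ[K] V) (hσ : ∀ c ∈ E'.deg 0, σ c ∈ D.deg 0)
    (hσd : ∀ c ∈ E'.deg 0, D.d (σ c) = 0) (hpσ : ∀ c ∈ E'.deg 0, C.p (σ c) = c)
    (hσb : ∀ c ∈ E'.deg 0, ∀ c' ∈ E'.deg 0, σ (E'.bracket c c') = D.bracket (σ c) (σ c'))
    (hinv : ∀ c ∈ E'.deg 0, ∀ x, ∃ y, D.bracket (σ c) (R.incl x) = R.incl y)
    {F : Word M → M} (hF : IsCochain E E 1 F) (hF0 : F [] = 0) (hcomm : codiffComm E F = 0)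
    (hFinv : ∀ c ∈ E'.deg 0, infAct (R.compress (D.bracket (σ c))) F = 0)
    (hF1 : ∀ (s : ℤ) (z : M), z ∈ E.deg (s + 1) → E.d z = 0 →
      F [(s, z)] - ((s + 1 : ℤ) : K) • z ∈ E.boundaries) :
    Nonempty (EulerData D E') := by
  have hpg : ∀ i x, x ∈ D.deg i → C.p x ∈ E'.deg i := fun i x hx => by
    simpa using C.p_graded i x hx
  -- The image of `r` is the sum of the image of `M` and of the chosen cycles representing the
  -- cohomology of degree zero.
  let r : V →ₗ[K] V := R.incl ∘ₗ R.pr + σ ∘ₗ C.p ∘ₗ D.proj 0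
  have hr : ∀ x, r x = R.incl (R.pr x) + σ (C.p (D.proj 0 x)) := fun _ => rfl
  have hr0 : ∀ x ∈ D.deg 0, r x = σ (C.p x) := fun x hx => by
    rw [hr, R.pr_eq_zero le_rfl hx, map_zero, zero_add, D.proj_same hx]
  have hrn : ∀ i x, x ∈ D.deg i → i ≠ 0 → r x = R.incl (R.pr x) := fun i x hx hi => by
    rw [hr, D.proj_ne hi hx, map_zero, map_zero, add_zero]
  have hrσ : ∀ c ∈ E'.deg 0, r (σ c) = σ c := fun c hc => by
    rw [hr0 _ (hσ c hc), hpσ c hc]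
  have hri : ∀ x, r (R.incl x) = R.incl x := fun x => by
    have h1 : E.proj 0 x = 0 := by
      have := E.proj_mem 0 x
      rwa [R.deg_nonpos 0 le_rfl, Submodule.mem_bot] at this
    rw [hr, R.pr_incl, R.proj_incl, h1]
    simp
  have hcases : ∀ x, ∃ m, ∃ c ∈ E'.deg 0, r x = R.incl m + σ c := fun x =>
    ⟨R.pr x, C.p (D.proj 0 x), hpg 0 _ (D.proj_mem 0 x), hr x⟩
  have hrg : IsGraded D D 0 r := by
    intro i x hx
    rw [add_zero]
    by_cases hi : i = 0
    · subst hi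
      rw [hr0 x hx]
      exact hσ _ (hpg 0 x hx)
    · rw [hrn i x hx hi]
      exact R.incl_pr_mem hx
  have hrd : ∀ x, r (D.d x) = D.d (r x) := by
    refine linearMap_ext_deg (D := D) (a := r ∘ₗ D.d) (b := D.d ∘ₗ r) ?_
    intro i x hx
    simp only [LinearMap.comp_apply]
    have h1 : σ (C.p (D.proj 0 (D.d x))) = 0 := by
      have := D.proj_d (-1) x
      rw [show (-1 : ℤ) + 1 = 0 by norm_num] at this
      rw [this, C.p_d, map_zero]
    have h2 : D.d (σ (C.p (D.proj 0 x))) = 0 := hσd _ (hpg 0 _ (D.proj_mem 0 x))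
    rw [hr, hr, h1, map_add, h2, R.pr_d, R.incl_d]
  have hrr : ∀ x, r (r x) = r x := fun x => by
    obtain ⟨m, c, hc, h⟩ := hcases x
    rw [h, map_add, hri, hrσ c hc]
  have hinv' : ∀ c ∈ E'.deg 0, ∀ x, ∃ y, D.bracket (R.incl x) (σ c) = R.incl y := by
    intro c hc x
    refine E.induction_deg (P := fun x => ∃ y, D.bracket (R.incl x) (σ c) = R.incl y) ?_
      ⟨0, by simp⟩ ?_ x
    · intro i x hx
      obtain ⟨y, hy⟩ := hinv c hc x
      refine ⟨-y, ?_⟩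
      have h1 : R.incl x ∈ D.deg i := by simpa using R.incl_graded i x hx
      rw [D.bracket_skew h1 (hσ c hc), hy]
      simp
    · rintro x x' ⟨y, hy⟩ ⟨y', hy'⟩
      exact ⟨y + y', by simp [hy, hy']⟩
  have hrb : ∀ x y, r (D.bracket (r x) (r y)) = D.bracket (r x) (r y) := by
    intro x y
    obtain ⟨m, c, hc, h⟩ := hcases x
    obtain ⟨m', c', hc', h'⟩ := hcases y
    obtain ⟨y1, h1⟩ := hinv c hc m'
    obtain ⟨y2, h2⟩ := hinv' c' hc' m
    have h3 : E'.bracket c c' ∈ E'.deg 0 := by simpa using E'.bracket_mem hc hc'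
    simp only [h, h', map_add, LinearMap.add_apply, h1, h2, ← R.incl_bracket, ← hσb c hc c' hc',
      hri, hrσ _ h3]
  have hpr : ∀ i, ∀ z ∈ D.deg i, D.d z = 0 → C.p (r z) = C.p z := by
    intro i z hz hd
    rcases lt_trichotomy i 0 with hi | rfl | hi
    · have h1 := hpg i z hz
      have h2 : C.p (r z) ∈ E'.deg i := by
        have := hpg _ _ (hrg i z hz)
        rwa [add_zero] at this
      rw [hneg i hi, Submodule.mem_bot] at h1 h2
      rw [h1, h2]
    · rw [hr0 z hz, hpσ _ (hpg 0 z hz)]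
    · rw [hrn i z hz (by omega)]
      obtain ⟨y, hy⟩ := R.sub_mem i (by omega) z hz
      have := C.p_d y
      rw [hy, map_sub, sub_eq_zero] at this
      exact this.symm
  have hprr : ∀ x, R.pr (r x) = R.pr x := fun x => by
    rw [hr, map_add, R.pr_incl, R.pr_eq_zero le_rfl (hσ _ (hpg 0 _ (D.proj_mem 0 x))), add_zero]
  have hFc := R.isCochain_extend hF
  have hT := hFc.codiffComm
  -- The extension vanishes when a letter `σ c` is inserted, because `pr` kills degree zero. By
  -- `contr_codiffComm` the obstruction is then, up to sign, the infinitesimal action, which is zero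
  -- by invariance.
  have hhead : ∀ c ∈ E'.deg 0, ∀ l, codiffComm D (R.extend F) ((-1, σ c) :: l) = 0 := by
    intro c hc l
    have hder := isDerivation_bracket (hσ c hc) (hσd c hc)
    have h1 : contr (-1, σ c) (R.extend F) = 0 := by
      funext m
      rw [contr_apply, extend_apply, mapWord_cons, R.pr_eq_zero le_rfl (hσ c hc)]
      have := hF.lin.map_zero [] (-1) (mapWord R.pr m)
      rw [List.nil_append] at this
      rw [this]
      simp
    have h2 := contr_codiffComm (hσ c hc) (hσd c hc) hFc h1
    rw [R.infAct_extend hder (hinv c hc) (hFinv c hc), neg_zero] at h2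
    exact congrFun h2 l
  have hmain : ∀ l, codiffComm D (R.extend F) (mapWord r l) = 0 := by
    intro l
    have hpl : ∀ i x, D.proj i (r x) = r (D.proj i x) := fun i x => by simpa using hrg.proj i x
    -- A letter of degree zero is brought to the front by symmetry; without such letters the whole
    -- word comes from `M`.
    by_cases hl : ∃ x ∈ l, x.1 = -1
    · obtain ⟨⟨s, x⟩, hx, rfl : s = -1⟩ := hl
      obtain ⟨p, q, rfl⟩ := List.append_of_mem hx
      rw [mapWord_append, mapWord_cons, hT.proj]
      simp only [neg_add_cancel]
      rw [hpl, hr0 _ (D.proj_mem 0 x)]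
      exact IsSymm.eq_zero_of_head hT.symm (hhead _ (hpg 0 _ (D.proj_mem 0 x))) _ _
    · rw [hT.apply_proj]
      have h1 : (mapWord r l).map (fun x => (x.1, D.proj (x.1 + 1) x.2)) =
          mapWord R.incl (l.map fun x => (x.1, R.pr (D.proj (x.1 + 1) x.2))) := by
        simp only [mapWord, List.map_map]
        refine List.map_congr_left fun x hx => ?_
        simp only [Function.comp_apply]
        rw [hpl, hrn _ _ (D.proj_mem _ _) fun h => hl ⟨x, hx, by omega⟩]
      rw [h1]
      exact R.codiffComm_mapWord hcomm _
  refine ⟨{ toContraction := C, p_bracket := hC, r := r, r_graded := hrg, r_d := hrd, r_r := hrr,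
            r_bracket := hrb, p_r := ?_, F := R.extend F, F_cochain := hFc, F_nil := ?_,
            F_comm := ?_, F_single := ?_ }⟩
  · intro z hz
    exact D.cycles_induction (P := fun z => C.p (r z) = C.p z)
      (fun i x hx hxi => hpr i x hxi hx) (by simp)
      (fun x y hx hy => by simp only [map_add, hx, hy]) hz
  · rw [extend_apply, mapWord_nil, hF0, map_zero]
  · intro l
    have := hmain l
    rwa [codiffComm, Pi.sub_apply, sub_eq_zero] at this
  · intro s z hz hd
    rw [extend_apply, mapWord_cons, mapWord_nil, hprr]
    rcases le_or_gt (s + 1) 0 with hs | hs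
    · have h1 := hF.lin.map_zero [] s []
      rw [List.nil_append] at h1
      -- In nonpositive degrees the extension gives zero, as it should: either the factor `s + 1` is
      -- zero or the cohomology is.
      rw [R.pr_eq_zero hs hz, h1, map_zero, map_zero]
      rcases eq_or_lt_of_le hs with h | h
      · rw [h]; simp
      · have h2 := hpg _ z hz
        rw [hneg _ h, Submodule.mem_bot] at h2
        rw [h2, smul_zero]
    · obtain ⟨y, hy⟩ := hF1 s (R.pr z) (by simpa using R.pr_graded _ _ hz)
        (by rw [← R.pr_d, hd, map_zero])
      obtain ⟨w, hw⟩ := R.sub_mem (s + 1) (by omega) z hz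
      have h1 := C.p_d w
      have h2 := C.p_d (R.incl y)
      rw [← R.incl_d, hy, map_sub, map_smul, map_sub, map_smul, sub_eq_zero] at h2
      rw [hw, map_sub, sub_eq_zero] at h1
      rw [h2, h1]

end PositiveRetract

end Extension

/-! ### The two implications for a positive retract. -/

section Descent

variable {K : Type v} [Field K] {V M : Type u} [AddCommGroup V] [Module K V]
  [AddCommGroup M] [Module K M] {D : DGLieAlgebra K V} {E : DGLieAlgebra K M}

theorem eq_zero_of_forall_proj {x : V} (h : ∀ i, D.proj i x = 0) : x = 0 := by
  have := D.mem_iSup_inf_of_proj_mem (P := ⊥) (x := x) fun i => by simp [h i]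
  simpa using this

theorem mk_mem_cohomologyDeg {i : ℤ} {z : D.cycles} (hz : (z : V) ∈ D.deg i) :
    (Submodule.Quotient.mk z : D.H) ∈ D.cohomology.deg i := ⟨z, hz, rfl⟩

theorem exists_of_mem_cohomologyDeg {i : ℤ} {c : D.H} (hc : c ∈ D.cohomology.deg i) :
    ∃ z : D.cycles, (z : V) ∈ D.deg i ∧ Submodule.Quotient.mk z = c := by
  obtain ⟨z, hz, rfl⟩ := hc
  exact ⟨z, hz, rfl⟩

variable (D) in
/-- A contraction onto the cohomology that sends cycles to their classes. -/
theorem exists_class_contraction : ∃ C : Contraction D D.cohomology,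
    ∀ z : D.cycles, C.p z = Submodule.Quotient.mk z := by
  -- The class map on cycles is extended arbitrarily to the whole space and then replaced by its
  -- part of degree zero.
  obtain ⟨p₀, hp₀⟩ := LinearMap.exists_extend D.boundariesInCycles.mkQ
  have hp₀' : ∀ z : D.cycles, p₀ z = Submodule.Quotient.mk z := fun z => LinearMap.congr_fun hp₀ z
  have hp : ∀ z : V, z ∈ D.cycles → ∃ hz : z ∈ D.cycles,
      gradedPart D D.cohomology 0 p₀ z = Submodule.Quotient.mk ⟨z, hz⟩ := by
    intro z hz
    refine D.cycles_induction (P := fun z => ∃ hz : z ∈ D.cycles,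
      gradedPart D D.cohomology 0 p₀ z = Submodule.Quotient.mk ⟨z, hz⟩) ?_ ?_ ?_ hz
    · intro i x hx hxi
      refine ⟨hx, ?_⟩
      rw [gradedPart_apply D D.cohomology 0 p₀ hxi, add_zero, hp₀' ⟨x, hx⟩]
      exact D.cohomology.proj_same (mk_mem_cohomologyDeg hxi)
    · exact ⟨zero_mem _, by rw [map_zero]; rfl⟩
    · rintro x y ⟨hx, hx'⟩ ⟨hy, hy'⟩
      exact ⟨add_mem hx hy, by rw [map_add, hx', hy']; rfl⟩
  have hp' : ∀ z : D.cycles, gradedPart D D.cohomology 0 p₀ z = Submodule.Quotient.mk z :=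
    fun z => (hp z z.2).2
  obtain ⟨C, hC⟩ := exists_contraction (D := D) (E := D.cohomology)
    (gradedPart D D.cohomology 0 p₀) (isGraded_gradedPart _ _ _ _)
    (fun x => by
      rw [hp' ⟨D.d x, D.d_d x⟩]
      exact (Submodule.Quotient.mk_eq_zero _).2 ⟨x, rfl⟩)
    (fun z hz h => by
      rw [hp' ⟨z, hz⟩] at h
      exact (Submodule.Quotient.mk_eq_zero _).1 h)
    (fun w => by
      obtain ⟨z, rfl⟩ := Submodule.Quotient.mk_surjective _ w
      exact ⟨z, z.2, hp' z⟩)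
  exact ⟨C, fun z => by rw [hC, hp']⟩

/-- An Euler coderivation acts on cycles through the degree, up to boundaries. -/
theorem euler_sub_mem_boundaries {W : Type u} [AddCommGroup W] [Module K W]
    {E' : DGLieAlgebra K W} (C : Contraction D E') {F : Word V → V} (hF : IsCochain D D 1 F)
    (hF0 : F [] = 0) (hcomm : comp K 1 F (codiff D) = comp K 0 (codiff D) F)
    (hp : ∀ x, C.p (F [x]) = eulerMap E' (unary D C.p [x])) {s : ℤ} {z : V}
    (hz : z ∈ D.deg (s + 1)) (hd : D.d z = 0) :
    F [(s, z)] - ((s + 1 : ℤ) : K) • z ∈ D.boundaries := by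
  have h1 : F [(s, z)] ∈ D.deg (s + 1) := by
    have := hF.mem [(s, z)]
    simpa [add_comm] using this
  have h2 : D.d (F [(s, z)]) = 0 := by
    have h3 := congrFun hcomm [(s, z)]
    have h4 := hF.lin.map_zero [] (1 + s) []
    have h5 := hF.lin.map_zero [(s, z)] 1 []
    simp only [List.nil_append, List.singleton_append] at h4 h5
    simp only [comp, contr_apply, codiff_single, codiff_pair, D.proj_same hz, hd, neg_zero, h4,
      codiff_nil, h5, hF0, map_zero, smul_zero, add_zero, zero_add, D.proj_same h1] at h3
    simpa using h3.symm
  have h3 : C.p (F [(s, z)]) = ((s + 1 : ℤ) : K) • C.p z := by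
    rw [hp, unary_single, D.proj_same hz, eulerMap_apply E' (i := s + 1)]
    simpa using C.p_graded _ _ hz
  refine ⟨C.h (F [(s, z)] - ((s + 1 : ℤ) : K) • z), ?_⟩
  have h4 := C.homotopy (F [(s, z)] - ((s + 1 : ℤ) : K) • z)
  rw [map_sub D.d, map_smul, h2, hd, smul_zero, sub_zero, map_zero, add_zero, map_sub C.p, map_smul,
    h3, sub_self, map_zero, sub_zero] at h4
  exact h4

/-- Compatibility with the brackets is needed only on values of the two cochains, since `prH` is
known to be multiplicative only in positive degrees. -/
theorem map_conv_of_values {U W W' : Type u} [AddCommGroup W] [Module K W] [AddCommGroup W']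
    [Module K W'] (B : W →ₗ[K] W →ₗ[K] W) (B' : W' →ₗ[K] W' →ₗ[K] W') (A : W →ₗ[K] W') (k : ℤ)
    {f g : Word U → W} (h : ∀ m m', A (B (f m) (g m')) = B' (A (f m)) (A (g m'))) (l : Word U) :
    conv B' k (fun m => A (f m)) (fun m => A (g m)) l = A (conv B k f g l) := by
  induction l generalizing k f g with
  | nil => exact (h _ _).symm
  | cons x l ih =>
    have h1 := ih k (f := contr x f) (g := g) fun m m' => h (x :: m) m'
    have h2 := ih (k + x.1) (f := f) (g := contr x g) fun m m' => h m (x :: m')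
    simp only [conv, map_add, map_smul, ← h1, ← h2]
    rfl

namespace PositiveRetract

theorem pr_mem_cycles (R : PositiveRetract D E) {z : V} (hz : z ∈ D.cycles) : R.pr z ∈ E.cycles := by
  rw [DGLieAlgebra.mem_cycles] at hz ⊢
  rw [← R.pr_d, hz, map_zero]

/-- The map in cohomology induced by the retraction. -/
def prH (R : PositiveRetract D E) : D.H →ₗ[K] E.H :=
  D.boundariesInCycles.mapQ E.boundariesInCycles
    (R.pr.restrict fun _ hz => R.pr_mem_cycles hz) (by
      rintro z ⟨y, hy⟩
      exact ⟨R.pr y, by rw [← R.pr_d, hy]; rfl⟩)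

theorem prH_mk (R : PositiveRetract D E) (z : D.cycles) :
    R.prH (Submodule.Quotient.mk z) = Submodule.Quotient.mk ⟨R.pr z, R.pr_mem_cycles z.2⟩ := rfl

theorem isGraded_prH (R : PositiveRetract D E) : IsGraded D.cohomology E.cohomology 0 R.prH := by
  rintro i _ ⟨z, hz, rfl⟩
  exact ⟨⟨R.pr z, R.pr_mem_cycles z.2⟩, R.pr_graded i z hz, rfl⟩

theorem cohomologyDeg_eq_bot (R : PositiveRetract D E) {i : ℤ} (hi : i ≤ 0) : E.cohomology.deg i = ⊥ := by
  rw [eq_bot_iff]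
  rintro _ ⟨z, hz, rfl⟩
  have h : (z : M) ∈ E.deg i := hz
  rw [R.deg_nonpos i hi, Submodule.mem_bot] at h
  have h' : z = 0 := Subtype.ext h
  rw [h', map_zero]
  exact zero_mem _

/-- In positive degrees `z` is cohomologous to `incl (pr z)`, which is a boundary if `pr z` is. -/
theorem prH_injective (R : PositiveRetract D E) {i : ℤ} (hi : 1 ≤ i) {c : D.H} (hc : c ∈ D.cohomology.deg i)
    (h : R.prH c = 0) : c = 0 := by
  obtain ⟨z, hz, rfl⟩ := exists_of_mem_cohomologyDeg hc
  rw [prH_mk, Submodule.Quotient.mk_eq_zero] at h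
  obtain ⟨y, hy⟩ := h
  refine (Submodule.Quotient.mk_eq_zero _).2 ?_
  have h1 := R.sub_mem i hi z hz
  have h2 : R.incl (R.pr z) ∈ D.boundaries := ⟨R.incl y, by rw [← R.incl_d, hy]; rfl⟩
  have := add_mem h1 h2
  rwa [sub_add_cancel] at this

/-- The retraction is not multiplicative, but `incl` is, and in positive degrees cycles may be
replaced by their images under `incl ∘ pr` up to boundaries. -/
theorem prH_bracket (R : PositiveRetract D E) {i j : ℤ} (hi : 1 ≤ i) (hj : 1 ≤ j) {c c' : D.H}
    (hc : c ∈ D.cohomology.deg i) (hc' : c' ∈ D.cohomology.deg j) :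
    R.prH (D.cohomology.bracket c c') = E.cohomology.bracket (R.prH c) (R.prH c') := by
  obtain ⟨z, hz, rfl⟩ := exists_of_mem_cohomologyDeg hc
  obtain ⟨z', hz', rfl⟩ := exists_of_mem_cohomologyDeg hc'
  change (Submodule.Quotient.mk _ : E.H) = Submodule.Quotient.mk _
  rw [Submodule.Quotient.eq]
  have hcyc : ∀ z : D.cycles, R.incl (R.pr z) ∈ D.cycles := fun z => by
    have h := z.2
    rw [DGLieAlgebra.mem_cycles] at h ⊢
    rw [← R.incl_d, ← R.pr_d, h, map_zero, map_zero]
  obtain ⟨y, hy⟩ := add_mem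
    (D.bracket_mem_boundaries_left (R.sub_mem i hi z hz) z'.2)
    (D.bracket_mem_boundaries_right (hcyc z) (R.sub_mem j hj z' hz'))
  refine ⟨R.pr y, ?_⟩
  rw [← R.pr_d, hy]
  simp only [map_sub, LinearMap.sub_apply, map_add]
  rw [← R.incl_bracket, R.pr_incl]
  change _ = R.pr (D.bracket z z') - E.bracket (R.pr z) (R.pr z')
  abel

/-- Formality of `V` restricts to `M`. -/
theorem isFormal_of_isFormal (R : PositiveRetract D E) [CharZero K] (h : D.IsFormal) : E.IsFormal := by
  obtain ⟨Φ, hΦ⟩ := h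
  obtain ⟨C, f, hf, hf0, hf1, hmc⟩ := exists_cochain_of_isWeakEquivalence rfl hΦ
  have hpg : ∀ i x, x ∈ D.deg i → C.p x ∈ D.cohomology.deg i := fun i x hx => by
    simpa using C.p_graded i x hx
  have hig : ∀ i x, x ∈ E.deg i → R.incl x ∈ D.deg i := fun i x hx => by
    simpa using R.incl_graded i x hx
  have hqg : ∀ i x, x ∈ D.cohomology.deg i → R.prH x ∈ E.cohomology.deg i := fun i x hx => by
    simpa using R.isGraded_prH i x hx
  have hqproj : ∀ i x, E.cohomology.proj i (R.prH x) = R.prH (D.cohomology.proj i x) :=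
    fun i x => by simpa using R.isGraded_prH.proj i x
  have hpproj : ∀ i x, D.cohomology.proj i (C.p x) = C.p (D.proj i x) :=
    fun i x => by simpa using C.p_graded.proj i x
  obtain ⟨C', hC'⟩ := exists_contraction (D := E) (E := E.cohomology) (R.prH ∘ₗ C.p ∘ₗ R.incl)
    (fun i x hx => by
      rw [add_zero]
      exact hqg _ _ (hpg _ _ (hig _ _ hx)))
    (fun x => by
      simp only [LinearMap.comp_apply, R.incl_d, C.p_d, map_zero])
    (fun z hz h => by
      simp only [LinearMap.comp_apply] at h
      have h1 : C.p (R.incl z) = 0 := by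
        refine eq_zero_of_forall_proj (D := D.cohomology) fun i => ?_
        rw [hpproj, R.proj_incl]
        rcases le_or_gt i 0 with hi | hi
        · have := E.proj_mem i z
          rw [R.deg_nonpos i hi, Submodule.mem_bot] at this
          rw [this, map_zero, map_zero]
        · refine R.prH_injective (i := i) (by omega) (hpg _ _ (hig _ _ (E.proj_mem i z))) ?_
          rw [← R.proj_incl, ← hpproj, ← hqproj, h, map_zero]
      have h2 := C.homotopy (R.incl z)
      rw [← R.incl_d, hz, map_zero, map_zero, add_zero, h1, map_zero, sub_zero] at h2
      exact ⟨R.pr (C.h (R.incl z)), by rw [← R.pr_d, h2, R.pr_incl]⟩)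
    (fun w => by
      refine E.cohomology.induction_deg
        (P := fun w => ∃ z, E.d z = 0 ∧ (R.prH ∘ₗ C.p ∘ₗ R.incl) z = w) ?_ ⟨0, by simp⟩ ?_ w
      · intro i w hw
        rcases le_or_gt i 0 with hi | hi
        · rw [R.cohomologyDeg_eq_bot hi, Submodule.mem_bot] at hw
          exact ⟨0, by simp [hw]⟩
        · obtain ⟨m, hm, rfl⟩ := exists_of_mem_cohomologyDeg hw
          have hmc : R.incl m ∈ D.cycles := by
            rw [DGLieAlgebra.mem_cycles, ← R.incl_d, E.mem_cycles.1 m.2, map_zero]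
          set c : D.H := Submodule.Quotient.mk ⟨R.incl m, hmc⟩ with hc
          have hcd : c ∈ D.cohomology.deg i := mk_mem_cohomologyDeg (hig _ _ hm)
          have hid : C.i c ∈ D.deg i := by simpa using C.i_graded _ _ hcd
          refine ⟨R.pr (C.i c), by rw [← R.pr_d, C.d_i, map_zero], ?_⟩
          obtain ⟨y, hy⟩ := R.sub_mem i (by omega) _ hid
          have h1 := C.p_d y
          rw [hy, map_sub, C.p_i, sub_eq_zero] at h1
          rw [LinearMap.comp_apply, LinearMap.comp_apply, ← h1, hc, prH_mk]
          congr 1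
          exact Subtype.ext (R.pr_incl _)
      · rintro x y ⟨z, hz, rfl⟩ ⟨z', hz', rfl⟩
        exact ⟨z + z', by rw [map_add, hz, hz', add_zero], by rw [map_add]⟩)
  have hg0 : IsCochain E D.cohomology 1 (pull R.incl f) := hf.pull R.incl_graded
  have hg : IsCochain E E.cohomology 1 (fun l => R.prH (pull R.incl f l)) := by
    have := hg0.map R.isGraded_prH
    rwa [add_zero] at this
  -- The letters of `M` have nonnegative labels and the cochain raises weight by one, so its values
  -- lie where `prH` respects brackets; words with a negative label give zero.
  have hval : ∀ m, ∃ i, 1 ≤ i ∧ pull R.incl f m ∈ D.cohomology.deg i := by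
    intro m
    by_cases hm : ∀ x ∈ m, 0 ≤ x.1
    · refine ⟨1 + Word.weight m, ?_, hg0.mem m⟩
      have := weight_le_of_sublist (List.nil_sublist m) hm
      simp at this
      omega
    · push Not at hm
      obtain ⟨x, hx, hx'⟩ := hm
      refine ⟨1, le_rfl, ?_⟩
      rw [hg0.eq_zero_of_neg R.deg_nonpos hx hx']
      exact zero_mem _
  refine exists_isWeakEquivalence (D := E) (E := E.cohomology) rfl C' hg ?_ ?_ ?_
  · change R.prH (f []) = 0
    rw [hf0, map_zero]
  · intro x
    rw [pull_apply, mapWord_cons, mapWord_nil, hf1, unary_single, unary_single, hC']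
    simp only [LinearMap.comp_apply, R.proj_incl]
  · funext l
    have h1 := congrFun hmc (mapWord R.incl l)
    rw [curv, Pi.add_apply, Pi.smul_apply, comp_pull 1 R.incl f R.codiff_mapWord,
      ← conv_pull] at h1
    rw [curv, Pi.add_apply, Pi.smul_apply, ← map_comp,
      map_conv_of_values D.cohomology.bracket E.cohomology.bracket R.prH 1 (by
        intro m m'
        obtain ⟨i, hi, hi'⟩ := hval m
        obtain ⟨j, hj, hj'⟩ := hval m'
        exact R.prH_bracket hi hj hi' hj'), ← map_smul, ← map_add, h1]
    simp

variable {n : ℕ} {G : Subgroup (GL (Fin n) K)} {ρ : Representation K G V}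

/-- Formality of `M` lifts to `V`, in the presence of a reductive group acting on `V` with
derivative given by cycles representing the cohomology of degree zero. -/
theorem isFormal_of_isFormal_retract (R : PositiveRetract D E) [CharZero K] (hred : IsLinearlyReductive G)
    (hρ : IsDGLieAction D ρ) (hneg : ∀ i < 0, D.cohomology.deg i = ⊥)
    {ζ : lieAlgebraOf G → V} (hζ : ∀ X, ζ X ∈ D.deg 0) (hζd : ∀ X, D.d (ζ X) = 0)
    (hinv : ∀ X x, ∃ y, D.bracket (ζ X) (R.incl x) = R.incl y)
    (ht : ∀ i, HasTangent (fun g => ρ g ∘ₗ D.proj i) fun X => D.bracket (ζ X) ∘ₗ D.proj i)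
    (σ : D.H →ₗ[K] V) (hσ : ∀ c ∈ D.cohomology.deg 0, ∃ X, σ c = ζ X)
    (hσ1 : ∀ c ∈ D.cohomology.deg 0, ∀ hz : σ c ∈ D.cycles, Submodule.Quotient.mk ⟨σ c, hz⟩ = c)
    (hσb : ∀ c ∈ D.cohomology.deg 0, ∀ c' ∈ D.cohomology.deg 0,
      σ (D.cohomology.bracket c c') = D.bracket (σ c) (σ c'))
    (h : E.IsFormal) : D.IsFormal := by
  obtain ⟨Φ, hΦ⟩ := h
  obtain ⟨C, f, hf, hf0, hf1, hmc⟩ := exists_cochain_of_isWeakEquivalence rfl hΦ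
  obtain ⟨F, hF, hF0, hcomm, hFp⟩ := exists_euler C hf hf0 hf1 hmc
  obtain ⟨F', hF', hF'0, hcomm', hFinv, hF'1⟩ :=
    (R.isRegularAction_inducedRep hρ hζ hζd hinv ht).exists_invariant_euler hred R.deg_nonpos
      hF hF0 (sub_eq_zero.2 hcomm) fun s z hz hd =>
        euler_sub_mem_boundaries C hF hF0 hcomm (fun x => by rw [hFp, hf1]) hz hd
  obtain ⟨P, hP⟩ := exists_class_contraction D
  obtain ⟨X⟩ := R.exists_eulerData P (fun z z' hz hz' => by
      rw [hP ⟨z, hz⟩, hP ⟨z', hz'⟩, hP ⟨_, D.bracket_mem_cycles hz hz'⟩]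
      rfl) hneg σ
    (fun c hc => by obtain ⟨X, hX⟩ := hσ c hc; rw [hX]; exact hζ X)
    (fun c hc => by obtain ⟨X, hX⟩ := hσ c hc; rw [hX]; exact hζd X)
    (fun c hc => by
      have hz : σ c ∈ D.cycles := by obtain ⟨X, hX⟩ := hσ c hc; rw [hX]; exact hζd X
      rw [hP ⟨σ c, hz⟩]
      exact hσ1 c hc hz) hσb
    (fun c hc => by obtain ⟨X, hX⟩ := hσ c hc; rw [hX]; exact hinv X)
    hF' hF'0 hcomm' (fun c hc => by obtain ⟨X, hX⟩ := hσ c hc; rw [hX]; exact hFinv X) hF'1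
  obtain ⟨g, hg, hg0, hg1, hgmc⟩ := X.exists_maurerCartan
  exact exists_isWeakEquivalence rfl X.toContraction hg hg0 hg1 hgmc

end PositiveRetract

end Descent

/-! ### The subalgebra `K` as a positive retract of `L`. -/

section PositiveSub

variable {K : Type v} [Field K] {V : Type u} [AddCommGroup V] [Module K V]
  {D : DGLieAlgebra K V} {K₁ : Submodule K V}

theorem exists_retraction_of_disjoint {W : Submodule K V} (h : W ⊓ K₁ = ⊥) :
    ∃ q : V →ₗ[K] K₁, (∀ x : K₁, q x = x) ∧ ∀ x ∈ W, q x = 0 := by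
  obtain ⟨ψ, hψ⟩ := (W.mkQ ∘ₗ K₁.subtype).exists_leftInverse_of_injective (by
    rw [LinearMap.ker_comp, Submodule.ker_mkQ, Submodule.eq_bot_iff]
    intro x hx
    have : (x : V) ∈ W ⊓ K₁ := ⟨hx, x.2⟩
    rw [h, Submodule.mem_bot] at this
    exact Subtype.ext this)
  refine ⟨ψ ∘ₗ W.mkQ, fun x => LinearMap.congr_fun hψ x, fun x hx => ?_⟩
  have hx' : W.mkQ x = 0 := (Submodule.Quotient.mk_eq_zero W).2 hx
  rw [LinearMap.comp_apply, hx', map_zero]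

/-- The retraction is zero in degrees at most zero, the projection along the boundaries in degree
one, and the identity above. It commutes with `d` because it kills the boundaries of degree one,
which `d` kills as well. -/
theorem exists_positiveRetract (h : D.IsComplementOfB1 K₁) :
    ∃ R : PositiveRetract D (D.positiveSub K₁ h.le).toDGLieAlgebra,
      ∀ x, R.incl x = (x : V) := by
  set S := D.positiveSub K₁ h.le with hS
  have hp1 : S.piece 1 = K₁ := rfl
  have hp2 : ∀ i, 2 ≤ i → S.piece i = D.deg i := fun i hi => D.positivePiece_of_two_le K₁ hi
  have hp0 : ∀ i ≤ 0, S.piece i = ⊥ := fun i hi => D.positivePiece_of_nonpos K₁ hi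
  have hle : ∀ i, S.piece i ≤ S.carrier := fun i => le_iSup S.piece i
  obtain ⟨q, hq, hq0⟩ := exists_retraction_of_disjoint h.1
  have hle1 : K₁ ≤ S.carrier := hle 1
  let c : ∀ i, D.deg i →ₗ[K] S.carrier := fun i =>
    if hi : 2 ≤ i then Submodule.inclusion ((hp2 i hi).ge.trans (hle i)) else
      if i = 1 then Submodule.inclusion hle1 ∘ₗ q ∘ₗ (D.deg i).subtype else 0
  let pr : V →ₗ[K] S.carrier := DirectSum.toModule K ℤ S.carrier c ∘ₗ D.decomp.symm.toLinearMap
  have hpr : ∀ {i x} (hx : x ∈ D.deg i), pr x = c i ⟨x, hx⟩ := fun hx => by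
    simp [pr, D.decomp_symm_apply hx]
  have hpr2 : ∀ {i x}, 2 ≤ i → x ∈ D.deg i → (pr x : V) = x := fun hi hx => by
    rw [hpr hx]
    simp [c, hi]
  have hpr1 : ∀ {x}, x ∈ D.deg 1 → (pr x : V) = q x := fun hx => by
    rw [hpr hx]
    simp [c]
  have hpr0 : ∀ {i x}, i ≤ 0 → x ∈ D.deg i → pr x = 0 := fun {i x} hi hx => by
    rw [hpr hx]
    simp [c, show ¬ 2 ≤ i by omega, show i ≠ 1 by omega]
  have hsub : ∀ x ∈ D.deg 1, x - q x ∈ D.boundaries := by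
    intro x hx
    rw [← h.2, Submodule.mem_sup] at hx
    obtain ⟨b, hb, k, hk, rfl⟩ := hx
    rw [map_add, hq0 b hb, hq ⟨k, hk⟩, zero_add, add_sub_cancel_right]
    exact hb.1
  refine ⟨{
    incl := S.carrier.subtype
    pr := pr
    incl_graded := fun i x hx => by
      rw [add_zero]
      exact S.piece_le i hx
    pr_graded := fun i x hx => by
      rw [add_zero]
      change (pr x : V) ∈ S.piece i
      rcases le_or_gt i 0 with hi | hi
      · rw [hpr0 hi hx]
        exact zero_mem _
      · rcases eq_or_lt_of_le (show 1 ≤ i by omega) with rfl | h2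
        · rw [hpr1 hx, hp1]
          exact (q x).2
        · rw [hpr2 (by omega) hx, hp2 i (by omega)]
          exact hx
    incl_d := fun x => rfl
    pr_d := by
      refine linearMap_ext_deg (D := D) (a := pr ∘ₗ D.d)
        (b := S.toDGLieAlgebra.d ∘ₗ pr) ?_
      intro i x hx
      apply Subtype.ext
      change (pr (D.d x) : V) = D.d (pr x : V)
      rcases le_or_gt i 0 with hi | hi
      · rw [hpr0 hi hx]
        rcases eq_or_lt_of_le hi with rfl | hi'
        · have h1 : D.d x ∈ D.deg 1 := by simpa using D.d_mem hx
          rw [hpr1 h1, hq0 _ ⟨⟨x, rfl⟩, h1⟩]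
          simp
        · rw [hpr0 (by omega) (D.d_mem hx)]
          simp
      · rw [hpr2 (by omega) (D.d_mem hx)]
        rcases eq_or_lt_of_le (show 1 ≤ i by omega) with rfl | h2
        · obtain ⟨y, hy⟩ := hsub x hx
          have := D.d_d y
          rw [hy, map_sub, sub_eq_zero] at this
          rw [hpr1 hx, this]
        · rw [hpr2 (by omega) hx]
    pr_incl := by
      refine linearMap_ext_deg (D := S.toDGLieAlgebra) (a := pr ∘ₗ S.carrier.subtype)
        (b := LinearMap.id) ?_
      intro i x hx
      have hx' : (x : V) ∈ S.piece i := hx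
      have hxd := S.piece_le i hx'
      apply Subtype.ext
      change (pr (x : V) : V) = x
      rcases le_or_gt i 0 with hi | hi
      · rw [hp0 i hi, Submodule.mem_bot] at hx'
        rw [hx']
        simp
      · rcases eq_or_lt_of_le (show 1 ≤ i by omega) with rfl | h2
        · rw [hpr1 hxd]
          exact congrArg Subtype.val (hq ⟨x, hx'⟩)
        · rw [hpr2 (by omega) hxd]
    incl_bracket := fun x y => rfl
    deg_nonpos := fun i hi => by
      rw [Submodule.eq_bot_iff]
      intro x hx
      have hx' : (x : V) ∈ S.piece i := hx
      rw [hp0 i hi, Submodule.mem_bot] at hx'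
      exact Subtype.ext hx'
    sub_mem := fun i hi x hx => by
      change x - (pr x : V) ∈ _
      rcases eq_or_lt_of_le hi with rfl | h2
      · rw [hpr1 hx]
        exact hsub x hx
      · rw [hpr2 (by omega) hx, sub_self]
        exact zero_mem _
    eq_of_two_le := fun i hi x hx => hpr2 hi hx }, fun _ => rfl⟩

theorem bracket_mem_positiveSub (h₁ : K₁ ≤ D.deg 1) {ξ : V} (hξ : ξ ∈ D.deg 0)
    (hinv : ∀ x ∈ K₁, D.bracket ξ x ∈ K₁) {x : V} (hx : x ∈ (D.positiveSub K₁ h₁).carrier) :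
    D.bracket ξ x ∈ (D.positiveSub K₁ h₁).carrier := by
  refine Submodule.iSup_induction (D.positiveSub K₁ h₁).piece
    (motive := fun x => D.bracket ξ x ∈ (D.positiveSub K₁ h₁).carrier) hx ?_ (by simp)
    fun x y hx hy => by rw [map_add]; exact add_mem hx hy
  intro i x hx
  refine Submodule.mem_iSup_of_mem i ?_
  rcases le_or_gt i 0 with hi | hi
  · have : x ∈ D.positivePiece K₁ i := hx
    rw [D.positivePiece_of_nonpos K₁ hi, Submodule.mem_bot] at this
    rw [this, map_zero]
    exact zero_mem _
  · rcases eq_or_lt_of_le (show 1 ≤ i by omega) with rfl | h2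
    · exact hinv x hx
    · have hxd := D.positivePiece_le h₁ i hx
      change _ ∈ D.positivePiece K₁ i
      rw [D.positivePiece_of_two_le K₁ (by omega)]
      simpa using D.bracket_mem hξ hxd

end PositiveSub

end LieCochain

/-! ### The main theorem. -/

theorem mainTheorem7 {K : Type v} [Field K] [CharZero K]
    {L : Type u} [AddCommGroup L] [Module K L] (D : DGLieAlgebra K L)
    {n : ℕ} (G : Subgroup (GL (Fin n) K)) (hG : IsZariskiClosed G) (hred : IsLinearlyReductive G)
    (hneg : ∀ i < 0, D.cohomology.deg i = ⊥)
    (e : lieAlgebraOf G ≃ₗ⁅K⁆ D.cohomology.deg 0)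
    (ι : D.cohomology.deg 0 →ₗ⁅K⁆ D.zeroCycles) (hι : ∀ c, D.zeroClass (ι c) = c)
    (ρ : Representation K G L) (hρ : IsDGLieAction D ρ)
    (hrat : ∀ i, IsRationalRep (hρ.onDeg i)) (hfin : ∀ i, IsFinitelySupported (hρ.onDeg i))
    (had : ∀ (X : lieAlgebraOf G) (x : L),
      IsInfinitesimalAction ρ X x (D.bracket ((ι (e X) : D.deg 0) : L) x)) :
    (∃ K₁ : Submodule K L, D.IsComplementOfB1 K₁ ∧
      ∀ (c : D.cohomology.deg 0), ∀ x ∈ K₁, D.bracket ((ι c : D.deg 0) : L) x ∈ K₁) ∧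
    ∀ (K₁ : Submodule K L) (hK₁ : D.IsComplementOfB1 K₁),
      (∀ (c : D.cohomology.deg 0), ∀ x ∈ K₁, D.bracket ((ι c : D.deg 0) : L) x ∈ K₁) →
      (D.IsFormal ↔ (D.positiveSub K₁ hK₁.le).toDGLieAlgebra.IsFormal) := by
  have ht : ∀ i, LieCochain.HasTangent (fun g => ρ g ∘ₗ D.proj i)
      fun X => D.bracket ((ι (e X) : D.deg 0) : L) ∘ₗ D.proj i := fun i =>
    LieCochain.hasTangent_of_isInfinitesimalAction hred hρ (hrat i) (hfin i) had
  refine ⟨?_, fun K₁ hK₁ hinv => ?_⟩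
  · obtain ⟨K₁, hK₁, hinv⟩ := LieCochain.exists_isComplementOfB1 hred hρ (hrat 1) (ht 1)
    refine ⟨K₁, hK₁, fun c => ?_⟩
    obtain ⟨X, rfl⟩ := e.surjective c
    exact hinv X
  · obtain ⟨R, hR⟩ := LieCochain.exists_positiveRetract hK₁
    refine ⟨R.isFormal_of_isFormal, ?_⟩
    -- The section is given on cohomology of degree zero only; an arbitrary linear extension serves,
    -- since only its values in degree zero are used.
    obtain ⟨σ, hσ⟩ := LinearMap.exists_extend
      ((D.deg 0).subtype ∘ₗ D.zeroCycles.toSubmodule.subtype ∘ₗ ι.toLinearMap)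
    have hσ' : ∀ c : D.cohomology.deg 0, σ c = ((ι c : D.deg 0) : L) :=
      fun c => LinearMap.congr_fun hσ c
    refine R.isFormal_of_isFormal_retract hred hρ hneg
      (ζ := fun X => ((ι (e X) : D.deg 0) : L)) (fun X => (ι (e X) : D.deg 0).2)
      (fun X => (ι (e X)).2) (fun X x => ?_) ht σ (fun c hc => ?_) (fun c hc hz => ?_)
      fun c hc c' hc' => ?_
    · have h := LieCochain.bracket_mem_positiveSub hK₁.le (ι (e X) : D.deg 0).2 (hinv (e X)) x.2
      rw [hR]
      exact ⟨⟨_, h⟩, (hR ⟨_, h⟩).symm⟩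
    · obtain ⟨X, hX⟩ := e.surjective ⟨c, hc⟩
      change e X = _ at hX
      exact ⟨X, by rw [hX]; exact hσ' ⟨c, hc⟩⟩
    · have h1 := congrArg Subtype.val (hι ⟨c, hc⟩)
      refine Eq.trans ?_ h1
      change Submodule.Quotient.mk _ = Submodule.Quotient.mk _
      congr 1
      exact Subtype.ext (hσ' ⟨c, hc⟩)
    · rw [hσ' ⟨c, hc⟩, hσ' ⟨c', hc'⟩]
      have h1 := hσ' ⁅(⟨c, hc⟩ : D.cohomology.deg 0), ⟨c', hc'⟩⁆
      rw [LieHom.map_lie] at h1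
      exact h1
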